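/- **Setting.** Fix a smooth $h:\mathbb R\to\mathbb R$ with $h>0$ on $(-\infty,0)$ and $h=0$ on $[0,\infty)$. In $\mathbb R^3$ let $\Sigma_1=\{z=0\}$, $\Sigma_2=\{z=h(x)\}$, $\Sigma_3=\{z=-h(y)\}$, $\Sigma_4=\{z=-h(-y)\}$, oriented so that the projection to the $(x,y)$-plane is positive, and let $D=\Sigma_1$, $E=\Sigma_1\cup\Sigma_2$, $V_+=\Sigma_1\cup\Sigma_2\cup\Sigma_3$, $V_-=\Sigma_1\cup\Sigma_2\cup\Sigma_4$. A ($C^\infty$, oriented) *branched surface* $P$ is a compact Hausdorff space with a finite atlas of open embeddings of $D,E,V_\pm$ into $P$ whose coordinate changes are, locally, smooth orientation-preserving maps from sheets $\Sigma_i$ to sheets $\Sigma_j$, and preserve the vertical order of the sheets through a point (the screw-orientation). Its *singular set* $S(P)$ consists of the points at which distinct sheets separate (the line $x=z=0$ in $E$; the lines $x=z=0$ and $y=z=0$ in $V_\pm$); the origins of $V_\pm$ give the *vertices*. A *diffeomorphism* of $P$ is a homeomorphism which in charts locally maps sheets to sheets, smoothly and preserving the orientation. Smooth functions and smooth 1-forms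 on $P$ are those which are smooth along all sheets. An (oriented, possibly singular) *foliation* ${\cal F}$ on $P$ is a class $[\alpha]$ of smooth 1-forms up to multiplication by positive smooth functions; the set of foliations carries the quotient of the $C^\infty$ topology on 1-forms. The foliation ${\cal F}=[\alpha]$ is *S-stable* if $\alpha$ does not vanish at any point of $S(P)$, and all tangency points of ${\cal F}$ to $S(P)$ are simple (i.e. of nondegenerate second-order contact), are not vertices, and have index $+1$, i.e. the leaf through the tangency point lies, near that point, on the side of the singular edge on which $P$ has two sheets. A *regular neighbourhood* of $S(P)$ is a set $U=\{\rho\le 1\}$ where $\rho:P\to[0,\infty)$ is continuous, $\rho^{-1}(0)=S(P)$, and $\rho$ is smooth without critical points on $\{0<\rho\le1\}$. **Proposition.** Let ${\cal F}$ be an S-stable foliation on a branched surface $P$. 1. For every neighbourhood ${\cal O}$ of $({\cal F},{\cal F})$ in the space of pairs of foliations on $P$ there is a $C^\infty$-neighbourhood ${\cal W}$ of ${\cal F}$ such that for each ${\cal F}'\in{\cal W}$ there exist a regular neighbourhood $U$ of $S(P)$ and a diffeomorphism $\varphi:P\to P$ with $\varphi(U)=U$, $\varphi_*({\cal F}|_U)={\cal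 F}'|_U$, and $(\varphi_*{\cal F},{\cal F}')\in{\cal O}$ (that is, $\varphi_*{\cal F}$ is $C^\infty$-close to ${\cal F}'$ on all of $P$). 2. In particular the germ of ${\cal F}$ along $S(P)$ is stable: for every foliation ${\cal F}'$ sufficiently $C^\infty$-close to ${\cal F}$ there is a diffeomorphism $\varphi$ of $P$ with $\varphi(S(P))=S(P)$ such that $\varphi_*{\cal F}$ and ${\cal F}'$ coincide on a neighbourhood of $S(P)$. -/

import Mathlib

open Set Filter Topology
open scoped ContDiff

namespace BranchedSurf

/-- The smooth function `hfun` with `hfun x > 0` for `x < 0` and `hfun x = 0` for `x ≥ 0`. -/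
noncomputable def hfun (x : ℝ) : ℝ := expNegInvGlue (-x)

/-- The four local models: the plane `D`, the singular edge `E`, and the two vertices `V₊`, `V₋`. -/
inductive Kind
  | D
  | E
  | Vpos
  | Vneg

/-- Each local model is a union of graphs over `ℝ²`, listed from bottom (`0`) to top (`2`); graph `1`
is always the horizontal plane. For `D` the three graphs coincide, for `E` the graphs `0` and `1`
coincide. `height k i` is the function whose graph is the `i`-th one. -/
noncomputable def height (k : Kind) (i : Fin 3) (u : ℝ × ℝ) : ℝ :=
  match k with
  | .D => 0
  | .E => if i = 2 then hfun u.1 else 0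
  | .Vpos => if i = 2 then hfun u.1 else if i = 0 then -hfun u.2 else 0
  | .Vneg => if i = 2 then hfun u.1 else if i = 0 then -hfun (-u.2) else 0

/-- The local models as subspaces of `ℝ³ = ℝ² × ℝ`. -/
abbrev Model (k : Kind) : Type := {q : (ℝ × ℝ) × ℝ // ∃ i, q.2 = height k i q.1}

/-- The parametrization of the `i`-th smooth sheet of a model by its projection to `ℝ²`. -/
noncomputable def lift (k : Kind) (i : Fin 3) (u : ℝ × ℝ) : Model k := ⟨(u, height k i u), i, rfl⟩

/-- The `i`-th sheet passes through the point `p`. -/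
def OnSheet {k : Kind} (p : Model k) (i : Fin 3) : Prop := p.1.2 = height k i p.1.1

/-- At the point `q` of the model there is a singular edge with tangent direction `e`, and the vector
`n` is transverse to it and points to the side where there is only one local sheet. -/
def IsEdgeAt (k : Kind) (q : (ℝ × ℝ) × ℝ) (e n : ℝ × ℝ) : Prop :=
  q.2 = 0 ∧
  match k with
  | .D => False
  | .E => q.1.1 = 0 ∧ e = (0, 1) ∧ n = (1, 0)
  | .Vpos => (q.1.1 = 0 ∧ e = (0, 1) ∧ n = (1, 0)) ∨ (q.1.2 = 0 ∧ e = (1, 0) ∧ n = (0, 1))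
  | .Vneg => (q.1.1 = 0 ∧ e = (0, 1) ∧ n = (1, 0)) ∨ (q.1.2 = 0 ∧ e = (1, 0) ∧ n = (0, -1))

/-- The vertex of `V₊` or `V₋`. -/
def IsVertexAt (k : Kind) (q : (ℝ × ℝ) × ℝ) : Prop :=
  (k = .Vpos ∨ k = .Vneg) ∧ q = ((0, 0), 0)

/-- Near `p`, and read through the parametrizations `f` and `g`, the map `a` sends the `i`-th sheet
through `p` into the `j`-th sheet of the target model, by the planar map `T`, which is smooth at the
projection of `p` and has positive Jacobian there. -/
def LocalRep {P Q : Type*} {k l : Kind} (f : Model k → P) (g : Model l → Q) (a : P → Q)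
    (p : Model k) (i j : Fin 3) (T : ℝ × ℝ → ℝ × ℝ) : Prop :=
  OnSheet p i ∧ ContDiffAt ℝ ∞ T p.1.1 ∧ 0 < (fderiv ℝ T p.1.1).det ∧
    ∀ᶠ u in 𝓝 p.1.1, a (f (lift k i u)) = g (lift l j (T u))

/-- An oriented branched `C^∞` structure on the space `P`: a finite atlas of open embeddings of the
local models, whose coordinate changes are smooth and oriented from sheets to sheets. The coordinate
changes preserve the screw-orientation, i.e. the vertical order of the sheets through a point
(`Monotone σ`). -/
structure BranchedSurface (P : Type*) [TopologicalSpace P] where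
  num : ℕ
  kind : Fin num → Kind
  chart : ∀ c, Model (kind c) → P
  isOpenEmbedding : ∀ c, IsOpenEmbedding (chart c)
  cover : ∀ x, ∃ c p, chart c p = x
  compat : ∀ c d p q, chart c p = chart d q → ∃ σ : Fin 3 → Fin 3, Monotone σ ∧
    ∀ i, OnSheet p i → ∃ T, LocalRep (chart c) (chart d) id p i (σ i) T

namespace BranchedSurface

variable {P : Type*} [TopologicalSpace P] (B : BranchedSurface P)

/-- The singular set `S(P)`. -/
def singularSet : Set P :=
  {x | ∃ c p, B.chart c p = x ∧ ∃ e n, IsEdgeAt (B.kind c) p.1 e n}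

/-- A homeomorphism is a diffeomorphism of branched surfaces if in charts it is smooth and oriented
from sheets to sheets. -/
def IsDiffeo {Q : Type*} [TopologicalSpace Q] (B : BranchedSurface P) (B' : BranchedSurface Q)
    (a : P ≃ₜ Q) : Prop :=
  ∀ c d p q, a (B.chart c p) = B'.chart d q →
    ∀ i, OnSheet p i → ∃ j T, LocalRep (B.chart c) (B'.chart d) a p i j T

/-- A real function is smooth if it is smooth along every sheet. -/
def SmoothFun (g : P → ℝ) : Prop :=
  ∀ c i, ContDiff ℝ ∞ fun u => g (B.chart c (lift (B.kind c) i u))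

/-- A smooth 1-form on `P`, given by its coordinate expressions: the tangent plane of `P` at a point
of a chart is identified with `ℝ²` by the projection. -/
@[ext]
structure OneForm where
  coe : ∀ c, Model (B.kind c) → (ℝ × ℝ →L[ℝ] ℝ)
  smooth : ∀ c i, ContDiff ℝ ∞ fun u => coe c (lift (B.kind c) i u)
  compat : ∀ c d p q i j T, B.chart c p = B.chart d q →
    LocalRep (B.chart c) (B.chart d) id p i j T →
    coe c p = (coe d q).comp (fderiv ℝ T p.1.1)

/-- The `C^∞` topology on 1-forms: uniform convergence of all derivatives on compact sets, along
every sheet of every chart. -/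
noncomputable instance : TopologicalSpace B.OneForm :=
  ⨅ (c : Fin B.num) (i : Fin 3) (m : ℕ), TopologicalSpace.induced
    (fun α : B.OneForm => UniformOnFun.ofFun {K : Set (ℝ × ℝ) | IsCompact K}
      (iteratedFDeriv ℝ m fun u => α.coe c (lift (B.kind c) i u)))
    inferInstance

/-- Two 1-forms are equivalent if they differ by a positive smooth function. -/
def formSetoid : Setoid B.OneForm where
  r α β := ∃ g : P → ℝ, B.SmoothFun g ∧ (∀ x, 0 < g x) ∧
    ∀ c p, β.coe c p = g (B.chart c p) • α.coe c p
  iseqv :=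
    { refl := fun α => ⟨fun _ => 1, fun _ _ => contDiff_const, fun _ => one_pos, by simp⟩
      symm := by
        rintro α β ⟨g, hg, hpos, hh⟩
        refine ⟨fun x => (g x)⁻¹, fun c i => (hg c i).inv fun u => (hpos _).ne',
          fun x => inv_pos.2 (hpos x), fun c p => ?_⟩
        rw [hh, smul_smul, inv_mul_cancel₀ (hpos _).ne', one_smul]
      trans := by
        rintro α β γ ⟨g, hg, hpos, hh⟩ ⟨g', hg', hpos', hh'⟩
        refine ⟨fun x => g' x * g x, fun c i => (hg' c i).mul (hg c i),
          fun x => mul_pos (hpos' x) (hpos x), fun c p => ?_⟩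
        rw [hh', hh, smul_smul] }

/-- An oriented (possibly singular) foliation on `P`: the kernel of a 1-form, i.e. a class of 1-forms
up to multiplication by positive smooth functions. -/
def Foliation : Type _ := Quotient B.formSetoid

/-- The quotient `C^∞` topology: a foliation is close to another one if they are defined by close
1-forms. -/
instance : TopologicalSpace B.Foliation :=
  inferInstanceAs (TopologicalSpace (Quotient B.formSetoid))

variable {B}

/-- The foliation defined by a 1-form. -/
def OneForm.foliation (α : B.OneForm) : B.Foliation := Quotient.mk B.formSetoid α

/-- `F` and `G` coincide on `U`. -/
def Foliation.EqOn (F G : B.Foliation) (U : Set P) : Prop :=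
  ∃ α β : B.OneForm, α.foliation = F ∧ β.foliation = G ∧
    ∀ c p, B.chart c p ∈ U → α.coe c p = β.coe c p

/-- `α` is the pull-back of `β` under `φ`. -/
def OneForm.IsPullback (φ : P ≃ₜ P) (α β : B.OneForm) : Prop :=
  ∀ c d p q i j T, φ (B.chart c p) = B.chart d q →
    LocalRep (B.chart c) (B.chart d) φ p i j T →
    α.coe c p = (β.coe d q).comp (fderiv ℝ T p.1.1)

/-- `G` is the push-forward `φ_* F` of `F`. -/
def Foliation.IsPushforward (φ : P ≃ₜ P) (F G : B.Foliation) : Prop :=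
  ∃ α β : B.OneForm, α.foliation = F ∧ β.foliation = G ∧ OneForm.IsPullback φ α β

/-- The condition of S-stability, in terms of a defining 1-form `α`. Along `S(P)` the form does not
vanish. At a point `p` of a singular edge with direction `e`, the foliation is tangent to the edge iff
`α(e) = 0`; then `p` is not a vertex, and with `n` pointing to the one-sheeted side the number
`α(n) · ∂ₑ(α(e))` is positive. The tangency is simple iff this number is nonzero, and its sign is the
index: the number is positive iff the leaf through `p` has a nondegenerate contact with the edge and
lies locally on the two-sheeted side. -/
def OneForm.SStable (α : B.OneForm) : Prop :=
  ∀ c p e n, IsEdgeAt (B.kind c) p.1 e n →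
    α.coe c p ≠ 0 ∧
    (α.coe c p e = 0 →
      ¬ IsVertexAt (B.kind c) p.1 ∧
      0 < α.coe c p n *
        fderiv ℝ (fun u => α.coe c (lift (B.kind c) 1 u) e) p.1.1 e)

/-- S-stable foliations (the condition does not depend on the defining 1-form). -/
def Foliation.SStable (F : B.Foliation) : Prop :=
  ∃ α : B.OneForm, α.foliation = F ∧ α.SStable

variable (B)

/-- A (smooth) regular neighbourhood of `S(P)`: a closed neighbourhood of the form `{ρ ≤ 1}` with
`ρ ≥ 0` continuous, `ρ⁻¹(0) = S(P)`, and `ρ` smooth without critical points on `{0 < ρ ≤ 1}`. Thus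
its boundary is a smooth curve, of which `U ∖ S(P)` is a half-open collar. -/
def IsRegularNhd (U : Set P) : Prop :=
  ∃ ρ : P → ℝ, Continuous ρ ∧ (∀ x, 0 ≤ ρ x) ∧ (∀ x, ρ x = 0 ↔ x ∈ B.singularSet) ∧
    U = {x | ρ x ≤ 1} ∧
    ∀ c p i, OnSheet p i → 0 < ρ (B.chart c p) → ρ (B.chart c p) ≤ 1 →
      ContDiffAt ℝ ∞ (fun u => ρ (B.chart c (lift (B.kind c) i u))) p.1.1 ∧
      fderiv ℝ (fun u => ρ (B.chart c (lift (B.kind c) i u))) p.1.1 ≠ 0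

variable {B}

/-- The germ of `F` along `S(P)` is stable: for any sufficiently close foliation `F'`, a diffeomorphism
of `P` carries the germ of `F` along `S(P)` to the germ of `F'`. -/
def Foliation.GermStable (F : B.Foliation) : Prop :=
  ∀ᶠ F' in 𝓝 F, ∃ φ : P ≃ₜ P, IsDiffeo B B φ ∧ φ '' B.singularSet = B.singularSet ∧
    ∃ G, Foliation.IsPushforward φ F G ∧ ∃ V ∈ 𝓝ˢ B.singularSet, G.EqOn F' V

end BranchedSurface

end BranchedSurf

/-! The `C^∞` topology on forms can be tested on smooth curves: a property holds for all forms near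
`α` as soon as, along every smooth curve `τ` with `τ 0 = α`, it holds for small parameters
(`eventually_of_isCurve`); and the passage from forms to foliations is open (`isOpenMap_foliation`).
So one fixes a curve `τ` and looks for a regular neighbourhood `U` and a curve `γ` at `α` such that,
for small `s`, `γ s = τ s` on `U`, while a diffeomorphism preserving `U` carries `α`, up to a
positive factor, to `γ s` (`OneForm.SStable.exists_conn`). Closeness on all of `P` is then
automatic, because `γ s` and `τ s` both tend to `α`.

Conjugations are produced by Moser's homotopy method, in one chart at a time. For a family `A` of
planar forms joining two given ones, one seeks a time-dependent field `X` along whose flow `A` stays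
proportional to itself. For `f = A(X)` this is a linear first order equation along the kernel `V` of
`A`, namely `V f = -(∂ₜ A)(V) - c f` (`HomotopyEq`, `lieCov_eq_smul`). Where `A` does not vanish it
is solved locally by integration from a hypersurface transverse to `V`. The freedom in the
hypersurface, and in `X` modulo `V`, is spent on making `X` agree on sheets which coincide, preserve
the singular edges and preserve `U`.

There are three local situations. At a tangency with an edge of direction `e`, the solution `f` is
taken to vanish where `A(e) = 0`; then `f = k A(e)` and `X = k e` is parallel to the edge. Index
`+1` makes this compatible between the sheets: from a point on the one-sheeted side the leaf reaches
`{A(e) = 0}` without leaving this side, so all sheets compute the same `k` there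
(`exists_tangency_solution`). At a vertex, `f` is taken to vanish where `A` annihilates the saddle
field `(x, -y)`; then `X = k (x, -y)` on the horizontal sheet preserves both edges and the function
`x y`, and it is continued to the other sheets across the edges, which are transverse to the
foliation (`exists_vertex_deformation`). Along a transverse edge, `f` and `X` vanish on the edge
(`exists_edge_deformation`).

The set `U` is `{ρ ≤ ε}` for a function `ρ` with zero set `S(P)` which is adapted to these fields:
the distance to the edge at tangencies, `|x y|` at vertices (`exists_definingFun`). Vertices and
tangencies are finite in number. They are treated first, on neighbourhoods chosen before `ε`; the
rest of `S(P)` is covered by finitely many spots on edges, `ε` is chosen, and the edge deformations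
follow one another, each preserving the agreement with `τ` already obtained in `U`. -/

namespace BranchedSurf

/-! ### Germs of smooth maps -/

section SmoothNear

variable {E F G : Type*} [NormedAddCommGroup E] [NormedSpace ℝ E] [NormedAddCommGroup F]
  [NormedSpace ℝ F] [NormedAddCommGroup G] [NormedSpace ℝ G]

/-- `f` is smooth on a neighbourhood of `x`. -/
def SmoothNear (f : E → F) (x : E) : Prop := ∀ᶠ y in 𝓝 x, ContDiffAt ℝ ∞ f y

namespace SmoothNear

variable {f g : E → F} {x : E}

theorem contDiffAt (h : SmoothNear f x) : ContDiffAt ℝ ∞ f x := h.self_of_nhds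

theorem continuousAt (h : SmoothNear f x) : ContinuousAt f x := h.contDiffAt.continuousAt

theorem differentiableAt (h : SmoothNear f x) : DifferentiableAt ℝ f x :=
  h.contDiffAt.differentiableAt (by simp)

theorem eventually (h : SmoothNear f x) : ∀ᶠ y in 𝓝 x, SmoothNear f y :=
  eventually_eventually_nhds.2 h

theorem congr (h : SmoothNear f x) (hg : g =ᶠ[𝓝 x] f) : SmoothNear g x := by
  filter_upwards [h, hg.eventuallyEq_nhds] with y h1 h2 using h1.congr_of_eventuallyEq h2

theorem _root_.ContDiff.smoothNear (h : ContDiff ℝ ∞ f) (x : E) : SmoothNear f x :=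
  Eventually.of_forall fun _ => h.contDiffAt

theorem comp {g : F → G} {f : E → F} {x : E} (hg : SmoothNear g (f x)) (hf : SmoothNear f x) :
    SmoothNear (fun y => g (f y)) x := by
  filter_upwards [hf, hf.continuousAt.eventually hg] with y h1 h2 using h2.comp y h1

theorem comp' {g : F → G} {f : E → F} {x : E} {z : F} (hg : SmoothNear g z) (hf : SmoothNear f x)
    (h : f x = z) : SmoothNear (fun y => g (f y)) x := by
  subst h; exact hg.comp hf

theorem const (c : F) : SmoothNear (fun _ : E => c) x := contDiff_const.smoothNear x

theorem prodMk {g : E → G} (hf : SmoothNear f x) (hg : SmoothNear g x) :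
    SmoothNear (fun y => (f y, g y)) x := by
  filter_upwards [hf, hg] with y h1 h2 using h1.prodMk h2

theorem add (hf : SmoothNear f x) (hg : SmoothNear g x) : SmoothNear (fun y => f y + g y) x := by
  filter_upwards [hf, hg] with y h1 h2 using h1.add h2

theorem sub (hf : SmoothNear f x) (hg : SmoothNear g x) : SmoothNear (fun y => f y - g y) x := by
  filter_upwards [hf, hg] with y h1 h2 using h1.sub h2

theorem neg (hf : SmoothNear f x) : SmoothNear (fun y => - f y) x := by
  filter_upwards [hf] with y h1 using h1.neg

theorem smul {f : E → ℝ} (hf : SmoothNear f x) (hg : SmoothNear g x) :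
    SmoothNear (fun y => f y • g y) x := by
  filter_upwards [hf, hg] with y h1 h2 using h1.smul h2

theorem mul {f g : E → ℝ} (hf : SmoothNear f x) (hg : SmoothNear g x) :
    SmoothNear (fun y => f y * g y) x := by
  filter_upwards [hf, hg] with y h1 h2 using h1.mul h2

theorem inv {f : E → ℝ} (hf : SmoothNear f x) (h0 : f x ≠ 0) :
    SmoothNear (fun y => (f y)⁻¹) x := by
  filter_upwards [hf, hf.continuousAt.eventually_ne h0] with y h1 h2 using h1.inv h2

theorem div {f g : E → ℝ} (hf : SmoothNear f x) (hg : SmoothNear g x) (h0 : g x ≠ 0) :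
    SmoothNear (fun y => f y / g y) x := by
  simpa only [div_eq_mul_inv] using hf.mul (hg.inv h0)

theorem clm_apply {f : E → F →L[ℝ] G} {g : E → F} (hf : SmoothNear f x) (hg : SmoothNear g x) :
    SmoothNear (fun y => f y (g y)) x := by
  filter_upwards [hf, hg] with y h1 h2 using h1.clm_apply h2

theorem clm_comp {H : Type*} [NormedAddCommGroup H] [NormedSpace ℝ H] {f : E → G →L[ℝ] H}
    {g : E → F →L[ℝ] G} (hf : SmoothNear f x) (hg : SmoothNear g x) :
    SmoothNear (fun y => (f y).comp (g y)) x := by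
  filter_upwards [hf, hg] with y h1 h2 using h1.clm_comp h2

theorem fderiv (hf : SmoothNear f x) : SmoothNear (_root_.fderiv ℝ f) x := by
  filter_upwards [hf] with y h1 using h1.fderiv_right (m := ∞) (by simp)

theorem id : SmoothNear (fun y : E => y) x := contDiff_id.smoothNear x

end SmoothNear

end SmoothNear

/-! ### The local models -/

theorem hfun_pos {x : ℝ} (h : x < 0) : 0 < hfun x := expNegInvGlue.pos_of_pos (by linarith)

theorem hfun_eq_zero {x : ℝ} (h : 0 ≤ x) : hfun x = 0 := expNegInvGlue.zero_of_nonpos (by linarith)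

theorem hfun_nonneg (x : ℝ) : 0 ≤ hfun x := expNegInvGlue.nonneg _

theorem hfun_eq_zero_iff {x : ℝ} : hfun x = 0 ↔ 0 ≤ x :=
  ⟨fun h => by by_contra hx; exact (hfun_pos (not_le.1 hx)).ne' h, hfun_eq_zero⟩

theorem contDiff_hfun : ContDiff ℝ ∞ hfun := expNegInvGlue.contDiff.comp contDiff_neg

theorem contDiff_height (k : Kind) (i : Fin 3) : ContDiff ℝ ∞ (height k i) := by
  have h1 : ContDiff ℝ ∞ fun u : ℝ × ℝ => hfun u.1 := contDiff_hfun.comp contDiff_fst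
  have h2 : ContDiff ℝ ∞ fun u : ℝ × ℝ => hfun u.2 := contDiff_hfun.comp contDiff_snd
  have h3 : ContDiff ℝ ∞ fun u : ℝ × ℝ => hfun (-u.2) := contDiff_hfun.comp contDiff_snd.neg
  cases k <;> fin_cases i <;>
    first | exact contDiff_const | exact h1 | exact h2.neg | exact h3.neg

theorem continuous_height (k : Kind) (i : Fin 3) : Continuous (height k i) :=
  (contDiff_height k i).continuous

theorem continuous_lift (k : Kind) (i : Fin 3) : Continuous (lift k i) :=
  (continuous_id.prodMk (continuous_height k i)).subtype_mk _

@[simp] theorem lift_fst (k : Kind) (i : Fin 3) (u : ℝ × ℝ) : (lift k i u).1.1 = u := rfl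

theorem onSheet_lift (k : Kind) (i : Fin 3) (u : ℝ × ℝ) : OnSheet (lift k i u) i := rfl

theorem OnSheet.lift_eq {k : Kind} {p : Model k} {i : Fin 3} (h : OnSheet p i) :
    lift k i p.1.1 = p := Subtype.ext (Prod.ext rfl h.symm)

theorem exists_onSheet {k : Kind} (p : Model k) : ∃ i, OnSheet p i := p.2

/-- The set over which two sheets of a model coincide. -/
def coincide (k : Kind) (i j : Fin 3) : Set (ℝ × ℝ) := {u | height k i u = height k j u}

theorem lift_eq_lift_iff {k : Kind} {i j : Fin 3} {u v : ℝ × ℝ} :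
    lift k i u = lift k j v ↔ u = v ∧ u ∈ coincide k i j := by
  constructor
  · intro h
    have h1 : u = v := congrArg (fun p : Model k => p.1.1) h
    subst h1
    exact ⟨rfl, congrArg (fun p : Model k => p.1.2) h⟩
  · rintro ⟨rfl, h⟩
    exact Subtype.ext (Prod.ext rfl h)

theorem coincide_comm (k : Kind) (i j : Fin 3) : coincide k i j = coincide k j i :=
  Set.ext fun _ => eq_comm

theorem OnSheet.mem_coincide {k : Kind} {p : Model k} {i j : Fin 3} (hi : OnSheet p i)
    (hj : OnSheet p j) : p.1.1 ∈ coincide k i j := hi.symm.trans hj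

theorem isClosed_coincide (k : Kind) (i j : Fin 3) : IsClosed (coincide k i j) :=
  isClosed_eq (continuous_height k i) (continuous_height k j)

theorem coincide_self (k : Kind) (i : Fin 3) : coincide k i i = univ := by
  ext; simp [coincide]

theorem coincide_one_two {k : Kind} (h : k ≠ .D) : coincide k 1 2 = {u | 0 ≤ u.1} := by
  ext u
  cases k <;> simp [coincide, height, eq_comm (a := (0 : ℝ)), hfun_eq_zero_iff] at h ⊢

theorem coincide_zero_one_Vpos : coincide .Vpos 0 1 = {u | 0 ≤ u.2} := by
  ext u; simp [coincide, height, hfun_eq_zero_iff]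

theorem coincide_zero_one_Vneg : coincide .Vneg 0 1 = {u | u.2 ≤ 0} := by
  ext u; simp [coincide, height, hfun_eq_zero_iff]

theorem coincide_zero_one_E : coincide .E 0 1 = univ := by
  ext u; simp [coincide, height]

theorem coincide_D (i j : Fin 3) : coincide .D i j = univ := by
  ext u; simp [coincide, height]

/-- Sheet `2` is never below the horizontal one and sheet `0` never above it, so they can only meet
at height zero. -/
theorem coincide_zero_two (k : Kind) : coincide k 0 2 = coincide k 0 1 ∩ coincide k 1 2 := by
  ext u
  have h1 := hfun_nonneg u.1
  have h2 := hfun_nonneg u.2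
  have h3 := hfun_nonneg (-u.2)
  cases k <;> simp only [coincide, height, mem_inter_iff, mem_ofPred_eq] <;>
    simp <;> grind

/-- Two sheets coincide over a convex set with non-empty interior. -/
theorem convex_coincide (k : Kind) (i j : Fin 3) :
    Convex ℝ (coincide k i j) ∧ (interior (coincide k i j)).Nonempty := by
  have hx : Convex ℝ {u : ℝ × ℝ | 0 ≤ u.1} := convex_halfSpace_ge (f := Prod.fst)
    (LinearMap.fst ℝ ℝ ℝ).isLinear 0
  have hy : Convex ℝ {u : ℝ × ℝ | 0 ≤ u.2} := convex_halfSpace_ge (f := Prod.snd)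
    (LinearMap.snd ℝ ℝ ℝ).isLinear 0
  have hy' : Convex ℝ {u : ℝ × ℝ | u.2 ≤ 0} := convex_halfSpace_le (f := Prod.snd)
    (LinearMap.snd ℝ ℝ ℝ).isLinear 0
  have ox : IsOpen {u : ℝ × ℝ | 0 < u.1} := isOpen_lt continuous_const continuous_fst
  have oy : IsOpen {u : ℝ × ℝ | 0 < u.2} := isOpen_lt continuous_const continuous_snd
  have oy' : IsOpen {u : ℝ × ℝ | u.2 < 0} := isOpen_lt continuous_snd continuous_const
  have key : ∀ k, (Convex ℝ (coincide k 0 1) ∧ Convex ℝ (coincide k 1 2)) ∧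
      ∃ (u : ℝ × ℝ) (U : Set (ℝ × ℝ)), IsOpen U ∧ u ∈ U ∧ U ⊆ coincide k 0 1 ∩ coincide k 1 2 := by
    intro k
    cases k
    · simp only [coincide_D, inter_self]
      exact ⟨⟨convex_univ, convex_univ⟩, 0, univ, isOpen_univ, trivial, subset_rfl⟩
    · rw [coincide_zero_one_E, coincide_one_two (by simp)]
      exact ⟨⟨convex_univ, hx⟩, (1, 0), _, ox, by simp, fun u hu => ⟨trivial, (le_of_lt hu : (0 : ℝ) ≤ u.1)⟩⟩
    · rw [coincide_zero_one_Vpos, coincide_one_two (by simp)]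
      exact ⟨⟨hy, hx⟩, (1, 1), _, ox.inter oy, by simp,
        fun u hu => ⟨(le_of_lt hu.2 : (0 : ℝ) ≤ u.2), (le_of_lt hu.1 : (0 : ℝ) ≤ u.1)⟩⟩
    · rw [coincide_zero_one_Vneg, coincide_one_two (by simp)]
      exact ⟨⟨hy', hx⟩, (1, -1), _, ox.inter oy', by simp,
        fun u hu => ⟨(le_of_lt hu.2 : u.2 ≤ (0 : ℝ)), (le_of_lt hu.1 : (0 : ℝ) ≤ u.1)⟩⟩
  obtain ⟨⟨c1, c2⟩, u, U, hU, hu, hsub⟩ := key k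
  have c3 : Convex ℝ (coincide k 0 2) := by rw [coincide_zero_two]; exact c1.inter c2
  have fin : ∀ i j, coincide k 0 1 ∩ coincide k 1 2 ⊆ coincide k i j ∧ Convex ℝ (coincide k i j) := by
    intro i j
    have cs : ∀ i, coincide k i i = univ := coincide_self k
    fin_cases i <;> fin_cases j <;>
      simp only [Fin.zero_eta, Fin.mk_one, Fin.reduceFinMk, cs, subset_univ, convex_univ,
        and_true, c1, c2, coincide_zero_two,
        coincide_comm k 1 0, coincide_comm k 2 0, coincide_comm k 2 1, inter_subset_left,
        inter_subset_right, subset_refl, c1.inter c2]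
  exact ⟨(fin i j).2, u, mem_interior.2 ⟨U, hsub.trans (fin i j).1, hU, hu⟩⟩

/-- Two smooth maps which agree on the region shared by two sheets have the same derivative there,
boundary edges included. This is why forms and planar representatives can be compared on any sheet
through a point. -/
theorem uniqueDiffOn_coincide (k : Kind) (i j : Fin 3) : UniqueDiffOn ℝ (coincide k i j) :=
  uniqueDiffOn_convex (convex_coincide k i j).1 (convex_coincide k i j).2

/-- The point `p` of a model lies on a singular edge. -/
def Sing {k : Kind} (p : Model k) : Prop := ∃ e n, IsEdgeAt k p.1 e n

end BranchedSurf

namespace BranchedSurf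

/-! ### Local representations -/

section LocalRep

variable {P Q R : Type*} {k l m : Kind} {f : Model k → P} {g : Model l → Q} {h : Model m → R}
  {a : P → Q} {b : Q → R} {p : Model k} {i j : Fin 3} {T : ℝ × ℝ → ℝ × ℝ}

theorem LocalRep.eq_lift (H : LocalRep f g a p i j T) (hg : Function.Injective g) {q : Model l}
    (hq : a (f p) = g q) : q = lift l j (T p.1.1) := by
  have := H.2.2.2.self_of_nhds
  rw [H.1.lift_eq, hq] at this
  exact hg this

theorem LocalRep.onSheet (H : LocalRep f g a p i j T) (hg : Function.Injective g) {q : Model l}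
    (hq : a (f p) = g q) : OnSheet q j ∧ q.1.1 = T p.1.1 := by
  rw [H.eq_lift hg hq]; exact ⟨rfl, rfl⟩

theorem LocalRep.comp (H : LocalRep f g a p i j T) (hg : Function.Injective g) {q : Model l}
    (hq : a (f p) = g q) {n : Fin 3} {T' : ℝ × ℝ → ℝ × ℝ} (H' : LocalRep g h b q j n T') :
    LocalRep f h (b ∘ a) p i n (T' ∘ T) := by
  have e := (H.onSheet hg hq).2
  obtain ⟨-, c, d, ev⟩ := H'
  rw [e] at c d ev
  obtain ⟨h1, c1, d1, ev1⟩ := H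
  refine ⟨h1, c.comp _ c1, ?_, ?_⟩
  · rw [fderiv_comp _ (c.differentiableAt (by simp)) (c1.differentiableAt (by simp))]
    change 0 < ((_ : ℝ × ℝ →ₗ[ℝ] ℝ × ℝ) ∘ₗ _).det
    rw [LinearMap.det_comp]
    exact mul_pos d d1
  · filter_upwards [ev1, c1.continuousAt.eventually ev] with u hu hu'
    simp only [Function.comp_apply, hu, hu']

theorem LocalRep.eventuallyEq (hg : Function.Injective g) {j' : Fin 3} {T' : ℝ × ℝ → ℝ × ℝ}
    (H : LocalRep f g a p i j T) (H' : LocalRep f g a p i j' T') : T =ᶠ[𝓝 p.1.1] T' := by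
  filter_upwards [H.2.2.2, H'.2.2.2] with u h1 h2
  exact (lift_eq_lift_iff.1 (hg (h1.symm.trans h2))).1

/-- The derivative of the planar representative does not depend on the sheets. -/
theorem LocalRep.fderiv_eq (hg : Function.Injective g) {i' j' : Fin 3} {T' : ℝ × ℝ → ℝ × ℝ}
    (H : LocalRep f g a p i j T) (H' : LocalRep f g a p i' j' T') :
    T p.1.1 = T' p.1.1 ∧ fderiv ℝ T p.1.1 = fderiv ℝ T' p.1.1 := by
  have hm := H.1.mem_coincide H'.1
  have hu := uniqueDiffOn_coincide k i i' _ hm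
  -- Over the shared region the two sheets consist of the same points, so injectivity of the target
  -- chart identifies the two planar maps; unique differentiability then passes to the derivatives.
  have ev : ∀ᶠ u in 𝓝 p.1.1, u ∈ coincide k i i' → T u = T' u := by
    filter_upwards [H.2.2.2, H'.2.2.2] with u h1 h2 hu
    have h3 : lift k i u = lift k i' u := lift_eq_lift_iff.2 ⟨rfl, hu⟩
    rw [h3] at h1
    exact (lift_eq_lift_iff.1 (hg (h1.symm.trans h2))).1
  have e0 := ev.self_of_nhds hm
  refine ⟨e0, ?_⟩
  have d1 := (H.2.1.differentiableAt (by simp)).hasFDerivAt.hasFDerivWithinAt (s := coincide k i i')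
  have d2 := (H'.2.1.differentiableAt (by simp)).hasFDerivAt.hasFDerivWithinAt
    (s := coincide k i i')
  have ev' : T' =ᶠ[𝓝[coincide k i i'] p.1.1] T :=
    eventually_nhdsWithin_iff.2 (ev.mono fun u h hu => (h hu).symm)
  exact hu.eq d1 (d2.congr_of_eventuallyEq ev'.symm e0)

theorem LocalRep.congr_map {a' : P → Q} (H : LocalRep f g a p i j T)
    (ha : ∀ᶠ u in 𝓝 p.1.1, a' (f (lift k i u)) = a (f (lift k i u))) :
    LocalRep f g a' p i j T := by
  obtain ⟨h1, c1, d1, ev1⟩ := H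
  refine ⟨h1, c1, d1, ?_⟩
  filter_upwards [ev1, ha] with u hu h
  rw [h, hu]

theorem LocalRep.self (hi : OnSheet p i) : LocalRep f f id p i i id := by
  refine ⟨hi, contDiffAt_id, ?_, Eventually.of_forall fun u => rfl⟩
  rw [fderiv_id]
  change 0 < LinearMap.det (LinearMap.id : ℝ × ℝ →ₗ[ℝ] ℝ × ℝ)
  rw [LinearMap.det_id]
  exact one_pos

/-- A local diffeomorphism of the plane is locally onto. -/
theorem map_nhds_eq_of_det_pos {T : ℝ × ℝ → ℝ × ℝ} {x : ℝ × ℝ} (hT : ContDiffAt ℝ ∞ T x)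
    (hd : 0 < (fderiv ℝ T x).det) : map T (𝓝 x) = 𝓝 (T x) := by
  have h1 := (hT.hasStrictFDerivAt (by simp))
  let e := ContinuousLinearMap.toContinuousLinearEquivOfDetNeZero (fderiv ℝ T x) hd.ne'
  have h2 : HasStrictFDerivAt T (e : ℝ × ℝ →L[ℝ] ℝ × ℝ) x := h1
  exact h2.map_nhds_eq_of_equiv

theorem LocalRep.map_nhds (H : LocalRep f g a p i j T) : map T (𝓝 p.1.1) = 𝓝 (T p.1.1) :=
  map_nhds_eq_of_det_pos H.2.1 H.2.2.1

theorem LocalRep.continuousAt (H : LocalRep f g a p i j T) : ContinuousAt T p.1.1 :=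
  H.2.1.continuousAt

end LocalRep

theorem sing_D {p : Model .D} : ¬ Sing p := fun ⟨_, _, h⟩ => h.2

theorem sing_E {p : Model .E} : Sing p ↔ p.1.2 = 0 ∧ p.1.1.1 = 0 :=
  ⟨fun ⟨_, _, h⟩ => ⟨h.1, h.2.1⟩, fun h => ⟨_, _, h.1, h.2, rfl, rfl⟩⟩

theorem sing_Vpos {p : Model .Vpos} : Sing p ↔ p.1.2 = 0 ∧ (p.1.1.1 = 0 ∨ p.1.1.2 = 0) :=
  ⟨fun ⟨_, _, h⟩ => ⟨h.1, h.2.imp And.left And.left⟩, fun h => h.2.elim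
    (fun h' => ⟨_, _, h.1, .inl ⟨h', rfl, rfl⟩⟩) fun h' => ⟨_, _, h.1, .inr ⟨h', rfl, rfl⟩⟩⟩

theorem sing_Vneg {p : Model .Vneg} : Sing p ↔ p.1.2 = 0 ∧ (p.1.1.1 = 0 ∨ p.1.1.2 = 0) :=
  ⟨fun ⟨_, _, h⟩ => ⟨h.1, h.2.imp And.left And.left⟩, fun h => h.2.elim
    (fun h' => ⟨_, _, h.1, .inl ⟨h', rfl, rfl⟩⟩) fun h' => ⟨_, _, h.1, .inr ⟨h', rfl, rfl⟩⟩⟩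

/-- A point of a model is singular iff two sheets separate there. -/
theorem sing_iff {k : Kind} {p : Model k} :
    Sing p ↔ ∃ i j, OnSheet p i ∧ OnSheet p j ∧ coincide k i j ∉ 𝓝 p.1.1 := by
  have nx : ∀ u : ℝ × ℝ, {u : ℝ × ℝ | 0 ≤ u.1} ∉ 𝓝 u ↔ u.1 ≤ 0 := by
    intro u
    rw [← mem_interior_iff_mem_nhds, show {u : ℝ × ℝ | 0 ≤ u.1} = Prod.fst ⁻¹' Ici 0 from rfl,
      ← isOpenMap_fst.preimage_interior_eq_interior_preimage continuous_fst, interior_Ici]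
    simp
  have ny : ∀ u : ℝ × ℝ, {u : ℝ × ℝ | 0 ≤ u.2} ∉ 𝓝 u ↔ u.2 ≤ 0 := by
    intro u
    rw [← mem_interior_iff_mem_nhds, show {u : ℝ × ℝ | 0 ≤ u.2} = Prod.snd ⁻¹' Ici 0 from rfl,
      ← isOpenMap_snd.preimage_interior_eq_interior_preimage continuous_snd, interior_Ici]
    simp
  have ny' : ∀ u : ℝ × ℝ, {u : ℝ × ℝ | u.2 ≤ 0} ∉ 𝓝 u ↔ 0 ≤ u.2 := by
    intro u
    rw [← mem_interior_iff_mem_nhds, show {u : ℝ × ℝ | u.2 ≤ 0} = Prod.snd ⁻¹' Iic 0 from rfl,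
      ← isOpenMap_snd.preimage_interior_eq_interior_preimage continuous_snd, interior_Iic]
    simp
  -- Sheets `0` and `2` meet only on sheet `1`, so a separating pair may be replaced by one which
  -- contains sheet `1`.
  have key : (∃ i j, OnSheet p i ∧ OnSheet p j ∧ coincide k i j ∉ 𝓝 p.1.1) ↔
      OnSheet p 1 ∧ ((OnSheet p 0 ∧ coincide k 0 1 ∉ 𝓝 p.1.1) ∨
        (OnSheet p 2 ∧ coincide k 1 2 ∉ 𝓝 p.1.1)) := by
    have h02 : OnSheet p 0 → OnSheet p 2 → OnSheet p 1 := by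
      intro h0 h2
      have := h0.mem_coincide h2
      rw [coincide_zero_two] at this
      exact h0.trans this.1
    have s : ∀ i, coincide k i i ∈ 𝓝 p.1.1 := fun i => by rw [coincide_self]; exact univ_mem
    constructor
    · rintro ⟨i, j, hi, hj, h⟩
      fin_cases i <;> fin_cases j <;>
        simp only [Fin.zero_eta, Fin.mk_one, Fin.reduceFinMk, s, not_true_eq_false] at hi hj h
      · exact ⟨hj, .inl ⟨hi, h⟩⟩
      · refine ⟨h02 hi hj, ?_⟩
        rw [coincide_zero_two, inter_mem_iff, not_and_or] at h
        exact h.imp (fun h => ⟨hi, h⟩) fun h => ⟨hj, h⟩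
      · exact ⟨hi, .inl ⟨hj, by rwa [coincide_comm]⟩⟩
      · exact ⟨hi, .inr ⟨hj, h⟩⟩
      · refine ⟨h02 hj hi, ?_⟩
        rw [coincide_comm, coincide_zero_two, inter_mem_iff, not_and_or] at h
        exact h.imp (fun h => ⟨hj, h⟩) fun h => ⟨hi, h⟩
      · exact ⟨hj, .inr ⟨hi, by rwa [coincide_comm]⟩⟩
    · rintro ⟨h1, ⟨h0, h⟩ | ⟨h2, h⟩⟩
      · exact ⟨0, 1, h0, h1, h⟩
      · exact ⟨1, 2, h1, h2, h⟩
  rw [key]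
  cases k
  · simp only [sing_D, coincide_D, univ_mem, not_true_eq_false, and_false, or_false]
  · rw [coincide_zero_one_E, coincide_one_two (by simp), nx, sing_E]
    have h1 : OnSheet p 1 ↔ p.1.2 = 0 := by simp [OnSheet, height]
    have h2 : OnSheet p 2 ↔ p.1.2 = hfun p.1.1.1 := by simp [OnSheet, height]
    have h3 := hfun_eq_zero_iff (x := p.1.1.1)
    simp only [h1, h2, univ_mem, not_true_eq_false, and_false, false_or]
    constructor
    · rintro ⟨h, h'⟩
      exact ⟨h, by rw [h, eq_comm, h3]; exact h'.ge, h'.le⟩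
    · rintro ⟨h, h', h''⟩
      rw [h, eq_comm, h3] at h'
      exact ⟨h, le_antisymm h'' h'⟩
  all_goals
    have h0 : ∀ q : Model .Vpos, OnSheet q 0 ↔ q.1.2 = -hfun q.1.1.2 := by simp [OnSheet, height]
    have h0' : ∀ q : Model .Vneg, OnSheet q 0 ↔ q.1.2 = -hfun (-q.1.1.2) := by
      simp [OnSheet, height]
    have h1 : ∀ q : Model .Vpos, OnSheet q 1 ↔ q.1.2 = 0 := by simp [OnSheet, height]
    have h1' : ∀ q : Model .Vneg, OnSheet q 1 ↔ q.1.2 = 0 := by simp [OnSheet, height]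
    have h2 : ∀ q : Model .Vpos, OnSheet q 2 ↔ q.1.2 = hfun q.1.1.1 := by simp [OnSheet, height]
    have h2' : ∀ q : Model .Vneg, OnSheet q 2 ↔ q.1.2 = hfun q.1.1.1 := by simp [OnSheet, height]
    have e1 := hfun_eq_zero_iff (x := p.1.1.1)
    have e2 := hfun_eq_zero_iff (x := p.1.1.2)
    have e3 := hfun_eq_zero_iff (x := -p.1.1.2)
  · rw [coincide_zero_one_Vpos, coincide_one_two (by simp), nx, ny, sing_Vpos, h0, h1, h2]
    refine and_congr_right fun hz => ?_
    rw [hz, eq_comm (b := hfun _), e1, eq_comm (b := -hfun _), neg_eq_zero, e2,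
      ← le_antisymm_iff, ← le_antisymm_iff]
    constructor <;> rintro (h | h) <;> simp [h]
  · rw [coincide_zero_one_Vneg, coincide_one_two (by simp), nx, ny', sing_Vneg, h0', h1', h2']
    refine and_congr_right fun hz => ?_
    rw [hz, eq_comm (b := hfun _), e1, eq_comm (b := -hfun _), neg_eq_zero, e3,
      neg_nonneg, ← le_antisymm_iff, ← le_antisymm_iff]
    constructor <;> rintro (h | h) <;> simp [h]

namespace BranchedSurface

variable {P Q R : Type*} [TopologicalSpace P] [TopologicalSpace Q] [TopologicalSpace R]
  {B : BranchedSurface P} {B' : BranchedSurface Q} {B'' : BranchedSurface R}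

theorem chart_injective (B : BranchedSurface P) (c : Fin B.num) : Function.Injective (B.chart c) :=
  (B.isOpenEmbedding c).injective

theorem continuous_chart (B : BranchedSurface P) (c : Fin B.num) : Continuous (B.chart c) :=
  (B.isOpenEmbedding c).continuous

theorem isDiffeo_refl (B : BranchedSurface P) : IsDiffeo B B (Homeomorph.refl P) := by
  intro c d p q h i hi
  obtain ⟨σ, -, H⟩ := B.compat c d p q h
  obtain ⟨T, hT⟩ := H i hi
  exact ⟨σ i, T, hT⟩

theorem exists_transition (B : BranchedSurface P) {c d : Fin B.num} {p : Model (B.kind c)}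
    {q : Model (B.kind d)} (h : B.chart c p = B.chart d q) {i : Fin 3} (hi : OnSheet p i) :
    ∃ j T, LocalRep (B.chart c) (B.chart d) id p i j T :=
  B.isDiffeo_refl c d p q h i hi

theorem IsDiffeo.trans {a : P ≃ₜ Q} {b : Q ≃ₜ R} (ha : IsDiffeo B B' a) (hb : IsDiffeo B' B'' b) :
    IsDiffeo B B'' (a.trans b) := by
  intro c d p q h i hi
  obtain ⟨e, r, hr⟩ := B'.cover (a (B.chart c p))
  obtain ⟨j, T, hT⟩ := ha c e p r hr.symm i hi
  have hj := (hT.onSheet (B'.chart_injective e) hr.symm).1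
  obtain ⟨n, T', hT'⟩ := hb e d r q (by rw [hr]; exact h) j hj
  exact ⟨n, T' ∘ T, hT.comp (B'.chart_injective e) hr.symm hT'⟩

/-- Diffeomorphisms preserve singular points. -/
theorem IsDiffeo.sing {a : P ≃ₜ Q} (ha : IsDiffeo B B' a) {c : Fin B.num} {d : Fin B'.num}
    {p : Model (B.kind c)} {q : Model (B'.kind d)} (h : a (B.chart c p) = B'.chart d q)
    (hp : Sing p) : Sing q := by
  obtain ⟨i, j, hi, hj, hC⟩ := sing_iff.1 hp
  obtain ⟨i', S, hS⟩ := ha c d p q h i hi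
  obtain ⟨j', T, hT⟩ := ha c d p q h j hj
  have inj := B'.chart_injective d
  refine sing_iff.2 ⟨i', j', (hS.onSheet inj h).1, (hT.onSheet inj h).1, fun hC' => hC ?_⟩
  rw [(hS.onSheet inj h).2] at hC'
  have e : T p.1.1 = S p.1.1 := (hS.fderiv_eq inj hT).1.symm
  -- `T` is locally onto. If the target sheets agreed near `q`, every point of sheet `i` near `p`
  -- would have the same image as a point of sheet `j`, hence be that point, and the sheets `i` and
  -- `j` would not separate.
  have h1 : ∀ᶠ w in 𝓝 (S p.1.1), ∃ u, T u = w ∧ a (B.chart c (lift _ j u)) =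
      B'.chart d (lift _ j' (T u)) := by
    have h2 := hT.map_nhds
    rw [e] at h2
    rw [← h2, eventually_map]
    filter_upwards [hT.2.2.2] with u hu using ⟨u, rfl, hu⟩
  filter_upwards [hS.2.2.2, hS.continuousAt.eventually h1, hS.continuousAt.eventually hC']
    with u h3 h4 h5
  obtain ⟨u', hu', h6⟩ := h4
  have h7 : lift (B'.kind d) i' (S u) = lift (B'.kind d) j' (S u) := lift_eq_lift_iff.2 ⟨rfl, h5⟩
  rw [h7, ← hu', ← h6] at h3
  exact (lift_eq_lift_iff.1 (B.chart_injective c (a.injective h3))).2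

theorem sing_iff_of_chart_eq {c d : Fin B.num} {p : Model (B.kind c)} {q : Model (B.kind d)}
    (h : B.chart c p = B.chart d q) : Sing p ↔ Sing q :=
  ⟨fun hp => B.isDiffeo_refl.sing h hp, fun hq => B.isDiffeo_refl.sing h.symm hq⟩

theorem chart_mem_singularSet {c : Fin B.num} {p : Model (B.kind c)} :
    B.chart c p ∈ B.singularSet ↔ Sing p := by
  constructor
  · rintro ⟨d, q, h, hq⟩
    exact (sing_iff_of_chart_eq h).1 hq
  · exact fun hp => ⟨c, p, rfl, hp⟩

theorem IsDiffeo.mapsTo_singularSet {a : P ≃ₜ Q} (ha : IsDiffeo B B' a) :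
    MapsTo a B.singularSet B'.singularSet := by
  rintro x ⟨c, p, rfl, hp⟩
  obtain ⟨d, q, hq⟩ := B'.cover (a (B.chart c p))
  exact ⟨d, q, hq, ha.sing hq.symm hp⟩

theorem IsDiffeo.image_singularSet {a : P ≃ₜ Q} (ha : IsDiffeo B B' a)
    (ha' : IsDiffeo B' B a.symm) : a '' B.singularSet = B'.singularSet := by
  refine subset_antisymm (image_subset_iff.2 ha.mapsTo_singularSet) fun y hy => ?_
  exact ⟨a.symm y, ha'.mapsTo_singularSet hy, a.apply_symm_apply y⟩

end BranchedSurface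

end BranchedSurf

namespace BranchedSurf

/-! ### Maps defined sheet by sheet -/

/-- A sheet through a point of a model. -/
noncomputable def sheetOf {k : Kind} (p : Model k) : Fin 3 := Classical.choose p.2

theorem onSheet_sheetOf {k : Kind} (p : Model k) : OnSheet p (sheetOf p) := Classical.choose_spec p.2

/-- The map on a model given by a family of maps on the sheets. -/
noncomputable def glue {X : Type*} (k : Kind) (F : Fin 3 → ℝ × ℝ → X) (p : Model k) : X :=
  F (sheetOf p) p.1.1

theorem glue_lift {X : Type*} {k : Kind} {F : Fin 3 → ℝ × ℝ → X}
    (hF : ∀ i j, ∀ u ∈ coincide k i j, F i u = F j u) (i : Fin 3) (u : ℝ × ℝ) :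
    glue k F (lift k i u) = F i u :=
  hF _ _ _ ((onSheet_sheetOf (lift k i u)).mem_coincide (onSheet_lift k i u))

theorem continuous_of_lift {X : Type*} [TopologicalSpace X] {k : Kind} {f : Model k → X}
    (h : ∀ i, Continuous fun u => f (lift k i u)) : Continuous f := by
  have hc : ∀ i, IsClosed {p : Model k | OnSheet p i} := fun i =>
    isClosed_eq (by fun_prop) ((continuous_height k i).comp (by fun_prop))
  refine (locallyFinite_of_finite fun i => {p : Model k | OnSheet p i}).continuous
    (iUnion_eq_univ_iff.2 fun p => exists_onSheet p) hc fun i => ?_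
  have : ContinuousOn (fun p : Model k => f (lift k i p.1.1)) {p : Model k | OnSheet p i} :=
    ((h i).comp (by fun_prop : Continuous fun p : Model k => p.1.1)).continuousOn
  exact this.congr fun p hp => congrArg f (OnSheet.lift_eq hp).symm

theorem isCompact_over {k : Kind} {K : Set (ℝ × ℝ)} (hK : IsCompact K) :
    IsCompact {p : Model k | p.1.1 ∈ K} := by
  have : {p : Model k | p.1.1 ∈ K} = ⋃ i, lift k i '' K := by
    ext p
    simp only [mem_ofPred_eq, mem_iUnion, mem_image]
    constructor
    · intro h
      obtain ⟨i, hi⟩ := p.2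
      exact ⟨i, p.1.1, h, OnSheet.lift_eq hi⟩
    · rintro ⟨i, u, hu, rfl⟩
      exact hu
  rw [this]
  exact isCompact_iUnion fun i => hK.image (continuous_lift k i)

/-- A compactly supported family of planar diffeomorphisms `Ψ`, with inverses `Ψ'`, compatible with
the coincidences of the sheets. -/
structure SheetDiffeo (k : Kind) (K : Set (ℝ × ℝ)) (Ψ Ψ' : Fin 3 → ℝ × ℝ → ℝ × ℝ) : Prop where
  left_inv : ∀ i u, Ψ' i (Ψ i u) = u
  right_inv : ∀ i u, Ψ i (Ψ' i u) = u
  smooth : ∀ i, ContDiff ℝ ∞ (Ψ i)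
  smooth' : ∀ i, ContDiff ℝ ∞ (Ψ' i)
  det : ∀ i u, 0 < (fderiv ℝ (Ψ i) u).det
  supp : ∀ i, ∀ u ∉ K, Ψ i u = u
  eq : ∀ i j, ∀ u ∈ coincide k i j, Ψ i u = Ψ j u
  mem : ∀ i j, ∀ u ∈ coincide k i j, Ψ i u ∈ coincide k i j
  mem' : ∀ i j, ∀ u ∈ coincide k i j, Ψ' i u ∈ coincide k i j

namespace SheetDiffeo

variable {k : Kind} {K : Set (ℝ × ℝ)} {Ψ Ψ' : Fin 3 → ℝ × ℝ → ℝ × ℝ}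

theorem symm (h : SheetDiffeo k K Ψ Ψ') : SheetDiffeo k K Ψ' Ψ where
  left_inv := h.right_inv
  right_inv := h.left_inv
  smooth := h.smooth'
  smooth' := h.smooth
  det i u := by
    have e : Ψ i ∘ Ψ' i = id := funext (h.right_inv i)
    have h1 := fderiv_comp u ((h.smooth i).differentiable (by simp) (Ψ' i u))
      ((h.smooth' i).differentiable (by simp) u)
    rw [e, fderiv_id] at h1
    have h2 : ((fderiv ℝ (Ψ i) (Ψ' i u)).det) * (fderiv ℝ (Ψ' i) u).det = 1 := by
      have h3 := congrArg ContinuousLinearMap.det h1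
      change LinearMap.det (LinearMap.id : ℝ × ℝ →ₗ[ℝ] ℝ × ℝ) =
        ((_ : ℝ × ℝ →ₗ[ℝ] ℝ × ℝ) ∘ₗ _).det at h3
      rw [LinearMap.det_comp, LinearMap.det_id] at h3
      exact h3.symm
    exact pos_of_mul_pos_right (h2 ▸ one_pos) (h.det i _).le
  supp i u hu := by
    have h1 := h.left_inv i u
    rwa [h.supp i u hu] at h1
  eq i j u hu := by
    have h1 := h.right_inv i u
    rw [h.eq i j _ (h.mem' i j u hu)] at h1
    rw [← h.left_inv j (Ψ' i u), h1]
  mem := h.mem'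
  mem' := h.mem

/-- The homeomorphism of the model. -/
theorem glue_glue (h : SheetDiffeo k K Ψ Ψ') (p : Model k) :
    glue k (fun i u => lift k i (Ψ' i u)) (glue k (fun i u => lift k i (Ψ i u)) p) = p := by
  have h1 : ∀ i j, ∀ u ∈ coincide k i j, lift k i (Ψ i u) = lift k j (Ψ j u) := fun i j u hu =>
    lift_eq_lift_iff.2 ⟨h.eq i j u hu, h.mem i j u hu⟩
  have h2 : ∀ i j, ∀ u ∈ coincide k i j, lift k i (Ψ' i u) = lift k j (Ψ' j u) := fun i j u hu =>
    lift_eq_lift_iff.2 ⟨h.symm.eq i j u hu, h.symm.mem i j u hu⟩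
  obtain ⟨i, hi⟩ := p.2
  have hi : OnSheet p i := hi
  rw [← hi.lift_eq, glue_lift h1, glue_lift h2, h.left_inv]

theorem glue_lift (h : SheetDiffeo k K Ψ Ψ') (i : Fin 3) (u : ℝ × ℝ) :
    glue k (fun i u => lift k i (Ψ i u)) (lift k i u) = lift k i (Ψ i u) :=
  BranchedSurf.glue_lift (fun i j u hu => lift_eq_lift_iff.2 ⟨h.eq i j u hu, h.mem i j u hu⟩) i u

end SheetDiffeo

namespace BranchedSurface

variable {P : Type*} [TopologicalSpace P] (B : BranchedSurface P)

theorem tendsto_chart_lift {d : Fin B.num} {p : Model (B.kind d)} {i : Fin 3} (hi : OnSheet p i) :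
    Tendsto (fun u => B.chart d (lift (B.kind d) i u)) (𝓝 p.1.1) (𝓝 (B.chart d p)) :=
  ((B.continuous_chart d).comp (continuous_lift (B.kind d) i)).tendsto' _ _
    (congrArg (B.chart d) hi.lift_eq)

open Classical in
/-- The extension of a map from the domain of a chart, by a default map. -/
noncomputable def extend {X : Type*} (c : Fin B.num) (F : Model (B.kind c) → X) (f : P → X)
    (x : P) : X :=
  if h : ∃ p, B.chart c p = x then F h.choose else f x

variable {B} {X : Type*} {c : Fin B.num} {F : Model (B.kind c) → X} {f : P → X}

theorem extend_chart (p : Model (B.kind c)) : B.extend c F f (B.chart c p) = F p := by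
  have h : ∃ q, B.chart c q = B.chart c p := ⟨p, rfl⟩
  rw [extend, dif_pos h, B.chart_injective c h.choose_spec]

theorem extend_of_notMem {x : P} (hx : x ∉ range (B.chart c)) : B.extend c F f x = f x := dif_neg hx

/-- The part of a chart over a subset of the plane. -/
def box (B : BranchedSurface P) (c : Fin B.num) (K : Set (ℝ × ℝ)) : Set P :=
  B.chart c '' {p | p.1.1 ∈ K}

theorem chart_mem_box {K : Set (ℝ × ℝ)} {p : Model (B.kind c)} :
    B.chart c p ∈ B.box c K ↔ p.1.1 ∈ K := by
  constructor
  · rintro ⟨q, hq, h⟩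
    rwa [← B.chart_injective c h]
  · exact fun h => ⟨p, h, rfl⟩

theorem isClosed_box [T2Space P] {K : Set (ℝ × ℝ)} (hK : IsCompact K) : IsClosed (B.box c K) :=
  ((isCompact_over hK).image (B.continuous_chart c)).isClosed

theorem isOpen_box {U : Set (ℝ × ℝ)} (hU : IsOpen U) : IsOpen (B.box c U) :=
  (B.isOpenEmbedding c).isOpenMap _ (hU.preimage (by fun_prop))

theorem extend_of_notMem_box {K : Set (ℝ × ℝ)}
    (hF : ∀ p : Model (B.kind c), p.1.1 ∉ K → F p = f (B.chart c p)) {x : P}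
    (hx : x ∉ B.box c K) : B.extend c F f x = f x := by
  by_cases h : x ∈ range (B.chart c)
  · obtain ⟨p, rfl⟩ := h
    rw [extend_chart, hF p fun h => hx (chart_mem_box.2 h)]
  · exact extend_of_notMem h

/-- In a Hausdorff space the compact part of the chart over `K` is closed, so the default map takes
over on an open set which contains everything outside the chart. -/
theorem continuous_extend [T2Space P] [TopologicalSpace X] {K : Set (ℝ × ℝ)} (hK : IsCompact K)
    (hF : ∀ p : Model (B.kind c), p.1.1 ∉ K → F p = f (B.chart c p)) (hFc : Continuous F)
    (hf : Continuous f) : Continuous (B.extend c F f) := by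
  rw [continuous_iff_continuousAt]
  intro x
  by_cases h : x ∈ range (B.chart c)
  · obtain ⟨p, rfl⟩ := h
    rw [← (B.isOpenEmbedding c).continuousAt_iff]
    have : B.extend c F f ∘ B.chart c = F := funext extend_chart
    rw [this]
    exact hFc.continuousAt
  · have hx : x ∉ B.box c K := fun hx => h (image_subset_range _ _ hx)
    refine hf.continuousAt.congr ?_
    filter_upwards [(isClosed_box hK).isOpen_compl.mem_nhds hx] with y hy
    exact (extend_of_notMem_box hF hy).symm

/-- A sheet-wise diffeomorphism of a chart extends to a diffeomorphism of the branched surface. -/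
theorem exists_diffeo_of_sheetDiffeo [T2Space P] (B : BranchedSurface P) (c : Fin B.num)
    {K : Set (ℝ × ℝ)} (hK : IsCompact K) {Ψ Ψ' : Fin 3 → ℝ × ℝ → ℝ × ℝ}
    (h : SheetDiffeo (B.kind c) K Ψ Ψ') :
    ∃ φ : P ≃ₜ P, IsDiffeo B B φ ∧ IsDiffeo B B φ.symm ∧
      (∀ i u, φ (B.chart c (lift _ i u)) = B.chart c (lift _ i (Ψ i u))) ∧
      (∀ i u, φ.symm (B.chart c (lift _ i u)) = B.chart c (lift _ i (Ψ' i u))) ∧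
      (∀ x ∉ B.box c K, φ x = x) := by
  let ext : (Fin 3 → ℝ × ℝ → ℝ × ℝ) → P → P := fun Φ =>
    B.extend c (fun p => B.chart c (glue _ (fun i u => lift _ i (Φ i u)) p)) id
  have main : ∀ {Φ Φ' : Fin 3 → ℝ × ℝ → ℝ × ℝ}, SheetDiffeo (B.kind c) K Φ Φ' →
      Continuous (ext Φ) ∧ (∀ x, ext Φ' (ext Φ x) = x) ∧ (∀ x ∉ B.box c K, ext Φ x = x) ∧
      ∀ i u, ext Φ (B.chart c (lift _ i u)) = B.chart c (lift _ i (Φ i u)) := by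
    intro Φ Φ' H
    have e : ∀ i u, ext Φ (B.chart c (lift _ i u)) = B.chart c (lift _ i (Φ i u)) := by
      intro i u
      simp only [ext, extend_chart, H.glue_lift]
    have h0 : ∀ p : Model (B.kind c), p.1.1 ∉ K →
        B.chart c (glue _ (fun i u => lift _ i (Φ i u)) p) = id (B.chart c p) := by
      intro p hp
      obtain ⟨i, hi⟩ := exists_onSheet p
      rw [← hi.lift_eq, H.glue_lift, H.supp i _ hp]
      rfl
    refine ⟨continuous_extend hK h0 ((B.continuous_chart c).comp (continuous_of_lift fun i => ?_))
      continuous_id, fun x => ?_, fun x hx => extend_of_notMem_box h0 hx, e⟩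
    · simp only [H.glue_lift]
      exact (continuous_lift _ i).comp (H.smooth i).continuous
    · by_cases hx : x ∈ range (B.chart c)
      · obtain ⟨p, rfl⟩ := hx
        simp only [ext, extend_chart]
        rw [H.glue_glue]
      · simp only [ext]
        rw [extend_of_notMem hx, id, extend_of_notMem hx, id]
  have smooth : ∀ {Φ Φ' : Fin 3 → ℝ × ℝ → ℝ × ℝ}, SheetDiffeo (B.kind c) K Φ Φ' →
      ∀ φ : P ≃ₜ P, (∀ x, φ x = ext Φ x) → IsDiffeo B B φ := by
    intro Φ Φ' H φ hφ d e p q hpq i hi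
    obtain ⟨-, -, h2, h3⟩ := main H
    by_cases hx : B.chart d p ∈ range (B.chart c)
    · obtain ⟨r, hr⟩ := hx
      obtain ⟨j, T, hT⟩ := B.exists_transition hr.symm hi
      have hj := (hT.onSheet (B.chart_injective c) hr.symm).1
      have hΦ : LocalRep (B.chart c) (B.chart c) φ r j j (Φ j) :=
        ⟨hj, (H.smooth j).contDiffAt, H.det j _, Eventually.of_forall fun u => by rw [hφ, h3]⟩
      have e1 : φ (B.chart c r) = B.chart c (lift _ j (Φ j r.1.1)) := by
        rw [hφ, ← h3, hj.lift_eq]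
      obtain ⟨n, T', hT'⟩ := B.exists_transition (c := c) (d := e)
        (p := lift _ j (Φ j r.1.1)) (q := q) (by rw [← e1, hr, hpq]) rfl
      refine ⟨n, _, ((hT.comp (B.chart_injective c) hr.symm hΦ).comp (B.chart_injective c)
        (q := lift _ j (Φ j r.1.1)) ?_ hT')⟩
      simp only [Function.comp_apply, id, ← e1, hr]
    · have hx' : B.chart d p ∉ B.box c K := fun h => hx (image_subset_range _ _ h)
      have e1 : φ (B.chart d p) = B.chart d p := by rw [hφ, h2 _ hx']
      obtain ⟨j, T, hT⟩ := B.exists_transition (e1.symm.trans hpq) hi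
      refine ⟨j, T, hT.congr_map ?_⟩
      have hc := B.tendsto_chart_lift hi
      filter_upwards [hc.eventually ((isClosed_box hK).isOpen_compl.mem_nhds hx')] with u hu
      rw [hφ, h2 _ hu]
      rfl
  obtain ⟨c1, i1, s1, e1⟩ := main h
  obtain ⟨c2, i2, s2, e2⟩ := main h.symm
  let φ : P ≃ₜ P :=
    { toFun := ext Ψ
      invFun := ext Ψ'
      left_inv := i1
      right_inv := i2
      continuous_toFun := c1
      continuous_invFun := c2 }
  exact ⟨φ, smooth h φ fun _ => rfl, smooth h.symm φ.symm fun _ => rfl, e1, e2, s1⟩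

end BranchedSurface

end BranchedSurf

namespace BranchedSurf

namespace BranchedSurface

variable {P : Type*} [TopologicalSpace P] {B : BranchedSurface P}

/-! ### Smooth functions and forms -/

theorem SmoothFun.comp {g : P → ℝ} (hg : B.SmoothFun g) {φ : P ≃ₜ P} (hφ : IsDiffeo B B φ) :
    B.SmoothFun fun x => g (φ x) := by
  intro c i
  rw [contDiff_iff_contDiffAt]
  intro u
  obtain ⟨d, q, hq⟩ := B.cover (φ (B.chart c (lift _ i u)))
  obtain ⟨j, T, hT⟩ := hφ c d (lift _ i u) q hq.symm i rfl
  refine ((hg d j).contDiffAt.comp u hT.2.1).congr_of_eventuallyEq ?_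
  filter_upwards [hT.2.2.2] with v hv
  simp only [Function.comp_apply, hv]

theorem SmoothFun.mul {g h : P → ℝ} (hg : B.SmoothFun g) (hh : B.SmoothFun h) :
    B.SmoothFun fun x => g x * h x := fun c i => (hg c i).mul (hh c i)

theorem SmoothFun.const (r : ℝ) : B.SmoothFun fun _ => r := fun _ _ => contDiff_const

/-- A transition map is smooth and oriented near every point, and represents the change of charts
at the nearby points as well. -/
theorem _root_.BranchedSurf.LocalRep.eventually {P Q : Type*} [TopologicalSpace P]
    [TopologicalSpace Q] {B : BranchedSurface P} {B' : BranchedSurface Q} {a : P ≃ₜ Q}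
    (ha : IsDiffeo B B' a) {c : Fin B.num} {d : Fin B'.num} {p : Model (B.kind c)} {i j : Fin 3}
    {T : ℝ × ℝ → ℝ × ℝ} (hT : LocalRep (B.chart c) (B'.chart d) a p i j T) :
    ∀ᶠ u in 𝓝 p.1.1, LocalRep (B.chart c) (B'.chart d) a (lift _ i u) i j T := by
  filter_upwards [hT.2.2.2.eventually_nhds] with u hu
  have hu' := hu.self_of_nhds
  obtain ⟨j', T', hT'⟩ := ha c d (lift _ i u) (lift _ j (T u)) hu' i rfl
  have e : T =ᶠ[𝓝 u] T' := by
    filter_upwards [hu, hT'.2.2.2] with v h1 h2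
    exact (lift_eq_lift_iff.1 (B'.chart_injective d (h1.symm.trans h2))).1
  exact ⟨rfl, hT'.2.1.congr_of_eventuallyEq e, by rw [lift_fst, e.fderiv_eq]; exact hT'.2.2.1, hu⟩

theorem _root_.BranchedSurf.LocalRep.smoothNear {P Q : Type*} [TopologicalSpace P]
    [TopologicalSpace Q] {B : BranchedSurface P} {B' : BranchedSurface Q} {a : P ≃ₜ Q}
    (ha : IsDiffeo B B' a) {c : Fin B.num} {d : Fin B'.num} {p : Model (B.kind c)} {i j : Fin 3}
    {T : ℝ × ℝ → ℝ × ℝ} (hT : LocalRep (B.chart c) (B'.chart d) a p i j T) :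
    SmoothNear T p.1.1 := (hT.eventually ha).mono fun _ h => h.2.1

theorem SmoothFun.extend [T2Space P] {c : Fin B.num} {F : Model (B.kind c) → ℝ} {K : Set (ℝ × ℝ)}
    (hK : IsCompact K) {f : P → ℝ} (hF : ∀ p : Model (B.kind c), p.1.1 ∉ K → F p = f (B.chart c p))
    (hFs : ∀ i, ContDiff ℝ ∞ fun u => F (lift _ i u)) (hf : B.SmoothFun f) :
    B.SmoothFun (B.extend c F f) := by
  intro d i
  rw [contDiff_iff_contDiffAt]
  intro u
  by_cases hx : B.chart d (lift _ i u) ∈ range (B.chart c)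
  · obtain ⟨r, hr⟩ := hx
    obtain ⟨j, T, hT⟩ := B.exists_transition (i := i) hr.symm rfl
    refine ((hFs j).contDiffAt.comp u hT.2.1).congr_of_eventuallyEq ?_
    filter_upwards [hT.2.2.2] with v hv
    simp only [Function.comp_apply, id] at hv ⊢
    rw [hv, extend_chart]
  · have hx' : B.chart d (lift _ i u) ∉ B.box c K := fun h => hx (image_subset_range _ _ h)
    refine (hf d i).contDiffAt.congr_of_eventuallyEq ?_
    filter_upwards [(B.tendsto_chart_lift (onSheet_lift _ i u)).eventually
      ((isClosed_box hK).isOpen_compl.mem_nhds hx')] with v hv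
    exact extend_of_notMem_box hF hv

namespace OneForm

/-- The sum of two forms. -/
noncomputable def add (α β : B.OneForm) : B.OneForm where
  coe c p := α.coe c p + β.coe c p
  smooth c i := (α.smooth c i).add (β.smooth c i)
  compat c d p q i j T h hT := by
    rw [α.compat c d p q i j T h hT, β.compat c d p q i j T h hT, ContinuousLinearMap.add_comp]

/-- The product of a form by a smooth function. -/
noncomputable def fmul (g : P → ℝ) (hg : B.SmoothFun g) (α : B.OneForm) : B.OneForm where
  coe c p := g (B.chart c p) • α.coe c p
  smooth c i := (hg c i).smul (α.smooth c i)
  compat c d p q i j T h hT := by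
    rw [α.compat c d p q i j T h hT, ContinuousLinearMap.smul_comp, h]

theorem foliation_eq_iff {α β : B.OneForm} : α.foliation = β.foliation ↔
    ∃ g : P → ℝ, B.SmoothFun g ∧ (∀ x, 0 < g x) ∧
      ∀ c p, β.coe c p = g (B.chart c p) • α.coe c p := Quotient.eq (r := B.formSetoid)

theorem foliation_fmul {g : P → ℝ} (hg : B.SmoothFun g) (h0 : ∀ x, 0 < g x) (α : B.OneForm) :
    (fmul g hg α).foliation = α.foliation :=
  (foliation_eq_iff.2 ⟨g, hg, h0, fun _ _ => rfl⟩).symm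

/-- Two forms coincide at a point of the branched surface. -/
def EqAt (α β : B.OneForm) (x : P) : Prop := ∀ c p, B.chart c p = x → α.coe c p = β.coe c p

theorem eqAt_of_chart {α β : B.OneForm} {c : Fin B.num} {p : Model (B.kind c)}
    (h : α.coe c p = β.coe c p) : EqAt α β (B.chart c p) := by
  intro d q hq
  obtain ⟨i, hi⟩ := exists_onSheet q
  obtain ⟨j, T, hT⟩ := B.exists_transition hq hi
  rw [α.compat d c q p i j T hq hT, β.compat d c q p i j T hq hT, h]

open Classical in
/-- The extension by zero of a field of covectors on a chart, as seen in the other charts. -/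
noncomputable def extCoe (c : Fin B.num) (δ : Model (B.kind c) → (ℝ × ℝ →L[ℝ] ℝ)) (d : Fin B.num)
    (q : Model (B.kind d)) : ℝ × ℝ →L[ℝ] ℝ :=
  if h : ∃ p, B.chart d q = B.chart c p then (δ h.choose).comp (fderiv ℝ
    (B.exists_transition h.choose_spec (onSheet_sheetOf q)).choose_spec.choose q.1.1) else 0

variable {c : Fin B.num} {δ : Model (B.kind c) → (ℝ × ℝ →L[ℝ] ℝ)}

theorem extCoe_eq {d : Fin B.num} {p : Model (B.kind c)} {q : Model (B.kind d)}
    (h : B.chart d q = B.chart c p) {i j : Fin 3} {T : ℝ × ℝ → ℝ × ℝ}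
    (hT : LocalRep (B.chart d) (B.chart c) id q i j T) :
    extCoe c δ d q = (δ p).comp (fderiv ℝ T q.1.1) := by
  have h' : ∃ p, B.chart d q = B.chart c p := ⟨p, h⟩
  have hp : h'.choose = p := B.chart_injective c (h'.choose_spec.symm.trans h)
  rw [extCoe, dif_pos h',
    ((B.exists_transition h'.choose_spec (onSheet_sheetOf q)).choose_spec.choose_spec.fderiv_eq
      (B.chart_injective c) hT).2, hp]

theorem extCoe_self (p : Model (B.kind c)) : extCoe c δ c p = δ p := by
  obtain ⟨i, hi⟩ := exists_onSheet p
  rw [extCoe_eq rfl (LocalRep.self hi), fderiv_id, ContinuousLinearMap.comp_id]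

theorem extCoe_of_notMem {d : Fin B.num} {q : Model (B.kind d)}
    (h : B.chart d q ∉ range (B.chart c)) : extCoe c δ d q = 0 :=
  dif_neg fun ⟨p, hp⟩ => h ⟨p, hp.symm⟩

theorem extCoe_of_notMem_box {K : Set (ℝ × ℝ)} (h0 : ∀ p : Model (B.kind c), p.1.1 ∉ K → δ p = 0)
    {d : Fin B.num} {q : Model (B.kind d)} (h : B.chart d q ∉ B.box c K) :
    extCoe c δ d q = 0 := by
  by_cases hx : B.chart d q ∈ range (B.chart c)
  · obtain ⟨p, hp⟩ := hx
    obtain ⟨i, hi⟩ := exists_onSheet q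
    obtain ⟨j, T, hT⟩ := B.exists_transition hp.symm hi
    rw [extCoe_eq hp.symm hT, h0 p fun hpK => h (hp ▸ chart_mem_box.2 hpK),
      ContinuousLinearMap.zero_comp]
  · exact extCoe_of_notMem hx

/-- The parameter is carried along because curves of forms have to be smooth jointly in the
parameter and the point. -/
theorem smoothNear_extCoe [T2Space P] {E : Type*} [NormedAddCommGroup E] [NormedSpace ℝ E] {s₀ : E}
    {δ : E → Model (B.kind c) → (ℝ × ℝ →L[ℝ] ℝ)} {K : Set (ℝ × ℝ)} (hK : IsCompact K)
    (h0 : ∀ᶠ s in 𝓝 s₀, ∀ p : Model (B.kind c), p.1.1 ∉ K → δ s p = 0)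
    (hδ : ∀ j u, SmoothNear (fun z : E × (ℝ × ℝ) => δ z.1 (lift _ j z.2)) (s₀, u))
    (d : Fin B.num) (i : Fin 3) (u : ℝ × ℝ) :
    SmoothNear (fun z : E × (ℝ × ℝ) => extCoe c (δ z.1) d (lift _ i z.2)) (s₀, u) := by
  by_cases hx : B.chart d (lift _ i u) ∈ range (B.chart c)
  · obtain ⟨r, hr⟩ := hx
    obtain ⟨j, T, hT⟩ := B.exists_transition (i := i) hr.symm rfl
    have hsm : SmoothNear T u := hT.smoothNear B.isDiffeo_refl
    have h2 : SmoothNear (fun z : E × (ℝ × ℝ) => z.2) (s₀, u) := contDiff_snd.smoothNear _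
    have h1 : SmoothNear (fun z : E × (ℝ × ℝ) => z.1) (s₀, u) := contDiff_fst.smoothNear _
    have hTz : SmoothNear (fun z : E × (ℝ × ℝ) => T z.2) (s₀, u) := hsm.comp' h2 rfl
    have hDz : SmoothNear (fun z : E × (ℝ × ℝ) => fderiv ℝ T z.2) (s₀, u) := hsm.fderiv.comp' h2 rfl
    have hz : SmoothNear (fun z : E × (ℝ × ℝ) => δ z.1 (lift _ j (T z.2))) (s₀, u) :=
      (hδ j (T u)).comp' (h1.prodMk hTz) rfl
    refine (hz.clm_comp hDz).congr ?_
    filter_upwards [h2.continuousAt.eventually (hT.eventually B.isDiffeo_refl)] with z hz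
    exact extCoe_eq hz.2.2.2.self_of_nhds hz
  · have hx' : B.chart d (lift _ i u) ∉ B.box c K := fun h => hx (image_subset_range _ _ h)
    refine (SmoothNear.const (0 : ℝ × ℝ →L[ℝ] ℝ)).congr ?_
    have e1 : ∀ᶠ z : E × (ℝ × ℝ) in 𝓝 (s₀, u), B.chart d (lift _ i z.2) ∉ B.box c K :=
      (continuous_snd.tendsto' (s₀, u) u rfl).eventually
        ((B.tendsto_chart_lift (onSheet_lift _ i u)).eventually
          ((isClosed_box hK).isOpen_compl.mem_nhds hx'))
    filter_upwards [e1, (continuous_fst.tendsto' (s₀, u) s₀ rfl).eventually h0] with z h1 h2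
    exact extCoe_of_notMem_box h2 h1

/-- The extension by zero of a compactly supported field of covectors on a chart. -/
noncomputable def extForm [T2Space P] (c : Fin B.num) (δ : Model (B.kind c) → (ℝ × ℝ →L[ℝ] ℝ))
    {K : Set (ℝ × ℝ)} (hK : IsCompact K) (h0 : ∀ p : Model (B.kind c), p.1.1 ∉ K → δ p = 0)
    (hδ : ∀ j, ContDiff ℝ ∞ fun u => δ (lift _ j u)) : B.OneForm where
  coe := extCoe c δ
  smooth d i := by
    rw [contDiff_iff_contDiffAt]
    intro u
    have h := smoothNear_extCoe (s₀ := (0 : ℝ)) (δ := fun _ => δ) hK (Eventually.of_forall fun _ => h0)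
      (fun j u => ((hδ j).smoothNear u).comp' (contDiff_snd.smoothNear _) rfl) d i u
    exact h.contDiffAt.comp u (f := fun u => ((0 : ℝ), u)) (contDiff_prodMk_right 0).contDiffAt
  compat d e p q i j T h hT := by
    by_cases hx : B.chart e q ∈ range (B.chart c)
    · obtain ⟨r, hr⟩ := hx
      have hj := (hT.onSheet (B.chart_injective e) h)
      obtain ⟨n, S, hS⟩ := B.exists_transition hr.symm hj.1
      have hS' := hS.2.1
      rw [extCoe_eq hr.symm hS, extCoe_eq (h.trans hr.symm) (hT.comp (B.chart_injective e) h hS),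
        fderiv_comp _ (by rw [← hj.2]; exact hS'.differentiableAt (by simp))
          (hT.2.1.differentiableAt (by simp)), ← hj.2, ContinuousLinearMap.comp_assoc]
    · rw [extCoe_of_notMem hx, extCoe_of_notMem (h ▸ hx), ContinuousLinearMap.zero_comp]

/-! ### Pull-backs -/

theorem IsPullback.trans {φ ψ : P ≃ₜ P} (hφ : IsDiffeo B B φ) (hψ : IsDiffeo B B ψ)
    {α β γ : B.OneForm} (h1 : IsPullback φ α β) (h2 : IsPullback ψ β γ) :
    IsPullback (φ.trans ψ) α γ := by
  intro c d p q i j T h hT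
  obtain ⟨e, r, hr⟩ := B.cover (φ (B.chart c p))
  obtain ⟨m, S, hS⟩ := hφ c e p r hr.symm i hT.1
  have hm := hS.onSheet (B.chart_injective e) hr.symm
  have hq : ψ (B.chart e r) = B.chart d q := by rw [hr]; exact h
  obtain ⟨n, S', hS'⟩ := hψ e d r q hq m hm.1
  have h3 := hS.comp (B.chart_injective e) hr.symm hS'
  have hd : fderiv ℝ T p.1.1 = fderiv ℝ (S' ∘ S) p.1.1 := (hT.fderiv_eq (B.chart_injective d) h3).2
  rw [h1 c e p r i m S hr.symm hS, h2 e d r q m n S' hq hS', hd,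
    fderiv_comp _ (by rw [← hm.2]; exact hS'.2.1.differentiableAt (by simp))
      (hS.2.1.differentiableAt (by simp)), ← hm.2, ContinuousLinearMap.comp_assoc]

theorem IsPullback.fmul {φ : P ≃ₜ P} (hφ : IsDiffeo B B φ) {α β : B.OneForm}
    (h : IsPullback φ α β) {g : P → ℝ} (hg : B.SmoothFun g) :
    IsPullback φ (fmul (fun x => g (φ x)) (hg.comp hφ) α) (fmul g hg β) := by
  intro c d p q i j T hpq hT
  simp only [OneForm.fmul]
  rw [h c d p q i j T hpq hT, hpq, ContinuousLinearMap.smul_comp]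

/-- To check a pull-back it suffices to use one representation around every point. -/
theorem isPullback_of_local {φ : P ≃ₜ P} {α β : B.OneForm}
    (h : ∀ x, ∃ c d p q i j T, B.chart c p = x ∧ φ (B.chart c p) = B.chart d q ∧
      LocalRep (B.chart c) (B.chart d) φ p i j T ∧
      α.coe c p = (β.coe d q).comp (fderiv ℝ T p.1.1)) : IsPullback φ α β := by
  intro c' d' p' q' i' j' T' h' hT'
  obtain ⟨c, d, p, q, i, j, T, hp, hq, hT, e⟩ := h (B.chart c' p')
  obtain ⟨m, S, hS⟩ := B.exists_transition hp.symm hT'.1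
  have hm := hS.onSheet (B.chart_injective c) hp.symm
  obtain ⟨σ, S2, hS2⟩ : ∃ j2 S2, LocalRep (B.chart d) (B.chart d') id q j j2 S2 :=
    B.exists_transition (by rw [← hq, ← h', hp]) (hT.onSheet (B.chart_injective d) hq).1
  have hqq : B.chart d q = B.chart d' q' := by rw [← hq, ← h', hp]
  have hTj := hT.onSheet (B.chart_injective d) hq
  have h3 := hT.comp (B.chart_injective d) hq hS2
  -- the derivative at `p` of the representation from `c` to `d'`
  have hdT : fderiv ℝ (S2 ∘ T) p.1.1 = (fderiv ℝ S2 q.1.1).comp (fderiv ℝ T p.1.1) := by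
    rw [fderiv_comp _ (by rw [← hTj.2]; exact hS2.2.1.differentiableAt (by simp))
      (hT.2.1.differentiableAt (by simp)), ← hTj.2]
  -- a representation on the sheet `m`
  obtain ⟨n, S3, hS3⟩ : ∃ n S3, LocalRep (B.chart c) (B.chart d') φ p m n S3 := by
    obtain ⟨l, R, hR⟩ := B.exists_transition hp hm.1
    have hl := hR.onSheet (B.chart_injective c') hp
    -- go back to `p'` on the sheet `l`, which is the sheet `i'`
    have hRS : LocalRep (B.chart c') (B.chart c') id p' i' l (R ∘ S) :=
      hS.comp (B.chart_injective c) hp.symm hR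
    have e1 : R ∘ S =ᶠ[𝓝 p'.1.1] id := hRS.eventuallyEq (B.chart_injective c') (LocalRep.self hT'.1)
    refine ⟨j', T' ∘ R, hm.1, ?_, ?_, ?_⟩
    · refine ContDiffAt.comp _ ?_ hR.2.1
      rw [← hl.2]
      exact hT'.2.1
    · rw [fderiv_comp _ (by rw [← hl.2]; exact hT'.2.1.differentiableAt (by simp))
        (hR.2.1.differentiableAt (by simp)), ← hl.2]
      change 0 < ((_ : ℝ × ℝ →ₗ[ℝ] ℝ × ℝ) ∘ₗ _).det
      rw [LinearMap.det_comp]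
      exact mul_pos hT'.2.2.1 hR.2.2.1
    · have e2 : ∀ᶠ u in 𝓝 p.1.1, ∃ v, S v = u ∧ R (S v) = v ∧
          B.chart c' (lift _ i' v) = B.chart c (lift _ m (S v)) ∧
          φ (B.chart c' (lift _ i' v)) = B.chart d' (lift _ j' (T' v)) := by
        rw [hm.2, ← hS.map_nhds, eventually_map]
        filter_upwards [e1, hS.2.2.2, hT'.2.2.2] with v h1 h2 h3
        exact ⟨v, rfl, h1, h2, h3⟩
      filter_upwards [e2] with u hu
      obtain ⟨v, rfl, h1, h2, h3⟩ := hu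
      rw [Function.comp_apply, h1, ← h2, h3]
  -- At a given point all representatives have the same derivative, whatever sheet they are read on,
  -- so `S3` and `S2 ∘ T` are interchangeable.
  have hd3 := (hS3.fderiv_eq (B.chart_injective d') h3).2
  have h4 := hS.comp (B.chart_injective c) hp.symm hS3
  have hd4 : fderiv ℝ T' p'.1.1 = fderiv ℝ (S3 ∘ S) p'.1.1 :=
    (hT'.fderiv_eq (B.chart_injective d') h4).2
  rw [α.compat c' c p' p i' m S hp.symm hS, e, β.compat d d' q q' j σ S2 hqq hS2, hd4,
    fderiv_comp _ (by rw [← hm.2]; exact hS3.2.1.differentiableAt (by simp))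
      (hS.2.1.differentiableAt (by simp)), ← hm.2, hd3, hdT]
  simp only [ContinuousLinearMap.comp_assoc]

end OneForm

end BranchedSurface

end BranchedSurf

namespace BranchedSurf

/-! ### The flow of a Lipschitz smooth vector field -/

section Flow

universe u

open unitInterval

variable {E F : Type u} [NormedAddCommGroup E] [NormedSpace ℝ E] [NormedAddCommGroup F]
  [NormedSpace ℝ F]

/-- Pointwise evaluation of a curve of linear maps at a curve. -/
noncomputable def curveEval : C(I, E →L[ℝ] F) →L[ℝ] C(I, E) →L[ℝ] C(I, F) :=
  LinearMap.mkContinuous₂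
    (LinearMap.mk₂ ℝ (fun (A : C(I, E →L[ℝ] F)) (h : C(I, E)) =>
      (⟨fun t => A t (h t), A.continuous.clm_apply h.continuous⟩ : C(I, F)))
      (fun A B h => by ext t; simp) (fun c A h => by ext t; simp)
      (fun A g h => by ext t; simp) (fun c A h => by ext t; simp)) 1 (by
    intro A h
    rw [one_mul, ContinuousMap.norm_le _ (by positivity)]
    intro t
    exact ((A t).le_opNorm _).trans (mul_le_mul (A.norm_coe_le_norm t) (h.norm_coe_le_norm t)
      (norm_nonneg _) (norm_nonneg A)))

/-- The remainder in the first order expansion of `W` is small uniformly along the compact range of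
`g`, so the pointwise derivative is a derivative for the supremum norm. -/
theorem hasFDerivAt_curveComp {W : E → F} (hW : ContDiff ℝ ∞ W) (g : C(I, E)) :
    HasFDerivAt (fun x : C(I, E) => (⟨W, hW.continuous⟩ : C(E, F)).comp x)
      (curveEval ((⟨fderiv ℝ W, hW.continuous_fderiv (by simp)⟩ : C(E, E →L[ℝ] F)).comp g)) g := by
  rw [hasFDerivAt_iff_isLittleO_nhds_zero, Asymptotics.isLittleO_iff]
  intro ε hε
  have key : ∀ᶠ h in 𝓝 (0 : E), ∀ x ∈ range g,
      ‖W (x + h) - W x - fderiv ℝ W x h‖ ≤ ε * ‖h‖ := by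
    refine (isCompact_range g.continuous).eventually_forall_of_forall_eventually fun x _ => ?_
    have h1 := (hW.contDiffAt (x := x)).hasStrictFDerivAt (by simp)
    have h2 := (hasStrictFDerivAt_iff_isLittleO.1 h1).def (half_pos hε)
    have h3 : ∀ᶠ y in 𝓝 x, ‖fderiv ℝ W y - fderiv ℝ W x‖ < ε / 2 := by
      have := (hW.continuous_fderiv (by simp)).tendsto x
      simpa [dist_eq_norm] using this.eventually (Metric.ball_mem_nhds _ (half_pos hε))
    have t1 : Tendsto (fun p : E × E => (p.2 + p.1, p.2)) (𝓝 (0, x)) (𝓝 (x, x)) := by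
      refine Continuous.tendsto' (by fun_prop) _ _ (by simp)
    have t2 : Tendsto (fun p : E × E => p.2) (𝓝 (0, x)) (𝓝 x) :=
      Continuous.tendsto' (by fun_prop) _ _ rfl
    filter_upwards [t1.eventually h2, t2.eventually h3] with p h4 h5
    have e : W (p.2 + p.1) - W p.2 - fderiv ℝ W p.2 p.1 =
        (W (p.2 + p.1) - W p.2 - fderiv ℝ W x (p.2 + p.1 - p.2)) -
          (fderiv ℝ W p.2 - fderiv ℝ W x) p.1 := by
      simp
    rw [e]
    refine (norm_sub_le _ _).trans ?_
    have h6 := (fderiv ℝ W p.2 - fderiv ℝ W x).le_of_opNorm_le h5.le p.1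
    simp only [add_sub_cancel_left] at h4 ⊢
    linarith
  obtain ⟨δ, hδ, hball⟩ := Metric.eventually_nhds_iff.1 key
  rw [Metric.eventually_nhds_iff]
  refine ⟨δ, hδ, fun h hh => ?_⟩
  rw [ContinuousMap.norm_le _ (by positivity)]
  intro t
  have h1 : ‖h t‖ ≤ ‖h‖ := h.norm_coe_le_norm t
  rw [dist_zero_right] at hh
  exact (hball (by rw [dist_zero_right]; exact h1.trans_lt hh) (g t) (mem_range_self t)).trans
    (by gcongr)

/-- The derivative is the composition operator of `fderiv ℝ W` followed by the bounded map
`curveEval`. So the order of smoothness goes up by induction, with a varying target space. -/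
theorem contDiff_curveComp {W : E → F} (hW : ContDiff ℝ ∞ W) :
    ContDiff ℝ ∞ (fun x : C(I, E) => (⟨W, hW.continuous⟩ : C(E, F)).comp x) := by
  rw [contDiff_infty]
  intro n
  induction n generalizing F with
  | zero => exact contDiff_zero.2 (ContinuousMap.continuous_postcomp _)
  | succ n ih =>
    refine contDiff_succ_iff_hasFDerivAt.2 ⟨_, ?_, hasFDerivAt_curveComp hW⟩
    have h : ContDiff ℝ n fun A : C(I, E →L[ℝ] F) => curveEval A :=
      IsBoundedLinearMap.contDiff
        { map_add := fun A B => curveEval.map_add A B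
          map_smul := fun c A => curveEval.map_smul c A
          bound := ⟨1, one_pos, fun A => ContinuousLinearMap.opNorm_le_bound _ (by positivity)
            fun h => by
              rw [one_mul, ContinuousMap.norm_le _ (by positivity)]
              intro t
              exact ((A t).le_opNorm _).trans (mul_le_mul (A.norm_coe_le_norm t)
                (h.norm_coe_le_norm t) (norm_nonneg _) (norm_nonneg A))⟩ }
    exact h.comp (ih (hW.fderiv_right (m := ∞) (by simp)))

/-- The primitive of a curve. -/
noncomputable def curvePrimitive [CompleteSpace E] : C(I, E) →L[ℝ] C(I, E) :=
  LinearMap.mkContinuous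
    { toFun := fun x => ⟨fun t => ∫ s in (0 : ℝ)..t, IccExtend zero_le_one x s, by
        have : Continuous fun t : ℝ => ∫ s in (0 : ℝ)..t, IccExtend zero_le_one x s :=
          intervalIntegral.continuous_primitive
            (fun a b => (x.continuous.Icc_extend').intervalIntegrable a b) 0
        exact this.comp continuous_subtype_val⟩
      map_add' := fun x y => by
        ext t
        exact intervalIntegral.integral_add (x.continuous.Icc_extend'.intervalIntegrable _ _)
          (y.continuous.Icc_extend'.intervalIntegrable _ _)
      map_smul' := fun c x => by
        ext t
        exact intervalIntegral.integral_smul c _ } 1 (by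
    intro x
    rw [one_mul, ContinuousMap.norm_le _ (norm_nonneg _)]
    intro t
    have h := intervalIntegral.norm_integral_le_of_norm_le_const (a := 0) (b := t.1) (C := ‖x‖)
      (f := IccExtend zero_le_one x) fun s _ => x.norm_coe_le_norm _
    refine h.trans ?_
    rw [sub_zero, abs_of_nonneg t.2.1]
    exact mul_le_of_le_one_right (norm_nonneg _) t.2.2)

theorem curvePrimitive_apply [CompleteSpace E] (x : C(I, E)) (t : I) :
    curvePrimitive x t = ∫ s in (0 : ℝ)..t, IccExtend zero_le_one x s := rfl

theorem norm_curvePrimitive_le [CompleteSpace E] (x : C(I, E)) : ‖curvePrimitive x‖ ≤ ‖x‖ := by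
  have h : ‖(curvePrimitive : C(I, E) →L[ℝ] C(I, E))‖ ≤ 1 :=
    LinearMap.mkContinuous_norm_le _ zero_le_one _
  simpa using (curvePrimitive (E := E)).le_of_opNorm_le h x

variable [CompleteSpace E]

/-- Rescaled to the unit interval, the trajectory of `z` up to time `t` is the fixed point of `y ↦ z
+ t ∫ W(y)`, a contraction when `|t| L < 1`. Smooth dependence on `(t, z)` comes from the implicit
function theorem in the Banach space of curves, without differentiating the equation. -/
theorem exists_solution_curve {W : E → E} (hW : ContDiff ℝ ∞ W) {L : NNReal}
    (hL : LipschitzWith L W) :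
    ∃ x : ℝ × E → C(I, E), (∀ p, |p.1| * (L : ℝ) < 1 → ContDiffAt ℝ ∞ x p) ∧
      (∀ p, |p.1| * (L : ℝ) < 1 → ∀ y : C(I, E), y = x p ↔
        y = ContinuousMap.const I p.2 + p.1 • curvePrimitive
          ((⟨W, hW.continuous⟩ : C(E, E)).comp y)) := by
  let N : C(I, E) → C(I, E) := fun y => (⟨W, hW.continuous⟩ : C(E, E)).comp y
  have hN : ∀ y z : C(I, E), ‖N y - N z‖ ≤ L * ‖y - z‖ := fun y z => by
    rw [ContinuousMap.norm_le _ (by positivity)]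
    intro t
    have h1 := hL.dist_le_mul (y t) (z t)
    rw [dist_eq_norm, dist_eq_norm] at h1
    exact h1.trans (mul_le_mul_of_nonneg_left ((y - z).norm_coe_le_norm t) L.2)
  have hc : ∀ p : ℝ × E, |p.1| * (L : ℝ) < 1 → ContractingWith (Real.toNNReal (|p.1| * (L : ℝ)))
      fun y : C(I, E) => ContinuousMap.const I p.2 + p.1 • curvePrimitive (N y) := by
    intro p hp
    refine ⟨by rw [← NNReal.coe_lt_coe, Real.coe_toNNReal _ (by positivity)]; exact hp,
      LipschitzWith.of_dist_le_mul fun y z => ?_⟩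
    rw [Real.coe_toNNReal _ (by positivity), dist_eq_norm, dist_eq_norm, add_sub_add_left_eq_sub,
      ← smul_sub, ← map_sub, norm_smul, Real.norm_eq_abs, mul_assoc]
    exact mul_le_mul_of_nonneg_left ((norm_curvePrimitive_le _).trans (hN y z)) (abs_nonneg _)
  classical
  let x : ℝ × E → C(I, E) := fun p => if hp : |p.1| * (L : ℝ) < 1 then (hc p hp).fixedPoint else 0
  have hx : ∀ p, |p.1| * (L : ℝ) < 1 → ∀ y : C(I, E), y = x p ↔
      y = ContinuousMap.const I p.2 + p.1 • curvePrimitive (N y) := by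
    intro p hp y
    simp only [x, dif_pos hp]
    constructor
    · rintro rfl
      exact ((hc p hp).fixedPoint_isFixedPt).symm
    · intro h
      exact (hc p hp).fixedPoint_unique h.symm
  refine ⟨x, fun p hp => ?_, hx⟩
  let f : (ℝ × E) × C(I, E) → C(I, E) := fun q =>
    q.2 - (ContinuousMap.const I q.1.2 + q.1.1 • curvePrimitive (N q.2))
  have hconst : ContDiff ℝ ∞ (fun z : E => ContinuousMap.const I z) := by
    have : (fun z : E => ContinuousMap.const I z) =
        (LinearMap.mkContinuous (⟨⟨fun z : E => ContinuousMap.const I z, fun _ _ => rfl⟩,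
          fun _ _ => rfl⟩ : E →ₗ[ℝ] C(I, E)) 1 (fun z => by
            rw [one_mul, ContinuousMap.norm_le _ (norm_nonneg _)]
            exact fun _ => le_rfl)) := rfl
    rw [this]
    exact ContinuousLinearMap.contDiff _
  have hNs : ContDiff ℝ ∞ N := contDiff_curveComp hW
  have hf : ContDiff ℝ ∞ f := by
    refine contDiff_snd.sub ((hconst.comp (contDiff_snd.comp contDiff_fst)).add ?_)
    exact (contDiff_fst.comp contDiff_fst).smul
      ((ContinuousLinearMap.contDiff _).comp (hNs.comp contDiff_snd))
  have hf0 : f (p, x p) = 0 := sub_eq_zero.2 ((hx p hp _).1 rfl)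
  -- The partial derivative in the curve is the identity minus an operator of norm less than `1`, by
  -- the Lipschitz bound; a Neumann series inverts it.
  have hinv : (fderiv ℝ f (p, x p) ∘L .inr ℝ (ℝ × E) C(I, E)).IsInvertible := by
    have h1 : HasFDerivAt (fun y => f (p, y)) (fderiv ℝ f (p, x p) ∘L .inr ℝ (ℝ × E) C(I, E)) (x p) :=
      ((hf.differentiable (by simp) _).hasFDerivAt).comp (x p) (hasFDerivAt_prodMk_right p (x p))
    set D := curveEval ((⟨fderiv ℝ W, hW.continuous_fderiv (by simp)⟩ : C(E, E →L[ℝ] E)).comp (x p))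
    have h2 : HasFDerivAt (fun y => f (p, y)) (ContinuousLinearMap.id ℝ _ -
        p.1 • (curvePrimitive ∘L D)) (x p) := by
      refine (hasFDerivAt_id (x p)).sub ?_
      have h3 : HasFDerivAt (fun y => curvePrimitive (N y)) (curvePrimitive ∘L D) (x p) :=
        (curvePrimitive (E := E)).hasFDerivAt.comp (x p) (hasFDerivAt_curveComp hW (x p))
      have h4 : HasFDerivAt (fun y => p.1 • curvePrimitive (N y)) (p.1 • (curvePrimitive ∘L D))
        (x p) := h3.const_smul p.1
      exact h4.const_add (ContinuousMap.const I p.2)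
    rw [h1.unique h2]
    have hD : ‖p.1 • (curvePrimitive ∘L D)‖ < 1 := by
      refine lt_of_le_of_lt (ContinuousLinearMap.opNorm_le_bound _ (by positivity) fun y => ?_) hp
      change ‖p.1 • curvePrimitive (D y)‖ ≤ _
      rw [norm_smul, Real.norm_eq_abs, mul_assoc]
      refine mul_le_mul_of_nonneg_left ((norm_curvePrimitive_le _).trans ?_) (abs_nonneg _)
      rw [ContinuousMap.norm_le _ (by positivity)]
      intro t
      exact ((fderiv ℝ W (x p t)).le_of_opNorm_le (norm_fderiv_le_of_lipschitz ℝ hL) _).trans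
        (mul_le_mul_of_nonneg_left (y.norm_coe_le_norm t) L.2)
    have : CompleteSpace (C(I, E) →L[ℝ] C(I, E)) := inferInstance
    obtain ⟨v, hv⟩ := isUnit_one_sub_of_norm_lt_one (R := C(I, E) →L[ℝ] C(I, E)) hD
    exact ⟨ContinuousLinearEquiv.unitsEquiv ℝ _ v, hv⟩
  have h3 := hf.contDiffAt (x := (p, x p))
  refine (h3.contDiffAt_implicitFunction (by simp) hinv).congr_of_eventuallyEq ?_
  have hopen : ∀ᶠ q : ℝ × E in 𝓝 p, |q.1| * (L : ℝ) < 1 :=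
    (by fun_prop : Continuous fun q : ℝ × E => |q.1| * (L : ℝ)).continuousAt.eventually_lt
      continuousAt_const hp
  filter_upwards [h3.eventually_apply_implicitFunction (by simp) hinv, hopen] with q h4 h5
  rw [hf0] at h4
  exact ((hx q h5 _).2 (sub_eq_zero.1 h4)).symm

/-- A smooth global flow of the vector field `W`. -/
structure IsFlow (W : E → E) (Θ : ℝ × E → E) : Prop where
  contDiff : ContDiff ℝ ∞ Θ
  zero : ∀ z, Θ (0, z) = z
  hasDerivAt : ∀ t z, HasDerivAt (fun s => Θ (s, z)) (W (Θ (t, z))) t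

theorem exists_local_flow {W : E → E} (hW : ContDiff ℝ ∞ W) {L : NNReal} (hL : LipschitzWith L W) :
    ∃ Θ : ℝ × E → E, (∀ t z, |t| * (L : ℝ) < 1 → ContDiffAt ℝ ∞ Θ (t, z)) ∧ (∀ z, Θ (0, z) = z) ∧
      ∀ t z, |t| * (L : ℝ) < 1 → HasDerivAt (fun s => Θ (s, z)) (W (Θ (t, z))) t := by
  obtain ⟨x, hx, hu⟩ := exists_solution_curve hW hL
  let Θ : ℝ × E → E := fun p => x p 1
  have heval : ContDiff ℝ ∞ fun y : C(I, E) => y 1 := IsBoundedLinearMap.contDiff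
    { map_add := fun _ _ => rfl
      map_smul := fun _ _ => rfl
      bound := ⟨1, one_pos, fun y => by rw [one_mul]; exact y.norm_coe_le_norm _⟩ }
  have hΘ : ∀ t z, |t| * (L : ℝ) < 1 → ContDiffAt ℝ ∞ Θ (t, z) := fun t z ht =>
    (heval.contDiffAt (x := x (t, z))).comp (t, z) (hx (t, z) ht)
  -- By uniqueness, the trajectory up to time `t` run over its fraction `θ` is the trajectory up to
  -- time `θ * t`. This turns the fixed point equation into an integral equation for the endpoint
  -- map `Θ`.
  have hs : ∀ t z, |t| * (L : ℝ) < 1 → ∀ θ : I, x (t, z) θ = Θ (θ * t, z) := by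
    intro t z ht θ
    have hθ : |(θ : ℝ) * t| * (L : ℝ) < 1 := by
      rw [abs_mul, abs_of_nonneg θ.2.1]
      refine lt_of_le_of_lt ?_ ht
      exact mul_le_mul_of_nonneg_right (mul_le_of_le_one_left (abs_nonneg _) θ.2.2) L.2
    let y : C(I, E) := (x (t, z)).comp ⟨fun s => θ * s, by fun_prop⟩
    have hy : y = x (θ * t, z) := by
      rw [hu _ hθ]
      ext s
      have e1 := (hu (t, z) ht (x (t, z))).1 rfl
      have e2 := congrArg (fun f : C(I, E) => f (θ * s)) e1
      simp only [ContinuousMap.add_apply, ContinuousMap.const_apply, ContinuousMap.smul_apply,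
        curvePrimitive_apply] at e2 ⊢
      change x (t, z) (θ * s) = _
      rw [e2, mul_comm (θ : ℝ) t, mul_smul]
      congr 2
      have e3 := intervalIntegral.smul_integral_comp_mul_left (a := 0) (b := (s : ℝ))
        (fun r => IccExtend zero_le_one ((⟨W, hW.continuous⟩ : C(E, E)).comp (x (t, z))) r) (θ : ℝ)
      rw [mul_zero] at e3
      rw [show ((θ * s : I) : ℝ) = (θ : ℝ) * s from rfl, ← e3]
      congr 1
      refine intervalIntegral.integral_congr fun r hr => ?_
      rw [uIcc_of_le s.2.1] at hr
      have hr1 : r ∈ Icc (0 : ℝ) 1 := ⟨hr.1, hr.2.trans s.2.2⟩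
      have hr2 : (θ : ℝ) * r ∈ Icc (0 : ℝ) 1 :=
        ⟨mul_nonneg θ.2.1 hr1.1, mul_le_one₀ θ.2.2 hr1.1 hr1.2⟩
      rw [IccExtend_of_mem _ _ hr1, IccExtend_of_mem _ _ hr2]
      rfl
    have := congrArg (fun f : C(I, E) => f 1) hy
    simpa [y] using this
  have hint : ∀ t z, |t| * (L : ℝ) < 1 → Θ (t, z) = z + ∫ s in (0 : ℝ)..t, W (Θ (s, z)) := by
    intro t z ht
    have e1 := congrArg (fun f : C(I, E) => f 1) ((hu (t, z) ht (x (t, z))).1 rfl)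
    simp only [ContinuousMap.add_apply, ContinuousMap.const_apply, ContinuousMap.smul_apply,
      curvePrimitive_apply] at e1
    change x (t, z) 1 = _
    rw [e1]
    congr 1
    have e3 := intervalIntegral.smul_integral_comp_mul_right (a := 0) (b := (1 : ℝ))
      (fun r => W (Θ (r, z))) t
    rw [zero_mul, one_mul] at e3
    rw [← e3]
    congr 1
    refine intervalIntegral.integral_congr fun r hr => ?_
    rw [Icc.coe_one, uIcc_of_le zero_le_one] at hr
    rw [IccExtend_of_mem _ _ hr]
    exact congrArg W (hs t z ht ⟨r, hr⟩)
  have hzero : ∀ z, Θ (0, z) = z := fun z => by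
    have := hint 0 z (by simp)
    simpa using this
  refine ⟨Θ, hΘ, hzero, fun t z ht => ?_⟩
  have hopen : IsOpen {s : ℝ | |s| * (L : ℝ) < 1} := isOpen_lt (by fun_prop) continuous_const
  have hcont : ∀ s, |s| * (L : ℝ) < 1 → ContinuousAt (fun s => W (Θ (s, z))) s := fun s hs =>
    hW.continuous.continuousAt.comp
      ((hΘ s z hs).continuousAt.comp (f := fun s => (s, z)) (by fun_prop))
  have hii : IntervalIntegrable (fun s => W (Θ (s, z))) MeasureTheory.volume 0 t := by
    refine ContinuousOn.intervalIntegrable fun s hs => (hcont s ?_).continuousWithinAt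
    refine lt_of_le_of_lt (mul_le_mul_of_nonneg_right ?_ L.2) ht
    rcases le_total 0 t with h | h
    · rw [uIcc_of_le h] at hs
      rw [abs_of_nonneg hs.1, abs_of_nonneg h]; exact hs.2
    · rw [uIcc_of_ge h] at hs
      rw [abs_of_nonpos hs.2, abs_of_nonpos h]; linarith [hs.1]
  have hm : StronglyMeasurableAtFilter (fun s => W (Θ (s, z))) (𝓝 t) :=
    ContinuousOn.stronglyMeasurableAtFilter hopen
      (fun s hs => (hcont s hs).continuousWithinAt) t ht
  have h1 := (intervalIntegral.integral_hasDerivAt_right hii hm (hcont t ht)).const_add z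
  refine h1.congr_of_eventuallyEq ?_
  filter_upwards [hopen.mem_nhds ht] with s hs using hint s z hs

end Flow

end BranchedSurf

namespace BranchedSurf

section Flow

universe u

variable {E : Type u} [NormedAddCommGroup E] [NormedSpace ℝ E]

theorem eqOn_of_hasDerivAt {W : E → E} {L : NNReal} (hL : LipschitzWith L W) {a b t₀ : ℝ}
    (ht : t₀ ∈ Ioo a b) {f g : ℝ → E} (hf : ∀ t ∈ Ioo a b, HasDerivAt f (W (f t)) t)
    (hg : ∀ t ∈ Ioo a b, HasDerivAt g (W (g t)) t) (h : f t₀ = g t₀) : EqOn f g (Ioo a b) :=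
  ODE_solution_unique_of_mem_Ioo (v := fun _ => W) (s := fun _ => univ)
    (fun _ _ => hL.lipschitzOnWith) ht
    (fun t h => ⟨hf t h, trivial⟩) (fun t h => ⟨hg t h, trivial⟩) h

/-- A Lipschitz smooth vector field has a smooth global flow. -/
theorem exists_isFlow [CompleteSpace E] {W : E → E} (hW : ContDiff ℝ ∞ W) {L : NNReal}
    (hL : LipschitzWith L W) : ∃ Θ : ℝ × E → E, IsFlow W Θ := by
  obtain ⟨θ, h1, h2, h3⟩ := exists_local_flow hW hL
  obtain ⟨T, hT0, hT⟩ : ∃ T : ℝ, 0 < T ∧ ∀ t : ℝ, |t| < T → |t| * (L : ℝ) < 1 := by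
    refine ⟨1 / ((L : ℝ) + 1), by positivity, fun t ht => ?_⟩
    rw [lt_div_iff₀ (by positivity)] at ht
    nlinarith [abs_nonneg t, L.2]
  have h1 : ∀ t z, |t| < T → ContDiffAt ℝ ∞ θ (t, z) := fun t z h => h1 t z (hT t h)
  have h3 : ∀ t z, |t| < T → HasDerivAt (fun s => θ (s, z)) (W (θ (t, z))) t :=
    fun t z h => h3 t z (hT t h)
  have hadd : ∀ s t z, |s| < T → |t| < T → |s + t| < T → θ (s + t, z) = θ (s, θ (t, z)) := by
    intro s t z hs ht hst
    have h0 : (0 : ℝ) ∈ Ioo (max (-T) (-T - t)) (min T (T - t)) := by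
      rw [abs_lt] at ht
      exact ⟨max_lt (by linarith) (by linarith), lt_min (by linarith) (by linarith)⟩
    have hI : ∀ r ∈ Ioo (max (-T) (-T - t)) (min T (T - t)), |r| < T ∧ |r + t| < T := by
      intro r hr
      have a1 := max_lt_iff.1 hr.1
      have a2 := lt_min_iff.1 hr.2
      exact ⟨abs_lt.2 ⟨a1.1, a2.1⟩, abs_lt.2 ⟨by linarith [a1.2], by linarith [a2.2]⟩⟩
    refine eqOn_of_hasDerivAt hL h0 (f := fun r => θ (r + t, z)) (g := fun r => θ (r, θ (t, z)))
      (fun r hr => ?_) (fun r hr => h3 r _ (hI r hr).1) ?_ ?_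
    · exact (h3 (r + t) z (hI r hr).2).comp_add_const r t
    · simp only [zero_add, h2]
    · rw [abs_lt] at hs hst
      exact ⟨max_lt hs.1 (by linarith), lt_min hs.2 (by linarith)⟩
  have haT : |T / 2| < T := by rw [abs_of_pos (by positivity)]; linarith
  have haT' : |-(T / 2)| < T := by rwa [abs_neg]
  let Φ : Equiv.Perm E :=
    { toFun := fun z => θ (T / 2, z)
      invFun := fun z => θ (-(T / 2), z)
      left_inv := fun z => by dsimp only; rw [← hadd _ _ _ haT' haT (by simpa using hT0)]; simp [h2]
      right_inv := fun z => by dsimp only; rw [← hadd _ _ _ haT haT' (by simpa using hT0)]; simp [h2] }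
  have hΦ : ∀ k : ℤ, ContDiff ℝ ∞ fun z => (Φ ^ k) z := by
    have p1 : ContDiff ℝ ∞ fun z => Φ z := contDiff_iff_contDiffAt.2 fun z =>
      (h1 (T / 2) z haT).comp z (f := fun z => (T / 2, z)) (by fun_prop)
    have p2 : ContDiff ℝ ∞ fun z => (Φ⁻¹ : Equiv.Perm E) z := contDiff_iff_contDiffAt.2 fun z =>
      (h1 (-(T / 2)) z haT').comp z (f := fun z => (-(T / 2), z)) (by fun_prop)
    intro k
    induction k using Int.induction_on with
    | zero => simp only [zpow_zero]; exact contDiff_id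
    | succ k ih => simp only [zpow_add_one]; exact ih.comp p1
    | pred k ih => simp only [zpow_sub_one]; exact ih.comp p2
  have hstep : ∀ (k : ℤ) t z, |t - (k + 1) * (T / 2)| < T → |t - k * (T / 2)| < T →
      θ (t - (k + 1) * (T / 2), (Φ ^ (k + 1)) z) = θ (t - k * (T / 2), (Φ ^ k) z) := by
    intro k t z ha hb
    have e : t - k * (T / 2) = (t - (k + 1) * (T / 2)) + T / 2 := by ring
    rw [e, hadd _ _ _ ha haT (by rwa [← e]), add_comm k 1, zpow_add, zpow_one]
    rfl
  -- Time is cut into steps of length `T / 2`: an integer power of the time `T / 2` map, then the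
  -- local flow for the remainder.
  let Θ : ℝ × E → E := fun p => θ (p.1 - ⌊p.1 / (T / 2)⌋ * (T / 2), (Φ ^ ⌊p.1 / (T / 2)⌋) p.2)
  have hloc : ∀ t₀, ∃ k : ℤ, |t₀ - k * (T / 2)| < T / 2 ∧ ∀ᶠ t in 𝓝 t₀, ∀ z,
      Θ (t, z) = θ (t - k * (T / 2), (Φ ^ k) z) := by
    intro t₀
    have hpos : 0 < T / 2 := by positivity
    have f1 := Int.floor_le (t₀ / (T / 2))
    have f2 := Int.lt_floor_add_one (t₀ / (T / 2))
    rw [le_div_iff₀ hpos] at f1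
    rw [div_lt_iff₀ hpos] at f2
    refine ⟨⌊t₀ / (T / 2)⌋, abs_lt.2 ⟨by linarith, by linarith⟩, ?_⟩
    set k := ⌊t₀ / (T / 2)⌋
    have n1 : ∀ᶠ t in 𝓝 t₀, t < (k + 1) * (T / 2) := gt_mem_nhds f2
    have n2 : ∀ᶠ t in 𝓝 t₀, (k - 1) * (T / 2) < t := lt_mem_nhds (by linarith)
    filter_upwards [n1, n2] with t m1 m2 z
    have q1 : t / (T / 2) < k + 1 := by rwa [div_lt_iff₀ hpos]
    have q2 : (k : ℝ) - 1 < t / (T / 2) := by rwa [lt_div_iff₀ hpos]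
    -- Near `t₀` the floor can only drop by one, and in that case `hstep` shows that the other
    -- number of steps gives the same point.
    have hk : ⌊t / (T / 2)⌋ = k ∨ ⌊t / (T / 2)⌋ = k - 1 := by
      have r1 : ⌊t / (T / 2)⌋ < k + 1 := Int.floor_lt.2 (by exact_mod_cast q1)
      have r2 : k - 1 ≤ ⌊t / (T / 2)⌋ := Int.le_floor.2 (by push_cast; exact q2.le)
      omega
    rcases hk with h | h
    · simp only [Θ, h]
    · simp only [Θ, h]
      have := hstep (k - 1) t z (by push_cast; rw [abs_lt]; constructor <;> linarith)
        (by push_cast; rw [abs_lt]; constructor <;> linarith)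
      push_cast at this ⊢
      simp only [sub_add_cancel] at this
      exact this.symm
  refine ⟨Θ, contDiff_iff_contDiffAt.2 fun p => ?_, fun z => ?_, fun t z => ?_⟩
  · obtain ⟨k, hk, he⟩ := hloc p.1
    have c1 := (h1 (p.1 - k * (T / 2)) ((Φ ^ k) p.2) (by linarith)).comp p
      (f := fun p : ℝ × E => (p.1 - k * (T / 2), (Φ ^ k) p.2))
      ((contDiff_fst.sub contDiff_const).prodMk ((hΦ k).comp contDiff_snd)).contDiffAt
    refine c1.congr_of_eventuallyEq ?_
    filter_upwards [continuous_fst.continuousAt.eventually he] with q hq using hq q.2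
  · simp [Θ, h2]
  · obtain ⟨k, hk, he⟩ := hloc t
    have c1 := (h3 (t - k * (T / 2)) ((Φ ^ k) z) (by linarith)).comp_sub_const t (k * (T / 2))
    rw [he.self_of_nhds z]
    exact c1.congr_of_eventuallyEq (he.mono fun s hs => hs z)

namespace IsFlow

variable {W : E → E} {Θ : ℝ × E → E} {L : NNReal}

theorem eq_of_hasDerivAt (h : IsFlow W Θ) (hL : LipschitzWith L W) {f : ℝ → E}
    (hf : ∀ t, HasDerivAt f (W (f t)) t) (t : ℝ) : f t = Θ (t, f 0) := by
  obtain ⟨a, b, h0, ht⟩ : ∃ a b, (0 : ℝ) ∈ Ioo a b ∧ t ∈ Ioo a b :=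
    ⟨-|t| - 1, |t| + 1, by constructor <;> linarith [abs_nonneg t], by
      constructor <;> linarith [neg_abs_le t, le_abs_self t]⟩
  exact eqOn_of_hasDerivAt hL h0 (fun t _ => hf t) (fun t _ => h.hasDerivAt t _) (h.zero _).symm ht

theorem add (h : IsFlow W Θ) (hL : LipschitzWith L W) (s t : ℝ) (z : E) :
    Θ (s + t, z) = Θ (s, Θ (t, z)) := by
  have := h.eq_of_hasDerivAt hL (f := fun r => Θ (r + t, z))
    (fun r => (h.hasDerivAt (r + t) z).comp_add_const r t) s
  simpa using this

end IsFlow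

/-- A smooth vector field with compact support, plus a constant, is Lipschitz. -/
theorem exists_lipschitzWith {F : Type*} [NormedAddCommGroup F] [NormedSpace ℝ F] {W : E → F}
    (hW : ContDiff ℝ ∞ W) {K : Set E} (hK : IsCompact K) (c : F) (h : ∀ z ∉ K, W z = c) :
    ∃ L : NNReal, LipschitzWith L W := by
  have h0 : ContDiff ℝ ∞ fun z => W z - c := hW.sub contDiff_const
  have hs : HasCompactSupport fun z => W z - c :=
    HasCompactSupport.intro hK fun z hz => by rw [h z hz, sub_self]
  obtain ⟨L, hL⟩ := (h0.of_le (by simp : (1 : WithTop ℕ∞) ≤ ∞)).lipschitzWith_of_hasCompactSupport hs (by simp)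
  refine ⟨L, fun x y => ?_⟩
  simpa [edist_sub_right] using hL x y

end Flow

end BranchedSurf

namespace BranchedSurf

/-! ### Cut-offs, parametric integrals, implicit functions and division -/

section Tools

universe u

variable {E : Type u} [NormedAddCommGroup E] [NormedSpace ℝ E]

/-- A smooth cut-off function equal to `1` near `K`, with compact support in `U`. -/
theorem exists_cutoff [FiniteDimensional ℝ E] {K U : Set E} (hK : IsCompact K) (hU : IsOpen U)
    (hKU : K ⊆ U) : ∃ (χ : E → ℝ) (K' : Set E), ContDiff ℝ ∞ χ ∧ (∀ᶠ x in 𝓝ˢ K, χ x = 1) ∧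
      IsCompact K' ∧ K' ⊆ U ∧ (∀ x ∉ K', χ x = 0) ∧ ∀ x, χ x ∈ Icc (0 : ℝ) 1 := by
  have : ProperSpace E := FiniteDimensional.proper ℝ E
  obtain ⟨K', hK', h1, h2⟩ := exists_compact_between hK hU hKU
  obtain ⟨f, hf1, hf0, hf⟩ := exists_contMDiffMap_one_nhds_of_subset_interior (n := ⊤)
    (modelWithCornersSelf ℝ E) hK.isClosed h1
  exact ⟨f, K', f.contMDiff.contDiff, hf1, hK', h2, hf0, hf⟩

/-- A function smooth near a compact set agrees near it with a compactly supported smooth one. -/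
theorem exists_contDiff_eventuallyEq [FiniteDimensional ℝ E] {F : Type*} [NormedAddCommGroup F]
    [NormedSpace ℝ F] {f : E → F} {K : Set E} (hK : IsCompact K) (hf : ∀ x ∈ K, SmoothNear f x) :
    ∃ (g : E → F) (K' : Set E), ContDiff ℝ ∞ g ∧ (∀ᶠ x in 𝓝ˢ K, g x = f x) ∧ IsCompact K' ∧
      ∀ x ∉ K', g x = 0 := by
  have hU : IsOpen {x | SmoothNear f x} := isOpen_iff_eventually.2 fun x hx => SmoothNear.eventually hx
  obtain ⟨χ, K', hχ, h1, hK', hsub, h0, -⟩ := exists_cutoff hK hU hf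
  refine ⟨fun x => χ x • f x, K', contDiff_iff_contDiffAt.2 fun x => ?_,
    h1.mono fun x hx => by simp only [hx, one_smul], hK', fun x hx => by simp only [h0 x hx, zero_smul]⟩
  by_cases hx : x ∈ K'
  · exact hχ.contDiffAt.smul (SmoothNear.contDiffAt (hsub hx))
  · refine (contDiffAt_const (c := (0 : F))).congr_of_eventuallyEq ?_
    filter_upwards [hK'.isClosed.isOpen_compl.mem_nhds hx] with y hy
    rw [h0 y hy, zero_smul]

-- The integral is the primitive, evaluated at `1`, of the composition of `q` with the curve `s ↦
-- (z, s)`, which depends affinely on `z`. Smoothness of the composition operator replaces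
-- differentiation under the integral sign.
open unitInterval in
theorem contDiff_integral_zero_one {F : Type u} [NormedAddCommGroup F] [NormedSpace ℝ F]
    [CompleteSpace F] {q : E × ℝ → F} (hq : ContDiff ℝ ∞ q) :
    ContDiff ℝ ∞ fun z => ∫ s in (0 : ℝ)..1, q (z, s) := by
  let c : E → C(I, E × ℝ) := fun z => ContinuousMap.const I (z, 0) + ⟨fun s : I => (0, (s : ℝ)), by fun_prop⟩
  have hc : ContDiff ℝ ∞ c := by
    refine ContDiff.add (IsBoundedLinearMap.contDiff (f := fun z : E => ContinuousMap.const I (z, (0 : ℝ)))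
      { map_add := fun x y => by ext s <;> simp
        map_smul := fun a x => by ext s <;> simp
        bound := ⟨1, one_pos, fun z => ?_⟩ }) contDiff_const
    rw [one_mul, ContinuousMap.norm_le _ (norm_nonneg _)]
    intro s
    simp [Prod.norm_def]
  have heval : ContDiff ℝ ∞ fun y : C(I, F) => y 1 := IsBoundedLinearMap.contDiff
    { map_add := fun _ _ => rfl
      map_smul := fun _ _ => rfl
      bound := ⟨1, one_pos, fun y => by rw [one_mul]; exact y.norm_coe_le_norm _⟩ }
  have hp : ContDiff ℝ ∞ fun y : C(I, F) => curvePrimitive y := by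
    refine IsBoundedLinearMap.contDiff
      { map_add := fun _ _ => map_add _ _ _
        map_smul := fun _ _ => map_smul _ _ _
        bound := ⟨1, one_pos, fun y => by rw [one_mul]; exact norm_curvePrimitive_le y⟩ }
  have h := heval.comp (hp.comp ((contDiff_curveComp hq).comp hc))
  convert! h using 1
  funext z
  symm
  simp only [Function.comp_apply, curvePrimitive_apply]
  refine intervalIntegral.integral_congr fun s hs => ?_
  rw [Icc.coe_one, uIcc_of_le zero_le_one] at hs
  have hs' : s ∈ Icc (0 : ℝ) 1 := hs
  rw [IccExtend_of_mem _ _ hs']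
  simp [c]

/-- The substitution `s ↦ p.2 * s` makes the interval of integration constant. -/
theorem contDiff_primitive {F : Type u} [NormedAddCommGroup F] [NormedSpace ℝ F]
    [CompleteSpace F] {q : E × ℝ → F} (hq : ContDiff ℝ ∞ q) :
    ContDiff ℝ ∞ fun p : E × ℝ => ∫ s in (0 : ℝ)..p.2, q (p.1, s) := by
  have h := contDiff_integral_zero_one (E := E × ℝ) (q := fun x => q (x.1.1, x.1.2 * x.2))
    (hq.comp (by fun_prop))
  convert! contDiff_snd.smul h using 1
  funext p
  have e3 := intervalIntegral.smul_integral_comp_mul_left (a := 0) (b := (1 : ℝ))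
    (fun r => q (p.1, r)) p.2
  rw [mul_zero, mul_one] at e3
  exact e3.symm

/-- The implicit function theorem for a scalar equation. -/
theorem exists_implicit [CompleteSpace E] {f : E × ℝ → ℝ} {z₀ : E} (hf : SmoothNear f (z₀, 0))
    (h0 : f (z₀, 0) = 0) (hd : fderiv ℝ f (z₀, 0) (0, 1) ≠ 0) :
    ∃ τ : E → ℝ, SmoothNear τ z₀ ∧ τ z₀ = 0 ∧ ∀ᶠ p in 𝓝 (z₀, (0 : ℝ)), f p = 0 ↔ τ p.1 = p.2 := by
  have hinv : ∀ p, fderiv ℝ f p (0, 1) ≠ 0 → (fderiv ℝ f p ∘L .inr ℝ E ℝ).IsInvertible := by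
    intro p hp
    refine ⟨ContinuousLinearEquiv.unitsEquivAut ℝ (Units.mk0 _ hp), ?_⟩
    ext
    simp
  have hc := hf.contDiffAt
  set τ := hc.implicitFunction (by simp) (hinv _ hd)
  have h1 := hc.eventually_apply_eq_iff_implicitFunction (by simp) (hinv _ hd)
  have h2 : τ z₀ = 0 := hc.implicitFunction_apply_self (by simp) (hinv _ hd)
  have h3 : ContDiffAt ℝ ∞ τ z₀ := hc.contDiffAt_implicitFunction (by simp) (hinv _ hd)
  rw [h0] at h1
  refine ⟨τ, ?_, h2, h1⟩
  have hopen : ∀ᶠ p in 𝓝 (z₀, (0 : ℝ)), fderiv ℝ f p (0, 1) ≠ 0 :=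
    (hf.fderiv.clm_apply (SmoothNear.const _)).continuousAt.eventually_ne hd
  have hall := (h1.and (hf.and hopen)).eventually_nhds
  have ht : Tendsto (fun z => (z, τ z)) (𝓝 z₀) (𝓝 (z₀, (0 : ℝ))) := by
    have := (continuousAt_id.prodMk h3.continuousAt : ContinuousAt (fun z => (z, τ z)) z₀).tendsto
    rwa [h2] at this
  -- The implicit function theorem at `z₀` gives smoothness at that point only. It is applied again
  -- at nearby points `z`, and local uniqueness identifies the new solution with `τ`.
  filter_upwards [ht.eventually hall] with z hz
  obtain ⟨hz1, hz2, hz3⟩ := hz.self_of_nhds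
  have hfz : f (z, τ z) = 0 := hz1.2 rfl
  have g1 := hz2.contDiffAt_implicitFunction (by simp) (hinv _ hz3)
  refine g1.congr_of_eventuallyEq ?_
  have g2 := hz2.eventually_apply_implicitFunction (by simp) (hinv _ hz3)
  rw [hfz] at g2
  have g3 : hz2.implicitFunction (by simp) (hinv _ hz3) z = τ z :=
    hz2.implicitFunction_apply_self (by simp) (hinv _ hz3)
  have ht' : Tendsto (fun y => (y, hz2.implicitFunction (by simp) (hinv _ hz3) y)) (𝓝 z)
      (𝓝 (z, τ z)) := by
    have := (continuousAt_id.prodMk g1.continuousAt : ContinuousAt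
      (fun y => (y, hz2.implicitFunction (by simp) (hinv _ hz3) y)) z).tendsto
    rwa [g3] at this
  filter_upwards [g2, ht'.eventually hz] with y hy1 hy2
  exact hy2.1.1 hy1

/-- The time needed to reach the zero set of `b` backwards along the flow `Θ`. -/
theorem exists_hitting_time [CompleteSpace E] {Θ : ℝ × E → E} (hΘ : ContDiff ℝ ∞ Θ)
    (hΘ0 : ∀ z, Θ (0, z) = z) {v : E} {z₀ : E} (hv : HasDerivAt (fun t => Θ (t, z₀)) v 0)
    {b : E → ℝ} (hb : SmoothNear b z₀) (hb0 : b z₀ = 0) (hd : fderiv ℝ b z₀ v ≠ 0) :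
    ∃ τ : E → ℝ, SmoothNear τ z₀ ∧ τ z₀ = 0 ∧
      ∀ᶠ p in 𝓝 (z₀, (0 : ℝ)), b (Θ (-p.2, p.1)) = 0 ↔ τ p.1 = p.2 := by
  have hbz : SmoothNear b (Θ (0, z₀)) := by rwa [hΘ0]
  have hsm : SmoothNear (fun p : E × ℝ => b (Θ (-p.2, p.1))) (z₀, 0) :=
    hbz.comp' ((hΘ.comp (by fun_prop : ContDiff ℝ ∞ fun p : E × ℝ => (-p.2, p.1))).smoothNear _)
      (by simp)
  refine exists_implicit hsm (by simp [hΘ0, hb0]) ?_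
  have h1 : HasDerivAt (fun t : ℝ => b (Θ (-t, z₀))) (fderiv ℝ b z₀ (-v)) 0 := by
    have e : HasDerivAt (fun t : ℝ => Θ (-t, z₀)) (-v) 0 := by
      have := HasDerivAt.scomp (0 : ℝ) (g₁ := fun t => Θ (t, z₀)) (h := fun t : ℝ => -t) (g₁' := v)
        (by simpa using hv) (hasDerivAt_neg 0)
      rwa [neg_one_smul] at this
    have hb' : HasFDerivAt b (fderiv ℝ b z₀) (Θ (-0, z₀)) := by
      rw [neg_zero, hΘ0]; exact hb.differentiableAt.hasFDerivAt
    exact hb'.comp_hasDerivAt 0 e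
  have h2 : HasDerivAt (fun t : ℝ => b (Θ (-t, z₀)))
      (fderiv ℝ (fun p : E × ℝ => b (Θ (-p.2, p.1))) (z₀, 0) (0, 1)) 0 :=
    (hsm.differentiableAt.hasFDerivAt).comp_hasDerivAt 0
      ((hasDerivAt_const (0 : ℝ) z₀).prodMk (hasDerivAt_id 0))
  rw [h2.unique h1, map_neg]
  exact neg_ne_zero.2 hd

/-- A function vanishing on a regular zero set is divisible by the equation. -/
theorem exists_division {E : Type} [NormedAddCommGroup E] [NormedSpace ℝ E] [FiniteDimensional ℝ E]
    {f b : E → ℝ} {z₀ v : E} (hf : SmoothNear f z₀)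
    (hb : SmoothNear b z₀) (hb0 : b z₀ = 0) (hd : fderiv ℝ b z₀ v ≠ 0)
    (h : ∀ᶠ z in 𝓝 z₀, b z = 0 → f z = 0) :
    ∃ k : E → ℝ, SmoothNear k z₀ ∧ ∀ᶠ z in 𝓝 z₀, f z = k z * b z := by
  have : CompleteSpace E := FiniteDimensional.complete ℝ E
  obtain ⟨τ, hτ, hτ0, hbτ⟩ := exists_hitting_time (Θ := fun p : ℝ × E => p.2 + p.1 • v) (z₀ := z₀)
    (v := v) (by fun_prop) (by simp)
    (by simpa using ((hasDerivAt_id (0 : ℝ)).smul_const v).const_add z₀) hb hb0 hd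
  -- a smooth function which vanishes at `z - τ z v` is divisible by `τ`
  have key : ∀ g : E → ℝ, SmoothNear g z₀ → (∀ᶠ z in 𝓝 z₀, g (z - τ z • v) = 0) →
      ∃ k : E → ℝ, SmoothNear k z₀ ∧ k z₀ = fderiv ℝ g z₀ v ∧ ∀ᶠ z in 𝓝 z₀, g z = k z * τ z := by
    intro g hg hgτ
    obtain ⟨G, -, hG, hGg, -, -⟩ := exists_contDiff_eventuallyEq (isCompact_singleton (x := z₀))
      (f := g) (by simpa using hg)
    rw [nhdsSet_singleton] at hGg
    have hDG : ContDiff ℝ ∞ (fun x : (E × ℝ) × ℝ => fderiv ℝ G (x.1.1 - (x.2 * x.1.2) • v) v) :=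
      ((hG.fderiv_right (m := ∞) (by simp)).comp (by fun_prop)).clm_apply contDiff_const
    have hint := contDiff_integral_zero_one hDG
    have hzτ : SmoothNear (fun z => (z, τ z)) z₀ := SmoothNear.id.prodMk hτ
    refine ⟨fun z => ∫ s in (0 : ℝ)..1, fderiv ℝ G (z - (s * τ z) • v) v,
      (hint.smoothNear _).comp hzτ, ?_, ?_⟩
    · simp [hτ0, Filter.EventuallyEq.fderiv_eq hGg]
    · have t1 : Tendsto (fun z => z - τ z • v) (𝓝 z₀) (𝓝 z₀) := by
        have : ContinuousAt (fun z => z - τ z • v) z₀ :=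
          continuousAt_id.sub (hτ.continuousAt.smul continuousAt_const)
        simpa [ContinuousAt, hτ0] using this
      filter_upwards [hGg, t1.eventually hGg, hgτ] with z z1 z2 z3
      have hder : ∀ s ∈ uIcc (0 : ℝ) 1, HasDerivAt (fun s : ℝ => -G (z - (s * τ z) • v))
          (τ z * fderiv ℝ G (z - (s * τ z) • v) v) s := by
        intro s _
        have d1 : HasDerivAt (fun s : ℝ => z - (s * τ z) • v) (-((1 * τ z) • v)) s :=
          (((hasDerivAt_id s).mul_const (τ z)).smul_const v).const_sub z
        have d2 := ((hG.differentiable (by simp) (z - (s * τ z) • v)).hasFDerivAt).comp_hasDerivAt s d1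
        have d3 := d2.neg
        have e : -(fderiv ℝ G (z - (s * τ z) • v) (-((1 * τ z) • v))) =
            τ z * fderiv ℝ G (z - (s * τ z) • v) v := by simp
        rw [← e]
        exact d3
      have hc : Continuous fun s : ℝ => τ z * fderiv ℝ G (z - (s * τ z) • v) v := by
        have := hDG.continuous.comp (by fun_prop : Continuous fun s : ℝ => ((z, τ z), s))
        exact continuous_const.mul this
      have h4 := intervalIntegral.integral_eq_sub_of_hasDerivAt hder (hc.intervalIntegrable _ _)
      rw [intervalIntegral.integral_const_mul] at h4
      simp only [one_mul, zero_mul, zero_smul, sub_zero] at h4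
      rw [z2, z3, z1] at h4
      rw [mul_comm, h4]
      simp
  have hz : ∀ᶠ z in 𝓝 z₀, b (z - τ z • v) = 0 := by
    have ht : Tendsto (fun z => (z, τ z)) (𝓝 z₀) (𝓝 (z₀, (0 : ℝ))) := by
      have := (continuousAt_id.prodMk hτ.continuousAt : ContinuousAt (fun z => (z, τ z)) z₀).tendsto
      rwa [hτ0] at this
    filter_upwards [ht.eventually hbτ] with z hz
    have := hz.2 rfl
    simpa [sub_eq_add_neg] using this
  have t1 : Tendsto (fun z => z - τ z • v) (𝓝 z₀) (𝓝 z₀) := by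
    have : ContinuousAt (fun z => z - τ z • v) z₀ :=
      continuousAt_id.sub (hτ.continuousAt.smul continuousAt_const)
    simpa [ContinuousAt, hτ0] using this
  have hz' : ∀ᶠ z in 𝓝 z₀, f (z - τ z • v) = 0 := by
    filter_upwards [hz, t1.eventually h] with z h1 h2 using h2 h1
  -- Both `f` and `b` vanish at the foot point `z - τ z • v`, so both are multiples of `τ`; the
  -- multiplier of `b` is `db(v) ≠ 0` at `z₀`.
  obtain ⟨k1, hk1, -, e1⟩ := key f hf hz'
  obtain ⟨k2, hk2, hk20, e2⟩ := key b hb hz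
  have hne : k2 z₀ ≠ 0 := by rwa [hk20]
  refine ⟨fun z => k1 z / k2 z, hk1.div hk2 hne, ?_⟩
  filter_upwards [e1, e2, hk2.continuousAt.eventually_ne hne] with z a1 a2 a3
  rw [a1, a2]
  field_simp

end Tools

end BranchedSurf

namespace BranchedSurf

/-! ### Linear differential inequalities -/

section Gronwall

/-- A function with `|r'| ≤ C |r|` which vanishes somewhere vanishes identically. -/
theorem eq_zero_of_abs_deriv_le {r r' : ℝ → ℝ} {a b C : ℝ}
    (hr : ∀ t ∈ Icc a b, HasDerivAt r (r' t) t) (hC : ∀ t ∈ Icc a b, |r' t| ≤ C * |r t|) {t₀ : ℝ}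
    (ht₀ : t₀ ∈ Icc a b) (h0 : r t₀ = 0) : ∀ t ∈ Icc a b, r t = 0 := by
  intro t ht
  rcases le_total t₀ t with h | h
  · have sub : Icc t₀ b ⊆ Icc a b := Icc_subset_Icc_left ht₀.1
    exact eq_zero_of_abs_deriv_le_mul_abs_self_of_eq_zero_right (a := t₀) (b := b)
      (fun s hs => (hr s (sub hs)).continuousAt.continuousWithinAt)
      (fun s hs => (hr s (sub ⟨hs.1, hs.2.le⟩)).hasDerivWithinAt) h0
      (fun s hs => hC s (sub ⟨hs.1, hs.2.le⟩)) t ⟨h, ht.2⟩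
  · have sub : ∀ s ∈ Icc (-t₀) (-a), -s ∈ Icc a b := fun s hs =>
      ⟨by linarith [hs.2], by linarith [hs.1, ht₀.2]⟩
    have hd : ∀ s ∈ Icc (-t₀) (-a), HasDerivAt (fun s => r (-s)) (-r' (-s)) s := fun s hs => by
      have := HasDerivAt.scomp s (g₁ := r) (h := fun t : ℝ => -t) (hr (-s) (sub s hs))
        (hasDerivAt_neg s)
      rwa [neg_one_smul] at this
    have := eq_zero_of_abs_deriv_le_mul_abs_self_of_eq_zero_right (a := -t₀) (b := -a)
      (f := fun s => r (-s)) (f' := fun s => -r' (-s)) (K := C)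
      (fun s hs => (hd s hs).continuousAt.continuousWithinAt)
      (fun s hs => (hd s ⟨hs.1, hs.2.le⟩).hasDerivWithinAt) (by simpa using h0)
      (fun s hs => by
        rw [norm_neg]; exact hC _ (sub s ⟨hs.1, hs.2.le⟩)) (-t) ⟨by linarith, by linarith [ht.1]⟩
    simpa using this

/-- A function with `|r'| ≤ C |r|` keeps its sign. -/
theorem pos_of_abs_deriv_le {r r' : ℝ → ℝ} {a b C : ℝ}
    (hr : ∀ t ∈ Icc a b, HasDerivAt r (r' t) t) (hC : ∀ t ∈ Icc a b, |r' t| ≤ C * |r t|) {t₀ : ℝ}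
    (ht₀ : t₀ ∈ Icc a b) (h0 : 0 < r t₀) : ∀ t ∈ Icc a b, 0 < r t := by
  intro t ht
  by_contra h
  push Not at h
  have hc : ContinuousOn r (uIcc t t₀) := fun s hs =>
    (hr s (uIcc_subset_Icc ht ht₀ hs)).continuousAt.continuousWithinAt
  -- A zero in between would force `r` to vanish at `t₀` as well.
  obtain ⟨s, hs, hs0⟩ := intermediate_value_uIcc hc (by
    rw [uIcc_of_le (h.trans h0.le)]; exact ⟨h, h0.le⟩ : (0 : ℝ) ∈ uIcc (r t) (r t₀))
  have := eq_zero_of_abs_deriv_le hr hC (uIcc_subset_Icc ht ht₀ hs) hs0 t₀ ht₀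
  linarith

theorem nonneg_of_abs_deriv_le {r r' : ℝ → ℝ} {a b C : ℝ}
    (hr : ∀ t ∈ Icc a b, HasDerivAt r (r' t) t) (hC : ∀ t ∈ Icc a b, |r' t| ≤ C * |r t|) {t₀ : ℝ}
    (ht₀ : t₀ ∈ Icc a b) (h0 : 0 ≤ r t₀) : ∀ t ∈ Icc a b, 0 ≤ r t := by
  intro t ht
  rcases h0.eq_or_lt with h | h
  · exact (eq_zero_of_abs_deriv_le hr hC ht₀ h.symm t ht).ge
  · exact (pos_of_abs_deriv_le hr hC ht₀ h t ht).le

end Gronwall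

/-! ### Linear first order equations along a flow -/

section PDE

/-- The solution of `∂f/∂W + c f = r` which vanishes for `τ = 0`. -/
noncomputable def transport {E : Type} (Θ : ℝ × E → E) (c r : E → ℝ) (τ : E → ℝ) (z : E) : ℝ :=
  -∫ s in (0 : ℝ)..(-τ z), r (Θ (s, z)) * Real.exp (∫ q in (0 : ℝ)..s, c (Θ (q, z)))

theorem transport_eq_zero {E : Type} {Θ : ℝ × E → E} {c r τ : E → ℝ} {z : E} (h : ∀ s ∈ uIcc 0 (-τ z), r (Θ (s, z)) = 0) :
    transport Θ c r τ z = 0 := by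
  rw [transport, intervalIntegral.integral_congr (g := fun _ => 0) fun s hs => by
    simp only [h s hs, zero_mul]]
  simp

variable {E : Type} [NormedAddCommGroup E] [NormedSpace ℝ E] {W : E → E} {Θ : ℝ × E → E}
  {L : NNReal} {c r τ : E → ℝ}

/-- A function with derivative `1` along a field increases linearly along the flow. -/
theorem IsFlow.eventually_add (hΘ : IsFlow W Θ) {τ : E → ℝ} {z : E} (hτ : SmoothNear τ z)
    (h1 : ∀ᶠ y in 𝓝 z, fderiv ℝ τ y (W y) = 1) : ∀ᶠ h in 𝓝 (0 : ℝ), τ (Θ (h, z)) = τ z + h := by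
  have ht : Tendsto (fun h => Θ (h, z)) (𝓝 0) (𝓝 z) :=
    (hΘ.contDiff.continuous.comp (by fun_prop : Continuous fun h : ℝ => (h, z))).tendsto' _ _
      (hΘ.zero z)
  obtain ⟨ε, hε, hball⟩ := Metric.eventually_nhds_iff_ball.1 (ht.eventually (h1.and hτ))
  filter_upwards [Metric.ball_mem_nhds (0 : ℝ) hε] with h hh
  have hd : ∀ s ∈ Metric.ball (0 : ℝ) ε, HasDerivAt (fun s => τ (Θ (s, z)) - s) 0 s := by
    intro s hs
    obtain ⟨a1, a2⟩ := hball s hs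
    have := ((a2.differentiableAt (by simp)).hasFDerivAt.comp_hasDerivAt s
      (hΘ.hasDerivAt s z)).sub (hasDerivAt_id s)
    rw [a1, sub_self] at this
    exact this
  have := (convex_ball (0 : ℝ) ε).is_const_of_fderivWithin_eq_zero (𝕜 := ℝ)
    (f := fun s => τ (Θ (s, z)) - s)
    (fun s hs => (hd s hs).differentiableAt.differentiableWithinAt)
    (fun s hs => by
      rw [fderivWithin_of_isOpen Metric.isOpen_ball hs]
      ext
      simpa using (hd s hs).deriv) hh (Metric.mem_ball_self hε)
  simp only [hΘ.zero, sub_zero] at this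
  linarith

theorem contDiff_transport_aux (hΘ : ContDiff ℝ ∞ Θ) (hc : ContDiff ℝ ∞ c) (hr : ContDiff ℝ ∞ r) :
    ContDiff ℝ ∞ fun p : E × ℝ => ∫ s in (0 : ℝ)..p.2,
      r (Θ (s, p.1)) * Real.exp (∫ q in (0 : ℝ)..s, c (Θ (q, p.1))) := by
  have h1 : ContDiff ℝ ∞ fun p : E × ℝ => ∫ q in (0 : ℝ)..p.2, c (Θ (q, p.1)) :=
    contDiff_primitive (q := fun p : E × ℝ => c (Θ (p.2, p.1)))
      (hc.comp (hΘ.comp (by fun_prop)))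
  exact contDiff_primitive (q := fun p : E × ℝ => r (Θ (p.2, p.1)) *
    Real.exp (∫ q in (0 : ℝ)..p.2, c (Θ (q, p.1)))) ((hr.comp (hΘ.comp (by fun_prop))).mul h1.exp)

theorem smoothNear_transport (hΘ : ContDiff ℝ ∞ Θ) (hc : ContDiff ℝ ∞ c) (hr : ContDiff ℝ ∞ r)
    {z : E} (hτ : SmoothNear τ z) : SmoothNear (transport Θ c r τ) z :=
  ((contDiff_transport_aux hΘ hc hr).smoothNear _ |>.comp
    (SmoothNear.id.prodMk hτ.neg)).neg

/-- By the group law, on the integral curve through `z` the value at time `h` is, up to sign, `exp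
(-e h)` times the integral over `[h, -τ z]` of a fixed function. The upper limit does not move
because `τ` increases at unit speed, so an ordinary differentiation in `h` gives the equation. -/
theorem fderiv_transport (hΘ : IsFlow W Θ) (hL : LipschitzWith L W) (hc : ContDiff ℝ ∞ c)
    (hr : ContDiff ℝ ∞ r) {z : E} (hτ : SmoothNear τ z)
    (h1 : ∀ᶠ y in 𝓝 z, fderiv ℝ τ y (W y) = 1) :
    fderiv ℝ (transport Θ c r τ) z (W z) = r z - c z * transport Θ c r τ z := by
  have hcΘ : Continuous fun q => c (Θ (q, z)) :=
    hc.continuous.comp (hΘ.contDiff.continuous.comp (by fun_prop))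
  set e : ℝ → ℝ := fun s => ∫ q in (0 : ℝ)..s, c (Θ (q, z)) with he
  have hec : ∀ s, HasDerivAt e (c (Θ (s, z))) s := fun s =>
    intervalIntegral.integral_hasDerivAt_right (hcΘ.intervalIntegrable _ _)
      (hcΘ.stronglyMeasurableAtFilter _ _) hcΘ.continuousAt
  have hecont : Continuous e := continuous_iff_continuousAt.2 fun s => (hec s).continuousAt
  set g : ℝ → ℝ := fun s => r (Θ (s, z)) * Real.exp (e s) with hg
  have hgcont : Continuous g := (hr.continuous.comp (hΘ.contDiff.continuous.comp
    (by fun_prop))).mul (Real.continuous_exp.comp hecont)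
  have key : ∀ᶠ h in 𝓝 (0 : ℝ), transport Θ c r τ (Θ (h, z)) =
      -(Real.exp (-e h) * ∫ s in h..(-τ z), g s) := by
    filter_upwards [hΘ.eventually_add hτ h1] with h hh
    rw [transport, hh]
    congr 1
    have e1 : ∀ s, ∫ q in (0 : ℝ)..s, c (Θ (q, Θ (h, z))) = e (s + h) - e h := by
      intro s
      have : ∀ q, c (Θ (q, Θ (h, z))) = c (Θ (q + h, z)) := fun q => by rw [hΘ.add hL]
      simp_rw [this]
      rw [intervalIntegral.integral_comp_add_right (fun q => c (Θ (q, z))), he]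
      simp only
      rw [intervalIntegral.integral_interval_sub_left (hcΘ.intervalIntegrable _ _)
        (hcΘ.intervalIntegrable _ _), zero_add]
    have e2 : ∀ s, r (Θ (s, Θ (h, z))) * Real.exp (∫ q in (0 : ℝ)..s, c (Θ (q, Θ (h, z)))) =
        Real.exp (-e h) * g (s + h) := by
      intro s
      rw [e1, ← hΘ.add hL, hg, sub_eq_add_neg, Real.exp_add]
      ring
    simp_rw [e2]
    rw [intervalIntegral.integral_const_mul, intervalIntegral.integral_comp_add_right (fun s => g s)]
    congr 2 <;> ring
  have d1 : HasDerivAt (fun h => -(Real.exp (-e h) * ∫ s in h..(-τ z), g s))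
      (r z - c z * transport Θ c r τ z) 0 := by
    have i1 : HasDerivAt (fun h => ∫ s in h..(-τ z), g s) (-g 0) 0 :=
      intervalIntegral.integral_hasDerivAt_left (hgcont.intervalIntegrable _ _)
        (hgcont.stronglyMeasurableAtFilter _ _) hgcont.continuousAt
    have i2 := (((hec 0).neg.exp).mul i1).neg
    have e0 : e 0 = 0 := by simp [he]
    have g0 : g 0 = r z := by simp [hg, e0, hΘ.zero]
    refine i2.congr_deriv ?_
    have e0' : (-e) 0 = 0 := by simp [e0]
    have tr : transport Θ c r τ z = -∫ s in (0 : ℝ)..(-τ z), g s := rfl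
    rw [tr, e0', g0, hΘ.zero]
    simp
  have hsm := smoothNear_transport (c := c) (r := r) hΘ.contDiff hc hr hτ
  have d2 : HasDerivAt (fun h => transport Θ c r τ (Θ (h, z)))
      (fderiv ℝ (transport Θ c r τ) z (W z)) 0 := by
    have a := hΘ.hasDerivAt 0 z
    rw [hΘ.zero] at a
    have b : HasFDerivAt (transport Θ c r τ) (fderiv ℝ (transport Θ c r τ) z) (Θ (0, z)) := by
      rw [hΘ.zero]; exact hsm.differentiableAt.hasFDerivAt
    exact b.comp_hasDerivAt 0 a
  exact d2.unique (d1.congr_of_eventuallyEq key)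

/-- Two solutions of the same linear equation which agree at one point of an integral curve agree
along it. -/
theorem eq_of_transport_equation (hΘ : IsFlow W Θ) (hc : Continuous c) {f g : E → ℝ} {z : E}
    {a b : ℝ} {r' : E → ℝ}
    (hf : ∀ s ∈ Icc a b, DifferentiableAt ℝ f (Θ (s, z)) ∧
      fderiv ℝ f (Θ (s, z)) (W (Θ (s, z))) = r' (Θ (s, z)) - c (Θ (s, z)) * f (Θ (s, z)))
    (hg : ∀ s ∈ Icc a b, DifferentiableAt ℝ g (Θ (s, z)) ∧
      fderiv ℝ g (Θ (s, z)) (W (Θ (s, z))) = r' (Θ (s, z)) - c (Θ (s, z)) * g (Θ (s, z)))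
    {t₀ : ℝ} (ht₀ : t₀ ∈ Icc a b) (h0 : f (Θ (t₀, z)) = g (Θ (t₀, z))) :
    ∀ s ∈ Icc a b, f (Θ (s, z)) = g (Θ (s, z)) := by
  have hcc : Continuous fun s => c (Θ (s, z)) :=
    hc.comp (hΘ.contDiff.continuous.comp (by fun_prop))
  obtain ⟨C, hC⟩ := (isCompact_Icc (a := a) (b := b)).exists_bound_of_continuousOn hcc.continuousOn
  have hd : ∀ s ∈ Icc a b, HasDerivAt (fun s => f (Θ (s, z)) - g (Θ (s, z)))
      (-c (Θ (s, z)) * (f (Θ (s, z)) - g (Θ (s, z)))) s := by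
    intro s hs
    have h1 := ((hf s hs).1.hasFDerivAt.comp_hasDerivAt s (hΘ.hasDerivAt s z)).sub
      ((hg s hs).1.hasFDerivAt.comp_hasDerivAt s (hΘ.hasDerivAt s z))
    rw [(hf s hs).2, (hg s hs).2] at h1
    refine h1.congr_deriv ?_
    ring
  intro s hs
  have := eq_zero_of_abs_deriv_le hd (C := C) (fun s hs => by
    rw [abs_mul, abs_neg]
    exact mul_le_mul_of_nonneg_right (hC s hs) (abs_nonneg _)) ht₀ (sub_eq_zero.2 h0) s hs
  exact sub_eq_zero.1 this

end PDE

end BranchedSurf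

namespace BranchedSurf

/-! ### Moser's homotopy method for planar forms up to a factor -/

section Moser

/-- A flow satisfies the variational equation. -/
theorem IsFlow.hasDerivAt_fderiv {E : Type*} [NormedAddCommGroup E] [NormedSpace ℝ E] {W : E → E}
    {Θ : ℝ × E → E} (hΘ : IsFlow W Θ) (hW : ContDiff ℝ ∞ W) (t : ℝ) (z v : E) :
    HasDerivAt (fun s => fderiv ℝ Θ (s, z) (0, v))
      (fderiv ℝ W (Θ (t, z)) (fderiv ℝ Θ (t, z) (0, v))) t := by
  have hD : ContDiff ℝ ∞ (fderiv ℝ Θ) := hΘ.contDiff.fderiv_right (m := ∞) (by simp)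
  have hDd : HasFDerivAt (fderiv ℝ Θ) (fderiv ℝ (fderiv ℝ Θ) (t, z)) (t, z) :=
    (hD.differentiable (by simp) _).hasFDerivAt
  -- The variational equation exchanges the derivative in time with the derivative in the direction
  -- `v`.
  have hsymm : IsSymmSndFDerivAt ℝ Θ (t, z) :=
    hΘ.contDiff.contDiffAt.isSymmSndFDerivAt (by
      rw [minSmoothness_of_isRCLikeNormedField]; exact WithTop.coe_le_coe.2 (le_top : (2 : ℕ∞) ≤ ⊤))
  have h1 : HasDerivAt (fun s => fderiv ℝ Θ (s, z)) (fderiv ℝ (fderiv ℝ Θ) (t, z) (1, 0)) t :=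
    hDd.comp_hasDerivAt t ((hasDerivAt_id t).prodMk (hasDerivAt_const t z))
  have h2 := h1.clm_apply (hasDerivAt_const t ((0 : ℝ), v))
  rw [map_zero, add_zero] at h2
  refine h2.congr_deriv ?_
  rw [hsymm.eq]
  -- differentiate the flow equation in the direction `v`
  have h3 : (fun p : ℝ × E => fderiv ℝ Θ p (1, 0)) = fun p => W (Θ p) := by
    funext p
    have a := hΘ.hasDerivAt p.1 p.2
    have b : HasDerivAt (fun s => Θ (s, p.2)) (fderiv ℝ Θ p (1, 0)) p.1 :=
      ((hΘ.contDiff.differentiable (by simp) p).hasFDerivAt).comp_hasDerivAt p.1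
        ((hasDerivAt_id p.1).prodMk (hasDerivAt_const p.1 p.2))
    exact b.unique a
  have h4 : HasFDerivAt (fun p : ℝ × E => fderiv ℝ Θ p (1, 0))
      ((fderiv ℝ (fderiv ℝ Θ) (t, z)).flip (1, 0)) (t, z) := by
    have := hDd.clm_apply (hasFDerivAt_const ((1 : ℝ), (0 : E)) (t, z))
    simpa using this
  have h5 : HasFDerivAt (fun p : ℝ × E => W (Θ p))
      ((fderiv ℝ W (Θ (t, z))).comp (fderiv ℝ Θ (t, z))) (t, z) :=
    ((hW.differentiable (by simp) _).hasFDerivAt).comp (t, z)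
      (hΘ.contDiff.differentiable (by simp) _).hasFDerivAt
  rw [h3] at h4
  have := congrArg (fun L => L (0, v)) (h4.unique h5)
  simpa using this

/-- Two parameters and a point of the plane. -/
abbrev PPlane : Type := (ℝ × ℝ) × (ℝ × ℝ)

variable {A : PPlane → (ℝ × ℝ →L[ℝ] ℝ)} {X : PPlane → ℝ × ℝ}

/-- The vector field on the space of parameters and points for which the second parameter is the
time. -/
def timeField (X : PPlane → ℝ × ℝ) (z : PPlane) : PPlane := ((0, 1), X z)

/-- The exterior derivative of a family of planar forms. -/
noncomputable def extDeriv₂ (A : PPlane → (ℝ × ℝ →L[ℝ] ℝ)) (z : PPlane) (v w : ℝ × ℝ) : ℝ :=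
  fderiv ℝ A z (0, v) w - fderiv ℝ A z (0, w) v

/-- The kernel field of the form `A`, normalized with respect to a basis `l`, `m`. -/
noncomputable def kerField (A : PPlane → (ℝ × ℝ →L[ℝ] ℝ)) (l m : ℝ × ℝ) (z : PPlane) : ℝ × ℝ :=
  l - (A z l / A z m) • m

/-- The zeroth order coefficient of the homotopy equation. -/
noncomputable def curlCoef (A : PPlane → (ℝ × ℝ →L[ℝ] ℝ)) (l m : ℝ × ℝ) (z : PPlane) : ℝ :=
  extDeriv₂ A z m (kerField A l m z) / A z m

/-- The derivative of the form `A` along the flow of the time-dependent field `X`. -/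
noncomputable def lieCov (A : PPlane → (ℝ × ℝ →L[ℝ] ℝ)) (X : PPlane → ℝ × ℝ) (z : PPlane) :
    ℝ × ℝ →L[ℝ] ℝ :=
  fderiv ℝ A z ((0, 1), X z) + (A z).comp ((fderiv ℝ X z).comp (.inr ℝ (ℝ × ℝ) (ℝ × ℝ)))

theorem apply_kerField {l m : ℝ × ℝ} {z : PPlane} (h : A z m ≠ 0) : A z (kerField A l m z) = 0 := by
  simp [kerField, h]

/-- The homotopy equation for `f = A(X)` means that the derivative of `A` along the flow of `X` is
proportional to `A`. -/
theorem lieCov_eq_smul {l m : ℝ × ℝ} (hlm : ∀ w : ℝ × ℝ, ∃ a b : ℝ, w = a • l + b • m) {z : PPlane}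
    (hA : DifferentiableAt ℝ A z) (hX : DifferentiableAt ℝ X z) (hm : A z m ≠ 0) {f : PPlane → ℝ}
    (hf : f =ᶠ[𝓝 z] fun y => A y (X y))
    (heq : fderiv ℝ f z (0, kerField A l m z) = - (fderiv ℝ A z ((0, 1), 0) (kerField A l m z)) -
      curlCoef A l m z * f z) :
    lieCov A X z = (lieCov A X z m / A z m) • A z := by
  set V := kerField A l m z with hV
  have hAV : A z V = 0 := apply_kerField hm
  have hspan : ∀ w : ℝ × ℝ, ∃ a b : ℝ, w = a • V + b • m := by
    intro w
    obtain ⟨a, b, rfl⟩ := hlm w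
    refine ⟨a, b + a * (A z l / A z m), ?_⟩
    rw [hV, kerField]
    module
  have hfz : f z = A z (X z) := hf.self_of_nhds
  have h1 : fderiv ℝ f z (0, V) = fderiv ℝ A z (0, V) (X z) + A z (fderiv ℝ X z (0, V)) := by
    rw [hf.fderiv_eq, fderiv_clm_apply hA hX]
    simp [add_comm]
  -- The exterior derivative is alternating, so only the `m`-component of `X z` contributes, and
  -- this component is `f z / A z m`.
  have h2 : extDeriv₂ A z (X z) V = curlCoef A l m z * f z := by
    obtain ⟨a, b, hab⟩ := hspan (X z)
    have e1 : f z = b * A z m := by rw [hfz, hab]; simp [hAV]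
    rw [curlCoef, ← hV, e1, extDeriv₂, extDeriv₂, hab]
    have e2 : ((0 : ℝ × ℝ), a • V + b • m) = a • ((0 : ℝ × ℝ), V) + b • ((0 : ℝ × ℝ), m) := by simp
    rw [e2, map_add, map_smul, map_smul]
    simp only [add_apply, smul_apply, map_add, map_smul,
      smul_eq_mul]
    field_simp
    ring
  -- Cartan's formula evaluated on the kernel vector `V`: the homotopy equation says exactly that
  -- the Lie derivative of `A` vanishes on `V`, hence is a multiple of `A z`.
  have h3 : lieCov A X z V = 0 := by
    have e : ((0, 1), X z) = (((0, 1), 0) : PPlane) + ((0, X z) : PPlane) := by simp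
    have : lieCov A X z V = fderiv ℝ A z ((0, 1), 0) V + fderiv ℝ A z (0, X z) V +
        A z (fderiv ℝ X z (0, V)) := by
      simp [lieCov, e, -Prod.mk_add_mk]
    rw [extDeriv₂] at h2
    rw [this]
    linarith
  refine ContinuousLinearMap.ext fun w => ?_
  · obtain ⟨a, b, hab⟩ := hspan w
    rw [hab]
    simp [h3, hAV]
    field_simp

/-- If the derivative of `A` along the flow of `X` is proportional to `A`, then the flow carries the
kernels of `A` to each other. -/
theorem apply_fderiv_flow_eq_zero {Θ : ℝ × PPlane → PPlane} (hΘ : IsFlow (timeField X) Θ)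
    (hX : ContDiff ℝ ∞ X) {z : PPlane} {s : ℝ} {m : ℝ × ℝ}
    (h : ∀ t ∈ uIcc 0 s, SmoothNear A (Θ (t, z)) ∧ A (Θ (t, z)) m ≠ 0 ∧
      lieCov A X (Θ (t, z)) = (lieCov A X (Θ (t, z)) m / A (Θ (t, z)) m) • A (Θ (t, z)))
    {v : ℝ × ℝ} (hv : A z v = 0) :
    A (Θ (s, z)) (fderiv ℝ Θ (s, z) (0, (0, v))).2 = 0 := by
  have hW : ContDiff ℝ ∞ (timeField X) := contDiff_const.prodMk hX
  set w : ℝ → PPlane := fun t => fderiv ℝ Θ (t, z) (0, (0, v)) with hw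
  have hwd : ∀ t, HasDerivAt w (fderiv ℝ (timeField X) (Θ (t, z)) (w t)) t := fun t =>
    hΘ.hasDerivAt_fderiv hW t z (0, v)
  have hfW : ∀ y u, fderiv ℝ (timeField X) y u = (0, fderiv ℝ X y u) := by
    intro y u
    have : HasFDerivAt (timeField X) ((0 : PPlane →L[ℝ] ℝ × ℝ).prod (fderiv ℝ X y)) y :=
      (hasFDerivAt_const _ _).prodMk (hX.differentiable (by simp) y).hasFDerivAt
    rw [this.fderiv]
    rfl
  have hw0 : w 0 = (0, v) := by
    have h1 : HasFDerivAt (fun y => Θ (0, y)) ((fderiv ℝ Θ (0, z)).comp (.inr ℝ ℝ PPlane)) z :=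
      ((hΘ.contDiff.differentiable (by simp) _).hasFDerivAt).comp z (hasFDerivAt_prodMk_right _ _)
    have h2 : (fun y => Θ (0, y)) = id := funext hΘ.zero
    rw [h2] at h1
    have := congrArg (fun L => L (0, v)) (h1.unique (hasFDerivAt_id z))
    simpa [hw] using this
  have hw1 : ∀ t, (w t).1 = 0 := by
    intro t
    have hd : ∀ t, HasDerivAt (fun t => (w t).1) 0 t := fun t => by
      have := (hasFDerivAt_fst (𝕜 := ℝ) (p := w t)).comp_hasDerivAt t (hwd t)
      rw [hfW] at this
      exact this
    have := is_const_of_deriv_eq_zero (fun t => (hd t).differentiableAt) (fun t => (hd t).deriv) t 0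
    rw [this, hw0]
  -- `A` evaluated on the transported vector satisfies a homogeneous linear equation; it starts at
  -- zero and so stays zero.
  have hd : ∀ t ∈ uIcc 0 s, HasDerivAt (fun t => A (Θ (t, z)) (w t).2)
      (lieCov A X (Θ (t, z)) m / A (Θ (t, z)) m * A (Θ (t, z)) (w t).2) t := by
    intro t ht
    obtain ⟨hA, hm, hc⟩ := h t ht
    have h1 : HasDerivAt (fun t => A (Θ (t, z))) (fderiv ℝ A (Θ (t, z)) (timeField X (Θ (t, z)))) t :=
      hA.differentiableAt.hasFDerivAt.comp_hasDerivAt t (hΘ.hasDerivAt t z)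
    have h2 : HasDerivAt (fun t => (w t).2) (fderiv ℝ X (Θ (t, z)) (w t)) t := by
      have := (hasFDerivAt_snd (𝕜 := ℝ) (p := w t)).comp_hasDerivAt t (hwd t)
      rw [hfW] at this
      exact this
    refine (h1.clm_apply h2).congr_deriv ?_
    have e : (w t) = (0, (w t).2) := Prod.ext (hw1 t) rfl
    have : lieCov A X (Θ (t, z)) (w t).2 =
        lieCov A X (Θ (t, z)) m / A (Θ (t, z)) m * A (Θ (t, z)) (w t).2 := by
      conv_lhs => rw [hc]
      rfl
    rw [← this]
    conv_lhs => rw [e]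
    rfl
  have hcont : ContinuousOn (fun t => lieCov A X (Θ (t, z)) m / A (Θ (t, z)) m) (uIcc 0 s) := by
    intro t ht
    obtain ⟨hA, hm, -⟩ := h t ht
    have hL : SmoothNear (fun y => lieCov A X y m / A y m) (Θ (t, z)) := by
      have a1 : SmoothNear (fun y => fderiv ℝ A y ((0, 1), X y)) (Θ (t, z)) :=
        hA.fderiv.clm_apply ((SmoothNear.const _).prodMk (hX.smoothNear _))
      have a2 : SmoothNear (fun y => (A y).comp ((fderiv ℝ X y).comp (.inr ℝ (ℝ × ℝ) (ℝ × ℝ))))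
          (Θ (t, z)) := hA.clm_comp ((hX.smoothNear _).fderiv.clm_comp (SmoothNear.const _))
      exact ((a1.add a2).clm_apply (SmoothNear.const m)).div
        (hA.clm_apply (SmoothNear.const m)) hm
    exact (hL.continuousAt.comp (f := fun t => Θ (t, z)) (hΘ.contDiff.continuous.comp
      (by fun_prop : Continuous fun t : ℝ => (t, z))).continuousAt).continuousWithinAt
  obtain ⟨C, hC⟩ := isCompact_uIcc.exists_bound_of_continuousOn hcont
  refine eq_zero_of_abs_deriv_le (C := C) hd (fun t ht => ?_) left_mem_uIcc ?_ s right_mem_uIcc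
  · rw [abs_mul]
    exact mul_le_mul_of_nonneg_right (hC t ht) (abs_nonneg _)
  · simp [hw0, hΘ.zero, hv]

end Moser

end BranchedSurf

namespace BranchedSurf

namespace BranchedSurface

variable {P : Type*} [TopologicalSpace P] {B : BranchedSurface P}

namespace OneForm

/-! ### Curves of forms and the topology of forms -/

/-- A coordinate expression of a form along a sheet. -/
noncomputable def rep (α : B.OneForm) (c : Fin B.num) (i : Fin 3) (u : ℝ × ℝ) : ℝ × ℝ →L[ℝ] ℝ :=
  α.coe c (lift (B.kind c) i u)

/-- A smooth curve of forms (near the parameter `0`) starting at `α`. -/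
def IsCurve (α : B.OneForm) (β : ℝ → B.OneForm) : Prop :=
  β 0 = α ∧ ∀ c i u, SmoothNear (fun z : ℝ × (ℝ × ℝ) => (β z.1).rep c i z.2) (0, u)

theorem tendsto_nhds_iff {ι : Type*} {l : Filter ι} {γ : ι → B.OneForm} {α : B.OneForm} :
    Tendsto γ l (𝓝 α) ↔ ∀ c i (m : ℕ) (K : Set (ℝ × ℝ)), IsCompact K →
      TendstoUniformlyOn (fun s => iteratedFDeriv ℝ m ((γ s).rep c i))
        (iteratedFDeriv ℝ m (α.rep c i)) l K := by
  rw [nhds_iInf, tendsto_iInf]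
  refine forall_congr' fun c => ?_
  rw [nhds_iInf, tendsto_iInf]
  refine forall_congr' fun i => ?_
  rw [nhds_iInf, tendsto_iInf]
  refine forall_congr' fun m => ?_
  rw [nhds_induced, tendsto_comap_iff, UniformOnFun.tendsto_iff_tendstoUniformlyOn]
  rfl

/-- The derivatives of a slice are the total derivatives restricted to vectors tangent to the slice.
-/
theorem continuous_iteratedFDeriv_slice {F : Type*} [NormedAddCommGroup F] [NormedSpace ℝ F]
    {G : ℝ × (ℝ × ℝ) → F} (hG : ContDiff ℝ ∞ G) (m : ℕ) :
    Continuous fun z : ℝ × (ℝ × ℝ) => iteratedFDeriv ℝ m (fun u => G (z.1, u)) z.2 := by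
  have h : ∀ z : ℝ × (ℝ × ℝ), iteratedFDeriv ℝ m (fun u => G (z.1, u)) z.2 =
      (iteratedFDeriv ℝ m G z).compContinuousLinearMap fun _ => .inr ℝ ℝ (ℝ × ℝ) := by
    intro z
    have e : (fun u => G (z.1, u)) = (fun y => G (y + (z.1, 0))) ∘ (ContinuousLinearMap.inr ℝ ℝ (ℝ × ℝ)) := by
      funext u
      simp
    have hs : ContDiff ℝ ∞ fun y => G (y + (z.1, 0)) := hG.comp (contDiff_id.add contDiff_const)
    rw [e, ContinuousLinearMap.iteratedFDeriv_comp_right (n := ∞) _ hs _ (mod_cast le_top)]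
    congr 1
    rw [← iteratedFDerivWithin_univ, iteratedFDerivWithin_comp_add_right]
    simp [iteratedFDerivWithin_univ]
  simp_rw [h]
  exact (ContinuousMultilinearMap.compContinuousLinearMapL
    (fun _ : Fin m => ContinuousLinearMap.inr ℝ ℝ (ℝ × ℝ)) :
      ContinuousMultilinearMap ℝ (fun _ : Fin m => ℝ × (ℝ × ℝ)) F →L[ℝ] _).continuous.comp
    (hG.continuous_iteratedFDeriv (by exact mod_cast le_top))

/-- The derivatives along the slices are jointly continuous near `{0} × K`, and compactness of `K`
makes the convergence uniform. -/
theorem IsCurve.tendsto {α : B.OneForm} {β : ℝ → B.OneForm} (h : IsCurve α β) :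
    Tendsto β (𝓝 0) (𝓝 α) := by
  rw [tendsto_nhds_iff]
  intro c i m K hK
  obtain ⟨G, -, hG, hGe, -, -⟩ := exists_contDiff_eventuallyEq
    (f := fun z : ℝ × (ℝ × ℝ) => (β z.1).rep c i z.2) (isCompact_singleton.prod hK : IsCompact (({0} : Set ℝ) ×ˢ K))
    (by rintro ⟨s, u⟩ ⟨hs, -⟩; obtain rfl : s = 0 := hs; exact h.2 c i u)
  have h1 : ∀ᶠ s in 𝓝 (0 : ℝ), ∀ u ∈ K, ∀ᶠ v in 𝓝 u, G (s, v) = (β s).rep c i v := by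
    refine hK.eventually_forall_of_forall_eventually fun u hu => ?_
    have h2 : ∀ᶠ z in 𝓝 ((0 : ℝ), u), G z = (β z.1).rep c i z.2 :=
      (eventually_nhdsSet_iff_forall.1 hGe) (0, u) ⟨rfl, hu⟩
    filter_upwards [h2.eventually_nhds] with z hz
    exact (by fun_prop : Continuous fun v : ℝ × ℝ => (z.1, v)).tendsto' z.2 z rfl |>.eventually hz
  have h0 := h1.self_of_nhds
  have hcont := continuous_iteratedFDeriv_slice hG m
  have h3 : TendstoUniformlyOn (fun s => iteratedFDeriv ℝ m fun u => G (s, u))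
      (iteratedFDeriv ℝ m fun u => G (0, u)) (𝓝 0) K := by
    rw [Metric.tendstoUniformlyOn_iff]
    intro ε hε
    refine hK.eventually_forall_of_forall_eventually fun u _ => ?_
    have c1 : Continuous fun z : ℝ × (ℝ × ℝ) =>
        dist (iteratedFDeriv ℝ m (fun u => G (0, u)) z.2)
          (iteratedFDeriv ℝ m (fun u => G (z.1, u)) z.2) :=
      (hcont.comp (by fun_prop : Continuous fun z : ℝ × (ℝ × ℝ) => ((0 : ℝ), z.2))).dist hcont
    exact c1.continuousAt.eventually_lt continuousAt_const (by simpa using hε)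
  refine (h3.congr ?_).congr_right ?_
  · filter_upwards [h1] with s hs u hu
    exact (EventuallyEq.iteratedFDeriv ℝ (hs u hu) m).self_of_nhds
  · intro u hu
    rw [← h.1]
    exact (EventuallyEq.iteratedFDeriv ℝ (h0 u hu) m).self_of_nhds

/-- The affine combination `α + t (β - α)`. -/
noncomputable def lerp (α β : B.OneForm) (t : ℝ) : B.OneForm where
  coe c p := α.coe c p + t • (β.coe c p - α.coe c p)
  smooth c i := (α.smooth c i).add (((β.smooth c i).sub (α.smooth c i)).const_smul t)
  compat c d p q i j T h hT := by
    rw [α.compat c d p q i j T h hT, β.compat c d p q i j T h hT]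
    ext <;> simp

theorem lerp_one (α β : B.OneForm) : lerp α β 1 = β := by
  apply OneForm.ext; funext c p; simp [lerp]

theorem contDiff_rep (α : B.OneForm) (c : Fin B.num) (i : Fin 3) : ContDiff ℝ ∞ (α.rep c i) :=
  α.smooth c i

/-- The bounds on derivatives used to build curves through a sequence of forms. -/
theorem eventually_iteratedFDeriv_le (α : B.OneForm) (n : ℕ) {ε : ℝ} (hε : 0 < ε) :
    ∀ᶠ β in 𝓝 α, ∀ c i, ∀ m : ℕ, m ≤ n → ∀ u : ℝ × ℝ, ‖u‖ ≤ n →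
      ‖iteratedFDeriv ℝ m (fun u => β.rep c i u - α.rep c i u) u‖ ≤ ε := by
  have h := (tendsto_nhds_iff (γ := id) (l := 𝓝 α) (α := α)).1 tendsto_id
  simp only [eventually_all, ← Nat.lt_succ_iff]
  intro c i
  have h2 : ∀ᶠ β in 𝓝 α, ∀ m ∈ Finset.range (n + 1), ∀ u : ℝ × ℝ, ‖u‖ ≤ n →
      ‖iteratedFDeriv ℝ m (fun u => β.rep c i u - α.rep c i u) u‖ ≤ ε := by
    rw [eventually_all_finset]
    intro m _
    have := h c i m (Metric.closedBall 0 n) (isCompact_closedBall 0 _)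
    rw [Metric.tendstoUniformlyOn_iff] at this
    filter_upwards [this ε hε] with β hβ u hu
    have h3 := hβ u (by simpa using hu)
    have hs := iteratedFDeriv_sub_apply (𝕜 := ℝ) (i := m) (x := u)
      ((β.contDiff_rep c i).contDiffAt.of_le (by exact mod_cast le_top))
      ((α.contDiff_rep c i).contDiffAt.of_le (by exact mod_cast le_top))
    change ‖iteratedFDeriv ℝ m (β.rep c i - α.rep c i) u‖ ≤ ε
    rw [hs, ← dist_eq_norm, dist_comm]
    exact h3.le
  filter_upwards [h2] with β hβ m hm u hu using hβ m (Finset.mem_range.2 hm) u hu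

end OneForm

end BranchedSurface

end BranchedSurf

/-! ### Testing the topology of forms on smooth curves -/

namespace BranchedSurf

/-- Composition with a contracting linear map does not increase iterated derivatives. -/
theorem norm_iteratedFDeriv_comp_linear_le {D G H : Type*} [NormedAddCommGroup D] [NormedSpace ℝ D]
    [NormedAddCommGroup G] [NormedSpace ℝ G] [NormedAddCommGroup H] [NormedSpace ℝ H] {f : G → H}
    (hf : ContDiff ℝ ∞ f) (L : D →L[ℝ] G) (hL : ‖L‖ ≤ 1) (z : D) (j : ℕ) :
    ‖iteratedFDeriv ℝ j (f ∘ L) z‖ ≤ ‖iteratedFDeriv ℝ j f (L z)‖ := by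
  rw [L.iteratedFDeriv_comp_right (n := ∞) hf _ (mod_cast le_top)]
  refine (ContinuousMultilinearMap.norm_compContinuousLinearMap_le _ _).trans ?_
  rw [Finset.prod_const]
  exact mul_le_of_le_one_right (norm_nonneg _) (pow_le_one₀ (norm_nonneg _) hL)

/-- The iterated derivatives of a product of functions of different variables are bounded by those
of the factors. -/
theorem norm_iteratedFDeriv_smul_prod_le {F : Type*} [NormedAddCommGroup F] [NormedSpace ℝ F]
    {κ : ℝ → ℝ} {δ : ℝ × ℝ → F} (hκ : ContDiff ℝ ∞ κ) (hδ : ContDiff ℝ ∞ δ) {k n : ℕ} (hk : k ≤ n)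
    {C ε : ℝ} {z : ℝ × (ℝ × ℝ)} (hC : ∀ j : ℕ, j ≤ n → ‖iteratedFDeriv ℝ j κ z.1‖ ≤ C)
    (hε : ∀ j : ℕ, j ≤ n → ‖iteratedFDeriv ℝ j δ z.2‖ ≤ ε) :
    ‖iteratedFDeriv ℝ k (fun z : ℝ × (ℝ × ℝ) => κ z.1 • δ z.2) z‖ ≤ 2 ^ k * (C * ε) := by
  have hC0 : 0 ≤ C := (norm_nonneg _).trans (hC 0 (Nat.zero_le _))
  have hε0 : 0 ≤ ε := (norm_nonneg _).trans (hε 0 (Nat.zero_le _))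
  have h1 : ContDiff ℝ ∞ (κ ∘ ContinuousLinearMap.fst ℝ ℝ (ℝ × ℝ)) :=
    hκ.comp (ContinuousLinearMap.contDiff _)
  have h2 : ContDiff ℝ ∞ (δ ∘ ContinuousLinearMap.snd ℝ ℝ (ℝ × ℝ)) :=
    hδ.comp (ContinuousLinearMap.contDiff _)
  refine (norm_iteratedFDeriv_smul_le h1 h2 z (mod_cast le_top)).trans ?_
  have : ((2 : ℝ) ^ k) = ∑ i ∈ Finset.range (k + 1), (k.choose i : ℝ) := by
    exact_mod_cast (Nat.sum_range_choose k).symm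
  rw [this, Finset.sum_mul]
  refine Finset.sum_le_sum fun i hi => ?_
  rw [Finset.mem_range, Nat.lt_succ_iff] at hi
  rw [mul_assoc]
  refine mul_le_mul_of_nonneg_left (mul_le_mul ?_ ?_ (norm_nonneg _) hC0) (by positivity)
  · exact (norm_iteratedFDeriv_comp_linear_le hκ (ContinuousLinearMap.fst ℝ ℝ (ℝ × ℝ))
      (ContinuousLinearMap.norm_fst_le ..) z i).trans (hC i (hi.trans hk))
  · exact (norm_iteratedFDeriv_comp_linear_le hδ (ContinuousLinearMap.snd ℝ ℝ (ℝ × ℝ))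
      (ContinuousLinearMap.norm_snd_le ..) z (k - i)).trans (hε _ ((Nat.sub_le _ _).trans hk))

/-- A series of functions with fast decreasing derivatives on larger and larger balls is smooth. -/
theorem contDiff_tsum_of_decay {E F : Type*} [NormedAddCommGroup E] [NormedSpace ℝ E]
    [FiniteDimensional ℝ E] [NormedAddCommGroup F] [NormedSpace ℝ F] [CompleteSpace F] {f : ℕ → E → F}
    (hf : ∀ n, ContDiff ℝ ∞ (f n))
    (h : ∀ n k : ℕ, k ≤ n → ∀ x : E, ‖x‖ ≤ n → ‖iteratedFDeriv ℝ k (f n) x‖ ≤ (1 / 2) ^ n) :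
    ContDiff ℝ ∞ fun x => ∑' n, f n x := by
  have : ProperSpace E := FiniteDimensional.proper ℝ E
  rw [contDiff_iff_contDiffAt]
  intro x₀
  obtain ⟨χ, K', hχ, h1, hK', -, h0, -⟩ := exists_cutoff (isCompact_singleton (x := x₀)) isOpen_univ
    (subset_univ _)
  rw [nhdsSet_singleton] at h1
  obtain ⟨R, hR⟩ := hK'.isBounded.exists_norm_le
  have hb : ∀ k : ℕ, ∃ M : ℝ, ∀ i : ℕ, i ≤ k → ∀ x, ‖iteratedFDeriv ℝ i χ x‖ ≤ M := by
    intro k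
    have hsupp : HasCompactSupport χ := HasCompactSupport.intro hK' h0
    have : ∀ i : ℕ, ∃ M : ℝ, ∀ x, ‖iteratedFDeriv ℝ i χ x‖ ≤ M := fun i =>
      (hχ.continuous_iteratedFDeriv (m := i) (mod_cast le_top)).bounded_above_of_compact_support
        (hsupp.iteratedFDeriv i)
    choose M hM using this
    refine ⟨∑ i ∈ Finset.range (k + 1), |M i|, fun i hi x => (hM i x).trans ((le_abs_self _).trans ?_)⟩
    exact Finset.single_le_sum (f := fun i => |M i|) (fun _ _ => abs_nonneg _)
      (Finset.mem_range.2 (Nat.lt_succ_of_le hi))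
  choose M hM using hb
  -- The cut-off `χ` turns the bounds on balls into global ones: all terms with `n ≥ k` and `n ≥ R`
  -- obey the decay estimate on the whole support of `χ`.
  have key : ContDiff ℝ ∞ fun x => ∑' n, χ x • f n x := by
    refine contDiff_tsum_of_eventually (N := ⊤) (v := fun k n => 2 ^ k * (M k * (1 / 2) ^ n))
      (fun n => hχ.smul (hf n)) (fun k _ => ?_) (fun k _ => ?_)
    · exact ((summable_geometric_two).mul_left _).mul_left _
    · rw [Nat.cofinite_eq_atTop]
      filter_upwards [eventually_ge_atTop k, eventually_ge_atTop ⌈R⌉₊] with n hkn hRn x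
      have hM0 : 0 ≤ M k := (norm_nonneg _).trans (hM k 0 (Nat.zero_le _) x)
      by_cases hx : x ∈ tsupport χ
      · have hxK : x ∈ K' := closure_minimal (Function.support_subset_iff'.2 h0) hK'.isClosed hx
        have hxn : ‖x‖ ≤ n := (hR x hxK).trans ((Nat.le_ceil R).trans (by exact_mod_cast hRn))
        refine (norm_iteratedFDeriv_smul_le hχ (hf n) x (mod_cast le_top)).trans ?_
        have : ((2 : ℝ) ^ k) = ∑ i ∈ Finset.range (k + 1), (k.choose i : ℝ) := by
          exact_mod_cast (Nat.sum_range_choose k).symm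
        rw [this, Finset.sum_mul]
        refine Finset.sum_le_sum fun i hi => ?_
        rw [Finset.mem_range, Nat.lt_succ_iff] at hi
        rw [mul_assoc]
        exact mul_le_mul_of_nonneg_left (mul_le_mul (hM k i hi x)
          (h n _ ((Nat.sub_le _ _).trans hkn) x hxn) (norm_nonneg _) hM0) (by positivity)
      · have e : (fun y => χ y • f n y) =ᶠ[𝓝 x] fun _ => 0 := by
          filter_upwards [(isClosed_tsupport χ).isOpen_compl.mem_nhds hx] with y hy
          rw [image_eq_zero_of_notMem_tsupport hy, zero_smul]
        rw [(e.iteratedFDeriv ℝ k).self_of_nhds]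
        have : iteratedFDeriv ℝ k (fun _ : E => (0 : F)) x = 0 := by
          rw [iteratedFDeriv_fun_zero]; rfl
        rw [this, norm_zero]
        positivity
  refine key.contDiffAt.congr_of_eventuallyEq ?_
  filter_upwards [h1] with x hx
  simp [hx]

namespace BranchedSurface

variable {P : Type*} [TopologicalSpace P] {B : BranchedSurface P}

namespace OneForm

set_option maxHeartbeats 1000000 in
/-- A property holds near `α` if along every smooth curve at `α` it holds for small parameters. -/
theorem eventually_of_isCurve {α : B.OneForm} {p : B.OneForm → Prop}
    (h : ∀ β, IsCurve α β → ∀ᶠ s in 𝓝 (0 : ℝ), p (β s)) : ∀ᶠ β in 𝓝 α, p β := by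
  by_contra hcon
  rw [not_eventually] at hcon
  -- disjoint bumps
  let pt : ℕ → ℝ := fun n => (1 / 2) ^ n
  have hpt : ∀ n, 0 < pt n := fun n => by positivity
  -- The bump at `2⁻ⁿ` has a radius of a quarter of `2⁻ⁿ`. Since `2⁻ⁿ⁻¹` is half of `2⁻ⁿ`, different
  -- supports are disjoint.
  let κ : ∀ n, ContDiffBump (pt n) := fun n => ⟨pt n / 8, pt n / 4, by have := hpt n; positivity, by have := hpt n; linarith⟩
  have hκs : ∀ n, ContDiff ℝ ∞ fun s => κ n s := fun n => (κ n).contDiff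
  have hκ1 : ∀ n, κ n (pt n) = 1 := fun n => (κ n).one_of_mem_closedBall (by simp [(κ n).rIn_pos.le])
  have hκ0 : ∀ n s, κ n s ≠ 0 → |s - pt n| < pt n / 4 := fun n s hs => by
    by_contra hc
    exact hs ((κ n).zero_of_le_dist (by rw [Real.dist_eq]; exact not_lt.1 hc))
  have hdisj : ∀ m n s, κ m s ≠ 0 → κ n s ≠ 0 → m = n := by
    have : ∀ m n s, κ m s ≠ 0 → κ n s ≠ 0 → ¬ m < n := by
      intro m n s hm hn hlt
      have h1 := abs_lt.1 (hκ0 m s hm)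
      have h2 := abs_lt.1 (hκ0 n s hn)
      have h3 : pt n ≤ pt m / 2 := by
        have : pt n ≤ pt (m + 1) := pow_le_pow_of_le_one (by norm_num) (by norm_num) hlt
        simpa [pt, pow_succ, div_eq_mul_inv, mul_comm] using this
      have := hpt m
      linarith [h1.1, h2.2]
    intro m n s hm hn
    exact le_antisymm (not_lt.1 (this n m s hn hm)) (not_lt.1 (this m n s hm hn))
  have hbound : ∀ n : ℕ, ∃ C : ℝ, 0 ≤ C ∧ ∀ j : ℕ, j ≤ n → ∀ s, ‖iteratedFDeriv ℝ j (fun s => κ n s) s‖ ≤ C := by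
    intro n
    have : ∀ i : ℕ, ∃ M : ℝ, ∀ x, ‖iteratedFDeriv ℝ i (fun s => κ n s) x‖ ≤ M := fun i =>
      ((hκs n).continuous_iteratedFDeriv (m := i) (mod_cast le_top)).bounded_above_of_compact_support
        ((κ n).hasCompactSupport.iteratedFDeriv i)
    choose M hM using this
    refine ⟨∑ i ∈ Finset.range (n + 1), |M i|, by positivity,
      fun i hi x => (hM i x).trans ((le_abs_self _).trans ?_)⟩
    exact Finset.single_le_sum (f := fun i => |M i|) (fun _ _ => abs_nonneg _)
      (Finset.mem_range.2 (Nat.lt_succ_of_le hi))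
  choose C hC0 hC using hbound
  -- Chosen so that `2 ^ k * (C n * ε n) ≤ 2⁻ⁿ` for `k ≤ n`, which is the decay required of the
  -- series.
  let ε : ℕ → ℝ := fun n => (1 / 4) ^ n / (C n + 1)
  have hε : ∀ n, 0 < ε n := fun n => by have := hC0 n; positivity
  have hbad : ∀ n : ℕ, ∃ β : B.OneForm, ¬ p β ∧ ∀ c i, ∀ m : ℕ, m ≤ n → ∀ u : ℝ × ℝ, ‖u‖ ≤ n →
      ‖iteratedFDeriv ℝ m (fun u => β.rep c i u - α.rep c i u) u‖ ≤ ε n := fun n =>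
    (hcon.and_eventually (eventually_iteratedFDeriv_le α n (hε n))).exists
  choose bad hbad1 hbad2 using hbad
  classical
  -- For each parameter at most one bump is nonzero, so the series below has at most one nonzero
  -- term. At the parameter `2⁻ⁿ` the curve passes through the form `bad n`.
  let β : ℝ → B.OneForm := fun s =>
    if hs : ∃ n, κ n s ≠ 0 then lerp α (bad hs.choose) (κ hs.choose s) else α
  have hβ : ∀ s c i u, (β s).rep c i u =
      α.rep c i u + ∑' n, κ n s • ((bad n).rep c i u - α.rep c i u) := by
    intro s c i u
    by_cases hs : ∃ n, κ n s ≠ 0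
    · have h1 : ∀ n, n ≠ hs.choose → κ n s • ((bad n).rep c i u - α.rep c i u) = 0 := by
        intro n hn
        have : κ n s = 0 := by
          by_contra hne
          exact hn (hdisj _ _ s hne hs.choose_spec)
        rw [this, zero_smul]
      rw [tsum_eq_single hs.choose h1]
      simp only [β, dif_pos hs]
      rfl
    · push Not at hs
      simp only [β, hs]
      simp
  have hcurve : IsCurve α β := by
    refine ⟨?_, fun c i u => ?_⟩
    · have : ¬ ∃ n, κ n 0 ≠ 0 := by
        rintro ⟨n, hn⟩
        have := abs_lt.1 (hκ0 n 0 hn)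
        have := hpt n
        linarith
      simp only [β, dif_neg this]
    · have hsm : ContDiff ℝ ∞ fun z : ℝ × (ℝ × ℝ) =>
          ∑' n, κ n z.1 • ((bad n).rep c i z.2 - α.rep c i z.2) := by
        have hd : ∀ n, ContDiff ℝ ∞ fun u => (bad n).rep c i u - α.rep c i u := fun n =>
          ((bad n).contDiff_rep c i).sub (α.contDiff_rep c i)
        refine contDiff_tsum_of_decay
          (f := fun n (z : ℝ × (ℝ × ℝ)) => κ n z.1 • ((bad n).rep c i z.2 - α.rep c i z.2))
          (fun n => ((hκs n).comp contDiff_fst).smul ((hd n).comp contDiff_snd)) fun n k hk z hz => ?_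
        have hz2 : ‖z.2‖ ≤ n := (norm_snd_le z).trans hz
        refine (norm_iteratedFDeriv_smul_prod_le (hκs n) (hd n) hk (C := C n) (ε := ε n)
          (fun j hj => hC n j hj _) (fun j hj => hbad2 n c i j hj _ hz2)).trans ?_
        have e1 : C n * ε n ≤ (1 / 4) ^ n := by
          have h1 := hC0 n
          have h2 : (0 : ℝ) < (1 / 4) ^ n := by positivity
          simp only [ε]
          rw [mul_div_assoc', div_le_iff₀ (by positivity)]
          nlinarith
        have e2 : (2 : ℝ) ^ k ≤ 2 ^ n := pow_le_pow_right₀ (by norm_num) hk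
        calc (2 : ℝ) ^ k * (C n * ε n) ≤ 2 ^ n * (1 / 4) ^ n :=
              mul_le_mul e2 e1 (mul_nonneg (hC0 n) (hε n).le) (by positivity)
          _ = (1 / 2) ^ n := by rw [← mul_pow]; norm_num
      simp_rw [hβ]
      exact (((α.contDiff_rep c i).comp contDiff_snd).add hsm).smoothNear _
  have hev := h β hcurve
  have hlim : Tendsto pt atTop (𝓝 0) := tendsto_pow_atTop_nhds_zero_of_lt_one (by norm_num) (by norm_num)
  obtain ⟨n, hn⟩ := (hlim.eventually hev).exists
  have hs : ∃ m, κ m (pt n) ≠ 0 := ⟨n, by rw [hκ1]; exact one_ne_zero⟩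
  have he : hs.choose = n := hdisj _ _ (pt n) hs.choose_spec (by rw [hκ1]; exact one_ne_zero)
  have : β (pt n) = bad n := by
    simp only [β, dif_pos hs]
    rw [he, hκ1, lerp_one]
  rw [this] at hn
  exact hbad1 n hn

theorem IsCurve.fmul {α : B.OneForm} {β : ℝ → B.OneForm} (h : IsCurve α β) {g : P → ℝ}
    (hg : B.SmoothFun g) : IsCurve (fmul g hg α) fun s => fmul g hg (β s) := by
  refine ⟨by simp only [h.1], fun c i u => ?_⟩
  exact (((hg c i).comp contDiff_snd).smoothNear _).smul (h.2 c i u)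

/-- Multiplication by `g` carries smooth curves to smooth curves, and this suffices for continuity.
-/
theorem continuous_fmul {g : P → ℝ} (hg : B.SmoothFun g) : Continuous (fmul g hg) := by
  rw [continuous_iff_continuousAt]
  intro α O hO
  exact eventually_of_isCurve fun β hβ => (hβ.fmul hg).tendsto hO

/-- The saturation of an open set is the union of its preimages under the continuous maps `fmul g
hg` with `g > 0`. -/
theorem isOpenMap_foliation : IsOpenMap (OneForm.foliation : B.OneForm → B.Foliation) := by
  intro W hW
  have hq : IsQuotientMap (Quotient.mk B.formSetoid) := isQuotientMap_quotient_mk'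
  refine (hq.isOpen_preimage (s := (OneForm.foliation '' W : Set (Quotient B.formSetoid)))).1 ?_
  have : Quotient.mk B.formSetoid ⁻¹' (OneForm.foliation '' W) =
      ⋃ (g : P → ℝ) (hg : B.SmoothFun g) (_ : ∀ x, 0 < g x), fmul g hg ⁻¹' W := by
    ext α
    simp only [mem_preimage, mem_iUnion, exists_prop]
    constructor
    · rintro ⟨β, hβ, e⟩
      obtain ⟨g, hg, h0, hh⟩ := foliation_eq_iff.1 (e.symm : α.foliation = β.foliation)
      refine ⟨g, hg, h0, ?_⟩
      have : fmul g hg α = β := by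
        apply OneForm.ext
        funext c p
        exact (hh c p).symm
      rwa [this]
    · rintro ⟨g, hg, h0, hh⟩
      exact ⟨_, hh, foliation_fmul hg h0 α⟩
  rw [this]
  exact isOpen_iUnion fun g => isOpen_iUnion fun hg => isOpen_iUnion fun _ =>
    hW.preimage (continuous_fmul hg)

theorem continuous_foliation : Continuous (OneForm.foliation : B.OneForm → B.Foliation) :=
  continuous_quotient_mk'

theorem eventually_foliation {α : B.OneForm} {p : B.Foliation → Prop}
    (h : ∀ᶠ β in 𝓝 α, p β.foliation) : ∀ᶠ F in 𝓝 α.foliation, p F := by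
  have := isOpenMap_foliation.image_mem_nhds h
  filter_upwards [this]
  rintro _ ⟨β, hβ, rfl⟩
  exact hβ

end OneForm

end BranchedSurface

end BranchedSurf

namespace BranchedSurf

/-! ### Flows of sheet-wise fields -/

section Hadamard

variable {E : Type} [NormedAddCommGroup E] [NormedSpace ℝ E] [FiniteDimensional ℝ E]
  {F : Type} [NormedAddCommGroup F] [NormedSpace ℝ F] [CompleteSpace F]

/-- A smooth family of functions vanishing for the parameter `0` is divisible by the parameter. -/
theorem SmoothNear.dslope {f : ℝ × E → F} {x₀ : E} (hf : SmoothNear f (0, x₀)) :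
    SmoothNear (fun z : ℝ × E => _root_.dslope (fun t => f (t, z.2)) 0 z.1) (0, x₀) := by
  obtain ⟨g, -, hg, hgf, -⟩ := exists_contDiff_eventuallyEq (isCompact_singleton (x := ((0 : ℝ), x₀)))
    (f := f) (by rintro _ rfl; exact hf)
  rw [nhdsSet_singleton] at hgf
  obtain ⟨ε, hε, hball⟩ := Metric.eventually_nhds_iff_ball.1 hgf
  have hD : ContDiff ℝ ∞ fun p : (ℝ × E) × ℝ =>
      _root_.fderiv ℝ g (p.2 * p.1.1, p.1.2) (1, 0) :=
    ((hg.fderiv_right (m := ∞) (by simp)).comp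
      (by fun_prop : ContDiff ℝ ∞ fun p : (ℝ × E) × ℝ => (p.2 * p.1.1, p.1.2))).clm_apply contDiff_const
  -- Hadamard's formula: the difference quotient at `t` is `∫₀¹ ∂ₜ g (s t, x) ds`, also for `t = 0`.
  refine ((contDiff_integral_zero_one hD).smoothNear _).congr ?_
  filter_upwards [Metric.ball_mem_nhds ((0 : ℝ), x₀) hε] with z hz
  rw [Metric.mem_ball, Prod.dist_eq, max_lt_iff] at hz
  have hd : ∀ t, HasDerivAt (fun t => g (t, z.2)) (_root_.fderiv ℝ g (t, z.2) (1, 0)) t := fun t =>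
    (hg.differentiable (by simp) _).hasFDerivAt.comp_hasDerivAt t
      ((hasDerivAt_id t).prodMk (hasDerivAt_const t z.2))
  have e1 : (fun t => f (t, z.2)) =ᶠ[𝓝 0] fun t => g (t, z.2) := by
    filter_upwards [Metric.ball_mem_nhds (0 : ℝ) hε] with t ht
    refine (hball (t, z.2) ?_).symm
    rw [Metric.mem_ball, Prod.dist_eq]
    exact max_lt ht hz.2
  rcases eq_or_ne z.1 0 with h | h
  · rw [h, dslope_same, e1.deriv_eq, (hd 0).deriv]
    simp
  · have e2 : f (z.1, z.2) = g (z.1, z.2) := (hball z (by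
      rw [Metric.mem_ball, Prod.dist_eq]; exact max_lt hz.1 hz.2)).symm
    rw [dslope_of_ne _ h, slope_def_module, show f (0, z.2) = g (0, z.2) from e1.self_of_nhds, e2]
    have hcont : Continuous fun t => _root_.fderiv ℝ g (t, z.2) (1, 0) :=
      (((hg.fderiv_right (m := ∞) (by simp)).continuous).comp (by fun_prop)).clm_apply
        continuous_const
    have e3 := intervalIntegral.integral_eq_sub_of_hasDerivAt (a := 0) (b := z.1)
      (fun t _ => hd t) (hcont.intervalIntegrable _ _)
    have e4 := intervalIntegral.smul_integral_comp_mul_right (a := 0) (b := 1)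
      (fun t => _root_.fderiv ℝ g (t, z.2) (1, 0)) z.1
    rw [zero_mul, one_mul] at e4
    rw [← e3, ← e4, sub_zero, smul_smul, inv_mul_cancel₀ h, one_smul]

end Hadamard

section TimeField

variable {X : PPlane → ℝ × ℝ} {Θ : ℝ × PPlane → PPlane}

/-- The time-dependent field `X` is smooth and compactly supported, and `Θ` is its flow. -/
structure IsFieldFlow (X : PPlane → ℝ × ℝ) (Θ : ℝ × PPlane → PPlane) : Prop where
  smooth : ContDiff ℝ ∞ X
  lipschitz : ∃ L, LipschitzWith L (timeField X)
  flow : IsFlow (timeField X) Θ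

theorem exists_isFieldFlow (hX : ContDiff ℝ ∞ X) {K : Set PPlane} (hK : IsCompact K)
    (h0 : ∀ z ∉ K, X z = 0) : ∃ Θ, IsFieldFlow X Θ := by
  have hW : ContDiff ℝ ∞ (timeField X) := contDiff_const.prodMk hX
  obtain ⟨L, hL⟩ := exists_lipschitzWith hW hK ((0, 1), 0) fun z hz => by rw [timeField, h0 z hz]
  obtain ⟨Θ, hΘ⟩ := exists_isFlow hW hL
  exact ⟨Θ, hX, ⟨L, hL⟩, hΘ⟩

namespace IsFieldFlow

theorem contDiff (h : IsFieldFlow X Θ) : ContDiff ℝ ∞ Θ := h.flow.contDiff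

theorem hasDerivAt_snd (h : IsFieldFlow X Θ) (t : ℝ) (z : PPlane) :
    HasDerivAt (fun t => (Θ (t, z)).2) (X (Θ (t, z))) t := by
  have := (hasFDerivAt_snd (𝕜 := ℝ) (p := Θ (t, z))).comp_hasDerivAt t (h.flow.hasDerivAt t z)
  exact this

theorem fst (h : IsFieldFlow X Θ) (t : ℝ) (z : PPlane) :
    (Θ (t, z)).1 = (z.1.1, z.1.2 + t) := by
  have hd : ∀ t, HasDerivAt (fun t => (Θ (t, z)).1 - ((0 : ℝ), t)) 0 t := by
    intro t
    have h1 := ((hasFDerivAt_fst (𝕜 := ℝ) (p := Θ (t, z))).comp_hasDerivAt t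
      (h.flow.hasDerivAt t z)).sub ((hasDerivAt_const t (0 : ℝ)).prodMk (hasDerivAt_id t))
    refine h1.congr_deriv ?_
    simp [timeField]
  have h1 := is_const_of_deriv_eq_zero (fun t => (hd t).differentiableAt) (fun t => (hd t).deriv) t 0
  simp only [h.flow.zero, sub_eq_iff_eq_add] at h1
  rw [h1]
  ext <;> simp

theorem neg_comp (h : IsFieldFlow X Θ) (t : ℝ) (z : PPlane) : Θ (-t, Θ (t, z)) = z := by
  obtain ⟨L, hL⟩ := h.lipschitz
  rw [← h.flow.add hL, neg_add_cancel, h.flow.zero]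

/-- Uniqueness of trajectories. -/
theorem eq_of_hasDerivAt (h : IsFieldFlow X Θ) {f : ℝ → ℝ × ℝ} {s r : ℝ}
    (hf : ∀ t, HasDerivAt f (X ((s, r + t), f t)) t) (t : ℝ) :
    Θ (t, ((s, r), f 0)) = ((s, r + t), f t) := by
  obtain ⟨L, hL⟩ := h.lipschitz
  have := h.flow.eq_of_hasDerivAt hL (f := fun t => ((s, r + t), f t)) (fun t =>
    ((hasDerivAt_const t s).prodMk ((hasDerivAt_id t).const_add r)).prodMk (hf t)) t
  rw [this, add_zero]

theorem eq_self (h : IsFieldFlow X Θ) {u : ℝ × ℝ} {s r : ℝ} (h0 : ∀ t, X ((s, t), u) = 0) (t : ℝ) :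
    Θ (t, ((s, r), u)) = ((s, r + t), u) :=
  h.eq_of_hasDerivAt (f := fun _ => u) (fun t => by rw [h0]; exact hasDerivAt_const t u) t

/-- The derivative of the flow in the plane is orientation preserving. -/
theorem det_pos (h : IsFieldFlow X Θ) (s r t : ℝ) (u : ℝ × ℝ) :
    0 < (fderiv ℝ (fun u => (Θ (t, ((s, r), u))).2) u).det := by
  have hsm : ∀ t : ℝ, ∀ r : ℝ, ContDiff ℝ ∞ fun u : ℝ × ℝ => (Θ (t, ((s, r), u))).2 := fun t r =>
    contDiff_snd.comp (h.contDiff.comp (by fun_prop))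
  -- The determinant never vanishes because the flow is invertible; it is continuous in time and
  -- equals `1` at time `0`.
  have hinv : ∀ t, (fderiv ℝ (fun u => (Θ (t, ((s, r), u))).2) u).det ≠ 0 := by
    intro t
    set ψ : ℝ × ℝ → ℝ × ℝ := fun u => (Θ (t, ((s, r), u))).2
    set ψ' : ℝ × ℝ → ℝ × ℝ := fun u => (Θ (-t, ((s, r + t), u))).2
    have e : ψ' ∘ ψ = id := by
      funext u
      have h1 : ((s, r + t), ψ u) = Θ (t, ((s, r), u)) := Prod.ext (h.fst t ((s, r), u)).symm rfl
      change (Θ (-t, ((s, r + t), ψ u))).2 = u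
      rw [h1, h.neg_comp]
    have h1 := fderiv_comp u ((hsm (-t) (r + t)).differentiable (by simp) (ψ u))
      ((hsm t r).differentiable (by simp) u)
    have h2 : fderiv ℝ (ψ' ∘ ψ) u = ContinuousLinearMap.id ℝ _ := by rw [e, fderiv_id]
    have h3 := congrArg ContinuousLinearMap.det (h1.symm.trans h2)
    change ((_ : ℝ × ℝ →ₗ[ℝ] ℝ × ℝ) ∘ₗ _).det = LinearMap.det (LinearMap.id : ℝ × ℝ →ₗ[ℝ] ℝ × ℝ) at h3
    rw [LinearMap.det_comp, LinearMap.det_id] at h3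
    exact right_ne_zero_of_mul (h3 ▸ one_ne_zero)
  have hcont : Continuous fun t => (fderiv ℝ (fun u => (Θ (t, ((s, r), u))).2) u).det := by
    have h1 : ContDiff ℝ ∞ fun q : ℝ × (ℝ × ℝ) => (Θ (q.1, ((s, r), q.2))).2 :=
      contDiff_snd.comp (h.contDiff.comp (by fun_prop))
    have h2 : ∀ t, fderiv ℝ (fun u => (Θ (t, ((s, r), u))).2) u =
        (fderiv ℝ (fun q : ℝ × (ℝ × ℝ) => (Θ (q.1, ((s, r), q.2))).2) (t, u)).comp
          (.inr ℝ ℝ (ℝ × ℝ)) := fun t =>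
      (((h1.differentiable (by simp) (t, u)).hasFDerivAt).comp u
        (hasFDerivAt_prodMk_right t u)).fderiv
    simp_rw [h2]
    exact ContinuousLinearMap.continuous_det.comp
      ((((h1.fderiv_right (m := ∞) (by simp)).continuous).comp (by fun_prop)).clm_comp
        continuous_const)
  have h0 : 0 < (fderiv ℝ (fun u => (Θ (0, ((s, r), u))).2) u).det := by
    have : (fun u : ℝ × ℝ => (Θ (0, ((s, r), u))).2) = id := by
      funext u; rw [h.flow.zero]; rfl
    rw [this, fderiv_id]
    change 0 < LinearMap.det (LinearMap.id : ℝ × ℝ →ₗ[ℝ] ℝ × ℝ)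
    rw [LinearMap.det_id]
    exact one_pos
  by_contra hneg
  obtain ⟨t', -, ht'⟩ := intermediate_value_uIcc (a := t) (b := 0) hcont.continuousOn (by
    rw [uIcc_of_le ((not_lt.1 hneg).trans h0.le)]; exact ⟨not_lt.1 hneg, h0.le⟩ :
      (0 : ℝ) ∈ uIcc _ _)
  exact hinv t' ht'

/-- If `r` satisfies `|dr(X)| ≤ C |r|` then the flow keeps the sign of `r`. -/
theorem nonneg (h : IsFieldFlow X Θ) {r : ℝ × ℝ → ℝ} (hr : Differentiable ℝ r) {C : ℝ}
    (hC : ∀ z, |fderiv ℝ r z.2 (X z)| ≤ C * |r z.2|) {z : PPlane} (hz : 0 ≤ r z.2) (t : ℝ) :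
    0 ≤ r (Θ (t, z)).2 := by
  have hd : ∀ t, HasDerivAt (fun t => r (Θ (t, z)).2)
      (fderiv ℝ r (Θ (t, z)).2 (X (Θ (t, z)))) t := fun t =>
    (hr _).hasFDerivAt.comp_hasDerivAt t (h.hasDerivAt_snd t z)
  refine nonneg_of_abs_deriv_le (a := min 0 t) (b := max 0 t) (fun t _ => hd t) (fun t _ => hC _)
    (t₀ := 0) (by simp) ?_ t (by simp)
  rwa [h.flow.zero]

end IsFieldFlow

end TimeField

/-- Compactly supported time-dependent fields on the sheets of a model, with their flows, which agree
where the sheets coincide and preserve these sets. -/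
structure SheetField (k : Kind) (K : Set (ℝ × ℝ)) (X : Fin 3 → PPlane → ℝ × ℝ)
    (Θ : Fin 3 → ℝ × PPlane → PPlane) : Prop where
  flow : ∀ i, IsFieldFlow (X i) (Θ i)
  supp : ∀ i z, z.2 ∉ K → X i z = 0
  eq : ∀ i j z, z.2 ∈ coincide k i j → X i z = X j z
  mem : ∀ i j t z, z.2 ∈ coincide k i j → (Θ i (t, z)).2 ∈ coincide k i j

/-- The parameter `s` labels the problem and is also the duration: the flow runs from homotopy time
`0` to homotopy time `s`, which is why the inverse starts at `(s, s)`. At `s = 0` the map is the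
identity, however large the fields are. -/
theorem SheetField.sheetDiffeo {k : Kind} {K : Set (ℝ × ℝ)} {X : Fin 3 → PPlane → ℝ × ℝ}
    {Θ : Fin 3 → ℝ × PPlane → PPlane} (h : SheetField k K X Θ) (s : ℝ) :
    SheetDiffeo k K (fun i u => (Θ i (s, ((s, 0), u))).2) (fun i u => (Θ i (-s, ((s, s), u))).2) where
  left_inv i u := by
    have h1 : ((s, s), (Θ i (s, ((s, 0), u))).2) = Θ i (s, ((s, 0), u)) :=
      Prod.ext (by rw [(h.flow i).fst, zero_add]) rfl
    rw [h1, (h.flow i).neg_comp]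
  right_inv i u := by
    have h1 : ((s, 0), (Θ i (-s, ((s, s), u))).2) = Θ i (-s, ((s, s), u)) :=
      Prod.ext (by rw [(h.flow i).fst, add_neg_cancel]) rfl
    have h2 := (h.flow i).neg_comp (-s) ((s, s), u)
    rw [neg_neg] at h2
    rw [h1, h2]
  smooth i := contDiff_snd.comp ((h.flow i).contDiff.comp (by fun_prop))
  smooth' i := contDiff_snd.comp ((h.flow i).contDiff.comp (by fun_prop))
  det i u := (h.flow i).det_pos s 0 s u
  supp i u hu := by rw [(h.flow i).eq_self fun t => h.supp i _ hu]
  eq i j u hu := by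
    have h1 := (h.flow j).eq_of_hasDerivAt (s := s) (r := 0)
      (f := fun t => (Θ i (t, ((s, 0), u))).2) (fun t => by
        have h2 := (h.flow i).hasDerivAt_snd t ((s, 0), u)
        rw [h.eq i j _ (h.mem i j _ _ hu)] at h2
        have h3 : ((s, 0 + t), (Θ i (t, ((s, 0), u))).2) = Θ i (t, ((s, 0), u)) :=
          Prod.ext (by rw [(h.flow i).fst]) rfl
        rwa [h3]) s
    simp only [(h.flow i).flow.zero] at h1
    rw [h1]
  mem i j u hu := h.mem i j _ _ hu
  mem' i j u hu := h.mem i j _ _ hu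

end BranchedSurf

namespace BranchedSurf

namespace BranchedSurface

variable {P : Type*} [TopologicalSpace P] {B : BranchedSurface P}

namespace OneForm

/-! ### Conjugation of foliations preserving a set -/

/-- Some diffeomorphism preserving `U` carries the foliation of `α` to that of `β`. -/
def Conn (U : Set P) (α β : B.OneForm) : Prop :=
  ∃ φ : P ≃ₜ P, IsDiffeo B B φ ∧ IsDiffeo B B φ.symm ∧ φ '' U = U ∧
    ∃ (g : P → ℝ) (hg : B.SmoothFun g), (∀ x, 0 < g x) ∧ IsPullback φ (fmul g hg α) β

theorem Conn.trans {U : Set P} {α β γ : B.OneForm} (h1 : Conn U α β) (h2 : Conn U β γ) :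
    Conn U α γ := by
  obtain ⟨φ, hφ, hφ', hU, g, hg, h0, hp⟩ := h1
  obtain ⟨ψ, hψ, hψ', hU', k, hk, k0, hq⟩ := h2
  refine ⟨φ.trans ψ, hφ.trans hψ, hψ'.trans hφ', ?_, fun x => k (φ x) * g x, (hk.comp hφ).mul hg,
    fun x => mul_pos (k0 _) (h0 _), ?_⟩
  · change (ψ ∘ φ) '' U = U
    rw [image_comp, hU, hU']
  · have := (hp.fmul hφ hk).trans hφ hψ hq
    convert this using 1
    apply OneForm.ext
    funext c p
    simp only [OneForm.fmul, smul_smul]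

theorem Conn.refl (U : Set P) (α : B.OneForm) : Conn U α α := by
  refine ⟨Homeomorph.refl P, B.isDiffeo_refl, B.isDiffeo_refl, by simp, fun _ => 1,
    SmoothFun.const 1, fun _ => one_pos, ?_⟩
  intro c d p q i j T h hT
  simp only [OneForm.fmul, one_smul]
  exact α.compat c d p q i j T h hT

theorem fderiv_eq_of_eqOn_coincide {k : Kind} {i j : Fin 3} {f g : ℝ × ℝ → ℝ × ℝ} {u : ℝ × ℝ}
    (hf : DifferentiableAt ℝ f u) (hg : DifferentiableAt ℝ g u)
    (h : ∀ u ∈ coincide k i j, f u = g u) (hu : u ∈ coincide k i j) :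
    fderiv ℝ f u = fderiv ℝ g u := by
  have hd := uniqueDiffOn_coincide k i j u hu
  rw [← hf.fderivWithin hd, ← hg.fderivWithin hd]
  exact fderivWithin_congr h (h u hu)

theorem rep_eq_of_mem_coincide (α : B.OneForm) {c : Fin B.num} {i j : Fin 3} {u : ℝ × ℝ}
    (hu : u ∈ coincide (B.kind c) i j) : α.rep c i u = α.rep c j u :=
  congrArg (α.coe c) (lift_eq_lift_iff.2 ⟨rfl, hu⟩)

/-- The pull-back of a form by a planar map on a sheet. -/
noncomputable def pull (α : B.OneForm) (c : Fin B.num) (i : Fin 3) (ψ : ℝ × ℝ → ℝ × ℝ) (u : ℝ × ℝ) :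
    ℝ × ℝ →L[ℝ] ℝ :=
  (α.rep c i (ψ u)).comp (fderiv ℝ ψ u)

/-- The pull-back normalized to agree with `T` on the vector `m`, where `θ = 1`. -/
noncomputable def factor (α : B.OneForm) (c : Fin B.num) (i : Fin 3) (ψ : ℝ × ℝ → ℝ × ℝ)
    (θ : ℝ × ℝ → ℝ) (T : ℝ × ℝ → (ℝ × ℝ →L[ℝ] ℝ)) (m : ℝ × ℝ) (u : ℝ × ℝ) : ℝ :=
  1 + θ u * (T u m / α.pull c i ψ u m - 1)

theorem contDiff_slice {f : ℝ × (ℝ × ℝ) → ℝ × ℝ} (hf : ContDiff ℝ ∞ f) (z : ℝ × (ℝ × ℝ)) :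
    fderiv ℝ (fun u => f (z.1, u)) z.2 = (fderiv ℝ f z).comp (.inr ℝ ℝ (ℝ × ℝ)) :=
  (((hf.differentiable (by simp) (z.1, z.2)).hasFDerivAt).comp z.2
    (hasFDerivAt_prodMk_right z.1 z.2)).fderiv

theorem IsCurve.smoothNear_pull {α : B.OneForm} {β : ℝ → B.OneForm} (hβ : IsCurve α β)
    {c : Fin B.num} {i : Fin 3} {ψ : ℝ → ℝ × ℝ → ℝ × ℝ}
    (hψ : ContDiff ℝ ∞ fun z : ℝ × (ℝ × ℝ) => ψ z.1 z.2) (h0 : ∀ u, ψ 0 u = u) (u : ℝ × ℝ) :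
    SmoothNear (fun z : ℝ × (ℝ × ℝ) => (β z.1).pull c i (ψ z.1) z.2) (0, u) := by
  have h1 : SmoothNear (fun z : ℝ × (ℝ × ℝ) => (β z.1).rep c i (ψ z.1 z.2)) (0, u) :=
    (hβ.2 c i u).comp' (f := fun z : ℝ × (ℝ × ℝ) => (z.1, ψ z.1 z.2))
      ((contDiff_fst.prodMk hψ).smoothNear _) (by simp [h0])
  refine h1.clm_comp ?_
  have h2 : (fun z : ℝ × (ℝ × ℝ) => fderiv ℝ (ψ z.1) z.2) = fun z =>
      (fderiv ℝ (fun z : ℝ × (ℝ × ℝ) => ψ z.1 z.2) z).comp (.inr ℝ ℝ (ℝ × ℝ)) :=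
    funext fun z => contDiff_slice hψ z
  rw [h2]
  exact ((hψ.fderiv_right (m := ∞) (by simp)).clm_comp contDiff_const).smoothNear _

theorem pull_zero {α : B.OneForm} {c : Fin B.num} {i : Fin 3} {ψ : ℝ × ℝ → ℝ × ℝ} {u : ℝ × ℝ}
    (h : ∀ᶠ v in 𝓝 u, ψ v = v) : α.pull c i ψ u = α.rep c i u := by
  have h' : ψ =ᶠ[𝓝 u] id := h
  rw [pull, h'.fderiv_eq, h.self_of_nhds, fderiv_id, ContinuousLinearMap.comp_id]

set_option maxHeartbeats 800000 in
/-- Deformation of a curve of forms by sheet-wise diffeomorphisms of a chart. -/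
theorem IsCurve.exists_deformation [T2Space P] {α : B.OneForm} {β : ℝ → B.OneForm}
    (hβ : IsCurve α β) {c : Fin B.num} {K : Set (ℝ × ℝ)} (hK : IsCompact K)
    {ψ ψ' : Fin 3 → ℝ → ℝ × ℝ → ℝ × ℝ}
    (hψ : ∀ i, ContDiff ℝ ∞ fun z : ℝ × (ℝ × ℝ) => ψ i z.1 z.2) (hψ0 : ∀ i u, ψ i 0 u = u)
    (hsd : ∀ s, SheetDiffeo (B.kind c) K (fun i => ψ i s) (fun i => ψ' i s))
    {θ : Fin 3 → ℝ × ℝ → ℝ} (hθ : ∀ i, ContDiff ℝ ∞ (θ i)) (hθ0 : ∀ i, ∀ u ∉ K, θ i u = 0)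
    (hθe : ∀ i j, ∀ u ∈ coincide (B.kind c) i j, θ i u = θ j u)
    {T : Fin 3 → ℝ × (ℝ × ℝ) → (ℝ × ℝ →L[ℝ] ℝ)} {m : ℝ × ℝ}
    (hT : ∀ i, ∀ u ∈ K, SmoothNear (T i) (0, u)) (hT0 : ∀ i, ∀ u ∈ K, T i (0, u) = α.rep c i u)
    (hTe : ∀ i j, ∀ u ∈ coincide (B.kind c) i j, ∀ s, T i (s, u) = T j (s, u))
    (hm : ∀ i, (∀ u, θ i u = 0) ∨ ∀ u ∈ K, α.rep c i u m ≠ 0) :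
    ∃ γ, IsCurve α γ ∧
      (∀ᶠ s in 𝓝 0, ∀ U : Set P,
        (∀ i u, B.chart c (lift _ i u) ∈ U → B.chart c (lift _ i (ψ i s u)) ∈ U) →
        (∀ i u, B.chart c (lift _ i u) ∈ U → B.chart c (lift _ i (ψ' i s u)) ∈ U) →
        Conn U (β s) (γ s)) ∧
      (∀ s, ∀ x ∉ B.box c K, EqAt (γ s) (β s) x) ∧
      ∀ᶠ s in 𝓝 0, ∀ i u, (γ s).rep c i u =
        (β s).factor c i (ψ i s) (θ i) (fun u => T i (s, u)) m u • (β s).pull c i (ψ i s) u := by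
  classical
  set pb : Fin 3 → ℝ → ℝ × ℝ → (ℝ × ℝ →L[ℝ] ℝ) := fun i s u => (β s).pull c i (ψ i s) u with hpb
  set g : Fin 3 → ℝ → ℝ × ℝ → ℝ := fun i s u =>
    (β s).factor c i (ψ i s) (θ i) (fun u => T i (s, u)) m u with hg
  -- `F` is the correction which turns `β s` into the rescaled pull-back. It vanishes off `K`, so it
  -- extends by zero to the whole surface.
  set F : Fin 3 → ℝ → ℝ × ℝ → (ℝ × ℝ →L[ℝ] ℝ) := fun i s u =>
    g i s u • pb i s u - (β s).rep c i u with hF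
  have hg1 : ∀ i s, ∀ u ∉ K, g i s u = 1 := fun i s u hu => by
    simp [hg, factor, hθ0 i u hu]
  have hpb1 : ∀ i s, ∀ u ∉ K, pb i s u = (β s).rep c i u := fun i s u hu =>
    pull_zero (by
      filter_upwards [hK.isClosed.isOpen_compl.mem_nhds hu] with v hv
      exact (hsd s).supp i v hv)
  have hF0 : ∀ i s, ∀ u ∉ K, F i s u = 0 := fun i s u hu => by
    simp only [hF]
    rw [hg1 i s u hu, hpb1 i s u hu, one_smul, sub_self]
  have hpbs : ∀ i u, SmoothNear (fun z : ℝ × (ℝ × ℝ) => pb i z.1 z.2) (0, u) := fun i u =>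
    hβ.smoothNear_pull (hψ i) (hψ0 i) u
  have hpb0 : ∀ i u, pb i 0 u = α.rep c i u := fun i u => by
    simp only [hpb]
    rw [pull_zero (Eventually.of_forall (hψ0 i)), hβ.1]
  have hg0 : ∀ i u, g i 0 u = 1 := by
    intro i u
    by_cases hu : u ∈ K
    · rcases hm i with h | h
      · simp [hg, factor, h]
      · have h1 : g i 0 u = 1 + θ i u * (T i (0, u) m / pb i 0 u m - 1) := rfl
        rw [h1, hT0 i u hu, hpb0, div_self (h u hu)]
        simp
    · exact hg1 i 0 u hu
  have hgs : ∀ i u, SmoothNear (fun z : ℝ × (ℝ × ℝ) => g i z.1 z.2) (0, u) := by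
    intro i u
    by_cases hu : u ∈ K
    · rcases hm i with h | h
      · have : (fun z : ℝ × (ℝ × ℝ) => g i z.1 z.2) = fun _ => 1 := by
          funext z
          simp [hg, factor, h]
        rw [this]
        exact SmoothNear.const 1
      · have e : (fun z : ℝ × (ℝ × ℝ) => g i z.1 z.2) =
            fun z => 1 + θ i z.2 * (T i z m / pb i z.1 z.2 m - 1) := rfl
        rw [e]
        refine (SmoothNear.const 1).add ((((hθ i).comp contDiff_snd).smoothNear _).mul
          ((((hT i u hu).clm_apply (SmoothNear.const m)).div
            ((hpbs i u).clm_apply (SmoothNear.const m)) ?_).sub (SmoothNear.const 1)))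
        change pb i 0 u m ≠ 0
        rw [hpb0]
        exact h u hu
    · refine (SmoothNear.const (1 : ℝ)).congr ?_
      have : ∀ᶠ z : ℝ × (ℝ × ℝ) in 𝓝 (0, u), z.2 ∉ K :=
        (continuous_snd.tendsto' ((0 : ℝ), u) u rfl).eventually (hK.isClosed.isOpen_compl.mem_nhds hu)
      filter_upwards [this] with z hz using hg1 i z.1 z.2 hz
  have hFs : ∀ i u, SmoothNear (fun z : ℝ × (ℝ × ℝ) => F i z.1 z.2) (0, u) := fun i u =>
    ((hgs i u).smul (hpbs i u)).sub (hβ.2 c i u)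
  -- the parameters for which everything is defined
  set valid : ℝ → Prop := fun s => ∀ i, ContDiff ℝ ∞ (g i s) ∧ ContDiff ℝ ∞ (F i s) ∧
    ∀ u, 0 < g i s u with hvalid
  have hslice : ∀ {H : Type} [NormedAddCommGroup H] [NormedSpace ℝ H] (f : ℝ → ℝ × ℝ → H) (c : H),
      (∀ u, SmoothNear (fun z : ℝ × (ℝ × ℝ) => f z.1 z.2) (0, u)) → (∀ s, ∀ u ∉ K, f s u = c) →
      ∀ᶠ s in 𝓝 (0 : ℝ), ContDiff ℝ ∞ (f s) := by
    intro H _ _ f c hf hfc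
    have h1 : ∀ᶠ s in 𝓝 (0 : ℝ), ∀ u ∈ K, ContDiffAt ℝ ∞ (fun z : ℝ × (ℝ × ℝ) => f z.1 z.2) (s, u) :=
      hK.eventually_forall_of_forall_eventually fun u _ => hf u
    filter_upwards [h1] with s hs
    rw [contDiff_iff_contDiffAt]
    intro u
    by_cases hu : u ∈ K
    · exact (hs u hu).comp u (f := fun u => (s, u)) (contDiff_prodMk_right s).contDiffAt
    · refine (contDiffAt_const (c := c)).congr_of_eventuallyEq ?_
      filter_upwards [hK.isClosed.isOpen_compl.mem_nhds hu] with v hv using hfc s v hv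
  have hval : ∀ᶠ s in 𝓝 (0 : ℝ), valid s := by
    simp only [hvalid, eventually_all, eventually_and]
    refine fun i => ⟨hslice (g i) 1 (hgs i) (hg1 i), hslice (F i) 0 (hFs i) (hF0 i), ?_⟩
    have h1 : ∀ᶠ s in 𝓝 (0 : ℝ), ∀ u ∈ K, 0 < g i s u :=
      hK.eventually_forall_of_forall_eventually fun u _ =>
        (hgs i u).continuousAt.eventually_const_lt (show 0 < g i 0 u by rw [hg0]; exact one_pos)
    filter_upwards [h1] with s hs u
    by_cases hu : u ∈ K
    · exact hs u hu
    · rw [hg1 i s u hu]; exact one_pos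
  have hpbe : ∀ s i j, ∀ u ∈ coincide (B.kind c) i j, pb i s u = pb j s u := by
    intro s i j u hu
    simp only [hpb, pull]
    rw [fderiv_eq_of_eqOn_coincide (((hsd s).smooth i).differentiable (by simp) u)
      (((hsd s).smooth j).differentiable (by simp) u) ((hsd s).eq i j) hu, ← (hsd s).eq i j u hu,
      (β s).rep_eq_of_mem_coincide ((hsd s).mem i j u hu)]
  have hge : ∀ s i j, ∀ u ∈ coincide (B.kind c) i j, g i s u = g j s u := by
    intro s i j u hu
    have h1 : ∀ i, g i s u = 1 + θ i u * (T i (s, u) m / pb i s u m - 1) := fun _ => rfl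
    rw [h1, h1, hθe i j u hu, hTe i j u hu, hpbe s i j u hu]
  have hFe : ∀ s i j, ∀ u ∈ coincide (B.kind c) i j, F i s u = F j s u := by
    intro s i j u hu
    simp only [hF]
    rw [hge s i j u hu, hpbe s i j u hu, (β s).rep_eq_of_mem_coincide hu]
  set δ : ℝ → Model (B.kind c) → (ℝ × ℝ →L[ℝ] ℝ) := fun s => glue (B.kind c) fun i u => F i s u with hδ
  have hδl : ∀ s i u, δ s (lift _ i u) = F i s u := fun s i u => glue_lift (hFe s) i u
  have hδ0 : ∀ s, ∀ p : Model (B.kind c), p.1.1 ∉ K → δ s p = 0 := by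
    intro s p hp
    obtain ⟨i, hi⟩ := exists_onSheet p
    rw [← hi.lift_eq, hδl, hF0 i s _ hp]
  have hδs : ∀ s, valid s → ∀ j, ContDiff ℝ ∞ fun u => δ s (lift _ j u) := by
    intro s hs j
    simp only [hδl]
    exact (hs j).2.1
  -- All parameters near `0` are valid and only these matter; the default value `β s` keeps the
  -- agreement with `β s` outside the box for every `s`.
  set γ : ℝ → B.OneForm := fun s =>
    if hs : valid s then add (β s) (extForm c (δ s) hK (hδ0 s) (hδs s hs)) else β s with hγ
  have hγv : ∀ s, valid s → ∀ d q, (γ s).coe d q = (β s).coe d q + extCoe c (δ s) d q := by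
    intro s hs d q
    simp only [hγ, dif_pos hs]
    rfl
  have hγrep : ∀ s, valid s → ∀ i u, (γ s).rep c i u = g i s u • pb i s u := by
    intro s hs i u
    rw [rep, hγv s hs, extCoe_self, hδl]
    simp only [hF, rep]
    abel
  have hoff : ∀ s, ∀ x ∉ B.box c K, EqAt (γ s) (β s) x := by
    intro s x hx d q hq
    by_cases hs : valid s
    · rw [hγv s hs, extCoe_of_notMem_box (hδ0 s) (hq ▸ hx), add_zero]
    · simp only [hγ, dif_neg hs]
  refine ⟨γ, ⟨?_, fun d i u => ?_⟩, ?_, hoff, hval.mono hγrep⟩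
  · apply OneForm.ext
    funext d q
    rw [hγv 0 hval.self_of_nhds, hβ.1]
    have : δ 0 = fun _ => 0 := by
      funext p
      obtain ⟨i, hi⟩ := exists_onSheet p
      rw [← hi.lift_eq, hδl]
      simp only [hF]
      rw [hg0, hpb0, hβ.1, one_smul, sub_self]
    rw [this]
    have h2 : extCoe c (fun _ : Model (B.kind c) => (0 : ℝ × ℝ →L[ℝ] ℝ)) d q = 0 :=
      extCoe_of_notMem_box (K := ∅) (fun _ _ => rfl) (by simp [box])
    rw [h2, add_zero]
  · have h1 : SmoothNear (fun z : ℝ × (ℝ × ℝ) => (β z.1).rep d i z.2 +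
        extCoe c (δ z.1) d (lift _ i z.2)) (0, u) :=
      (hβ.2 d i u).add (smoothNear_extCoe hK (Eventually.of_forall hδ0)
        (fun j v => by simpa only [hδl] using hFs j v) d i u)
    refine h1.congr ?_
    filter_upwards [(continuous_fst.tendsto' ((0 : ℝ), u) 0 rfl).eventually hval] with z hz
    exact hγv z.1 hz _ _
  · filter_upwards [hval] with s hs U hU hU'
    -- `γ s` is a function times the pull-back of `β s` by `ψ`, so it is the inverse of `ψ` which
    -- carries `β s` to `γ s`.
    obtain ⟨φ, hφ, hφ', e1, e2, e3⟩ := B.exists_diffeo_of_sheetDiffeo c hK (hsd s).symm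
    have hout : ∀ x ∉ range (B.chart c), φ x = x := fun x hx =>
      e3 x fun h => hx (image_subset_range _ _ h)
    set G₀ : P → ℝ := B.extend c (glue (B.kind c) fun i u => g i s u) fun _ => 1 with hG₀
    have hG₀s : B.SmoothFun G₀ := by
      refine SmoothFun.extend hK (fun p hp => ?_) (fun i => ?_) (SmoothFun.const 1)
      · obtain ⟨i, hi⟩ := exists_onSheet p
        rw [← hi.lift_eq, glue_lift (hge s), hg1 i s _ hp]
      · simp only [glue_lift (hge s)]
        exact (hs i).1
    have hG₀c : ∀ i u, G₀ (B.chart c (lift _ i u)) = g i s u := fun i u => by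
      simp only [hG₀, extend_chart]
      rw [glue_lift (hge s)]
    have hG₀out : ∀ x ∉ range (B.chart c), G₀ x = 1 := fun x hx => extend_of_notMem hx
    refine ⟨φ, hφ, hφ', ?_, fun x => G₀ (φ x), hG₀s.comp hφ, fun x => ?_, ?_⟩
    · have m1 : MapsTo φ U U := by
        intro x hx
        by_cases hr : x ∈ range (B.chart c)
        · obtain ⟨p, rfl⟩ := hr
          obtain ⟨i, hi⟩ := exists_onSheet p
          rw [← hi.lift_eq] at hx ⊢
          rw [e1]
          exact hU' i _ hx
        · rwa [hout x hr]
      have m2 : MapsTo φ.symm U U := by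
        intro x hx
        by_cases hr : x ∈ range (B.chart c)
        · obtain ⟨p, rfl⟩ := hr
          obtain ⟨i, hi⟩ := exists_onSheet p
          rw [← hi.lift_eq] at hx ⊢
          rw [e2]
          exact hU i _ hx
        · rwa [show φ.symm x = x from φ.injective (by rw [φ.apply_symm_apply, hout x hr])]
      exact subset_antisymm m1.image_subset fun x hx => ⟨φ.symm x, m2 hx, φ.apply_symm_apply x⟩
    · change 0 < G₀ (φ x)
      by_cases hr : φ x ∈ range (B.chart c)
      · obtain ⟨p, hp⟩ := hr
        obtain ⟨i, hi⟩ := exists_onSheet p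
        rw [← hp, ← hi.lift_eq, hG₀c]
        exact (hs i).2.2 _
      · rw [hG₀out _ hr]; exact one_pos
    · refine isPullback_of_local fun x => ?_
      by_cases hr : x ∈ range (B.chart c)
      · obtain ⟨p, rfl⟩ := hr
        obtain ⟨i, hi⟩ := exists_onSheet p
        rw [← hi.lift_eq]
        set v := p.1.1
        refine ⟨c, c, lift _ i v, lift _ i (ψ' i s v), i, i, ψ' i s, rfl, e1 i v,
          ⟨rfl, ((hsd s).smooth' i).contDiffAt, (hsd s).symm.det i v,
            Eventually.of_forall fun u => e1 i u⟩, ?_⟩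
        have h1 : (OneForm.fmul (fun x => G₀ (φ x)) (hG₀s.comp hφ) (β s)).coe c (lift _ i v) =
            g i s (ψ' i s v) • (β s).rep c i v := by
          simp only [OneForm.fmul]
          rw [e1, hG₀c]
          rfl
        have h2 : (γ s).coe c (lift _ i (ψ' i s v)) = g i s (ψ' i s v) • pb i s (ψ' i s v) :=
          hγrep s hs i _
        rw [h1, h2, ContinuousLinearMap.smul_comp]
        congr 1
        simp only [hpb, pull, lift_fst]
        rw [(hsd s).right_inv i v, ContinuousLinearMap.comp_assoc]
        have h3 := fderiv_comp v (((hsd s).smooth i).differentiable (by simp) (ψ' i s v))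
          (((hsd s).smooth' i).differentiable (by simp) v)
        have h4 : ψ i s ∘ ψ' i s = id := funext ((hsd s).right_inv i)
        rw [h4, fderiv_id] at h3
        rw [← h3, ContinuousLinearMap.comp_id]
      · obtain ⟨d, p, hp⟩ := B.cover x
        obtain ⟨i, hi⟩ := exists_onSheet p
        have hb : B.chart d p ∉ B.box c K := fun h => hr (hp ▸ image_subset_range _ _ h)
        refine ⟨d, d, p, p, i, i, id, hp, by rw [hp, hout x hr], ?_, ?_⟩
        · refine (LocalRep.self hi).congr_map ?_
          filter_upwards [(B.tendsto_chart_lift hi).eventually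
            ((isClosed_box hK).isOpen_compl.mem_nhds hb)] with u hu
          rw [e3 _ hu]
          rfl
        · rw [fderiv_id, ContinuousLinearMap.comp_id]
          simp only [OneForm.fmul]
          rw [hp, hout x hr, hG₀out x hr, one_smul]
          exact (hoff s _ hb d p rfl).symm

/-- The normalized pull-back by the time `s` map of a field satisfying the homotopy equation. -/
theorem factor_smul_pull_eq {α : B.OneForm} {c : Fin B.num} {i : Fin 3} {X : PPlane → ℝ × ℝ}
    {Θ : ℝ × PPlane → PPlane} (hΘ : IsFieldFlow X Θ) {A : PPlane → (ℝ × ℝ →L[ℝ] ℝ)} {s : ℝ}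
    {u m : ℝ × ℝ} (hA : A (Θ (s, ((s, 0), u))) = α.rep c i (Θ (s, ((s, 0), u))).2)
    (h : ∀ t ∈ uIcc 0 s, SmoothNear A (Θ (t, ((s, 0), u))) ∧ A (Θ (t, ((s, 0), u))) m ≠ 0 ∧
      lieCov A X (Θ (t, ((s, 0), u))) =
        (lieCov A X (Θ (t, ((s, 0), u))) m / A (Θ (t, ((s, 0), u))) m) • A (Θ (t, ((s, 0), u))))
    {θ : ℝ × ℝ → ℝ}
    (hθ : θ u = 1 ∨ ∀ᶠ v in 𝓝 u, (Θ (s, ((s, 0), v))).2 = v ∧ A ((s, 0), v) = A ((s, s), v)) :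
    α.factor c i (fun u => (Θ (s, ((s, 0), u))).2) θ (fun u => A ((s, 0), u)) m u •
      α.pull c i (fun u => (Θ (s, ((s, 0), u))).2) u = A ((s, 0), u) := by
  set ψ : ℝ × ℝ → ℝ × ℝ := fun u => (Θ (s, ((s, 0), u))).2 with hψ
  set z : PPlane := ((s, 0), u) with hz
  have hend : Θ (s, z) = ((s, s), ψ u) := Prod.ext (by rw [hΘ.fst, hz, zero_add]) rfl
  have hm0 : A z m ≠ 0 := by
    have := (h 0 left_mem_uIcc).2.1
    rwa [hΘ.flow.zero] at this
  have hm1 : α.rep c i (ψ u) m ≠ 0 := by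
    have := (h s right_mem_uIcc).2.1
    rwa [hA] at this
  have hd : ∀ v, fderiv ℝ ψ u v = (fderiv ℝ Θ (s, z) (0, (0, v))).2 := by
    intro v
    have h1 : HasFDerivAt (fun u : ℝ × ℝ => (s, (((s, 0) : ℝ × ℝ), u)))
        ((0 : ℝ × ℝ →L[ℝ] ℝ).prod ((0 : ℝ × ℝ →L[ℝ] ℝ × ℝ).prod (ContinuousLinearMap.id ℝ _))) u :=
      (hasFDerivAt_const _ _).prodMk ((hasFDerivAt_const _ _).prodMk (hasFDerivAt_id u))
    have h2 := (((hΘ.contDiff.differentiable (by simp) (s, z)).hasFDerivAt).comp u h1).snd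
    have h3 : fderiv ℝ ψ u = _ := h2.fderiv
    rw [h3]
    rfl
  have hpull : ∀ v, α.pull c i ψ u v = A (Θ (s, z)) (fderiv ℝ Θ (s, z) (0, (0, v))).2 := by
    intro v
    rw [hA, ← hd]
    rfl
  -- By Moser's argument the pull-back annihilates the kernel of `A` at homotopy time `0`, so it is
  -- a multiple of that form, and the multiplier can be read off on `m`.
  have hker : ∀ v, A z v = 0 → α.pull c i ψ u v = 0 := fun v hv => by
    rw [hpull]
    exact apply_fderiv_flow_eq_zero hΘ.flow hΘ.smooth h hv
  have hpar : ∀ v, α.pull c i ψ u v = α.pull c i ψ u m / A z m * A z v := by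
    intro v
    have h1 := hker (v - (A z v / A z m) • m) (by simp [hm0])
    rw [map_sub, map_smul, sub_eq_zero, smul_eq_mul] at h1
    rw [h1]
    ring
  -- The pull-back of a nonzero covector by a local diffeomorphism is nonzero; being proportional to
  -- `A z`, it cannot vanish on `m`.
  have hpm : α.pull c i ψ u m ≠ 0 := by
    intro h0
    have hdet := hΘ.det_pos s 0 s u
    let e := ContinuousLinearMap.toContinuousLinearEquivOfDetNeZero (fderiv ℝ ψ u) hdet.ne'
    have h1 : α.pull c i ψ u (e.symm m) = α.rep c i (ψ u) m := by
      have : fderiv ℝ ψ u (e.symm m) = m := e.apply_symm_apply m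
      rw [pull, ContinuousLinearMap.comp_apply, this]
    rw [hpar, h0, zero_div, zero_mul] at h1
    exact hm1 h1.symm
  have hfac : α.factor c i ψ θ (fun u => A ((s, 0), u)) m u = A z m / α.pull c i ψ u m := by
    rw [factor]
    rcases hθ with h1 | h1
    · rw [h1]; ring
    -- Near `u` nothing moves and the two ends of the homotopy agree, so the factor is `1` whatever
    -- the value of `θ u`.
    · have e1 : ψ u = u := h1.self_of_nhds.1
      have h2 : α.pull c i ψ u = A z := by
        rw [pull_zero (h1.mono fun v hv => hv.1), hz, h1.self_of_nhds.2]
        have h3 : Θ (s, z) = ((s, s), u) := hend.trans (by rw [e1])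
        rw [h3] at hA
        exact hA.symm
      rw [h2, div_self hm0]; ring
  refine ContinuousLinearMap.ext fun v => ?_
  rw [hfac, smul_apply, smul_eq_mul, hpar v]
  field_simp

end OneForm

end BranchedSurface

end BranchedSurf

namespace BranchedSurf

/-! ### The sides of the singular edges -/

/-- The linear form which is nonnegative where the sheet `i` coincides with the horizontal one. -/
noncomputable def side (k : Kind) (i : Fin 3) : ℝ × ℝ →L[ℝ] ℝ :=
  match k with
  | .D => 0
  | .E => if i = 2 then .fst ℝ ℝ ℝ else 0
  | .Vpos => if i = 2 then .fst ℝ ℝ ℝ else if i = 0 then .snd ℝ ℝ ℝ else 0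
  | .Vneg => if i = 2 then .fst ℝ ℝ ℝ else if i = 0 then -.snd ℝ ℝ ℝ else 0

/-- The direction of the edge along which the sheet `a` leaves the horizontal one. -/
noncomputable def edgeDir (a : Fin 3) : ℝ × ℝ := if a = 2 then (0, 1) else (1, 0)

/-- The normal of this edge. -/
noncomputable def edgeNormal (k : Kind) (a : Fin 3) : ℝ × ℝ :=
  if a = 2 then (1, 0) else match k with
  | .Vneg => (0, -1)
  | _ => (0, 1)

/-- The coordinate along this edge. -/
noncomputable def edgeCoord (a : Fin 3) : ℝ × ℝ →L[ℝ] ℝ :=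
  if a = 2 then .snd ℝ ℝ ℝ else .fst ℝ ℝ ℝ

theorem side_one (k : Kind) : side k 1 = 0 := by cases k <;> simp [side]

theorem height_eq_zero_iff {k : Kind} {i : Fin 3} {u : ℝ × ℝ} : height k i u = 0 ↔ 0 ≤ side k i u := by
  cases k <;> fin_cases i <;> simp [height, side, hfun_eq_zero_iff]

theorem height_eq_zero_or {k : Kind} {i : Fin 3} {u : ℝ × ℝ} (h : side k i u < 0) :
    (i = 0 ∧ height k i u < 0) ∨ (i = 2 ∧ 0 < height k i u) := by
  cases k <;> fin_cases i <;> simp [height, side] at h ⊢ <;> apply hfun_pos <;> linarith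

/-- Off height zero the sheet is determined by the sign of the height, so different sheets meet only
on the horizontal one. -/
theorem mem_coincide_iff {k : Kind} {i j : Fin 3} {u : ℝ × ℝ} :
    u ∈ coincide k i j ↔ i = j ∨ (0 ≤ side k i u ∧ 0 ≤ side k j u) := by
  constructor
  · intro h
    by_contra hcon
    push Not at hcon
    obtain ⟨hne, h2⟩ := hcon
    have h : height k i u = height k j u := h
    by_cases hi : 0 ≤ side k i u
    · have h3 := height_eq_zero_or (h2 hi)
      rw [← h, height_eq_zero_iff.2 hi] at h3
      simp at h3
    · have h3 := height_eq_zero_or (not_le.1 hi)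
      by_cases hj : 0 ≤ side k j u
      · rw [h, height_eq_zero_iff.2 hj] at h3
        simp at h3
      · have h4 := height_eq_zero_or (not_le.1 hj)
        rcases h3 with ⟨h3, h3'⟩ | ⟨h3, h3'⟩ <;> rcases h4 with ⟨h4, h4'⟩ | ⟨h4, h4'⟩
        · exact hne (h3.trans h4.symm)
        · linarith
        · linarith
        · exact hne (h3.trans h4.symm)
  · rintro (rfl | ⟨h1, h2⟩)
    · rw [coincide_self]; trivial
    · exact (height_eq_zero_iff.2 h1).trans (height_eq_zero_iff.2 h2).symm

theorem side_edgeNormal {k : Kind} {a : Fin 3} (h : side k a ≠ 0) : side k a (edgeNormal k a) = 1 := by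
  cases k <;> fin_cases a <;> simp [side, edgeNormal] at h ⊢

theorem side_edgeDir (k : Kind) (a : Fin 3) : side k a (edgeDir a) = 0 := by
  cases k <;> fin_cases a <;> simp [side, edgeDir]

theorem edgeCoord_edgeDir (a : Fin 3) : edgeCoord a (edgeDir a) = 1 := by
  fin_cases a <;> simp [edgeCoord, edgeDir]

theorem edgeCoord_edgeNormal (k : Kind) (a : Fin 3) : edgeCoord a (edgeNormal k a) = 0 := by
  cases k <;> fin_cases a <;> simp [edgeNormal, edgeCoord]

theorem eq_side_smul_add {k : Kind} {a : Fin 3} (h : side k a ≠ 0) (w : ℝ × ℝ) :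
    w = side k a w • edgeNormal k a + edgeCoord a w • edgeDir a := by
  cases k <;> fin_cases a <;> simp [side, edgeNormal, edgeCoord, edgeDir] at h ⊢

theorem isEdgeAt_iff {k : Kind} {q : (ℝ × ℝ) × ℝ} {e n : ℝ × ℝ} :
    IsEdgeAt k q e n ↔ q.2 = 0 ∧ ∃ a, side k a ≠ 0 ∧ side k a q.1 = 0 ∧ e = edgeDir a ∧
      n = edgeNormal k a := by
  have h1 : (ContinuousLinearMap.fst ℝ ℝ ℝ) ≠ 0 := fun h => by
    simpa using congrArg (fun L => L (1, 0)) h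
  have h2 : (ContinuousLinearMap.snd ℝ ℝ ℝ) ≠ 0 := fun h => by
    simpa using congrArg (fun L => L (0, 1)) h
  refine and_congr_right fun _ => ?_
  cases k <;> simp [Fin.exists_fin_succ, side, edgeDir, edgeNormal, h1, h2, or_comm]

theorem isVertexAt_of_side {k : Kind} {q : (ℝ × ℝ) × ℝ} (hq : q.2 = 0) {a b : Fin 3} (hab : a ≠ b)
    (ha : side k a ≠ 0) (hb : side k b ≠ 0) (h1 : side k a q.1 = 0) (h2 : side k b q.1 = 0) :
    IsVertexAt k q := by
  obtain ⟨⟨x, y⟩, z⟩ := q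
  cases k <;> fin_cases a <;> fin_cases b <;> simp_all [side, IsVertexAt]

theorem sing_iff_side {k : Kind} {p : Model k} :
    Sing p ↔ p.1.2 = 0 ∧ ∃ a, side k a ≠ 0 ∧ side k a p.1.1 = 0 := by
  constructor
  · rintro ⟨e, n, h⟩
    obtain ⟨h1, a, h2, h3, -⟩ := isEdgeAt_iff.1 h
    exact ⟨h1, a, h2, h3⟩
  · rintro ⟨h1, a, h2, h3⟩
    exact ⟨_, _, isEdgeAt_iff.2 ⟨h1, a, h2, h3, rfl, rfl⟩⟩

theorem onSheet_iff_side {k : Kind} {p : Model k} (h : p.1.2 = 0) {i : Fin 3} :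
    OnSheet p i ↔ 0 ≤ side k i p.1.1 := by
  rw [OnSheet, h, eq_comm, height_eq_zero_iff]

theorem eventually_notMem_coincide {k : Kind} (p : Model k) :
    ∀ᶠ u in 𝓝 p.1.1, ∀ i j, OnSheet p i → ¬ OnSheet p j → u ∉ coincide k i j := by
  simp only [eventually_all]
  intro i j hi hj
  refine (isClosed_coincide k i j).isOpen_compl.mem_nhds fun h => hj ?_
  have h : height k i p.1.1 = height k j p.1.1 := h
  exact Eq.trans hi h

theorem eventually_onSheet {k : Kind} (p : Model k) :
    ∀ᶠ q in 𝓝 p, ∀ i, OnSheet q i → OnSheet p i := by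
  rw [eventually_all]
  intro i
  by_cases h : OnSheet p i
  · exact Eventually.of_forall fun _ _ => h
  · have hc : IsClosed {q : Model k | OnSheet q i} :=
      isClosed_eq (by fun_prop) ((continuous_height k i).comp (by fun_prop))
    filter_upwards [hc.isOpen_compl.mem_nhds h] with q hq hq'
    exact absurd hq' hq

/-- Fields on the sheets which agree with the field of the horizontal sheet where they should. -/
theorem SheetField.of_side {k : Kind} {K : Set (ℝ × ℝ)} {X : Fin 3 → PPlane → ℝ × ℝ}
    {Θ : Fin 3 → ℝ × PPlane → PPlane} (hflow : ∀ i, IsFieldFlow (X i) (Θ i))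
    (hsupp : ∀ i z, z.2 ∉ K → X i z = 0) (heq : ∀ i z, 0 ≤ side k i z.2 → X i z = X 1 z)
    (hmem : ∀ i t z, 0 ≤ side k i z.2 → 0 ≤ side k i (Θ 1 (t, z)).2) : SheetField k K X Θ := by
  -- A trajectory of the horizontal field which stays in the shared region is also a trajectory of
  -- the field on sheet `i`; uniqueness identifies the two flows.
  have hΘ : ∀ i t z, 0 ≤ side k i z.2 → Θ i (t, z) = Θ 1 (t, z) := by
    intro i t z hz
    have h1 := (hflow i).eq_of_hasDerivAt (s := z.1.1) (r := z.1.2)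
      (f := fun t => (Θ 1 (t, z)).2) (fun t => by
        have h2 := (hflow 1).hasDerivAt_snd t z
        have h3 : ((z.1.1, z.1.2 + t), (Θ 1 (t, z)).2) = Θ 1 (t, z) :=
          Prod.ext (by rw [(hflow 1).fst]) rfl
        rw [h3, heq i _ (hmem i t z hz)]
        exact h2) t
    simp only [(hflow 1).flow.zero] at h1
    rw [h1]
    exact Prod.ext (by rw [(hflow 1).fst]) rfl
  refine ⟨hflow, hsupp, fun i j z hz => ?_, fun i j t z hz => ?_⟩
  · rcases mem_coincide_iff.1 hz with rfl | ⟨h1, h2⟩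
    · rfl
    · rw [heq i z h1, heq j z h2]
  · rcases mem_coincide_iff.1 hz with rfl | ⟨h1, h2⟩
    · rw [coincide_self]; trivial
    · rw [mem_coincide_iff, hΘ i t z h1]
      exact Or.inr ⟨hmem i t z h1, hmem j t z h2⟩

/-- Points outside `K` are at rest, so a trajectory found outside `K` has always been there. -/
theorem IsFieldFlow.mem_of_mem {X : PPlane → ℝ × ℝ} {Θ : ℝ × PPlane → PPlane} (h : IsFieldFlow X Θ)
    {K : Set (ℝ × ℝ)} (h0 : ∀ z, z.2 ∉ K → X z = 0) {z : PPlane} (hz : z.2 ∈ K) (t : ℝ) :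
    (Θ (t, z)).2 ∈ K := by
  by_contra hcon
  have h1 := h.eq_self (u := (Θ (t, z)).2) (s := (Θ (t, z)).1.1) (r := (Θ (t, z)).1.2)
    (fun t => h0 _ hcon) (-t)
  have h2 := h.neg_comp t z
  change Θ (-t, Θ (t, z)) = _ at h1
  rw [h1] at h2
  rw [← h2] at hz
  exact hcon hz

/-- The preservation of a half-plane by a flow supported in `K`, where the boundary is far from
`K`. -/
theorem IsFieldFlow.nonneg_of_ne {X : PPlane → ℝ × ℝ} {Θ : ℝ × PPlane → PPlane}
    (h : IsFieldFlow X Θ) {K : Set (ℝ × ℝ)} (h0 : ∀ z, z.2 ∉ K → X z = 0) {r : ℝ × ℝ → ℝ}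
    (hr : Continuous r) (hK : ∀ u ∈ K, r u ≠ 0) {z : PPlane} (hz : 0 ≤ r z.2) (t : ℝ) :
    0 ≤ r (Θ (t, z)).2 := by
  by_cases hzK : z.2 ∈ K
  · by_contra hcon
    have hc : Continuous fun t => r (Θ (t, z)).2 :=
      hr.comp (continuous_snd.comp (h.contDiff.continuous.comp (by fun_prop)))
    obtain ⟨t', -, ht'⟩ := intermediate_value_uIcc (a := t) (b := 0) hc.continuousOn (by
      simp only [h.flow.zero]
      rw [uIcc_of_le ((not_le.1 hcon).le.trans hz)]
      exact ⟨(not_le.1 hcon).le, hz⟩ : (0 : ℝ) ∈ uIcc _ _)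
    exact hK _ (h.mem_of_mem h0 hzK t') ht'
  · have := h.eq_self (u := z.2) (s := z.1.1) (r := z.1.2) (fun t => h0 _ hzK) t
    change Θ (t, z) = _ at this
    rw [this]
    exact hz

namespace BranchedSurface

variable {P : Type*} [TopologicalSpace P] {B : BranchedSurface P}

/-- The points over `closedBall p.1.1 r` on the sheets through `p`. -/
def spot (B : BranchedSurface P) (c : Fin B.num) (p : Model (B.kind c)) (r : ℝ) : Set P :=
  {x | ∃ i, OnSheet p i ∧ ∃ u ∈ Metric.closedBall p.1.1 r, B.chart c (lift _ i u) = x}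

namespace OneForm

/-- A deformation of the curve `β` by time-dependent fields on the sheets, which realizes the form
`A` where the homotopy equation holds. -/
theorem IsCurve.exists_moser [T2Space P] {α : B.OneForm} {β : ℝ → B.OneForm}
    (hβ : IsCurve α β) {c : Fin B.num} {K : Set (ℝ × ℝ)} (hK : IsCompact K)
    {X : Fin 3 → PPlane → ℝ × ℝ} {Θ : Fin 3 → ℝ × PPlane → PPlane}
    (hX : SheetField (B.kind c) K X Θ)
    {θ : Fin 3 → ℝ × ℝ → ℝ} (hθ : ∀ i, ContDiff ℝ ∞ (θ i)) (hθ0 : ∀ i, ∀ u ∉ K, θ i u = 0)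
    (hθe : ∀ i j, ∀ u ∈ coincide (B.kind c) i j, θ i u = θ j u)
    {A : Fin 3 → PPlane → (ℝ × ℝ →L[ℝ] ℝ)} {m : ℝ × ℝ}
    (hA : ∀ i, ∀ u ∈ K, SmoothNear (A i) ((0, 0), u))
    (hA0 : ∀ i, ∀ u ∈ K, A i ((0, 0), u) = α.rep c i u)
    (hAe : ∀ i j, ∀ u ∈ coincide (B.kind c) i j, ∀ s, A i ((s, 0), u) = A j ((s, 0), u))
    (hm : ∀ i, (∀ u, θ i u = 0) ∨ ∀ u ∈ K, α.rep c i u m ≠ 0) :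
    ∃ γ, IsCurve α γ ∧
      (∀ᶠ s in 𝓝 0, ∀ U : Set P,
        (∀ i t z, B.chart c (lift _ i z.2) ∈ U → B.chart c (lift _ i (Θ i (t, z)).2) ∈ U) →
        Conn U (β s) (γ s)) ∧
      (∀ s, ∀ x ∉ B.box c K, EqAt (γ s) (β s) x) ∧
      (∀ᶠ s in 𝓝 0, ∀ i u,
        A i (Θ i (s, ((s, 0), u))) = (β s).rep c i (Θ i (s, ((s, 0), u))).2 →
        (∀ t ∈ uIcc 0 s, SmoothNear (A i) (Θ i (t, ((s, 0), u))) ∧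
          A i (Θ i (t, ((s, 0), u))) m ≠ 0 ∧
          lieCov (A i) (X i) (Θ i (t, ((s, 0), u))) =
            (lieCov (A i) (X i) (Θ i (t, ((s, 0), u))) m / A i (Θ i (t, ((s, 0), u))) m) •
              A i (Θ i (t, ((s, 0), u)))) →
        (θ i u = 1 ∨ ∀ᶠ v in 𝓝 u, (Θ i (s, ((s, 0), v))).2 = v ∧ A i ((s, 0), v) = A i ((s, s), v)) →
        (γ s).rep c i u = A i ((s, 0), u)) ∧
      ∀ᶠ s in 𝓝 0, ∀ i u, θ i u = 0 → (∀ᶠ v in 𝓝 u, (Θ i (s, ((s, 0), v))).2 = v) →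
        (γ s).rep c i u = (β s).rep c i u := by
  have hψ : ∀ i, ContDiff ℝ ∞ fun z : ℝ × (ℝ × ℝ) => (Θ i (z.1, ((z.1, 0), z.2))).2 := fun i =>
    contDiff_snd.comp ((hX.flow i).contDiff.comp (by fun_prop))
  obtain ⟨γ, h1, h2, h3, h4⟩ := hβ.exists_deformation hK
    (ψ := fun i s u => (Θ i (s, ((s, 0), u))).2) hψ
    (fun i u => by rw [(hX.flow i).flow.zero]) hX.sheetDiffeo hθ hθ0 hθe (m := m)
    (T := fun i z => A i ((z.1, 0), z.2))
    (fun i u hu => (hA i u hu).comp' (f := fun z : ℝ × (ℝ × ℝ) => (((z.1, 0) : ℝ × ℝ), z.2))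
      ((by fun_prop : ContDiff ℝ ∞ fun z : ℝ × (ℝ × ℝ) => (((z.1, 0) : ℝ × ℝ), z.2)).smoothNear _) rfl)
    hA0 hAe hm
  refine ⟨γ, h1, ?_, h3, ?_, ?_⟩
  · filter_upwards [h2] with s hs U hU
    exact hs U (fun i u hu => hU i s _ hu) (fun i u hu => hU i (-s) _ hu)
  · filter_upwards [h4] with s hs i u hA1 hg hθ1
    rw [hs i u]
    exact factor_smul_pull_eq (hX.flow i) hA1 hg hθ1
  · filter_upwards [h4] with s hs i u hθu hψu
    rw [hs i u, pull_zero hψu, factor, hθu, zero_mul, add_zero, one_smul]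

/-- The difference quotient of two curves of forms. -/
noncomputable def diffQuot (β τ : ℝ → B.OneForm) (c : Fin B.num) (i : Fin 3) (z : ℝ × (ℝ × ℝ)) :
    ℝ × ℝ →L[ℝ] ℝ :=
  dslope (fun t => (τ t).rep c i z.2 - (β t).rep c i z.2) 0 z.1

/-- The homotopy from `β + χ (τ - β)` to `β`. -/
noncomputable def homot (β τ : ℝ → B.OneForm) (c : Fin B.num) (i : Fin 3) (χ : ℝ × ℝ → ℝ)
    (z : PPlane) : ℝ × ℝ →L[ℝ] ℝ :=
  (β z.1.1).rep c i z.2 + ((z.1.1 - z.1.2) * χ z.2) • diffQuot β τ c i (z.1.1, z.2)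

section

variable {α : B.OneForm} {β τ : ℝ → B.OneForm} {c : Fin B.num} {i : Fin 3} {χ : ℝ × ℝ → ℝ}

theorem smul_diffQuot (hβ : IsCurve α β) (hτ : IsCurve α τ) (s : ℝ) (u : ℝ × ℝ) :
    s • diffQuot β τ c i (s, u) = (τ s).rep c i u - (β s).rep c i u := by
  have := sub_smul_dslope (fun t => (τ t).rep c i u - (β t).rep c i u) 0 s
  simp only [sub_zero, hβ.1, hτ.1, sub_self] at this
  exact this

/-- Both curves start at `α`, so their difference is divisible by `s`. Running the homotopy for a
time `s` instead of `1`, with this quotient as its speed, keeps the homotopy equation regular at `s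
= 0`. -/
theorem smoothNear_diffQuot (hβ : IsCurve α β) (hτ : IsCurve α τ) (u : ℝ × ℝ) :
    SmoothNear (diffQuot β τ c i) (0, u) :=
  ((hτ.2 c i u).sub (hβ.2 c i u)).dslope

theorem diffQuot_eq (β τ : ℝ → B.OneForm) {j : Fin 3} {z : ℝ × (ℝ × ℝ)}
    (h : z.2 ∈ coincide (B.kind c) i j) : diffQuot β τ c i z = diffQuot β τ c j z := by
  simp only [diffQuot, fun t => (τ t).rep_eq_of_mem_coincide h, fun t => (β t).rep_eq_of_mem_coincide h]

theorem homot_self (s : ℝ) (u : ℝ × ℝ) : homot β τ c i χ ((s, s), u) = (β s).rep c i u := by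
  simp [homot]

theorem homot_zero (hβ : IsCurve α β) (hτ : IsCurve α τ) (s : ℝ) (u : ℝ × ℝ) :
    homot β τ c i χ ((s, 0), u) =
      (β s).rep c i u + χ u • ((τ s).rep c i u - (β s).rep c i u) := by
  rw [homot, ← smul_diffQuot hβ hτ, smul_smul, sub_zero, mul_comm]

theorem smoothNear_homot (hβ : IsCurve α β) (hτ : IsCurve α τ) (hχ : ContDiff ℝ ∞ χ) (u : ℝ × ℝ) :
    SmoothNear (homot β τ c i χ) ((0, 0), u) := by
  have h1 : SmoothNear (fun z : PPlane => (z.1.1, z.2)) ((0, 0), u) :=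
    (by fun_prop : ContDiff ℝ ∞ fun z : PPlane => (z.1.1, z.2)).smoothNear _
  have h2 : SmoothNear (fun z : PPlane => (z.1.1 - z.1.2) * χ z.2) ((0, 0), u) :=
    ((by fun_prop : ContDiff ℝ ∞ fun z : PPlane => z.1.1 - z.1.2).mul
      (hχ.comp contDiff_snd)).smoothNear _
  exact ((hβ.2 c i u).comp' h1 rfl).add (h2.smul ((smoothNear_diffQuot hβ hτ u).comp' h1 rfl))

theorem homot_eq (β τ : ℝ → B.OneForm) {j : Fin 3} {z : PPlane}
    (h : z.2 ∈ coincide (B.kind c) i j) : homot β τ c i χ z = homot β τ c j χ z := by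
  rw [homot, homot, diffQuot_eq β τ (z := (z.1.1, z.2)) h, (β z.1.1).rep_eq_of_mem_coincide h]

theorem fderiv_homot {z : PPlane} (h : DifferentiableAt ℝ (homot β τ c i χ) z) :
    fderiv ℝ (homot β τ c i χ) z ((0, 1), 0) = -(χ z.2 • diffQuot β τ c i (z.1.1, z.2)) := by
  have h1 : HasDerivAt (fun r : ℝ => homot β τ c i χ ((z.1.1, r), z.2))
      (fderiv ℝ (homot β τ c i χ) z ((0, 1), 0)) z.1.2 :=
    HasFDerivAt.comp_hasDerivAt (f := fun r : ℝ => (((z.1.1, r), z.2) : PPlane)) z.1.2 h.hasFDerivAt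
      (((hasDerivAt_const _ _).prodMk (hasDerivAt_id _)).prodMk (hasDerivAt_const _ _))
  have h2 : HasDerivAt (fun r : ℝ => homot β τ c i χ ((z.1.1, r), z.2))
      (((0 - 1) * χ z.2) • diffQuot β τ c i (z.1.1, z.2)) z.1.2 :=
    (((((hasDerivAt_const z.1.2 z.1.1).sub (hasDerivAt_id z.1.2)).mul_const (χ z.2)).smul_const
      (diffQuot β τ c i (z.1.1, z.2)))).const_add ((β z.1.1).rep c i z.2)
  rw [h1.unique h2, zero_sub, neg_one_mul]
  refine ContinuousLinearMap.ext fun v => ?_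
  change -χ z.2 * _ = -(χ z.2 * _)
  ring

end

end OneForm

end BranchedSurface

end BranchedSurf

namespace BranchedSurf

/-! ### Local solutions of the homotopy equation -/

/-- Global data which near `z₀` describe the homotopy equation for the family of forms `A`. -/
structure KerFlow (A : PPlane → (ℝ × ℝ →L[ℝ] ℝ)) (l m : ℝ × ℝ) (z₀ : PPlane) (W : PPlane → PPlane)
    (Θ : ℝ × PPlane → PPlane) (c r : PPlane → ℝ) : Prop where
  lipschitz : ∃ L, LipschitzWith L W
  flow : IsFlow W Θ
  smooth : ContDiff ℝ ∞ W
  smooth_c : ContDiff ℝ ∞ c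
  smooth_r : ContDiff ℝ ∞ r
  eventually : ∀ᶠ z in 𝓝 z₀, W z = (0, kerField A l m z) ∧ c z = curlCoef A l m z ∧
    r z = -(fderiv ℝ A z ((0, 1), 0)) (kerField A l m z)

variable {A : PPlane → (ℝ × ℝ →L[ℝ] ℝ)} {l m : ℝ × ℝ} {z₀ : PPlane}

theorem smoothNear_kerField (hA : SmoothNear A z₀) (hm : A z₀ m ≠ 0) :
    SmoothNear (kerField A l m) z₀ :=
  (SmoothNear.const l).sub (((hA.clm_apply (SmoothNear.const l)).div
    (hA.clm_apply (SmoothNear.const m)) hm).smul (SmoothNear.const m))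

theorem smoothNear_curlCoef (hA : SmoothNear A z₀) (hm : A z₀ m ≠ 0) :
    SmoothNear (curlCoef A l m) z₀ := by
  have h1 := smoothNear_kerField (l := l) hA hm
  refine SmoothNear.div (SmoothNear.sub ?_ ?_) (hA.clm_apply (SmoothNear.const m)) hm
  · exact (hA.fderiv.clm_apply (SmoothNear.const _)).clm_apply h1
  · exact (hA.fderiv.clm_apply ((SmoothNear.const _).prodMk h1)).clm_apply (SmoothNear.const _)

theorem exists_kerFlow (hA : SmoothNear A z₀) (hm : A z₀ m ≠ 0) (l : ℝ × ℝ) :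
    ∃ W Θ c r, KerFlow A l m z₀ W Θ c r := by
  have h1 := smoothNear_kerField (l := l) hA hm
  have hs : ∀ {F : Type} [NormedAddCommGroup F] [NormedSpace ℝ F] {f : PPlane → F}, SmoothNear f z₀ →
      ∃ (g : PPlane → F) (K : Set PPlane), ContDiff ℝ ∞ g ∧ (∀ᶠ x in 𝓝 z₀, g x = f x) ∧
        IsCompact K ∧ ∀ x ∉ K, g x = 0 := by
    intro F _ _ f hf
    have := exists_contDiff_eventuallyEq (isCompact_singleton (x := z₀)) (f := f)
      (by rintro _ rfl; exact hf)
    rwa [nhdsSet_singleton] at this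
  obtain ⟨W, K, hW, hWe, hK, hW0⟩ := hs ((SmoothNear.const (0 : ℝ × ℝ)).prodMk h1)
  obtain ⟨c, -, hc, hce, -, -⟩ := hs (smoothNear_curlCoef (l := l) hA hm)
  obtain ⟨r, -, hr, hre, -, -⟩ := hs
    ((hA.fderiv.clm_apply (SmoothNear.const (((0, 1), 0) : PPlane))).neg.clm_apply h1)
  obtain ⟨L, hL⟩ := exists_lipschitzWith hW hK 0 hW0
  obtain ⟨Θ, hΘ⟩ := exists_isFlow hW hL
  refine ⟨W, Θ, c, r, ⟨L, hL⟩, hΘ, hW, hc, hr, ?_⟩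
  filter_upwards [hWe, hce, hre] with z a1 a2 a3 using ⟨a1, a2, a3⟩

namespace KerFlow

variable {W : PPlane → PPlane} {Θ : ℝ × PPlane → PPlane} {c r : PPlane → ℝ}

theorem fderiv_transport (h : KerFlow A l m z₀ W Θ c r) {τ : PPlane → ℝ} (hτ : SmoothNear τ z₀)
    (h1 : ∀ᶠ z in 𝓝 z₀, fderiv ℝ τ z (W z) = 1) :
    ∀ᶠ z in 𝓝 z₀, fderiv ℝ (transport Θ c r τ) z (0, kerField A l m z) =
      -(fderiv ℝ A z ((0, 1), 0)) (kerField A l m z) - curlCoef A l m z * transport Θ c r τ z := by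
  obtain ⟨L, hL⟩ := h.lipschitz
  filter_upwards [h.eventually, hτ.eventually, h1.eventually_nhds] with z hz hτz h1z
  rw [← hz.2.2, ← hz.2.1, ← hz.1]
  exact BranchedSurf.fderiv_transport h.flow hL h.smooth_c h.smooth_r hτz h1z

/-- The hitting time of a hypersurface transverse to the kernel field. -/
theorem exists_hitting_time (h : KerFlow A l m z₀ W Θ c r) {b : PPlane → ℝ} (hb : SmoothNear b z₀)
    (hb0 : b z₀ = 0) (hd : fderiv ℝ b z₀ (W z₀) ≠ 0) :
    ∃ τ : PPlane → ℝ, SmoothNear τ z₀ ∧ τ z₀ = 0 ∧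
      (∀ᶠ z in 𝓝 z₀, (b z = 0 ↔ τ z = 0) ∧ fderiv ℝ τ z (W z) = 1) ∧
      ∀ᶠ p in 𝓝 (z₀, (0 : ℝ)), τ (Θ (p.2, p.1)) = τ p.1 + p.2 := by
  obtain ⟨L, hL⟩ := h.lipschitz
  have hv : HasDerivAt (fun t => Θ (t, z₀)) (W z₀) 0 := by
    have := h.flow.hasDerivAt 0 z₀
    rwa [h.flow.zero] at this
  obtain ⟨τ, hτ, hτ0, he⟩ := BranchedSurf.exists_hitting_time h.flow.contDiff h.flow.zero hv hb hb0 hd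
  have hΘc : Tendsto (fun p : PPlane × ℝ => Θ (p.2, p.1)) (𝓝 (z₀, 0)) (𝓝 z₀) :=
    (h.flow.contDiff.continuous.comp (by fun_prop : Continuous fun p : PPlane × ℝ => (p.2, p.1))).tendsto'
      _ _ (h.flow.zero z₀)
  have hτc : Tendsto τ (𝓝 z₀) (𝓝 0) := by
    have := hτ.continuousAt.tendsto
    rwa [hτ0] at this
  -- Going backwards from `Θ (h, z)`, the time needed to reach the hypersurface is that of `z` plus
  -- `h`. Both candidates are small, so the local uniqueness in `he` applies.
  have hadd : ∀ᶠ p in 𝓝 (z₀, (0 : ℝ)), τ (Θ (p.2, p.1)) = τ p.1 + p.2 := by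
    have e1 : Tendsto (fun p : PPlane × ℝ => (Θ (p.2, p.1), τ p.1 + p.2)) (𝓝 (z₀, 0)) (𝓝 (z₀, 0)) := by
      refine hΘc.prodMk_nhds ?_
      have := (hτc.comp (continuous_fst.tendsto' (z₀, (0 : ℝ)) z₀ rfl)).add
        (continuous_snd.tendsto' (z₀, (0 : ℝ)) 0 rfl)
      rwa [add_zero] at this
    have e2 : Tendsto (fun p : PPlane × ℝ => (p.1, τ p.1)) (𝓝 (z₀, 0)) (𝓝 (z₀, 0)) :=
      (continuous_fst.tendsto' (z₀, (0 : ℝ)) z₀ rfl).prodMk_nhds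
        (hτc.comp (continuous_fst.tendsto' (z₀, (0 : ℝ)) z₀ rfl))
    filter_upwards [e1.eventually he, e2.eventually he] with p h1 h2
    refine h1.1 ?_
    have : Θ (-(τ p.1 + p.2), Θ (p.2, p.1)) = Θ (-τ p.1, p.1) := by
      rw [← h.flow.add hL]
      congr 2
      ring
    rw [this]
    exact h2.2 rfl
  refine ⟨τ, hτ, hτ0, ?_, hadd⟩
  have e3 : Tendsto (fun z : PPlane => (z, (0 : ℝ))) (𝓝 z₀) (𝓝 (z₀, 0)) :=
    (by fun_prop : Continuous fun z : PPlane => (z, (0 : ℝ))).tendsto' _ _ rfl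
  filter_upwards [e3.eventually he, e3.eventually hadd.eventually_nhds, hτ.eventually] with z h1 h2 h3
  refine ⟨?_, ?_⟩
  · simpa [h.flow.zero] using h1
  · have h4 : HasDerivAt (fun t => τ (Θ (t, z))) (fderiv ℝ τ z (W z)) 0 := by
      have a := h.flow.hasDerivAt 0 z
      rw [h.flow.zero] at a
      have b : HasFDerivAt τ (fderiv ℝ τ z) (Θ (0, z)) := by
        rw [h.flow.zero]; exact h3.differentiableAt.hasFDerivAt
      exact b.comp_hasDerivAt 0 a
    have h5 : HasDerivAt (fun t => τ z + t) 1 0 := (hasDerivAt_id (0 : ℝ)).const_add _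
    refine h4.unique (h5.congr_of_eventuallyEq ?_)
    exact ((by fun_prop : Continuous fun t : ℝ => (z, t)).tendsto' 0 (z, 0) rfl).eventually h2

end KerFlow

/-- The set of points near which the field `X` satisfies the homotopy equation for `A`. -/
def GoodFor (A : PPlane → (ℝ × ℝ →L[ℝ] ℝ)) (X : PPlane → ℝ × ℝ) (m : ℝ × ℝ) (z : PPlane) : Prop :=
  SmoothNear A z ∧ A z m ≠ 0 ∧ lieCov A X z = (lieCov A X z m / A z m) • A z

theorem eventually_goodFor (hlm : ∀ w : ℝ × ℝ, ∃ a b : ℝ, w = a • l + b • m) {X : PPlane → ℝ × ℝ}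
    (hA : SmoothNear A z₀) (hX : SmoothNear X z₀) (hm : A z₀ m ≠ 0) {f : PPlane → ℝ}
    (hf : ∀ᶠ z in 𝓝 z₀, f z = A z (X z))
    (heq : ∀ᶠ z in 𝓝 z₀, fderiv ℝ f z (0, kerField A l m z) =
      -(fderiv ℝ A z ((0, 1), 0)) (kerField A l m z) - curlCoef A l m z * f z) :
    ∀ᶠ z in 𝓝 z₀, GoodFor A X m z := by
  filter_upwards [hA.eventually, hX.eventually, hf.eventually_nhds, heq,
    (hA.clm_apply (SmoothNear.const m)).continuousAt.eventually_ne hm] with z h1 h2 h3 h4 h5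
  exact ⟨h1, h5, lieCov_eq_smul hlm h1.differentiableAt h2.differentiableAt h5 h3 h4⟩

theorem GoodFor.congr {X Y : PPlane → ℝ × ℝ} {z : PPlane} (h : GoodFor A X m z)
    (hXY : Y =ᶠ[𝓝 z] X) : GoodFor A Y m z := by
  have : lieCov A Y z = lieCov A X z := by
    rw [lieCov, lieCov, hXY.fderiv_eq, hXY.self_of_nhds]
  refine ⟨h.1, h.2.1, ?_⟩
  rw [this]
  exact h.2.2

/-- Writing `t = q * s` with `q ∈ [0, 1]` treats both signs of `s` and reduces the claim to the
compact set `K × [0, 1]`. -/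
theorem eventually_trajectory {X : PPlane → ℝ × ℝ} {Θ : ℝ × PPlane → PPlane} (h : IsFieldFlow X Θ)
    {K : Set (ℝ × ℝ)} (hK : IsCompact K) {G : Set PPlane} (hG : IsOpen G)
    (hKG : ∀ u ∈ K, ((0, 0), u) ∈ G) :
    ∀ᶠ s in 𝓝 (0 : ℝ), ∀ u ∈ K, ∀ t ∈ uIcc 0 s, Θ (t, ((s, 0), u)) ∈ G := by
  have h1 : ∀ᶠ s in 𝓝 (0 : ℝ), ∀ q ∈ K ×ˢ Icc (0 : ℝ) 1, Θ (q.2 * s, ((s, 0), q.1)) ∈ G := by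
    refine (hK.prod isCompact_Icc).eventually_forall_of_forall_eventually fun q hq => ?_
    have hc : Continuous fun z : ℝ × ((ℝ × ℝ) × ℝ) => Θ (z.2.2 * z.1, ((z.1, 0), z.2.1)) :=
      h.contDiff.continuous.comp (by fun_prop)
    refine hc.continuousAt.eventually (hG.mem_nhds ?_)
    simp only [mul_zero, h.flow.zero]
    exact hKG _ hq.1
  filter_upwards [h1] with s hs u hu t ht
  rcases eq_or_ne s 0 with rfl | hs0
  · have : t = 0 := by simpa using ht
    subst this
    simpa using hs (u, 0) ⟨hu, by simp⟩
  · have h2 : t / s ∈ Icc (0 : ℝ) 1 := by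
      rcases mem_uIcc.1 ht with ⟨a, b⟩ | ⟨a, b⟩
      · exact ⟨div_nonneg a (a.trans b), div_le_one_of_le₀ b (a.trans b)⟩
      · exact ⟨div_nonneg_of_nonpos b (a.trans b),
          (div_le_one_of_neg (lt_of_le_of_ne (a.trans b) hs0)).2 a⟩
    have := hs (u, t / s) ⟨hu, h2⟩
    simpa [div_mul_cancel₀ t hs0] using this

namespace BranchedSurface

variable {P : Type*} [TopologicalSpace P] {B : BranchedSurface P}

namespace OneForm

set_option maxHeartbeats 800000 in
/-- Local solutions of the homotopy equation on the sheets through a point of the horizontal sheet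
yield a deformation. -/
theorem exists_local_deformation [T2Space P] {α : B.OneForm} {τ : ℝ → B.OneForm}
    (hτ : IsCurve α τ) {c : Fin B.num} {p : Model (B.kind c)} (hp : OnSheet p 1) {r : ℝ} (hr : 0 < r)
    {m : ℝ × ℝ}
    (hm : ∀ i, OnSheet p i → ∀ u ∈ Metric.closedBall p.1.1 r, α.rep c i u m ≠ 0)
    (hsep : ∀ u ∈ Metric.closedBall p.1.1 r, ∀ i j, OnSheet p i → ¬ OnSheet p j →
      u ∉ coincide (B.kind c) i j)
    {X : Fin 3 → PPlane → ℝ × ℝ}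
    (hX : ∀ i, OnSheet p i → ∀ z ∈ Metric.closedBall (((0, 0), p.1.1) : PPlane) r,
      SmoothNear (X i) z ∧ GoodFor (homot (fun _ => α) τ c i fun _ => 1) (X i) m z)
    (hXe : ∀ i, OnSheet p i → ∀ z ∈ Metric.closedBall (((0, 0), p.1.1) : PPlane) r,
      0 ≤ side (B.kind c) i z.2 → X i z = X 1 z)
    (hpres : ∀ i, (∀ u ∈ Metric.closedBall p.1.1 r, side (B.kind c) i u ≠ 0) ∨
      ∃ C, ∀ z ∈ Metric.closedBall (((0, 0), p.1.1) : PPlane) r,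
        |side (B.kind c) i (X 1 z)| ≤ C * |side (B.kind c) i z.2|)
    {β : ℝ → B.OneForm} (hβ : IsCurve α β)
    (hβα : ∀ᶠ s in 𝓝 0, ∀ i, OnSheet p i → ∀ u ∈ Metric.closedBall p.1.1 r,
      (β s).rep c i u = α.rep c i u) :
    ∃ (γ : ℝ → B.OneForm) (θ : PPlane → ℝ) (Θ : Fin 3 → ℝ × PPlane → PPlane), IsCurve α γ ∧
      (∀ z, θ z ∈ Icc (0 : ℝ) 1) ∧
      (∀ z ∉ Metric.closedBall (((0, 0), p.1.1) : PPlane) r, θ z = 0) ∧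
      (∀ i, OnSheet p i → IsFieldFlow (fun z => θ z • X i z) (Θ i)) ∧
      (∀ᶠ s in 𝓝 0, ∀ U : Set P,
        (∀ i, OnSheet p i → ∀ t z, B.chart c (lift _ i z.2) ∈ U →
          B.chart c (lift _ i (Θ i (t, z)).2) ∈ U) → Conn U (β s) (γ s)) ∧
      (∀ᶠ s in 𝓝 0, ∀ x ∉ B.spot c p r, EqAt (γ s) (β s) x) ∧
      ∀ᶠ s in 𝓝 0, ∀ i, OnSheet p i → ∀ u ∈ Metric.closedBall p.1.1 (r / 4),
        (γ s).rep c i u = (τ s).rep c i u := by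
  classical
  set u₀ := p.1.1 with hu₀
  set z₀ : PPlane := ((0, 0), u₀) with hz₀
  set K := Metric.closedBall u₀ r with hKdef
  have hK : IsCompact K := isCompact_closedBall _ _
  have hα : IsCurve α fun _ => α := ⟨rfl, fun c i u => ((α.contDiff_rep c i).comp contDiff_snd).smoothNear _⟩
  -- The fields are cut off between the radii `r / 2` and `r`, while agreement with `τ` is claimed
  -- on radius `r / 4`: for small `s` the trajectories from there never see the cut-off.
  obtain ⟨θ, K', hθ, hθ1, hK', hK's, hθ0, hθI⟩ := exists_cutoff
    (isCompact_closedBall z₀ (r / 2)) (U := Metric.ball z₀ r) Metric.isOpen_ball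
    (Metric.closedBall_subset_ball (by linarith))
  obtain ⟨η, L', hη, hη1, hL', hL's, hη0, -⟩ := exists_cutoff
    (isCompact_closedBall u₀ (r / 4)) (U := Metric.ball u₀ r) Metric.isOpen_ball
    (Metric.closedBall_subset_ball (by linarith))
  have hθout : ∀ z ∉ Metric.closedBall z₀ r, θ z = 0 := fun z hz =>
    hθ0 z fun h => hz (Metric.ball_subset_closedBall (hK's h))
  have hz2 : ∀ z ∈ Metric.closedBall z₀ r, z.2 ∈ K := by
    intro z hz
    rw [Metric.mem_closedBall, Prod.dist_eq] at hz
    exact Metric.mem_closedBall.2 ((le_max_right _ _).trans hz)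
  -- Sheets which do not pass through `p` are left fixed; over the ball they are disjoint from the
  -- moving ones by `hsep`.
  set X' : Fin 3 → PPlane → ℝ × ℝ := fun i z => if OnSheet p i then θ z • X i z else 0 with hX'
  have hXon : ∀ i, OnSheet p i → X' i = fun z => θ z • X i z := fun i hi => by
    funext z; simp only [hX', if_pos hi]
  have hXoff : ∀ i, ¬ OnSheet p i → X' i = fun z => 0 := fun i hi => by
    funext z; simp only [hX', if_neg hi]
  have hX's : ∀ i, ContDiff ℝ ∞ (X' i) := by
    intro i
    by_cases hi : OnSheet p i
    · rw [hXon i hi, contDiff_iff_contDiffAt]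
      intro z
      by_cases hz : z ∈ K'
      · exact hθ.contDiffAt.smul (hX i hi z (Metric.ball_subset_closedBall (hK's hz))).1.contDiffAt
      · refine (contDiffAt_const (c := (0 : ℝ × ℝ))).congr_of_eventuallyEq ?_
        filter_upwards [hK'.isClosed.isOpen_compl.mem_nhds hz] with y hy
        rw [hθ0 y hy, zero_smul]
    · rw [hXoff i hi]; exact contDiff_const
  have hX'0 : ∀ i, ∀ z ∉ Metric.closedBall z₀ r, X' i z = 0 := by
    intro i z hz
    by_cases hi : OnSheet p i
    · simp only [hXon i hi, hθout z hz, zero_smul]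
    · rw [hXoff i hi]
  have hflow : ∀ i, ∃ Θ, IsFieldFlow (X' i) Θ := fun i =>
    exists_isFieldFlow (hX's i) (isCompact_closedBall z₀ r) (hX'0 i)
  choose Θ hΘ using hflow
  have hsupp : ∀ i z, z.2 ∉ K → X' i z = 0 := fun i z hz => hX'0 i z fun h => hz (hz2 z h)
  have hfield : SheetField (B.kind c) K X' Θ := by
    refine SheetField.of_side hΘ hsupp (fun i z hz => ?_) (fun i t z hz => ?_)
    · by_cases hzb : z ∈ Metric.closedBall z₀ r
      · by_cases hi : OnSheet p i
        · rw [hXon i hi, hXon 1 hp]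
          simp only [hXe i hi z hzb hz]
        · exact absurd (mem_coincide_iff.2 (Or.inr ⟨by simp [side_one], hz⟩))
            (hsep z.2 (hz2 z hzb) 1 i hp hi)
      · rw [hX'0 i z hzb, hX'0 1 z hzb]
    -- A side is preserved either because its edge does not meet the ball or by a Gronwall estimate
    -- for the side function.
    · rcases hpres i with h | ⟨C, hC⟩
      · exact (hΘ 1).nonneg_of_ne (hsupp 1) (side (B.kind c) i).continuous h hz t
      · refine (hΘ 1).nonneg (side (B.kind c) i).differentiable (C := |C|) (fun z => ?_) hz t
        rw [ContinuousLinearMap.fderiv]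
        by_cases hzb : z ∈ Metric.closedBall z₀ r
        · have e : X' 1 z = θ z • X 1 z := congrFun (hXon 1 hp) z
          rw [e, map_smul, smul_eq_mul, abs_mul, abs_of_nonneg (hθI z).1]
          calc θ z * |side (B.kind c) i (X 1 z)| ≤ 1 * |side (B.kind c) i (X 1 z)| :=
                mul_le_mul_of_nonneg_right (hθI z).2 (abs_nonneg _)
            _ ≤ C * |side (B.kind c) i z.2| := by rw [one_mul]; exact hC z hzb
            _ ≤ |C| * |side (B.kind c) i z.2| := mul_le_mul_of_nonneg_right (le_abs_self _) (abs_nonneg _)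
        · rw [hX'0 1 z hzb, map_zero, abs_zero]
          positivity
  set η' : Fin 3 → ℝ × ℝ → ℝ := fun i u => if OnSheet p i then η u else 0 with hη'
  have hη'0 : ∀ i, ∀ u ∉ K, η' i u = 0 := by
    intro i u hu
    simp only [hη']
    rw [hη0 u fun h => hu (Metric.ball_subset_closedBall (hL's h)), ite_self]
  obtain ⟨γ, h1, h2, h3, h4, h5⟩ := hβ.exists_moser hK hfield (θ := η')
    (fun i => by
      by_cases hi : OnSheet p i
      · simp only [hη', if_pos hi]; exact hη
      · simp only [hη', if_neg hi]; exact contDiff_const)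
    hη'0
    (fun i j u hu => by
      by_cases huK : u ∈ K
      · have : OnSheet p i ↔ OnSheet p j :=
          ⟨fun hi => by_contra fun hj => hsep u huK i j hi hj hu,
            fun hj => by_contra fun hi => hsep u huK j i hj hi (coincide_comm _ _ _ ▸ hu)⟩
        simp only [hη', this]
      · rw [hη'0 i u huK, hη'0 j u huK])
    (A := fun i => homot (fun _ => α) τ c i fun _ => 1) (m := m)
    (fun i u _ => smoothNear_homot hα hτ contDiff_const u)
    (fun i u _ => homot_self 0 u)
    (fun i j u hu s => homot_eq _ _ hu)
    (fun i => by
      by_cases hi : OnSheet p i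
      · exact Or.inr (hm i hi)
      · left; intro u; simp only [hη', if_neg hi])
  refine ⟨γ, θ, Θ, h1, hθI, hθout, fun i hi => hXon i hi ▸ hΘ i, ?_, ?_, ?_⟩
  · filter_upwards [h2] with s hs U hU
    refine hs U fun i t z hz => ?_
    by_cases hi : OnSheet p i
    · exact hU i hi t z hz
    · have := (hΘ i).eq_self (u := z.2) (s := z.1.1) (r := z.1.2) (fun t => by rw [hXoff i hi]) t
      change Θ i (t, z) = _ at this
      rwa [this]
  · filter_upwards [h5] with s hs x hx
    by_cases hbox : x ∈ B.box c K
    · obtain ⟨q, hq, rfl⟩ := hbox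
      obtain ⟨i, hi⟩ := exists_onSheet q
      rw [← hi.lift_eq] at hx ⊢
      have hpi : ¬ OnSheet p i := fun h => hx ⟨i, h, _, hq, rfl⟩
      refine eqAt_of_chart (hs i q.1.1 (by simp only [hη', if_neg hpi]) ?_)
      exact Eventually.of_forall fun w => by rw [(hΘ i).eq_self fun t => by rw [hXoff i hpi]]
    · exact h3 s x hbox
  · have htr : ∀ᶠ s in 𝓝 (0 : ℝ), ∀ i, ∀ u ∈ Metric.closedBall u₀ (r / 4), ∀ t ∈ uIcc 0 s,
        Θ i (t, ((s, 0), u)) ∈ Metric.ball z₀ (r / 2) := by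
      rw [eventually_all]
      intro i
      refine eventually_trajectory (hΘ i) (isCompact_closedBall _ _) Metric.isOpen_ball fun u hu => ?_
      rw [Metric.mem_ball, Prod.dist_eq, hz₀]
      simp only [dist_self]
      exact max_lt (by linarith) ((Metric.mem_closedBall.1 hu).trans_lt (by linarith))
    filter_upwards [h4, htr, hβα] with s hs htr hβs i hi u hu
    have hsub : Metric.ball z₀ (r / 2) ⊆ Metric.closedBall z₀ r :=
      (Metric.ball_subset_ball (by linarith)).trans Metric.ball_subset_closedBall
    rw [hs i u ?_ ?_ ?_, homot_zero hα hτ, one_smul, add_sub_cancel]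
    · have e : Θ i (s, ((s, 0), u)) = ((s, s), (Θ i (s, ((s, 0), u))).2) :=
        Prod.ext (by rw [(hΘ i).fst, zero_add]) rfl
      have hmem := hz2 _ (hsub (htr i u hu s right_mem_uIcc))
      rw [hβs i hi _ hmem]
      conv_lhs => rw [e]
      exact homot_self s _
    · intro t ht
      have hball := htr i u hu t ht
      refine (hX i hi _ (hsub hball)).2.congr ?_
      rw [hXon i hi]
      have : ∀ᶠ y in 𝓝 (Θ i (t, ((s, 0), u))), θ y = 1 :=
        (eventually_nhdsSet_iff_forall.1 hθ1) _ (Metric.ball_subset_closedBall hball)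
      filter_upwards [this] with y hy
      rw [hy, one_smul]
    · left
      simp only [hη', if_pos hi]
      exact (eventually_nhdsSet_iff_forall.1 hη1 u hu).self_of_nhds

end OneForm

end BranchedSurface

end BranchedSurf

namespace BranchedSurf

/-! ### The homotopy equation at a tangency -/

/-- The homotopy equation for `f = A(X)`. -/
def HomotopyEq (A : PPlane → (ℝ × ℝ →L[ℝ] ℝ)) (l m : ℝ × ℝ) (f : PPlane → ℝ) (z : PPlane) : Prop :=
  fderiv ℝ f z (0, kerField A l m z) =
    -(fderiv ℝ A z ((0, 1), 0)) (kerField A l m z) - curlCoef A l m z * f z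

variable {A : PPlane → (ℝ × ℝ →L[ℝ] ℝ)} {l m : ℝ × ℝ} {z₀ : PPlane}

/-- The equation involves only the first order jet of the family `A`, so at a point shared by two
sheets it can be read on either of them. -/
theorem HomotopyEq.congr_form {A' : PPlane → (ℝ × ℝ →L[ℝ] ℝ)} {f : PPlane → ℝ} {z : PPlane}
    (h : HomotopyEq A l m f z) (h1 : A' z = A z) (h2 : fderiv ℝ A' z = fderiv ℝ A z) :
    HomotopyEq A' l m f z := by
  have e1 : kerField A' l m z = kerField A l m z := by rw [kerField, kerField, h1]
  have e2 : curlCoef A' l m z = curlCoef A l m z := by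
    rw [curlCoef, curlCoef, extDeriv₂, extDeriv₂, e1, h1, h2]
  rw [HomotopyEq, e1, e2, h2]
  exact h

/-- A property which holds near `(z₀, 0)` holds for all small times. -/
theorem eventually_forall_abs_le {E : Type*} [NormedAddCommGroup E] {z₀ : E} {τ : E → ℝ} (hτ : ContinuousAt τ z₀) (hτ0 : τ z₀ = 0)
    {p : E → ℝ → Prop} (hp : ∀ᶠ y in 𝓝 (z₀, (0 : ℝ)), p y.1 y.2) :
    ∀ᶠ z in 𝓝 z₀, ∀ h : ℝ, |h| ≤ |τ z| → p z h := by
  obtain ⟨ε, hε, hb⟩ := Metric.eventually_nhds_iff_ball.1 hp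
  have h1 : ∀ᶠ z in 𝓝 z₀, |τ z| < ε := by
    have := hτ.abs
    refine this.eventually_lt continuousAt_const ?_
    simpa [hτ0] using hε
  filter_upwards [h1, Metric.ball_mem_nhds z₀ hε] with z hz1 hz2 t ht
  refine hb (z, t) ?_
  rw [Metric.mem_ball, Prod.dist_eq]
  refine max_lt hz2 ?_
  rw [Real.dist_eq, sub_zero]
  exact ht.trans_lt hz1

/-- Integration starts from the hypersurface `{A l = 0}`, to which the kernel is transverse because
the contact is nondegenerate. This makes `f` divisible by `A l`, so the solution field `k • l` has
the direction of the edge. The sign in `hd` is the index condition: `σ` does not decrease on the way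
along the kernel to the hypersurface, so on `{0 ≤ σ}` a solution is determined by what happens in
this half-space. The last clause records this; it is what makes the solutions on two sheets agree
where the sheets coincide. -/
theorem exists_tangency_solution (hA : SmoothNear A z₀) (hl : A z₀ l = 0)
    (hd : 0 < A z₀ m * fderiv ℝ (fun z => A z l) z₀ (0, l)) (σ : ℝ × ℝ →L[ℝ] ℝ) (hσl : σ l = 0)
    (hσm : σ m = 1) :
    ∃ f k : PPlane → ℝ, SmoothNear f z₀ ∧ SmoothNear k z₀ ∧ (∀ᶠ z in 𝓝 z₀, f z = k z * A z l) ∧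
      (∀ᶠ z in 𝓝 z₀, HomotopyEq A l m f z) ∧
      ∀ S : Set PPlane, (S = univ ∨ S = {z | 0 ≤ σ z.2}) → ∀ g k' : PPlane → ℝ, SmoothNear g z₀ →
        SmoothNear k' z₀ → (∀ᶠ z in 𝓝 z₀, z ∈ S → HomotopyEq A l m g z ∧ g z = k' z * A z l) →
        ∀ᶠ z in 𝓝 z₀, z ∈ S → k' z = k z := by
  have hm : A z₀ m ≠ 0 := left_ne_zero_of_mul hd.ne'
  set b : PPlane → ℝ := fun z => A z l with hb
  have hbs : SmoothNear b z₀ := hA.clm_apply (SmoothNear.const l)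
  obtain ⟨W, Θ, c, r, hK⟩ := exists_kerFlow hA hm l
  have hW0 : W z₀ = (0, l) := by
    rw [hK.eventually.self_of_nhds.1, kerField, hl, zero_div, zero_smul, sub_zero]
  have hdne : fderiv ℝ b z₀ (0, l) ≠ 0 := right_ne_zero_of_mul hd.ne'
  obtain ⟨τ, hτ, hτ0, h1, h2⟩ := hK.exists_hitting_time hbs hl (by rwa [hW0])
  have hDτ : ∀ᶠ z in 𝓝 z₀, fderiv ℝ τ z (W z) = 1 := h1.mono fun z h => h.2
  -- `A l` is a multiple of the travel time `τ`, and the sign of the multiplier, compared with `A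
  -- m`, decides which way `σ` moves.
  obtain ⟨κ, hκ, hκe⟩ := exists_division hbs hτ hτ0 (v := W z₀) (by
    rw [hDτ.self_of_nhds]; exact one_ne_zero) (h1.mono fun z h hz => h.1.2 hz)
  have hκ0 : 0 < κ z₀ / A z₀ m := by
    have e1 : fderiv ℝ b z₀ (W z₀) = κ z₀ := by
      have e : b =ᶠ[𝓝 z₀] fun z => κ z * τ z := hκe
      rw [e.fderiv_eq, fderiv_fun_mul hκ.differentiableAt hτ.differentiableAt]
      simp [hτ0, hDτ.self_of_nhds]
    rw [hW0] at e1
    rw [e1] at hd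
    have : κ z₀ / A z₀ m = A z₀ m * κ z₀ / (A z₀ m) ^ 2 := by field_simp
    rw [this]
    positivity
  set f := transport Θ c r τ with hf
  have hfs : SmoothNear f z₀ := smoothNear_transport hK.flow.contDiff hK.smooth_c hK.smooth_r hτ
  have hfPDE : ∀ᶠ z in 𝓝 z₀, HomotopyEq A l m f z := hK.fderiv_transport hτ hDτ
  have hf0 : ∀ z, τ z = 0 → f z = 0 := fun z hz => by simp [hf, transport, hz]
  obtain ⟨k, hk, hke⟩ := exists_division hfs hbs hl (v := (0, l)) hdne
    (h1.mono fun z h hz => hf0 z (h.1.1 hz))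
  refine ⟨f, k, hfs, hk, hke, hfPDE, fun S hS g k' hg hk' hgS => ?_⟩
  -- the two solutions agree on `S`
  set G : PPlane → Prop := fun z => (W z = (0, kerField A l m z) ∧ c z = curlCoef A l m z ∧
    r z = -(fderiv ℝ A z ((0, 1), 0)) (kerField A l m z)) ∧ SmoothNear f z ∧ SmoothNear g z ∧
    HomotopyEq A l m f z ∧ (z ∈ S → HomotopyEq A l m g z ∧ g z = k' z * A z l) ∧
    (b z = 0 ↔ τ z = 0) ∧ b z = κ z * τ z ∧ 0 < κ z / A z m with hG
  have hGe : ∀ᶠ z in 𝓝 z₀, G z := by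
    have e1 : ∀ᶠ z in 𝓝 z₀, 0 < κ z / A z m :=
      (hκ.div (hA.clm_apply (SmoothNear.const m)) hm).continuousAt.eventually_const_lt hκ0
    filter_upwards [hK.eventually, hfs.eventually, hg.eventually, hfPDE, hgS, h1, hκe, e1] with
      z a1 a2 a3 a4 a5 a6 a7 a8 using ⟨a1, a2, a3, a4, a5, a6.1, a7, a8⟩
  have hΘc : Tendsto (fun p : PPlane × ℝ => Θ (p.2, p.1)) (𝓝 (z₀, 0)) (𝓝 z₀) :=
    (hK.flow.contDiff.continuous.comp (by fun_prop : Continuous fun p : PPlane × ℝ =>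
      (p.2, p.1))).tendsto' _ _ (hK.flow.zero z₀)
  have hpath := eventually_forall_abs_le hτ.continuousAt hτ0
    (p := fun z t => G (Θ (t, z)) ∧ τ (Θ (t, z)) = τ z + t) ((hΘc.eventually hGe).and h2)
  have hfg : ∀ᶠ z in 𝓝 z₀, z ∈ S → g z = f z := by
    filter_upwards [hpath] with z hz hzS
    have hsnd : ∀ t, HasDerivAt (fun t => (Θ (t, z)).2) (W (Θ (t, z))).2 t := fun t => by
      have := (hasFDerivAt_snd (𝕜 := ℝ) (p := Θ (t, z))).comp_hasDerivAt t (hK.flow.hasDerivAt t z)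
      exact this
    have hd : ∀ t, HasDerivAt (fun t => σ (Θ (t, z)).2) (σ (W (Θ (t, z))).2) t := fun t =>
      σ.hasFDerivAt.comp_hasDerivAt t (hsnd t)
    -- The kernel field has `σ`-component `-(A l / A m)`, where `A l = κ τ` and `τ` increases at
    -- unit speed.
    have hval : ∀ t, |t| ≤ |τ z| → σ (W (Θ (t, z))).2 =
        -(κ (Θ (t, z)) / A (Θ (t, z)) m * (τ z + t)) := by
      intro t ht
      obtain ⟨⟨g1, g2, g3, g4, g5, g6, g7, g8⟩, g9⟩ := hz t ht
      rw [g1.1, ← g9]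
      simp only [kerField, map_sub, map_smul, hσl, hσm, smul_eq_mul]
      have : A (Θ (t, z)) l = κ (Θ (t, z)) * τ (Θ (t, z)) := g7
      rw [this]
      ring
    have hpos : ∀ t, |t| ≤ |τ z| → 0 < κ (Θ (t, z)) / A (Θ (t, z)) m := fun t ht =>
      (hz t ht).1.2.2.2.2.2.2.2
    -- the interval between the two points
    have hmain : ∃ a b' : ℝ, (0 : ℝ) ∈ Icc a b' ∧ -τ z ∈ Icc a b' ∧ (∀ t ∈ Icc a b', |t| ≤ |τ z|) ∧
        ∀ t ∈ Icc a b', σ z.2 ≤ σ (Θ (t, z)).2 := by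
      rcases le_total 0 (τ z) with h0 | h0
      · have hab : ∀ t ∈ Icc (-τ z) 0, |t| ≤ |τ z| := fun t ht => by
          rw [abs_of_nonpos ht.2, abs_of_nonneg h0]; linarith [ht.1]
        refine ⟨-τ z, 0, ⟨by linarith, le_rfl⟩, ⟨le_rfl, by linarith⟩, hab, fun t ht => ?_⟩
        have := antitoneOn_of_hasDerivWithinAt_nonpos (convex_Icc (-τ z) 0)
          (fun t _ => (hd t).continuousAt.continuousWithinAt) (fun t _ => (hd t).hasDerivWithinAt)
          (fun t ht => by
            have ht := interior_subset ht
            rw [hval t (hab t ht)]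
            have := hpos t (hab t ht)
            have : 0 ≤ τ z + t := by linarith [ht.1]
            nlinarith) ht ⟨by linarith, le_rfl⟩ ht.2
        simpa [hK.flow.zero] using this
      · have hab : ∀ t ∈ Icc 0 (-τ z), |t| ≤ |τ z| := fun t ht => by
          rw [abs_of_nonneg ht.1, abs_of_nonpos h0]; exact ht.2
        refine ⟨0, -τ z, ⟨le_rfl, by linarith⟩, ⟨by linarith, le_rfl⟩, hab, fun t ht => ?_⟩
        have := monotoneOn_of_hasDerivWithinAt_nonneg (convex_Icc 0 (-τ z))
          (fun t _ => (hd t).continuousAt.continuousWithinAt) (fun t _ => (hd t).hasDerivWithinAt)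
          (fun t ht => by
            have ht := interior_subset ht
            rw [hval t (hab t ht)]
            have := hpos t (hab t ht)
            have : τ z + t ≤ 0 := by linarith [ht.2]
            nlinarith) ⟨le_rfl, by linarith⟩ ht ht.1
        simpa [hK.flow.zero] using this
    obtain ⟨a, b', h0, ht, hab, hσ⟩ := hmain
    have hS' : ∀ t ∈ Icc a b', Θ (t, z) ∈ S := by
      intro t ht
      rcases hS with rfl | rfl
      · trivial
      · exact le_trans hzS (hσ t ht)
    have heq := eq_of_transport_equation hK.flow hK.smooth_c.continuous (f := g) (g := f) (z := z)
      (a := a) (b := b') (r' := r) (fun t ht => by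
        obtain ⟨⟨g1, g2, g3, g4, g5, g6, g7, g8⟩, g9⟩ := hz t (hab t ht)
        refine ⟨g3.differentiableAt, ?_⟩
        rw [g1.1, g1.2.1, g1.2.2]
        exact (g5 (hS' t ht)).1) (fun t ht => by
        obtain ⟨⟨g1, g2, g3, g4, g5, g6, g7, g8⟩, g9⟩ := hz t (hab t ht)
        refine ⟨g2.differentiableAt, ?_⟩
        rw [g1.1, g1.2.1, g1.2.2]
        exact g4) ht (by
        obtain ⟨⟨g1, g2, g3, g4, g5, g6, g7, g8⟩, g9⟩ := hz _ (hab _ ht)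
        have hτz : τ (Θ (-τ z, z)) = 0 := by rw [g9]; ring
        have hbz : A (Θ (-τ z, z)) l = 0 := g6.2 hτz
        rw [hf0 _ hτz, (g5 (hS' _ ht)).2, hbz, mul_zero]) 0 h0
    rwa [hK.flow.zero] at heq
  -- divide by `b`
  have hDb : ∀ᶠ z in 𝓝 z₀, fderiv ℝ b z (0, l) ≠ 0 :=
    (hbs.fderiv.clm_apply (SmoothNear.const _)).continuousAt.eventually_ne hdne
  filter_upwards [(hfg.and (hke.and hgS)).eventually_nhds, hDb, hbs.eventually, hk.eventually,
    hk'.eventually] with z hz hDz hbz hkz hk'z hzS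
  have hprod : ∀ᶠ y in 𝓝 z, y ∈ S → b y ≠ 0 → k' y = k y := by
    filter_upwards [hz] with y hy hyS hy0
    have e1 := hy.1 hyS
    rw [(hy.2.2 hyS).2, hy.2.1] at e1
    exact mul_right_cancel₀ hy0 e1
  by_cases hbz0 : b z = 0
  -- Division by `A l` is impossible on its zero set. There `k` and `k'` are compared as limits
  -- along the line of direction `l`, on which `σ` is constant, so that it stays in `S`, and `A l`
  -- has an isolated zero.
  · have hline : Tendsto (fun t : ℝ => z + t • ((0, l) : PPlane)) (𝓝[≠] 0) (𝓝 z) :=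
      ((by fun_prop : Continuous fun t : ℝ => z + t • ((0, l) : PPlane)).tendsto' 0 z
        (by simp)).mono_left nhdsWithin_le_nhds
    have hdl : HasDerivAt (fun t : ℝ => b (z + t • ((0, l) : PPlane))) (fderiv ℝ b z (0, l)) 0 := by
      have h3 : HasDerivAt (fun t : ℝ => z + t • ((0, l) : PPlane)) (0, l) 0 := by
        simpa using ((hasDerivAt_id (0 : ℝ)).smul_const ((0, l) : PPlane)).const_add z
      have h4 : HasFDerivAt b (fderiv ℝ b z) (z + (0 : ℝ) • ((0, l) : PPlane)) := by
        simpa using hbz.differentiableAt.hasFDerivAt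
      exact h4.comp_hasDerivAt 0 h3
    have hne := hdl.eventually_ne (c := 0) hDz
    have hS' : ∀ t : ℝ, z + t • ((0, l) : PPlane) ∈ S := by
      intro t
      rcases hS with rfl | rfl
      · trivial
      · have hzS : 0 ≤ σ z.2 := hzS
        simpa [hσl] using hzS
    have hev : ∀ᶠ t in 𝓝[≠] (0 : ℝ), k' (z + t • ((0, l) : PPlane)) = k (z + t • ((0, l) : PPlane)) := by
      filter_upwards [hline.eventually hprod, hne] with t h3 h4 using h3 (hS' t) h4
    exact tendsto_nhds_unique_of_eventuallyEq (hk'z.continuousAt.tendsto.comp hline)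
      (hkz.continuousAt.tendsto.comp hline) hev
  · exact hprod.self_of_nhds hzS hbz0

namespace BranchedSurface

variable {P : Type*} [TopologicalSpace P] {B : BranchedSurface P}

namespace OneForm

theorem isCurve_const (α : B.OneForm) : IsCurve α fun _ => α :=
  ⟨rfl, fun c i _ => ((α.contDiff_rep c i).comp contDiff_snd).smoothNear _⟩

/-- Unique differentiability of the shared region again, with the two parameters as additional
factors. -/
theorem fderiv_homot_eq {β τ : ℝ → B.OneForm} {c : Fin B.num} {i j : Fin 3} {χ : ℝ × ℝ → ℝ}
    {z : PPlane} (hi : DifferentiableAt ℝ (homot β τ c i χ) z)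
    (hj : DifferentiableAt ℝ (homot β τ c j χ) z) (h : z.2 ∈ coincide (B.kind c) i j) :
    fderiv ℝ (homot β τ c i χ) z = fderiv ℝ (homot β τ c j χ) z := by
  have hu : UniqueDiffWithinAt ℝ ((univ : Set (ℝ × ℝ)) ×ˢ coincide (B.kind c) i j) z :=
    (uniqueDiffOn_univ.prod (uniqueDiffOn_coincide _ i j)) z ⟨trivial, h⟩
  rw [← hi.fderivWithin hu, ← hj.fderivWithin hu]
  exact fderivWithin_congr (fun y hy => homot_eq β τ hy.2) (homot_eq β τ h)

theorem fderiv_homot_zero {α : B.OneForm} {τ : ℝ → B.OneForm} {c : Fin B.num} {i : Fin 3}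
    {χ : ℝ × ℝ → ℝ} {u : ℝ × ℝ}
    (h : DifferentiableAt ℝ (homot (fun _ => α) τ c i χ) ((0, 0), u)) (l v : ℝ × ℝ) :
    fderiv ℝ (fun z => homot (fun _ => α) τ c i χ z l) ((0, 0), u) (0, v) =
      fderiv ℝ (fun u => α.rep c i u l) u v := by
  have h1 : HasFDerivAt (fun u : ℝ × ℝ => (((0, 0), u) : PPlane))
      ((0 : ℝ × ℝ →L[ℝ] ℝ × ℝ).prod (ContinuousLinearMap.id ℝ _)) u :=
    (hasFDerivAt_const _ _).prodMk (hasFDerivAt_id u)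
  have h3 : DifferentiableAt ℝ (fun z => homot (fun _ => α) τ c i χ z l) ((0, 0), u) :=
    h.clm_apply (differentiableAt_const l)
  have h2 : HasFDerivAt (fun u : ℝ × ℝ => homot (fun _ => α) τ c i χ ((0, 0), u) l) _ u :=
    h3.hasFDerivAt.comp u h1
  have e : (fun u : ℝ × ℝ => homot (fun _ => α) τ c i χ ((0, 0), u) l) = fun u => α.rep c i u l := by
    funext u
    rw [homot_self]
  rw [e] at h2
  rw [h2.fderiv]
  simp

set_option maxHeartbeats 800000 in
/-- Deformation near a tangency point. -/
theorem exists_tangency_deformation [T2Space P] {α : B.OneForm} {τ : ℝ → B.OneForm}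
    (hτ : IsCurve α τ) {c : Fin B.num} {p : Model (B.kind c)} (hz : p.1.2 = 0) {a : Fin 3}
    (ha : side (B.kind c) a ≠ 0) (hpa : side (B.kind c) a p.1.1 = 0)
    (hother : ∀ b, b ≠ a → side (B.kind c) b ≠ 0 → side (B.kind c) b p.1.1 ≠ 0)
    (h0 : α.coe c p (edgeDir a) = 0)
    (hD : 0 < α.coe c p (edgeNormal (B.kind c) a) *
      fderiv ℝ (fun u => α.coe c (lift (B.kind c) 1 u) (edgeDir a)) p.1.1 (edgeDir a))
    {O : Set (ℝ × ℝ)} (hO : O ∈ 𝓝 p.1.1) :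
    ∃ r > 0, Metric.closedBall p.1.1 r ⊆ O ∧ ∀ β, IsCurve α β →
      (∀ᶠ s in 𝓝 0, ∀ i, OnSheet p i → ∀ u ∈ Metric.closedBall p.1.1 r,
        (β s).rep c i u = α.rep c i u) →
      ∃ γ, IsCurve α γ ∧
        (∀ᶠ s in 𝓝 0, ∀ U : Set P, (∀ i, OnSheet p i → ∀ u ∈ Metric.closedBall p.1.1 r,
          ∀ v ∈ Metric.closedBall p.1.1 r, side (B.kind c) a u = side (B.kind c) a v →
          B.chart c (lift _ i u) ∈ U → B.chart c (lift _ i v) ∈ U) → Conn U (β s) (γ s)) ∧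
        (∀ᶠ s in 𝓝 0, ∀ x ∉ B.spot c p r, EqAt (γ s) (β s) x) ∧
        ∀ᶠ s in 𝓝 0, ∀ i, OnSheet p i → ∀ u ∈ Metric.closedBall p.1.1 (r / 4),
          (γ s).rep c i u = (τ s).rep c i u := by
  set l := edgeDir a with hl
  set m := edgeNormal (B.kind c) a with hm
  set z₀ : PPlane := ((0, 0), p.1.1) with hz₀
  set A : Fin 3 → PPlane → (ℝ × ℝ →L[ℝ] ℝ) := fun i => homot (fun _ => α) τ c i fun _ => 1 with hA
  have hσl : side (B.kind c) a l = 0 := side_edgeDir _ _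
  have hσm : side (B.kind c) a m = 1 := side_edgeNormal ha
  have hlm : ∀ w : ℝ × ℝ, ∃ x y : ℝ, w = x • l + y • m := fun w =>
    ⟨edgeCoord a w, side (B.kind c) a w, by rw [add_comm]; exact eq_side_smul_add ha w⟩
  have hAs : ∀ i, SmoothNear (A i) z₀ := fun i => smoothNear_homot (isCurve_const α) hτ contDiff_const _
  have hp1 : OnSheet p 1 := (onSheet_iff_side hz).2 (by simp [side_one])
  have hAz : ∀ i, OnSheet p i → A i z₀ = α.coe c p := fun i hi => by
    simp only [hA, hz₀]
    rw [homot_self]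
    exact congrArg (α.coe c) hi.lift_eq
  have hco : ∀ i, OnSheet p i → p.1.1 ∈ coincide (B.kind c) 1 i := fun i hi => hp1.mem_coincide hi
  have hAd : ∀ i, OnSheet p i → fderiv ℝ (fun z => A i z l) z₀ (0, l) =
      fderiv ℝ (fun u => α.coe c (lift (B.kind c) 1 u) l) p.1.1 l := by
    intro i hi
    have e1 := fderiv_homot_eq (hAs 1).differentiableAt (hAs i).differentiableAt (hco i hi)
    have e2 : ∀ i, fderiv ℝ (fun z => A i z l) z₀ (0, l) = fderiv ℝ (A i) z₀ (0, l) l := fun i => by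
      rw [fderiv_clm_apply (hAs i).differentiableAt (differentiableAt_const l)]
      simp
    rw [e2]
    change fderiv ℝ (homot (fun _ => α) τ c i fun _ => 1) z₀ (0, l) l = _
    rw [← e1]
    change fderiv ℝ (A 1) z₀ (0, l) l = _
    rw [← e2]
    exact fderiv_homot_zero (hAs 1).differentiableAt l l
  have hsol : ∀ i, ∃ f k : PPlane → ℝ, OnSheet p i → SmoothNear f z₀ ∧ SmoothNear k z₀ ∧
      (∀ᶠ z in 𝓝 z₀, f z = k z * A i z l) ∧ (∀ᶠ z in 𝓝 z₀, HomotopyEq (A i) l m f z) ∧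
      ∀ S : Set PPlane, (S = univ ∨ S = {z | 0 ≤ side (B.kind c) a z.2}) → ∀ g k' : PPlane → ℝ,
        SmoothNear g z₀ → SmoothNear k' z₀ →
        (∀ᶠ z in 𝓝 z₀, z ∈ S → HomotopyEq (A i) l m g z ∧ g z = k' z * A i z l) →
        ∀ᶠ z in 𝓝 z₀, z ∈ S → k' z = k z := by
    intro i
    by_cases hi : OnSheet p i
    · obtain ⟨f, k, h⟩ := exists_tangency_solution (hAs i) (l := l) (m := m) (by rw [hAz i hi]; exact h0)
        (by rw [hAz i hi, hAd i hi]; exact hD) (side (B.kind c) a) hσl hσm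
      exact ⟨f, k, fun _ => h⟩
    · exact ⟨0, 0, fun h => absurd h hi⟩
  choose f k hfk using hsol
  -- the solutions agree where the sheets coincide
  have hcomp : ∀ i, OnSheet p i → ∀ᶠ z in 𝓝 z₀, 0 ≤ side (B.kind c) i z.2 → k i z = k 1 z := by
    intro i hi
    -- On the sheet which leaves along this edge the shared region is the half-plane; on any other
    -- sheet through `p` it is everything near `p`.
    have hS : ∃ S : Set PPlane, (S = univ ∨ S = {z | 0 ≤ side (B.kind c) a z.2}) ∧
        ∀ᶠ z in 𝓝 z₀, (z ∈ S ↔ 0 ≤ side (B.kind c) i z.2) := by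
      by_cases hia : i = a
      · subst hia
        exact ⟨_, Or.inr rfl, Eventually.of_forall fun z => Iff.rfl⟩
      · refine ⟨univ, Or.inl rfl, ?_⟩
        by_cases hi0 : side (B.kind c) i = 0
        · simp [hi0]
        · have h1 := (onSheet_iff_side hz).1 hi
          have h2 : 0 < side (B.kind c) i p.1.1 := lt_of_le_of_ne h1 (hother i hia hi0).symm
          have hc : ContinuousAt (fun z : PPlane => side (B.kind c) i z.2) z₀ := by fun_prop
          filter_upwards [hc.eventually_const_lt h2] with z hz
          simp [hz.le]
    obtain ⟨S, hS, hSi⟩ := hS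
    obtain ⟨f1, k1, e1, p1, -⟩ := hfk i hi
    have huniq := (hfk 1 hp1).2.2.2.2 S hS (f i) (k i) f1 k1 (by
      filter_upwards [hSi, e1, p1, (hAs 1).eventually, (hAs i).eventually] with z hzS e1 p1 a1 a2 hz
      have hzc : z.2 ∈ coincide (B.kind c) 1 i :=
        mem_coincide_iff.2 (Or.inr ⟨by simp [side_one], hzS.1 hz⟩)
      have hAe : A 1 z = A i z := homot_eq _ _ hzc
      refine ⟨p1.congr_form hAe (fderiv_homot_eq a1.differentiableAt a2.differentiableAt hzc), ?_⟩
      rw [hAe, e1])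
    filter_upwards [huniq, hSi] with z h1 h2 h3 using h1 (h2.2 h3)
  -- The field is parallel to the edge, so its flow preserves the side function and with it all sets
  -- `{|side| ≤ ε}` at once. Thus the radius can be chosen without knowing `ε`.
  set X : Fin 3 → PPlane → ℝ × ℝ := fun i z => k i z • l with hX
  have hXs : ∀ i, OnSheet p i → SmoothNear (X i) z₀ := fun i hi => (hfk i hi).2.1.smul (SmoothNear.const l)
  have hgood : ∀ i, OnSheet p i → ∀ᶠ z in 𝓝 z₀, SmoothNear (X i) z ∧ GoodFor (A i) (X i) m z := by
    intro i hi
    obtain ⟨f1, k1, e1, p1, -⟩ := hfk i hi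
    have hne : A i z₀ m ≠ 0 := by rw [hAz i hi]; exact left_ne_zero_of_mul hD.ne'
    exact (hXs i hi).eventually.and (eventually_goodFor hlm (hAs i) (hXs i hi) hne (e1.mono fun z h => by
      rw [h, hX]; simp) p1)
  have hall : ∀ᶠ z in 𝓝 z₀, ∀ i, OnSheet p i → (SmoothNear (X i) z ∧ GoodFor (A i) (X i) m z) ∧
      (0 ≤ side (B.kind c) i z.2 → X i z = X 1 z) := by
    simp only [eventually_all]
    intro i hi
    filter_upwards [hgood i hi, hcomp i hi] with z h1 h2
    exact ⟨h1, fun h3 => by simp only [hX, h2 h3]⟩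
  have hne : ∀ᶠ u in 𝓝 p.1.1, ∀ i, OnSheet p i → α.rep c i u m ≠ 0 := by
    simp only [eventually_all]
    intro i hi
    refine ((α.contDiff_rep c i).continuous.clm_apply continuous_const).continuousAt.eventually_ne ?_
    have : α.rep c i p.1.1 = α.coe c p := congrArg (α.coe c) hi.lift_eq
    rw [this]
    exact left_ne_zero_of_mul hD.ne'
  have hsides : ∀ᶠ u in 𝓝 p.1.1, ∀ b, b ≠ a → side (B.kind c) b ≠ 0 → side (B.kind c) b u ≠ 0 := by
    simp only [eventually_all]
    intro b hb hb0
    exact (side (B.kind c) b).continuous.continuousAt.eventually_ne (hother b hb hb0)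
  obtain ⟨r1, hr1, hb1⟩ := Metric.nhds_basis_closedBall.eventually_iff.1 hall
  obtain ⟨r2, hr2, hb2⟩ := Metric.nhds_basis_closedBall.eventually_iff.1
    ((hne.and (eventually_notMem_coincide p)).and (hsides.and hO))
  set r := min r1 r2 with hr
  have hr0 : 0 < r := lt_min hr1 hr2
  have hs1 : Metric.closedBall z₀ r ⊆ Metric.closedBall z₀ r1 :=
    Metric.closedBall_subset_closedBall (min_le_left _ _)
  have hs2 : Metric.closedBall p.1.1 r ⊆ Metric.closedBall p.1.1 r2 :=
    Metric.closedBall_subset_closedBall (min_le_right _ _)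
  refine ⟨r, hr0, fun u hu => (hb2 (hs2 hu)).2.2, fun β hβ hβα => ?_⟩
  obtain ⟨γ, θ, Θ, h1, h2, h3, h4, h5, h6, h7⟩ := exists_local_deformation hτ hp1 hr0 (m := m)
    (fun i hi u hu => (hb2 (hs2 hu)).1.1 i hi) (fun u hu => (hb2 (hs2 hu)).1.2) (X := X)
    (fun i hi z hz => (hb1 (hs1 hz) i hi).1) (fun i hi z hz => (hb1 (hs1 hz) i hi).2)
    (fun i => by
      by_cases hia : i = a
      · subst hia
        right
        refine ⟨0, fun z _ => ?_⟩
        simp [hX, hσl]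
      · by_cases hi0 : side (B.kind c) i = 0
        · right
          exact ⟨0, fun z _ => by simp [hi0]⟩
        · left
          exact fun u hu => (hb2 (hs2 hu)).2.1 i hia hi0) hβ hβα
  refine ⟨γ, h1, ?_, h6, h7⟩
  filter_upwards [h5] with s hs U hU
  refine hs U fun i hi t z hzU => ?_
  have hout : ∀ z : PPlane, z.2 ∉ Metric.closedBall p.1.1 r → θ z • X i z = 0 := by
    intro z hz
    rw [h3 z fun h => hz ?_, zero_smul]
    rw [Metric.mem_closedBall, Prod.dist_eq] at h
    exact Metric.mem_closedBall.2 ((le_max_right _ _).trans h)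
  by_cases hzK : z.2 ∈ Metric.closedBall p.1.1 r
  · refine hU i hi _ hzK _ ((h4 i hi).mem_of_mem hout hzK t) ?_ hzU
    have hd : ∀ t, HasDerivAt (fun t => side (B.kind c) a (Θ i (t, z)).2) 0 t := by
      intro t
      have := (side (B.kind c) a).hasFDerivAt.comp_hasDerivAt t ((h4 i hi).hasDerivAt_snd t z)
      refine this.congr_deriv ?_
      simp [hX, hσl]
    have := is_const_of_deriv_eq_zero (fun t => (hd t).differentiableAt) (fun t => (hd t).deriv) 0 t
    simpa [(h4 i hi).flow.zero] using this
  · have := (h4 i hi).eq_self (u := z.2) (s := z.1.1) (r := z.1.2) (fun t => hout _ hzK) t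
    change Θ i (t, z) = _ at this
    rwa [this]

end OneForm

end BranchedSurface

end BranchedSurf

namespace BranchedSurf

/-! ### The homotopy equation at a vertex -/

variable {A : PPlane → (ℝ × ℝ →L[ℝ] ℝ)} {l m l' m' : ℝ × ℝ} {z₀ : PPlane}

theorem GoodFor.change {X : PPlane → ℝ × ℝ} {z : PPlane} (h : GoodFor A X m z) (hm' : A z m' ≠ 0) :
    GoodFor A X m' z := by
  refine ⟨h.1, hm', ?_⟩
  set q := lieCov A X z m / A z m with hq
  have h2 : lieCov A X z = q • A z := h.2.2
  have h3 : lieCov A X z m' / A z m' = q := by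
    rw [h2, div_eq_iff hm']
    rfl
  rw [h3, h2]

/-- The kernel vectors of two normalizations are proportional, and both sides of the equation scale
by the same factor. This allows the basis to be adapted to each edge in turn. -/
theorem HomotopyEq.change_basis (hlm : ∀ w : ℝ × ℝ, ∃ a b : ℝ, w = a • l + b • m) {f : PPlane → ℝ}
    {z : PPlane} (h : HomotopyEq A l m f z) (hm : A z m ≠ 0) (hm' : A z m' ≠ 0) :
    HomotopyEq A l' m' f z := by
  set V := kerField A l m z with hV
  have hAV : A z V = 0 := apply_kerField hm
  have hspan : ∀ w : ℝ × ℝ, ∃ a b : ℝ, w = a • V + b • m := by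
    intro w
    obtain ⟨a, b, rfl⟩ := hlm w
    refine ⟨a, b + a * (A z l / A z m), ?_⟩
    rw [hV, kerField]
    module
  obtain ⟨x, y, hxy⟩ := hspan (kerField A l' m' z)
  obtain ⟨x', y', hxy'⟩ := hspan m'
  have hy : y = 0 := by
    have h1 : A z (kerField A l' m' z) = 0 := apply_kerField hm'
    rw [hxy, map_add, map_smul, map_smul, hAV] at h1
    simpa [hm] using h1
  rw [hy, zero_smul, add_zero] at hxy
  have hAm' : A z m' = y' * A z m := by rw [hxy']; simp [hAV]
  have hy' : y' ≠ 0 := fun h => hm' (by rw [hAm', h, zero_mul])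
  have hpr : ∀ (t : ℝ) (w : ℝ × ℝ), ((0 : ℝ × ℝ), t • w) = t • (((0 : ℝ × ℝ), w) : PPlane) := by
    intro t w; simp
  have hpa : ∀ w w' : ℝ × ℝ, ((0 : ℝ × ℝ), w + w') = (((0 : ℝ × ℝ), w) : PPlane) + (0, w') := by
    intro w w'; simp
  have hcurl : curlCoef A l' m' z = x * curlCoef A l m z := by
    rw [curlCoef, curlCoef, ← hV, hxy, hAm', extDeriv₂, extDeriv₂, hxy', hpa, hpr, hpr, hpr,
      map_add, map_smul, map_smul, map_smul]
    simp only [add_apply, smul_apply, map_add, map_smul, smul_eq_mul]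
    field_simp
    ring
  rw [HomotopyEq, hcurl, hxy, hpr, map_smul, map_smul, smul_eq_mul, smul_eq_mul]
  have h2 : fderiv ℝ f z (0, V) = -(fderiv ℝ A z ((0, 1), 0)) V - curlCoef A l m z * f z := h
  rw [h2]
  ring

/-- The solution vanishing on a hypersurface transverse to the kernel. -/
theorem exists_transverse_solution (hA : SmoothNear A z₀) (hm : A z₀ m ≠ 0) {b : PPlane → ℝ}
    (hb : SmoothNear b z₀) (hb0 : b z₀ = 0) (hd : fderiv ℝ b z₀ (0, kerField A l m z₀) ≠ 0) :
    ∃ f k : PPlane → ℝ, SmoothNear f z₀ ∧ SmoothNear k z₀ ∧ (∀ᶠ z in 𝓝 z₀, f z = k z * b z) ∧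
      ∀ᶠ z in 𝓝 z₀, HomotopyEq A l m f z := by
  obtain ⟨W, Θ, c, r, hK⟩ := exists_kerFlow hA hm l
  obtain ⟨τ, hτ, hτ0, h1, -⟩ := hK.exists_hitting_time hb hb0
    (by rwa [hK.eventually.self_of_nhds.1])
  have hfs := smoothNear_transport hK.flow.contDiff hK.smooth_c hK.smooth_r hτ
  obtain ⟨k, hk, hke⟩ := exists_division hfs hb hb0 hd (h1.mono fun z h hz => by
    simp [transport, h.1.1 hz])
  exact ⟨_, k, hfs, hk, hke, hK.fderiv_transport hτ (h1.mono fun z h => h.2)⟩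

/-- A solution on a half-space bounded by a hyperplane transverse to the kernel extends across it. -/
theorem exists_extension_solution (hA : SmoothNear A z₀) (hm : A z₀ m ≠ 0) (σ : ℝ × ℝ →L[ℝ] ℝ)
    (hσl : σ l = 1) (hσm : σ m = 0) (hσ0 : σ z₀.2 = 0) {f₁ : PPlane → ℝ} (hf₁ : SmoothNear f₁ z₀)
    (h : ∀ᶠ z in 𝓝 z₀, 0 ≤ σ z.2 → HomotopyEq A l m f₁ z) :
    ∃ f : PPlane → ℝ, SmoothNear f z₀ ∧ (∀ᶠ z in 𝓝 z₀, HomotopyEq A l m f z) ∧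
      ∀ᶠ z in 𝓝 z₀, 0 ≤ σ z.2 → f z = f₁ z := by
  obtain ⟨W, Θ, c, r, hK⟩ := exists_kerFlow hA hm l
  obtain ⟨L, hL⟩ := hK.lipschitz
  obtain ⟨G, -, hG, hGe, -, -⟩ := exists_contDiff_eventuallyEq (isCompact_singleton (x := z₀))
    (f := f₁) (by rintro _ rfl; exact hf₁)
  rw [nhdsSet_singleton] at hGe
  -- The defect of `f₁` as a solution. Adding the solution with this right-hand side which vanishes
  -- on `σ = 0` repairs `f₁`. On the side `0 ≤ σ` the defect is zero and the path back to `σ = 0`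
  -- stays on that side, so nothing changes there.
  set r' : PPlane → ℝ := fun z => r z - fderiv ℝ G z (W z) - c z * G z with hr'
  have hr's : ContDiff ℝ ∞ r' := (hK.smooth_r.sub ((hG.fderiv_right (m := ∞) (by simp)).clm_apply
    hK.smooth)).sub (hK.smooth_c.mul hG)
  set τ : PPlane → ℝ := fun z => σ z.2 with hτ
  have hτs : ∀ z, SmoothNear τ z := fun z => (σ.contDiff.comp contDiff_snd).smoothNear z
  have hτd : ∀ z w, fderiv ℝ τ z w = σ w.2 := fun z w => by
    have : HasFDerivAt τ (σ.comp (.snd ℝ (ℝ × ℝ) (ℝ × ℝ))) z := σ.hasFDerivAt.comp z hasFDerivAt_snd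
    rw [this.fderiv]; rfl
  have h1 : ∀ᶠ z in 𝓝 z₀, fderiv ℝ τ z (W z) = 1 := by
    filter_upwards [hK.eventually] with z hz
    rw [hτd, hz.1]
    simp [kerField, hσl, hσm]
  have hT : SmoothNear (transport Θ c r' τ) z₀ :=
    smoothNear_transport hK.flow.contDiff hK.smooth_c hr's (hτs z₀)
  refine ⟨fun z => f₁ z + transport Θ c r' τ z, hf₁.add hT, ?_, ?_⟩
  · filter_upwards [hK.eventually, h1.eventually_nhds, hGe.eventually_nhds, hf₁.eventually,
      hT.eventually] with z hz h1z hGz hfz hTz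
    have e1 := fderiv_transport hK.flow hL hK.smooth_c hr's (hτs z) h1z
    have e2 : fderiv ℝ G z = fderiv ℝ f₁ z := EventuallyEq.fderiv_eq hGz
    have e3 : G z = f₁ z := hGz.self_of_nhds
    rw [HomotopyEq, fderiv_fun_add hfz.differentiableAt hTz.differentiableAt, ← hz.1, ← hz.2.1,
      add_apply, e1]
    simp only [hr', e2, e3, hz.2.2]
    ring
  · have hΘc : Tendsto (fun p : PPlane × ℝ => Θ (p.2, p.1)) (𝓝 (z₀, 0)) (𝓝 z₀) :=
      (hK.flow.contDiff.continuous.comp (by fun_prop : Continuous fun p : PPlane × ℝ =>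
        (p.2, p.1))).tendsto' _ _ (hK.flow.zero z₀)
    have hr0 : ∀ᶠ z in 𝓝 z₀, 0 ≤ τ z → r' z = 0 := by
      filter_upwards [hK.eventually, hGe.eventually_nhds, h] with z hz hGz hh hz0
      have e2 : fderiv ℝ G z = fderiv ℝ f₁ z := EventuallyEq.fderiv_eq hGz
      have e4 : fderiv ℝ f₁ z (0, kerField A l m z) = _ := hh hz0
      simp only [hr', e2, hGz.self_of_nhds]
      rw [hz.1, e4, hz.2.1, hz.2.2]
      ring
    have hpath := eventually_forall_abs_le (hτs z₀).continuousAt hσ0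
      (p := fun z t => fderiv ℝ τ (Θ (t, z)) (W (Θ (t, z))) = 1 ∧ (0 ≤ τ (Θ (t, z)) → r' (Θ (t, z)) = 0))
      (hΘc.eventually (h1.and hr0))
    filter_upwards [hpath] with z hz hz0
    have hz0' : 0 ≤ τ z := hz0
    have : transport Θ c r' τ z = 0 := by
      refine transport_eq_zero fun s hs => ?_
      rw [uIcc_of_ge (by linarith)] at hs
      have habs : ∀ t ∈ Icc (-τ z) 0, |t| ≤ |τ z| := fun t ht => by
        rw [abs_of_nonpos ht.2, abs_of_nonneg hz0']; linarith [ht.1]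
      refine (hz s (habs s hs)).2 ?_
      have e := eq_zero_of_abs_deriv_le (r := fun t => τ (Θ (t, z)) - τ z - t) (r' := fun _ => 0)
        (a := -τ z) (b := 0) (C := 0) (fun t ht => by
          have := (((((hτs _).differentiableAt).hasFDerivAt).comp_hasDerivAt t
            (hK.flow.hasDerivAt t z)).sub_const (τ z)).sub (hasDerivAt_id t)
          rw [(hz t (habs t ht)).1, sub_self] at this
          exact this) (fun t _ => by simp) (t₀ := 0) ⟨by linarith, le_rfl⟩
          (by simp [hK.flow.zero]) s hs
      have e' : τ (Θ (s, z)) = τ z + s := by linarith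
      rw [e']
      linarith [hs.1]
    rw [this, add_zero]

/-- A smooth step from `0` for `t ≤ -ε / 2` to `1` for `t ≥ -ε / 4`. -/
noncomputable def step (ε t : ℝ) : ℝ := Real.smoothTransition ((t + ε / 2) / (ε / 4))

theorem contDiff_step (ε : ℝ) : ContDiff ℝ ∞ (step ε) :=
  Real.smoothTransition.contDiff.comp ((contDiff_id.add contDiff_const).div_const _)

theorem step_eq_one {ε t : ℝ} (hε : 0 < ε) (h : -(ε / 4) ≤ t) : step ε t = 1 :=
  Real.smoothTransition.one_of_one_le (by rw [le_div_iff₀ (by linarith)]; linarith)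

theorem step_eq_zero {ε t : ℝ} (hε : 0 < ε) (h : t ≤ -(ε / 2)) : step ε t = 0 :=
  Real.smoothTransition.zero_of_nonpos (div_nonpos_of_nonpos_of_nonneg (by linarith) (by linarith))

theorem step_nonneg (ε t : ℝ) : 0 ≤ step ε t := Real.smoothTransition.nonneg _

theorem step_le_one (ε t : ℝ) : step ε t ≤ 1 := Real.smoothTransition.le_one _

/-- The hyperbolic linear field. -/
noncomputable def saddle : ℝ × ℝ →L[ℝ] ℝ × ℝ :=
  (ContinuousLinearMap.fst ℝ ℝ ℝ).prod (-ContinuousLinearMap.snd ℝ ℝ ℝ)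

/-- Every side function is zero or a coordinate up to sign, hence an eigenfunction of the saddle
field; so multiples of this field are tangent to both edges. -/
theorem side_saddle (k : Kind) (a : Fin 3) : ∃ κ : ℝ, |κ| ≤ 1 ∧ ∀ u, side k a (saddle u) = κ * side k a u := by
  by_cases h : a = 2
  · subst h
    exact ⟨1, by simp, fun u => by cases k <;> simp [side, saddle]⟩
  · refine ⟨-1, by simp, fun u => ?_⟩
    cases k <;> fin_cases a <;> simp [side, saddle] at h ⊢

/-- The field on a side sheet with given normal component `w` near the edge and `A(X) = f`. -/
noncomputable def sideField (A : PPlane → (ℝ × ℝ →L[ℝ] ℝ)) (n e : ℝ × ℝ) (f w : PPlane → ℝ)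
    (z : PPlane) : ℝ × ℝ :=
  w z • n + ((f z - w z * A z n) / A z e) • e

theorem apply_sideField {n e : ℝ × ℝ} {f w : PPlane → ℝ} {z : PPlane} (h : A z e ≠ 0) :
    A z (sideField A n e f w z) = f z := by
  simp only [sideField, map_add, map_smul, smul_eq_mul]
  field_simp
  ring

theorem smoothNear_sideField {n e : ℝ × ℝ} {f w : PPlane → ℝ} {z : PPlane} (hA : SmoothNear A z)
    (hf : SmoothNear f z) (hw : SmoothNear w z) (h : A z e ≠ 0) :
    SmoothNear (sideField A n e f w) z :=
  (hw.smul (SmoothNear.const n)).add (((hf.sub (hw.mul (hA.clm_apply (SmoothNear.const n)))).div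
    (hA.clm_apply (SmoothNear.const e)) h).smul (SmoothNear.const e))

end BranchedSurf

namespace BranchedSurf

/-- A normal speed bounded by a multiple of `|σ|` preserves `{σ ≥ 0}`. Damped by `step` it is zero
for `σ ≤ -ε / 2`, and for larger `σ` one has `|σ| ≤ |σ + ε|`; hence `{σ ≥ -ε}` is preserved too. -/
theorem step_mul_le {ε M σ w : ℝ} (hε : 0 < ε) (hw : |w| ≤ M * |σ|) (hM : 0 ≤ M) :
    |step ε σ * w| ≤ M * |σ + ε| ∧ |step ε σ * w| ≤ M * |σ| := by
  have h2 : |step ε σ * w| ≤ M * |σ| := by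
    rw [abs_mul, abs_of_nonneg (step_nonneg _ _)]
    calc step ε σ * |w| ≤ 1 * |w| := mul_le_mul_of_nonneg_right (step_le_one _ _) (abs_nonneg _)
      _ ≤ _ := by rwa [one_mul]
  refine ⟨?_, h2⟩
  rcases le_total σ (-(ε / 2)) with h | h
  · rw [step_eq_zero hε h, zero_mul, abs_zero]; positivity
  · refine h2.trans (mul_le_mul_of_nonneg_left ?_ hM)
    rw [abs_of_nonneg (by linarith : 0 ≤ σ + ε), abs_le]
    constructor <;> linarith

theorem IsVertexAt.sides {k : Kind} {q : (ℝ × ℝ) × ℝ} (h : IsVertexAt k q) (a : Fin 3) (ha : a ≠ 1) :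
    side k a ≠ 0 := by
  have h1 : (ContinuousLinearMap.fst ℝ ℝ ℝ) ≠ 0 := fun h => by
    simpa using congrArg (fun L => L (1, 0)) h
  have h2 : (ContinuousLinearMap.snd ℝ ℝ ℝ) ≠ 0 := fun h => by
    simpa using congrArg (fun L => L (0, 1)) h
  rcases h.1 with rfl | rfl <;> fin_cases a <;> simp [side, h1, h2] at ha ⊢

theorem hasFDerivAt_mul_coord (u : ℝ × ℝ) : HasFDerivAt (fun u : ℝ × ℝ => u.1 * u.2)
    (u.1 • ContinuousLinearMap.snd ℝ ℝ ℝ + u.2 • ContinuousLinearMap.fst ℝ ℝ ℝ) u :=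
  hasFDerivAt_fst.mul hasFDerivAt_snd

namespace BranchedSurface

variable {P : Type*} [TopologicalSpace P] {B : BranchedSurface P}

namespace OneForm

set_option maxHeartbeats 1000000 in
/-- Deformation near a vertex. -/
theorem exists_vertex_deformation [T2Space P] {α : B.OneForm} {τ : ℝ → B.OneForm}
    (hτ : IsCurve α τ) {c : Fin B.num} {p : Model (B.kind c)} (hv : IsVertexAt (B.kind c) p.1)
    (h0 : ∀ a, α.coe c p (edgeDir a) ≠ 0) {O : Set (ℝ × ℝ)} (hO : O ∈ 𝓝 p.1.1) :
    ∃ r > 0, Metric.closedBall p.1.1 r ⊆ O ∧ ∀ ε > 0, ∀ β, IsCurve α β →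
      (∀ᶠ s in 𝓝 0, ∀ i, OnSheet p i → ∀ u ∈ Metric.closedBall p.1.1 r,
        (β s).rep c i u = α.rep c i u) →
      ∃ γ, IsCurve α γ ∧
        (∀ᶠ s in 𝓝 0, ∀ U : Set P, (∀ u ∈ Metric.closedBall p.1.1 r,
          ∀ v ∈ Metric.closedBall p.1.1 r, u.1 * u.2 = v.1 * v.2 →
          B.chart c (lift _ 1 u) ∈ U → B.chart c (lift _ 1 v) ∈ U) →
          (∀ a, a ≠ 1 → ∀ u ∈ Metric.closedBall p.1.1 r, side (B.kind c) a u ≤ 0 →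
            (B.chart c (lift _ a u) ∈ U ↔ -ε ≤ side (B.kind c) a u)) → Conn U (β s) (γ s)) ∧
        (∀ᶠ s in 𝓝 0, ∀ x ∉ B.spot c p r, EqAt (γ s) (β s) x) ∧
        ∀ᶠ s in 𝓝 0, ∀ i, OnSheet p i → ∀ u ∈ Metric.closedBall p.1.1 (r / 4),
          (γ s).rep c i u = (τ s).rep c i u := by
  have hp0 : p.1.1 = 0 := by rw [hv.2]; rfl
  have hz : p.1.2 = 0 := by rw [hv.2]
  set z₀ : PPlane := ((0, 0), p.1.1) with hz₀
  set A : Fin 3 → PPlane → (ℝ × ℝ →L[ℝ] ℝ) := fun i => homot (fun _ => α) τ c i fun _ => 1 with hA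
  set l : ℝ × ℝ := (1, 0) with hl
  set m : ℝ × ℝ := (0, 1) with hm
  have hlm : ∀ w : ℝ × ℝ, ∃ x y : ℝ, w = x • l + y • m := fun w => ⟨w.1, w.2, by simp [hl, hm]⟩
  have hAs : ∀ i, SmoothNear (A i) z₀ := fun i => smoothNear_homot (isCurve_const α) hτ contDiff_const _
  have hp : ∀ i, OnSheet p i := fun i => (onSheet_iff_side hz).2 (by rw [hp0, map_zero])
  have hAz : ∀ i, A i z₀ = α.coe c p := fun i => by
    simp only [hA, hz₀]
    rw [homot_self]
    exact congrArg (α.coe c) (hp i).lift_eq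
  have hAm : ∀ i, A i z₀ m ≠ 0 := fun i => by
    rw [hAz i]; simpa [edgeDir] using h0 2
  have hAl : ∀ i, A i z₀ l ≠ 0 := fun i => by
    rw [hAz i]; simpa [edgeDir] using h0 0
  -- the horizontal sheet
  have hsad : ∀ z : PPlane, SmoothNear (fun z : PPlane => saddle z.2) z := fun z =>
    (saddle.contDiff.comp contDiff_snd).smoothNear z
  -- The initial hypersurface is where `A` annihilates the saddle field. The saddle map sends the
  -- kernel vector `l - q m` to `l + q m`, so the equation of the hypersurface has derivative `2
  -- A(l) ≠ 0` along the kernel. Then `f = k A(saddle)`, and `k • saddle` solves the problem on the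
  -- horizontal sheet.
  obtain ⟨f, k, hf, hk, hfk, hfPDE⟩ := exists_transverse_solution (l := l) (hAs 1) (hAm 1)
    (b := fun z => A 1 z (saddle z.2)) ((hAs 1).clm_apply (hsad z₀))
    (by simp [hz₀, hp0]) (by
      have hd : HasFDerivAt (fun z : PPlane => saddle z.2) (saddle.comp (.snd ℝ (ℝ × ℝ) (ℝ × ℝ))) z₀ :=
        saddle.hasFDerivAt.comp z₀ hasFDerivAt_snd
      rw [fderiv_clm_apply (hAs 1).differentiableAt hd.differentiableAt, hd.fderiv]
      have e1 : saddle z₀.2 = 0 := by simp [hz₀, hp0]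
      have e2 : saddle (kerField (A 1) l m z₀) = l + (A 1 z₀ l / A 1 z₀ m) • m := by
        simp [saddle, kerField, hl, hm]
      have e3 : A 1 z₀ (saddle (kerField (A 1) l m z₀)) = 2 * A 1 z₀ l := by
        rw [e2, map_add, map_smul, smul_eq_mul, div_mul_cancel₀ _ (hAm 1)]; ring
      simp [e1, e3, hAl 1])
  -- the other sheets
  have hside : ∀ i, i ≠ 1 → side (B.kind c) i ≠ 0 := hv.sides
  set n : Fin 3 → ℝ × ℝ := fun i => edgeNormal (B.kind c) i with hn
  set e : Fin 3 → ℝ × ℝ := fun i => edgeDir i with he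
  have hAe : ∀ i j, A i z₀ (e j) ≠ 0 := fun i j => by rw [hAz i]; exact h0 j
  have hne : ∀ i, i ≠ 1 → ∀ w : ℝ × ℝ, ∃ x y : ℝ, w = x • n i + y • e i := fun i hi w =>
    ⟨_, _, eq_side_smul_add (hside i hi) w⟩
  -- On a side sheet the solution is prescribed where the sheet coincides with the horizontal one;
  -- the edge is transverse to the foliation, so the solution continues across it.
  have hsol : ∀ i, ∃ g : PPlane → ℝ, i ≠ 1 → SmoothNear g z₀ ∧
      (∀ᶠ z in 𝓝 z₀, HomotopyEq (A i) (n i) (e i) g z) ∧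
      ∀ᶠ z in 𝓝 z₀, 0 ≤ side (B.kind c) i z.2 → g z = f z := by
    intro i
    by_cases hi : i = 1
    · exact ⟨0, fun h => absurd hi h⟩
    obtain ⟨g, hg⟩ := exists_extension_solution (l := n i) (hAs i) (hAe i i) (side (B.kind c) i)
      (side_edgeNormal (hside i hi)) (side_edgeDir _ _) (by simp [hz₀, hp0]) hf (by
      have h1 : ∀ᶠ z in 𝓝 z₀, A i z m ≠ 0 ∧ A i z (e i) ≠ 0 :=
        (((hAs i).clm_apply (SmoothNear.const m)).continuousAt.eventually_ne (hAm i)).and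
          (((hAs i).clm_apply (SmoothNear.const (e i))).continuousAt.eventually_ne (hAe i i))
      filter_upwards [hfPDE, h1, (hAs 1).eventually, (hAs i).eventually] with z p1 h1 a1 a2 hz
      have hzc : z.2 ∈ coincide (B.kind c) 1 i :=
        mem_coincide_iff.2 (Or.inr ⟨by simp [side_one], hz⟩)
      have hA1 : A 1 z = A i z := homot_eq _ _ hzc
      have hD1 : fderiv ℝ (A 1) z = fderiv ℝ (A i) z :=
        fderiv_homot_eq a1.differentiableAt a2.differentiableAt hzc
      exact (p1.congr_form hA1.symm hD1.symm).change_basis hlm h1.1 h1.2)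
    exact ⟨g, fun _ => hg⟩
  choose g hg using hsol
  obtain ⟨M, hM⟩ : ∃ M, |k z₀| < M := exists_gt _
  have hMz : ∀ᶠ z in 𝓝 z₀, |k z| < M := hk.continuousAt.abs.eventually_lt_const hM
  have hM0 : 0 ≤ M := (abs_nonneg _).trans hM.le
  have hall : ∀ᶠ z in 𝓝 z₀, (∀ᶠ y in 𝓝 z, f y = k y * A 1 y (saddle y.2) ∧ HomotopyEq (A 1) l m f y) ∧
      SmoothNear k z ∧ |k z| < M ∧ (∀ i, SmoothNear (A i) z ∧ A i z m ≠ 0) ∧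
      ∀ i, i ≠ 1 → A i z (e i) ≠ 0 ∧ SmoothNear (g i) z ∧
        (∀ᶠ y in 𝓝 z, HomotopyEq (A i) (n i) (e i) (g i) y) ∧
        (0 ≤ side (B.kind c) i z.2 → g i z = f z) := by
    refine ((hfk.and hfPDE).eventually_nhds).and (hk.eventually.and (hMz.and (.and ?_ ?_)))
    · rw [eventually_all]
      exact fun i => (hAs i).eventually.and
        (((hAs i).clm_apply (SmoothNear.const m)).continuousAt.eventually_ne (hAm i))
    · rw [eventually_all]
      intro i
      by_cases hi : i = 1
      · exact Eventually.of_forall fun _ h => absurd hi h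
      · filter_upwards [((hAs i).clm_apply (SmoothNear.const (e i))).continuousAt.eventually_ne (hAe i i),
          (hg i hi).1.eventually, (hg i hi).2.1.eventually_nhds, (hg i hi).2.2] with z a1 a2 a3 a4 _
        exact ⟨a1, a2, a3, a4⟩
  have hrep : ∀ᶠ u in 𝓝 p.1.1, ∀ i, α.rep c i u m ≠ 0 := by
    rw [eventually_all]
    intro i
    refine ((α.contDiff_rep c i).continuous.clm_apply continuous_const).continuousAt.eventually_ne ?_
    have : α.rep c i p.1.1 = α.coe c p := congrArg (α.coe c) (hp i).lift_eq
    rw [this, ← hAz i]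
    exact hAm i
  obtain ⟨r1, hr1, hb1⟩ := Metric.nhds_basis_closedBall.eventually_iff.1 hall
  obtain ⟨r2, hr2, hb2⟩ := Metric.nhds_basis_closedBall.eventually_iff.1 (hrep.and hO)
  set r := min r1 r2 with hr
  have hr0 : 0 < r := lt_min hr1 hr2
  have hs1 : Metric.closedBall z₀ r ⊆ Metric.closedBall z₀ r1 :=
    Metric.closedBall_subset_closedBall (min_le_left _ _)
  have hs2 : Metric.closedBall p.1.1 r ⊆ Metric.closedBall p.1.1 r2 :=
    Metric.closedBall_subset_closedBall (min_le_right _ _)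
  refine ⟨r, hr0, fun u hu => (hb2 (hs2 hu)).2, fun ε hε β hβ hβα => ?_⟩
  set σ : Fin 3 → ℝ × ℝ →L[ℝ] ℝ := fun i => side (B.kind c) i with hσ
  -- On a side sheet the condition `A(X) = g` leaves the multiples of the kernel free. They are used
  -- to prescribe the normal speed: that of the horizontal field near the edge, and zero where the
  -- side function is below `-ε / 2`.
  set w : Fin 3 → PPlane → ℝ := fun i z => step ε (σ i z.2) * σ i (k z • saddle z.2) with hw
  set X : Fin 3 → PPlane → ℝ × ℝ := fun i z => if i = 1 then k z • saddle z.2 else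
    sideField (A i) (n i) (e i) (g i) (w i) z with hX
  have hX1 : X 1 = fun z => k z • saddle z.2 := by funext z; simp [hX]
  have hXi : ∀ i, i ≠ 1 → X i = sideField (A i) (n i) (e i) (g i) (w i) := fun i hi => by
    funext z; simp [hX, hi]
  have hσk : ∀ i, ∀ z ∈ Metric.closedBall z₀ r, |σ i (k z • saddle z.2)| ≤ M * |σ i z.2| := by
    intro i z hz
    obtain ⟨κ, hκ, hκe⟩ := side_saddle (B.kind c) i
    rw [map_smul, smul_eq_mul, abs_mul]
    refine mul_le_mul (hb1 (hs1 hz)).2.2.1.le ?_ (abs_nonneg _) hM0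
    simp only [hσ, hκe, abs_mul]
    exact mul_le_of_le_one_left (abs_nonneg _) hκ
  have hσX : ∀ i, i ≠ 1 → ∀ z, σ i (X i z) = w i z := by
    intro i hi z
    rw [hXi i hi, sideField]
    simp [hσ, hn, he, side_edgeDir, side_edgeNormal (hside i hi)]
  have hXe : ∀ i, ∀ z ∈ Metric.closedBall z₀ r, 0 ≤ σ i z.2 → X i z = X 1 z := by
    intro i z hz h
    by_cases hi : i = 1
    · rw [hi]
    obtain ⟨a1, -, -, a4, a5⟩ := hb1 (hs1 hz)
    obtain ⟨b1, -, -, b4⟩ := a5 i hi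
    have hzc : z.2 ∈ coincide (B.kind c) 1 i := mem_coincide_iff.2 (Or.inr ⟨by simp [side_one], h⟩)
    have hAe : A 1 z = A i z := homot_eq _ _ hzc
    have hwz : w i z = σ i (X 1 z) := by
      simp only [hw, hX1]
      rw [step_eq_one hε (by linarith), one_mul]
    have hfz : g i z = A i z (X 1 z) := by
      rw [b4 h, a1.self_of_nhds.1, ← hAe, hX1]
      simp
    have hdec : X 1 z = σ i (X 1 z) • n i + edgeCoord i (X 1 z) • e i :=
      eq_side_smul_add (hside i hi) (X 1 z)
    have hfz2 : g i z = σ i (X 1 z) * A i z (n i) + edgeCoord i (X 1 z) * A i z (e i) := by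
      rw [hfz]
      conv_lhs => rw [hdec]
      simp
    have h5 : (g i z - w i z * A i z (n i)) / A i z (e i) = edgeCoord i (X 1 z) := by
      rw [div_eq_iff b1, hfz2, hwz]
      ring
    rw [hXi i hi, sideField, h5, hwz, ← hdec]
  obtain ⟨γ, θ, Θ, h1, h2, h3, h4, h5, h6, h7⟩ := exists_local_deformation hτ (hp 1) hr0 (m := m)
    (fun i _ u hu => (hb2 (hs2 hu)).1 i) (fun u _ i j _ h => absurd (hp j) h) (X := X)
    (fun i _ z hz => by
      obtain ⟨a1, a2, a3, a4, a5⟩ := hb1 (hs1 hz)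
      by_cases hi : i = 1
      · subst hi
        have hXs : SmoothNear (X 1) z := by rw [hX1]; exact a2.smul (hsad z)
        refine ⟨hXs, (eventually_goodFor hlm (a4 1).1 hXs (a4 1).2 (f := f) ?_ ?_).self_of_nhds⟩
        · filter_upwards [a1] with y hy
          rw [hy.1, hX1]; simp
        · exact a1.mono fun y hy => hy.2
      · obtain ⟨b1, b2, b3, b4⟩ := a5 i hi
        have hws : SmoothNear (w i) z := by
          refine SmoothNear.mul ?_ ?_
          · exact ((contDiff_step ε).comp ((σ i).contDiff.comp contDiff_snd)).smoothNear z
          · exact (SmoothNear.const (σ i)).clm_apply (a2.smul (hsad z))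
        have hXs : SmoothNear (X i) z := by
          rw [hXi i hi]; exact smoothNear_sideField (a4 i).1 b2 hws b1
        refine ⟨hXs, GoodFor.change (m := e i) (eventually_goodFor (hne i hi) (a4 i).1 hXs b1
          (f := g i) ?_ b3).self_of_nhds (a4 i).2⟩
        filter_upwards [((a4 i).1.clm_apply (SmoothNear.const (e i))).continuousAt.eventually_ne b1]
          with y hy
        rw [hXi i hi, apply_sideField hy])
    (fun i _ z hz => hXe i z hz)
    (fun i => Or.inr ⟨M, fun z hz => by rw [hX1]; exact hσk i z hz⟩) hβ hβα
  refine ⟨γ, h1, ?_, h6, h7⟩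
  filter_upwards [h5] with s hs U hU1 hU2
  have hz2 : ∀ z ∈ Metric.closedBall z₀ r, z.2 ∈ Metric.closedBall p.1.1 r := by
    intro z hz
    rw [Metric.mem_closedBall, Prod.dist_eq] at hz
    exact Metric.mem_closedBall.2 ((le_max_right _ _).trans hz)
  have hout : ∀ i, ∀ z : PPlane, z.2 ∉ Metric.closedBall p.1.1 r → θ z • X i z = 0 := by
    intro i z hz
    rw [h3 z fun h => hz (hz2 z h), zero_smul]
  -- Where the field is a multiple of the saddle field the product of the coordinates is a first
  -- integral, and outside the ball nothing moves.
  have hprod : ∀ i, ∀ z t, (∀ t, Θ i (t, z) ∈ Metric.closedBall z₀ r → X i (Θ i (t, z)) = X 1 (Θ i (t, z))) →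
      (Θ i (t, z)).2.1 * (Θ i (t, z)).2.2 = z.2.1 * z.2.2 := by
    intro i z t hXX
    have hd : ∀ t, HasDerivAt (fun t => (Θ i (t, z)).2.1 * (Θ i (t, z)).2.2) 0 t := by
      intro t
      have := (hasFDerivAt_mul_coord (Θ i (t, z)).2).comp_hasDerivAt t ((h4 i (hp i)).hasDerivAt_snd t z)
      refine this.congr_deriv ?_
      by_cases hin : Θ i (t, z) ∈ Metric.closedBall z₀ r
      · rw [hXX t hin, hX1]
        simp [saddle]
        ring
      · rw [h3 _ hin, zero_smul, map_zero]
    have := is_const_of_deriv_eq_zero (fun t => (hd t).differentiableAt) (fun t => (hd t).deriv) t 0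
    simpa [(h4 i (hp i)).flow.zero] using this
  refine hs U fun i _ t z hzU => ?_
  by_cases hzK : z.2 ∈ Metric.closedBall p.1.1 r
  · have hmem := (h4 i (hp i)).mem_of_mem (hout i) hzK t
    by_cases hi : i = 1
    · subst hi
      exact hU1 _ hzK _ hmem (hprod 1 z t fun _ _ => rfl).symm hzU
    · have hbound : ∀ z, |σ i (θ z • X i z)| ≤ M * |σ i z.2 + ε| ∧ |σ i (θ z • X i z)| ≤ M * |σ i z.2| := by
        intro z
        by_cases hzb : z ∈ Metric.closedBall z₀ r
        · have h8 := step_mul_le hε (hσk i z hzb) hM0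
          rw [map_smul, hσX i hi, smul_eq_mul, abs_mul, abs_of_nonneg (h2 z).1]
          have h9 : θ z * |w i z| ≤ |w i z| := mul_le_of_le_one_left (abs_nonneg _) (h2 z).2
          exact ⟨h9.trans h8.1, h9.trans h8.2⟩
        · rw [h3 z hzb, zero_smul, map_zero, abs_zero]
          exact ⟨by positivity, by positivity⟩
      have hlift : ∀ u, 0 ≤ σ i u → lift (B.kind c) i u = lift (B.kind c) 1 u := fun u hu =>
        lift_eq_lift_iff.2 ⟨rfl, mem_coincide_iff.2 (Or.inr ⟨hu, by simp [side_one]⟩)⟩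
      rcases le_total 0 (σ i z.2) with hpos | hneg
      · have hpos' : ∀ t, 0 ≤ σ i (Θ i (t, z)).2 := fun t =>
          (h4 i (hp i)).nonneg (σ i).differentiable (C := M)
            (fun z => by rw [ContinuousLinearMap.fderiv]; exact (hbound z).2) hpos t
        rw [hlift _ (hpos' t)]
        rw [hlift _ hpos] at hzU
        exact hU1 _ hzK _ hmem (hprod i z t fun t ht => hXe i _ ht (hpos' t)).symm hzU
      · have hneg' : σ i (Θ i (t, z)).2 ≤ 0 := by
          have := (h4 i (hp i)).nonneg (σ i).differentiable.neg (C := M) (z := z) (fun z => by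
            rw [fderiv_neg, ContinuousLinearMap.fderiv, neg_apply, abs_neg]
            simp only [Pi.neg_apply, abs_neg]
            exact (hbound z).2) (by simpa using hneg) t
          simpa using this
        rw [hU2 i hi _ hmem hneg']
        have h0' := (hU2 i hi _ hzK hneg).1 hzU
        have := (h4 i (hp i)).nonneg (r := fun u => σ i u + ε) ((σ i).differentiable.add_const ε)
          (C := M) (z := z) (fun z => by
            rw [fderiv_add_const]
            rw [ContinuousLinearMap.fderiv]; exact (hbound z).1) (by linarith [h0']) t
        linarith
  · have := (h4 i (hp i)).eq_self (u := z.2) (s := z.1.1) (r := z.1.2) (fun t => hout i _ hzK) t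
    change Θ i (t, z) = _ at this
    rwa [this]

end OneForm

end BranchedSurface

end BranchedSurf

/-! ### Edges transverse to the foliation -/

namespace BranchedSurf

theorem contDiff_cutoff_smul {E F : Type*} [NormedAddCommGroup E] [NormedSpace ℝ E]
    [NormedAddCommGroup F] [NormedSpace ℝ F] {θ : E → ℝ} {g : E → F} {K : Set E}
    (hθ : ContDiff ℝ ∞ θ) (hK : IsClosed K) (h0 : ∀ x ∉ K, θ x = 0) (hg : ∀ x ∈ K, SmoothNear g x) :
    ContDiff ℝ ∞ fun x => θ x • g x := by
  rw [contDiff_iff_contDiffAt]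
  intro x
  by_cases hx : x ∈ K
  · exact hθ.contDiffAt.smul (hg x hx).contDiffAt
  · refine (contDiffAt_const (c := (0 : F))).congr_of_eventuallyEq ?_
    filter_upwards [hK.isOpen_compl.mem_nhds hx] with y hy
    rw [h0 y hy, zero_smul]

set_option maxHeartbeats 800000 in
/-- Solutions of the homotopy equation vanishing along an edge transverse to the foliation, on
sheets which agree on one side of the edge. -/
theorem exists_edge_solutions {ι : Type} [Finite ι] {A E : ι → PPlane → (ℝ × ℝ →L[ℝ] ℝ)}
    {χ : ℝ × ℝ → ℝ} (hχ : ContDiff ℝ ∞ χ) {n e : ℝ × ℝ} {σ η : ℝ × ℝ →L[ℝ] ℝ} (hσn : σ n = 1)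
    (hσe : σ e = 0) (hηn : η n = 0) (hηe : η e = 1) {K : Set (ℝ × ℝ)} (hK : IsCompact K) {M : ℝ}
    (hM : 0 ≤ M) (hA : ∀ i, ∀ u ∈ K, SmoothNear (A i) ((0, 0), u))
    (hE : ∀ i, ∀ u ∈ K, SmoothNear (E i) ((0, 0), u))
    (hAE : ∀ i, ∀ u ∈ K, ∀ᶠ z in 𝓝 (((0, 0), u) : PPlane),
      fderiv ℝ (A i) z ((0, 1), 0) = -(χ z.2 • E i z))
    (hne : ∀ i, ∀ u ∈ K, A i ((0, 0), u) e ≠ 0 ∧ |A i ((0, 0), u) n| < M * |A i ((0, 0), u) e|)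
    (hAA : ∀ i j z, 0 ≤ σ z.2 → A i z = A j z) (hEE : ∀ i j z, 0 ≤ σ z.2 → E i z = E j z)
    (hDD : ∀ i j, ∀ u ∈ K, ∀ᶠ z in 𝓝 (((0, 0), u) : PPlane), 0 ≤ σ z.2 →
      fderiv ℝ (A i) z = fderiv ℝ (A j) z) :
    ∃ f : ι → PPlane → ℝ, (∀ i, ContDiff ℝ ∞ (f i)) ∧ (∀ i z, σ z.2 = 0 → f i z = 0) ∧
      (∀ i, ∀ u ∈ K, ∀ᶠ z in 𝓝 (((0, 0), u) : PPlane), HomotopyEq (A i) n e (f i) z) ∧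
      (∀ i z, (∀ v, |η v - η z.2| ≤ M * |σ z.2| → χ v = 0) → f i z = 0) ∧
      ∀ i j z, 0 ≤ σ z.2 → f i z = f j z := by
  set G : Set PPlane := {z | ∀ i, SmoothNear (A i) z ∧ SmoothNear (E i) z ∧ A i z e ≠ 0 ∧
    |A i z n| < M * |A i z e| ∧ ∀ j, 0 ≤ σ z.2 → fderiv ℝ (A i) z = fderiv ℝ (A j) z} with hG
  have hKG : (fun u : ℝ × ℝ => (((0, 0), u) : PPlane)) '' K ⊆ interior G := by
    rintro _ ⟨u, hu, rfl⟩
    rw [mem_interior_iff_mem_nhds]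
    change ∀ᶠ z in 𝓝 _, ∀ i, _
    rw [eventually_all]
    intro i
    have h1 := ((hA i u hu).clm_apply (SmoothNear.const e)).continuousAt
    have h2 := ((hA i u hu).clm_apply (SmoothNear.const n)).continuousAt
    refine (hA i u hu).eventually.and ((hE i u hu).eventually.and
      ((h1.eventually_ne (hne i u hu).1).and
      ((h2.abs.eventually_lt (continuousAt_const.mul h1.abs) (hne i u hu).2).and ?_)))
    rw [eventually_all]
    exact fun j => hDD i j u hu
  obtain ⟨θ, K', hθ, hθ1, hK', hK's, hθ0, hθI⟩ := exists_cutoff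
    (hK.image (by fun_prop : Continuous fun u : ℝ × ℝ => (((0, 0), u) : PPlane)))
    isOpen_interior hKG
  have hGK : ∀ z ∈ K', z ∈ G := fun z hz => interior_subset (hK's hz)
  set g : ι → PPlane → ℝ := fun i z => θ z • (A i z n / A i z e) with hg
  have hgs : ∀ i, ContDiff ℝ ∞ (g i) := fun i =>
    contDiff_cutoff_smul hθ hK'.isClosed hθ0 fun z hz =>
      ((hGK z hz i).1.clm_apply (SmoothNear.const n)).div ((hGK z hz i).1.clm_apply (SmoothNear.const e))
        (hGK z hz i).2.2.1
  have hg0 : ∀ i, ∀ z ∉ K', g i z = 0 := fun i z hz => by simp [hg, hθ0 z hz]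
  have hgM : ∀ i z, |g i z| ≤ M := by
    intro i z
    by_cases hz : z ∈ K'
    · have h1 := hGK z hz i
      have h2 : |A i z n / A i z e| ≤ M := by
        rw [abs_div, div_le_iff₀ (abs_pos.2 h1.2.2.1)]
        exact h1.2.2.2.1.le
      simp only [hg]
      rw [smul_eq_mul, abs_mul, abs_of_nonneg (hθI z).1]
      exact (mul_le_of_le_one_left (abs_nonneg _) (hθI z).2).trans h2
    · rw [hg0 i z hz, abs_zero]; exact hM
  set W : ι → PPlane → PPlane := fun i z => (0, n - g i z • e) with hW
  set c : ι → PPlane → ℝ := fun i z => θ z • curlCoef (A i) n e z with hc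
  set r : ι → PPlane → ℝ := fun i z => θ z • (χ z.2 * E i z (kerField (A i) n e z)) with hr
  have hWs : ∀ i, ContDiff ℝ ∞ (W i) := fun i =>
    contDiff_const.prodMk (contDiff_const.sub ((hgs i).smul contDiff_const))
  have hcs : ∀ i, ContDiff ℝ ∞ (c i) := fun i => contDiff_cutoff_smul hθ hK'.isClosed hθ0
    fun z hz => smoothNear_curlCoef (hGK z hz i).1 (hGK z hz i).2.2.1
  have hrs : ∀ i, ContDiff ℝ ∞ (r i) := fun i => contDiff_cutoff_smul hθ hK'.isClosed hθ0
    fun z hz => ((hχ.comp contDiff_snd).smoothNear z).mul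
      ((hGK z hz i).2.1.clm_apply (smoothNear_kerField (hGK z hz i).1 (hGK z hz i).2.2.1))
  have hL : ∀ i, ∃ L, LipschitzWith L (W i) := fun i =>
    exists_lipschitzWith (hWs i) hK' (0, n) fun z hz => by simp [hW, hg0 i z hz]
  choose L hL using hL
  have hfl : ∀ i, ∃ Θ, IsFlow (W i) Θ := fun i => exists_isFlow (hWs i) (hL i)
  choose Θ hΘ using hfl
  set τ : PPlane → ℝ := fun z => σ z.2 with hτ
  have hτs : ∀ z, SmoothNear τ z := fun z => (σ.contDiff.comp contDiff_snd).smoothNear z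
  have hτd : ∀ z w, fderiv ℝ τ z w = σ w.2 := fun z w => by
    have : HasFDerivAt τ (σ.comp (.snd ℝ (ℝ × ℝ) (ℝ × ℝ))) z := σ.hasFDerivAt.comp z hasFDerivAt_snd
    rw [this.fderiv]; rfl
  have hτ1 : ∀ i z, fderiv ℝ τ z (W i z) = 1 := fun i z => by
    rw [hτd]; simp [hW, hσn, hσe]
  have hΘσ : ∀ i z t, σ (Θ i (t, z)).2 = σ z.2 + t := by
    intro i z t
    have hd : ∀ t, HasDerivAt (fun t => τ (Θ i (t, z)) - t) 0 t := fun t => by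
      have := (((hτs _).differentiableAt).hasFDerivAt.comp_hasDerivAt t
        ((hΘ i).hasDerivAt t z)).sub (hasDerivAt_id t)
      rw [hτ1, sub_self] at this
      exact this
    have := is_const_of_deriv_eq_zero (fun t => (hd t).differentiableAt) (fun t => (hd t).deriv) t 0
    simp only [(hΘ i).zero, hτ] at this
    linarith
  -- Finite propagation: the integral curves have slope at most `M`, so the solution at `z` depends
  -- only on data in the cone `|η v - η z| ≤ M |σ z|`.
  have hΘη : ∀ i z t, |η (Θ i (t, z)).2 - η z.2| ≤ M * |t| := by
    intro i z t
    have hd : ∀ t, HasDerivAt (fun t => η (Θ i (t, z)).2) (-(g i (Θ i (t, z)))) t := fun t => by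
      have h1 := η.hasFDerivAt.comp_hasDerivAt t
        (hasFDerivAt_snd.comp_hasDerivAt t ((hΘ i).hasDerivAt t z))
      refine h1.congr_deriv ?_
      simp [hW, hηn, hηe]
    have h2 := convex_univ.norm_image_sub_le_of_norm_hasDerivWithin_le (C := M)
      (fun t _ => (hd t).hasDerivWithinAt) (fun t _ => by rw [norm_neg]; exact hgM i _)
      (mem_univ (0 : ℝ)) (mem_univ t)
    simpa [(hΘ i).zero] using h2
  have hfd : ∀ i z, fderiv ℝ (transport (Θ i) (c i) (r i) τ) z (W i z) =
      r i z - c i z * transport (Θ i) (c i) (r i) τ z := fun i z =>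
    fderiv_transport (hΘ i) (hL i) (hcs i) (hrs i) (hτs z) (Eventually.of_forall (hτ1 i))
  have hfs : ∀ i, ContDiff ℝ ∞ (transport (Θ i) (c i) (r i) τ) := fun i =>
    contDiff_iff_contDiffAt.2 fun z =>
      (smoothNear_transport (hΘ i).contDiff (hcs i) (hrs i) (hτs z)).contDiffAt
  have hf0 : ∀ i z, σ z.2 = 0 → transport (Θ i) (c i) (r i) τ z = 0 := fun i z hz => by
    simp [transport, hτ, hz]
  refine ⟨fun i => transport (Θ i) (c i) (r i) τ, hfs, hf0, ?_, ?_, ?_⟩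
  · intro i u hu
    have h1 : ∀ᶠ z in 𝓝 (((0, 0), u) : PPlane), θ z = 1 :=
      (eventually_nhdsSet_iff_forall.1 hθ1) _ (mem_image_of_mem _ hu)
    filter_upwards [h1, hAE i u hu] with z hz hz'
    have e1 := hfd i z
    have e2 : W i z = (0, kerField (A i) n e z) := by simp [hW, hg, hz, kerField]
    have e3 : c i z = curlCoef (A i) n e z := by simp [hc, hz]
    have e4 : r i z = -(fderiv ℝ (A i) z ((0, 1), 0)) (kerField (A i) n e z) := by
      rw [hz']
      simp [hr, hz]
    rw [e2, e3, e4] at e1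
    exact e1
  · intro i z hz
    refine transport_eq_zero fun s hs => ?_
    have hs' : |s| ≤ |σ z.2| := by
      have := abs_sub_left_of_mem_uIcc hs
      simpa [hτ] using this
    have : χ (Θ i (s, z)).2 = 0 :=
      hz _ ((hΘη i z s).trans (mul_le_mul_of_nonneg_left hs' hM))
    simp [hr, this]
  · intro i j z hz
    -- On the side `0 ≤ σ` the equations are the same for all indices, and the paths from there to
    -- the edge stay on this side; so the solutions agree.
    have hker : ∀ y : PPlane, 0 ≤ σ y.2 → W i y = W j y ∧ c i y = c j y ∧ r i y = r j y := by
      intro y hy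
      have e1 : A i y = A j y := hAA i j y hy
      have e2 : kerField (A i) n e y = kerField (A j) n e y := by rw [kerField, kerField, e1]
      refine ⟨by simp [hW, hg, e1], ?_, ?_⟩
      · by_cases hyK : y ∈ K'
        · have e3 := (hGK y hyK i).2.2.2.2 j hy
          simp only [hc]
          rw [curlCoef, curlCoef, extDeriv₂, extDeriv₂, e2, e1, e3]
        · simp [hc, hθ0 y hyK]
      · simp only [hr]
        rw [e2, hEE i j y hy]
    have hpos : ∀ s ∈ Icc (-σ z.2) 0, 0 ≤ σ (Θ i (s, z)).2 := fun s hs => by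
      rw [hΘσ]; linarith [hs.1]
    have := eq_of_transport_equation (hΘ i) (hcs i).continuous (z := z)
      (f := transport (Θ i) (c i) (r i) τ) (g := transport (Θ j) (c j) (r j) τ)
      (a := -σ z.2) (b := 0) (r' := r i)
      (fun s _ => ⟨(hfs i).differentiable (by simp) _, hfd i _⟩)
      (fun s hs => ⟨(hfs j).differentiable (by simp) _, by
        obtain ⟨e1, e2, e3⟩ := hker _ (hpos s hs)
        rw [e1, e2, e3]
        exact hfd j _⟩) (t₀ := -σ z.2) ⟨le_rfl, by linarith⟩ (by
        have : σ (Θ i (-σ z.2, z)).2 = 0 := by rw [hΘσ]; ring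
        rw [hf0 i _ this, hf0 j _ this]) 0 ⟨by linarith, le_rfl⟩
    simpa [(hΘ i).zero] using this

/-- The field in the kernel of `D` normalized by `A(X) = 1`. -/
noncomputable def levelField (A D : ℝ × ℝ →L[ℝ] ℝ) (n e : ℝ × ℝ) : ℝ × ℝ :=
  (D n * A e - D e * A n)⁻¹ • (D n • e - D e • n)

theorem apply_levelField {A D : ℝ × ℝ →L[ℝ] ℝ} {n e : ℝ × ℝ} (h : D n * A e - D e * A n ≠ 0) :
    A (levelField A D n e) = 1 ∧ D (levelField A D n e) = 0 := by
  simp only [levelField, map_smul, map_sub, smul_eq_mul]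
  exact ⟨inv_mul_cancel₀ h, by ring⟩

/-- Balls are squares with sides parallel and normal to the edge, so a point close to the edge can
leave the ball only lengthwise. -/
theorem dist_eq_max_side {k : Kind} {a : Fin 3} (ha : side k a ≠ 0) (u v : ℝ × ℝ) :
    dist u v = max |side k a u - side k a v| |edgeCoord a u - edgeCoord a v| := by
  rw [Prod.dist_eq, Real.dist_eq, Real.dist_eq]
  have h : ∀ x y : ℝ, |-x + y| = |x - y| := fun x y => by rw [abs_sub_comm]; congr 1; ring
  cases k <;> fin_cases a <;> simp [side, edgeCoord, h, max_comm] at ha ⊢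

end BranchedSurf

namespace BranchedSurf

/-- A flow fixing the zeros of `r` preserves the set `r ≥ 0`. -/
theorem IsFieldFlow.nonneg_of_fixed {X : PPlane → ℝ × ℝ} {Θ : ℝ × PPlane → PPlane}
    (h : IsFieldFlow X Θ) {r : ℝ × ℝ → ℝ} (hr : Continuous r) (h0 : ∀ z : PPlane, r z.2 = 0 → X z = 0)
    {z : PPlane} (hz : 0 ≤ r z.2) (t : ℝ) : 0 ≤ r (Θ (t, z)).2 := by
  by_contra hcon
  have hc : Continuous fun t => r (Θ (t, z)).2 :=
    hr.comp (continuous_snd.comp (h.contDiff.continuous.comp (by fun_prop)))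
  obtain ⟨t', -, ht'⟩ := intermediate_value_uIcc (a := t) (b := 0) hc.continuousOn (by
    simp only [h.flow.zero]
    rw [uIcc_of_le ((not_le.1 hcon).le.trans hz)]
    exact ⟨(not_le.1 hcon).le, hz⟩ : (0 : ℝ) ∈ uIcc _ _)
  have h1 := h.eq_self (u := (Θ (t', z)).2) (s := (Θ (t', z)).1.1) (r := (Θ (t', z)).1.2)
    (fun t => h0 _ ht') (-t')
  have h2 := h.neg_comp t' z
  change Θ (-t', Θ (t', z)) = _ at h1
  rw [h1] at h2
  have h3 : r z.2 = 0 := by rw [← h2]; exact ht'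
  have h4 := h.eq_self (u := z.2) (s := z.1.1) (r := z.1.2) (fun t => h0 _ h3) t
  change Θ (t, z) = _ at h4
  rw [h4] at hcon
  exact hcon h3.ge

set_option maxHeartbeats 1000000 in
/-- The field realizing a solution of the homotopy equation near an edge, which is tangent to the
level sets of `v` on one side of the edge, and of `v'` far from the edge on the other side. -/
theorem exists_edge_field {A : Bool → PPlane → (ℝ × ℝ →L[ℝ] ℝ)} {n e : ℝ × ℝ}
    (hne : ∀ w : ℝ × ℝ, ∃ a b : ℝ, w = a • n + b • e) {σ η : ℝ × ℝ →L[ℝ] ℝ}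
    {u₀ : ℝ × ℝ} (hdist : ∀ u, dist u u₀ = max |σ u| |η u - η u₀|) {r ε ε₀ : ℝ}
    (hε : 0 < ε) (hε₀ : 0 < ε₀) (hεr : ε₀ ≤ r) {v : ℝ × ℝ → ℝ} {v' : Bool → ℝ × ℝ → ℝ}
    (hv : ContDiff ℝ ∞ v) (hv' : ∀ b, ContDiff ℝ ∞ (v' b))
    (hgood : ∀ b, ∀ u ∈ Metric.closedBall u₀ r, SmoothNear (A b) ((0, 0), u) ∧
      A b ((0, 0), u) e ≠ 0 ∧
      fderiv ℝ v u n * A b ((0, 0), u) e - fderiv ℝ v u e * A b ((0, 0), u) n ≠ 0 ∧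
      fderiv ℝ (v' b) u n * A b ((0, 0), u) e - fderiv ℝ (v' b) u e * A b ((0, 0), u) n ≠ 0)
    (hv0 : ∀ b, ∀ u ∈ Metric.closedBall u₀ r, 0 ≤ σ u → 0 ≤ v' b u)
    (hAA : ∀ i j z, 0 ≤ σ z.2 → A i z = A j z)
    {f : Bool → PPlane → ℝ} (hf : ∀ b, ContDiff ℝ ∞ (f b)) (hf0 : ∀ b z, σ z.2 = 0 → f b z = 0)
    (hpde : ∀ b, ∀ u ∈ Metric.closedBall u₀ r, ∀ᶠ z in 𝓝 (((0, 0), u) : PPlane),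
      HomotopyEq (A b) n e (f b) z)
    (hfη : ∀ b z, |σ z.2| < ε₀ → 5 / 8 * r ≤ |η z.2 - η u₀| → f b z = 0)
    (hff : ∀ i j z, 0 ≤ σ z.2 → f i z = f j z) :
    ∃ Y : Bool → PPlane → ℝ × ℝ, (∀ b, ContDiff ℝ ∞ (Y b)) ∧
      (∃ C : Set PPlane, IsCompact C ∧ ∀ b, ∀ z ∉ C, Y b z = 0) ∧
      (∀ b z, z.2 ∉ Metric.closedBall u₀ r → Y b z = 0) ∧ (∀ b z, σ z.2 = 0 → Y b z = 0) ∧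
      (∀ b z, 5 / 8 * r ≤ |η z.2 - η u₀| → Y b z = 0) ∧
      (∀ i j z, 0 ≤ σ z.2 → Y i z = Y j z) ∧ (∀ b z, 0 ≤ σ z.2 → fderiv ℝ v z.2 (Y b z) = 0) ∧
      (∀ b, ∃ C, ∀ z, |fderiv ℝ (v' b) z.2 (Y b z)| ≤ C * |v' b z.2 + ε|) ∧
      ∀ b, ∀ u ∈ Metric.closedBall u₀ r, |σ u| ≤ ε₀ / 4 →
        ∀ᶠ z in 𝓝 (((0, 0), u) : PPlane), GoodFor (A b) (Y b) e z := by
  have hvs : ∀ (z : PPlane), SmoothNear (fun z : PPlane => fderiv ℝ v z.2) z := fun z =>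
    (((hv.fderiv_right (m := ∞) (by simp)).comp contDiff_snd)).smoothNear z
  have hv's : ∀ b (z : PPlane), SmoothNear (fun z : PPlane => fderiv ℝ (v' b) z.2) z := fun b z =>
    ((((hv' b).fderiv_right (m := ∞) (by simp)).comp contDiff_snd)).smoothNear z
  set N : Bool → PPlane → ℝ := fun b z =>
    fderiv ℝ v z.2 n * A b z e - fderiv ℝ v z.2 e * A b z n with hN
  set N' : Bool → PPlane → ℝ := fun b z =>
    fderiv ℝ (v' b) z.2 n * A b z e - fderiv ℝ (v' b) z.2 e * A b z n with hN'
  have hNs : ∀ b z, SmoothNear (A b) z → SmoothNear (N b) z ∧ SmoothNear (N' b) z := fun b z hA =>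
    ⟨(((hvs z).clm_apply (SmoothNear.const n)).mul (hA.clm_apply (SmoothNear.const e))).sub
      (((hvs z).clm_apply (SmoothNear.const e)).mul (hA.clm_apply (SmoothNear.const n))),
    (((hv's b z).clm_apply (SmoothNear.const n)).mul (hA.clm_apply (SmoothNear.const e))).sub
      (((hv's b z).clm_apply (SmoothNear.const e)).mul (hA.clm_apply (SmoothNear.const n)))⟩
  set G : Set PPlane := {z | ∀ b, SmoothNear (A b) z ∧ A b z e ≠ 0 ∧ N b z ≠ 0 ∧ N' b z ≠ 0} with hG
  have hGn : ∀ u ∈ Metric.closedBall u₀ r, G ∈ 𝓝 (((0, 0), u) : PPlane) := by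
    intro u hu
    change ∀ᶠ z in 𝓝 _, ∀ b, _
    rw [eventually_all]
    intro b
    obtain ⟨h1, h2, h3, h4⟩ := hgood b u hu
    exact h1.eventually.and (((h1.clm_apply (SmoothNear.const e)).continuousAt.eventually_ne h2).and
      (((hNs b _ h1).1.continuousAt.eventually_ne h3).and ((hNs b _ h1).2.continuousAt.eventually_ne h4)))
  set K₀ : Set (ℝ × ℝ) := Metric.closedBall u₀ (7 / 8 * r) ∩ {u | |σ u| ≤ ε₀ / 2} with hK₀
  have hK₀c : IsCompact K₀ := (isCompact_closedBall _ _).inter_right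
    (isClosed_le σ.continuous.abs continuous_const)
  set U₀ : Set PPlane := interior G ∩ {z | z.2 ∈ Metric.ball u₀ r ∧ |σ z.2| < ε₀} with hU₀
  have hr0 : 0 < r := hε₀.trans_le hεr
  have hU₀o : IsOpen U₀ := isOpen_interior.inter
    ((Metric.isOpen_ball.preimage continuous_snd).inter (isOpen_lt (σ.continuous.comp continuous_snd).abs continuous_const))
  obtain ⟨θ, C, hθ, hθ1, hC, hCs, hθ0, hθI⟩ := exists_cutoff
    (hK₀c.image (by fun_prop : Continuous fun u : ℝ × ℝ => (((0, 0), u) : PPlane))) hU₀o (by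
      rintro _ ⟨u, ⟨hu1, hu2⟩, rfl⟩
      have hu2 : |σ u| ≤ ε₀ / 2 := hu2
      refine ⟨mem_interior_iff_mem_nhds.2 (hGn u (Metric.closedBall_subset_closedBall
        (by linarith) hu1)), Metric.closedBall_subset_ball (by linarith) hu1, ?_⟩
      change |σ u| < ε₀
      linarith)
  have hCG : ∀ z ∈ C, z ∈ G := fun z hz => interior_subset (hCs hz).1
  set T : Bool → PPlane → ℝ := fun b z => step ε (v' b z.2) with hT
  have hTs : ∀ b z, SmoothNear (T b) z := fun b z =>
    ((contDiff_step ε).comp ((hv' b).comp contDiff_snd)).smoothNear z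
  -- Both level fields are normalized by `A = 1`, so any affine combination keeps this condition.
  -- The interpolation passes from level sets of `v`, used on the whole side `0 ≤ σ` and a little
  -- beyond the edge, to level sets of `v'` where `v' ≤ -ε / 2`.
  set V : Bool → PPlane → ℝ × ℝ := fun b z => T b z • levelField (A b z) (fderiv ℝ v z.2) n e +
    (1 - T b z) • levelField (A b z) (fderiv ℝ (v' b) z.2) n e with hV
  have hVs : ∀ b z, z ∈ G → SmoothNear (V b) z := by
    intro b z hz
    obtain ⟨h1, h2, h3, h4⟩ := hz b
    refine ((hTs b z).smul (SmoothNear.smul ((hNs b z h1).1.inv h3) ?_)).add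
      (((SmoothNear.const 1).sub (hTs b z)).smul (SmoothNear.smul ((hNs b z h1).2.inv h4) ?_))
    · exact (((hvs z).clm_apply (SmoothNear.const n)).smul (SmoothNear.const e)).sub
        (((hvs z).clm_apply (SmoothNear.const e)).smul (SmoothNear.const n))
    · exact (((hv's b z).clm_apply (SmoothNear.const n)).smul (SmoothNear.const e)).sub
        (((hv's b z).clm_apply (SmoothNear.const e)).smul (SmoothNear.const n))
  have hAV : ∀ b z, z ∈ G → A b z (V b z) = 1 := by
    intro b z hz
    obtain ⟨h1, h2, h3, h4⟩ := hz b
    simp only [hV, map_add, map_smul, smul_eq_mul, (apply_levelField h3).1, (apply_levelField h4).1]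
    ring
  set Y : Bool → PPlane → ℝ × ℝ := fun b z => θ z • (f b z • V b z) with hY
  have hYs : ∀ b, ContDiff ℝ ∞ (Y b) := fun b => contDiff_cutoff_smul hθ hC.isClosed hθ0
    fun z hz => ((hf b).smoothNear z).smul (hVs b z (hCG z hz))
  have hY0 : ∀ b, ∀ z ∉ C, Y b z = 0 := fun b z hz => by simp [hY, hθ0 z hz]
  have hYη : ∀ b z, 5 / 8 * r ≤ |η z.2 - η u₀| → Y b z = 0 := by
    intro b z hz
    by_cases hzC : z ∈ C
    · simp [hY, hfη b z (hCs hzC).2.2 hz]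
    · exact hY0 b z hzC
  have hV1 : ∀ b, ∀ z ∈ C, 0 ≤ σ z.2 → V b z = levelField (A b z) (fderiv ℝ v z.2) n e := by
    intro b z hz h0
    have h1 := hv0 b z.2 (Metric.ball_subset_closedBall (hCs hz).2.1) h0
    have : T b z = 1 := step_eq_one hε (by linarith)
    simp [hV, this]
  refine ⟨Y, hYs, ⟨C, hC, hY0⟩, fun b z hz => hY0 b z fun h =>
    hz (Metric.ball_subset_closedBall (hCs h).2.1), fun b z hz => by simp [hY, hf0 b z hz], hYη,
    fun i j z hz => ?_, fun b z hz => ?_, fun b => ?_, fun b u hu hσu => ?_⟩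
  · by_cases hzC : z ∈ C
    · simp only [hY]
      rw [hV1 i z hzC hz, hV1 j z hzC hz, hff i j z hz, hAA i j z hz]
    · rw [hY0 i z hzC, hY0 j z hzC]
  · by_cases hzC : z ∈ C
    · simp only [hY, map_smul]
      rw [hV1 b z hzC hz, (apply_levelField (hCG z hzC b).2.2.1).2]
      simp
    · rw [hY0 b z hzC, map_zero]
  · have hcont : Continuous fun z : PPlane => fderiv ℝ (v' b) z.2 (Y b z) :=
      ((((hv' b).fderiv_right (m := ∞) (by simp)).continuous.comp continuous_snd)).clm_apply
        (hYs b).continuous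
    obtain ⟨C₀, hC₀⟩ := hcont.bounded_above_of_compact_support
      (HasCompactSupport.intro hC fun z hz => by rw [hY0 b z hz, map_zero])
    have hC₀0 : 0 ≤ C₀ := (norm_nonneg _).trans (hC₀ 0)
    -- Where `v' ≤ -ε / 2` the field is tangent to the level sets of `v'`; elsewhere `|v' + ε| ≥ ε /
    -- 2`, and the bound `C₀` on the derivative of `v'` along the field gives this constant.
    refine ⟨2 * C₀ / ε, fun z => ?_⟩
    rcases le_total (v' b z.2) (-(ε / 2)) with h | h
    · have : fderiv ℝ (v' b) z.2 (Y b z) = 0 := by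
        by_cases hzC : z ∈ C
        · have h1 : T b z = 0 := step_eq_zero hε h
          have h2 : V b z = levelField (A b z) (fderiv ℝ (v' b) z.2) n e := by simp [hV, h1]
          simp only [hY, map_smul]
          rw [h2, (apply_levelField (hCG z hzC b).2.2.2).2]
          simp
        · rw [hY0 b z hzC, map_zero]
      rw [this, abs_zero]
      positivity
    · have h1 : ε / 2 ≤ |v' b z.2 + ε| := (by linarith : ε / 2 ≤ v' b z.2 + ε).trans (le_abs_self _)
      refine (hC₀ z).trans ?_
      calc C₀ = 2 * C₀ / ε * (ε / 2) := by field_simp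
        _ ≤ _ := mul_le_mul_of_nonneg_left h1 (by positivity)
  -- Outside the core of the cut-off a point of the thin strip is far away lengthwise. There `f` and
  -- the field both vanish, so `f = A(Y)` holds on the whole strip.
  · have hfY : ∀ᶠ z in 𝓝 (((0, 0), u) : PPlane), f b z = A b z (Y b z) := by
      rcases le_or_gt (dist u u₀) (7 / 8 * r) with hd | hd
      · have h1 : ∀ᶠ z in 𝓝 (((0, 0), u) : PPlane), θ z = 1 :=
          (eventually_nhdsSet_iff_forall.1 hθ1) _ (mem_image_of_mem _
            ⟨Metric.mem_closedBall.2 hd, (by linarith : |σ u| ≤ ε₀ / 2)⟩)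
        filter_upwards [h1, hGn u hu] with z hz hzG
        simp only [hY]
        rw [hz, one_smul, map_smul, hAV b z hzG, smul_eq_mul, mul_one]
      · have h1 : 7 / 8 * r < |η u - η u₀| := by
          rw [hdist] at hd
          rcases lt_max_iff.1 hd with h | h
          · linarith
          · exact h
        have h2 : ∀ᶠ z : PPlane in 𝓝 (((0, 0), u) : PPlane), |σ z.2| < ε₀ :=
          (by fun_prop : ContinuousAt (fun z : PPlane => |σ z.2|) ((0, 0), u)).eventually_lt_const
            (by change |σ u| < ε₀; linarith)
        have h3 : ∀ᶠ z : PPlane in 𝓝 (((0, 0), u) : PPlane), 5 / 8 * r < |η z.2 - η u₀| :=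
          (by fun_prop : ContinuousAt (fun z : PPlane => |η z.2 - η u₀|)
            ((0, 0), u)).eventually_const_lt (by change 5 / 8 * r < |η u - η u₀|; linarith)
        filter_upwards [h2, h3] with z h2 h3
        rw [hYη b z h3.le, hfη b z h2 h3.le, map_zero]
    obtain ⟨h1, h2, -⟩ := hgood b u hu
    exact eventually_goodFor hne h1 ((hYs b).smoothNear _) h2 hfY (hpde b u hu)

end BranchedSurf

namespace BranchedSurf

namespace BranchedSurface

variable {P : Type*} [TopologicalSpace P] {B : BranchedSurface P}

namespace OneForm

set_option maxHeartbeats 2000000 in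
/-- Deformation near a point of an edge transverse to the foliation. -/
theorem exists_edge_deformation [T2Space P] {α : B.OneForm} {c : Fin B.num} {p : Model (B.kind c)}
    (hz : p.1.2 = 0) {a : Fin 3} (ha : side (B.kind c) a ≠ 0) (hpa : side (B.kind c) a p.1.1 = 0)
    (hother : ∀ b, b ≠ a → side (B.kind c) b ≠ 0 → side (B.kind c) b p.1.1 ≠ 0)
    (he : α.coe c p (edgeDir a) ≠ 0) {k : ℝ × ℝ → ℝ} {k' : Bool → ℝ × ℝ → ℝ}
    (hk : ContDiff ℝ ∞ k) (hk' : ∀ b, ContDiff ℝ ∞ (k' b)) (hkp : 0 < k p.1.1)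
    (hkp' : ∀ b, 0 < k' b p.1.1) {O : Set (ℝ × ℝ)} (hO : O ∈ 𝓝 p.1.1) :
    ∃ r > 0, Metric.closedBall p.1.1 r ⊆ O ∧ ∃ ε₁ > 0, ∀ ε > 0, ε ≤ ε₁ → ∀ β τ, IsCurve α β →
      IsCurve α τ → ∃ γ, IsCurve α γ ∧ ∀ᶠ s in 𝓝 0, ∀ U : Set P,
        (∀ u ∈ Metric.closedBall p.1.1 r,
          (0 ≤ side (B.kind c) a u →
            (B.chart c (lift _ 1 u) ∈ U ↔ side (B.kind c) a u * k u ≤ ε)) ∧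
          ∀ b : Bool, side (B.kind c) a u ≤ 0 →
            (B.chart c (lift _ (cond b a 1) u) ∈ U ↔ -ε ≤ side (B.kind c) a u * k' b u)) →
        Conn U (β s) (γ s) ∧
        (∀ x ∈ U, EqAt (β s) (τ s) x → EqAt (γ s) (τ s) x) ∧
        ∀ i, OnSheet p i → ∀ u ∈ Metric.closedBall p.1.1 (r / 4), B.chart c (lift _ i u) ∈ U →
          EqAt (γ s) (τ s) (B.chart c (lift _ i u)) := by
  set σ := side (B.kind c) a with hσ
  set η := edgeCoord a with hη
  set n := edgeNormal (B.kind c) a with hn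
  set e := edgeDir a with he'
  set u₀ := p.1.1 with hu₀
  have hσn : σ n = 1 := side_edgeNormal ha
  have hσe : σ e = 0 := side_edgeDir _ _
  have hηn : η n = 0 := edgeCoord_edgeNormal _ _
  have hηe : η e = 1 := edgeCoord_edgeDir _
  have hne : ∀ w : ℝ × ℝ, ∃ a b : ℝ, w = a • n + b • e := fun w => ⟨_, _, eq_side_smul_add ha w⟩
  have hdist : ∀ u, dist u u₀ = max |σ u| |η u - η u₀| := fun u => by
    rw [dist_eq_max_side ha, hpa, sub_zero]
  have h1a : (1 : Fin 3) ≠ a := fun h => ha (by rw [hσ, ← h]; exact side_one _)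
  set sh : Bool → Fin 3 := fun b => cond b a 1 with hsh
  have hside : ∀ b u, 0 ≤ σ u → 0 ≤ side (B.kind c) (sh b) u := by
    intro b u hu
    cases b
    · simp [hsh, side_one]
    · exact hu
  have hco : ∀ i j u, 0 ≤ σ u → u ∈ coincide (B.kind c) (sh i) (sh j) := fun i j u hu =>
    mem_coincide_iff.2 (Or.inr ⟨hside i u hu, hside j u hu⟩)
  have hp : ∀ b, OnSheet p (sh b) := fun b => (onSheet_iff_side hz).2 (hside b _ hpa.ge)
  have hrep : ∀ b, α.rep c (sh b) u₀ = α.coe c p := fun b => congrArg (α.coe c) (hp b).lift_eq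
  set v : ℝ × ℝ → ℝ := fun u => σ u * k u with hv
  set v' : Bool → ℝ × ℝ → ℝ := fun b u => σ u * k' b u with hv'
  have hvs : ContDiff ℝ ∞ v := σ.contDiff.mul hk
  have hvs' : ∀ b, ContDiff ℝ ∞ (v' b) := fun b => σ.contDiff.mul (hk' b)
  have hdv : ∀ {g : ℝ × ℝ → ℝ}, ContDiff ℝ ∞ g → ∀ w, fderiv ℝ (fun u => σ u * g u) u₀ w =
      g u₀ * σ w := by
    intro g hg w
    rw [fderiv_fun_mul σ.differentiableAt (hg.differentiable (by simp) _), hpa]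
    simp
  -- Any number strictly above the slope of the kernel at `p` would do.
  set M : ℝ := |α.coe c p n| / |α.coe c p e| + 1 with hM
  have hM0 : 0 ≤ M := by positivity
  obtain ⟨κ, hκ, hκk, hκk'⟩ : ∃ κ > 0, κ < k u₀ ∧ ∀ b, κ < k' b u₀ := by
    refine ⟨min (k u₀) (min (k' true u₀) (k' false u₀)) / 2, ?_, ?_, fun b => ?_⟩
    · exact half_pos (lt_min hkp (lt_min (hkp' _) (hkp' _)))
    · have := min_le_left (k u₀) (min (k' true u₀) (k' false u₀)); linarith
    · have h1 := min_le_right (k u₀) (min (k' true u₀) (k' false u₀))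
      have h2 := hkp' b
      cases b
      · have := min_le_right (k' true u₀) (k' false u₀); linarith
      · have := min_le_left (k' true u₀) (k' false u₀); linarith
  have hev : ∀ᶠ u in 𝓝 u₀, (∀ b, α.rep c (sh b) u e ≠ 0 ∧
      |α.rep c (sh b) u n| < M * |α.rep c (sh b) u e| ∧
      fderiv ℝ v u n * α.rep c (sh b) u e - fderiv ℝ v u e * α.rep c (sh b) u n ≠ 0 ∧
      fderiv ℝ (v' b) u n * α.rep c (sh b) u e - fderiv ℝ (v' b) u e * α.rep c (sh b) u n ≠ 0) ∧
      (κ < k u ∧ ∀ b, κ < k' b u) ∧ (∀ j, j ≠ a → side (B.kind c) j ≠ 0 →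
        (OnSheet p j → 0 < side (B.kind c) j u) ∧ (¬ OnSheet p j → side (B.kind c) j u < 0)) ∧
      (∀ i j, OnSheet p i → ¬ OnSheet p j → u ∉ coincide (B.kind c) i j) ∧ u ∈ O := by
    refine .and ?_ (.and ?_ (.and ?_ ((eventually_notMem_coincide p).and hO)))
    · rw [eventually_all]
      intro b
      have c1 : ∀ w, ContinuousAt (fun u => α.rep c (sh b) u w) u₀ := fun w =>
        ((α.contDiff_rep c (sh b)).continuous.clm_apply continuous_const).continuousAt
      have c2 : ∀ w, ContinuousAt (fun u => fderiv ℝ v u w) u₀ := fun w =>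
        ((hvs.continuous_fderiv (by simp)).clm_apply continuous_const).continuousAt
      have c3 : ∀ w, ContinuousAt (fun u => fderiv ℝ (v' b) u w) u₀ := fun w =>
        (((hvs' b).continuous_fderiv (by simp)).clm_apply continuous_const).continuousAt
      refine ((c1 e).eventually_ne (by rw [hrep]; exact he)).and
        (((c1 n).abs.eventually_lt (continuousAt_const.mul (c1 e).abs) ?_).and
        (((((c2 n).mul (c1 e)).sub ((c2 e).mul (c1 n))).eventually_ne ?_).and
        ((((c3 n).mul (c1 e)).sub ((c3 e).mul (c1 n))).eventually_ne ?_)))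
      · change |α.rep c (sh b) u₀ n| < M * |α.rep c (sh b) u₀ e|
        rw [hrep, hM, add_mul, div_mul_cancel₀ _ (abs_ne_zero.2 he), one_mul]
        linarith [abs_pos.2 he]
      · change fderiv ℝ v u₀ n * α.rep c (sh b) u₀ e - fderiv ℝ v u₀ e * α.rep c (sh b) u₀ n ≠ 0
        rw [hrep, hdv hk, hdv hk, hσn, hσe]
        simp [hkp.ne', he]
      · change fderiv ℝ (v' b) u₀ n * α.rep c (sh b) u₀ e -
          fderiv ℝ (v' b) u₀ e * α.rep c (sh b) u₀ n ≠ 0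
        rw [hrep, hdv (hk' b), hdv (hk' b), hσn, hσe]
        simp [(hkp' b).ne', he]
    · refine (hk.continuous.continuousAt.eventually_const_lt hκk).and ?_
      rw [eventually_all]
      exact fun b => (hk' b).continuous.continuousAt.eventually_const_lt (hκk' b)
    · rw [eventually_all]
      intro j
      by_cases hj : j = a
      · exact Eventually.of_forall fun _ h => absurd hj h
      by_cases hj0 : side (B.kind c) j = 0
      · exact Eventually.of_forall fun _ _ h => absurd hj0 h
      have hcj : ContinuousAt (side (B.kind c) j) u₀ := (side (B.kind c) j).continuous.continuousAt
      by_cases hpj : OnSheet p j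
      · have h1 := lt_of_le_of_ne ((onSheet_iff_side hz).1 hpj) (hother j hj hj0).symm
        filter_upwards [hcj.eventually_const_lt h1] with u hu _ _
        exact ⟨fun _ => hu, fun h => absurd hpj h⟩
      · have h1 : side (B.kind c) j u₀ < 0 := not_le.1 fun h => hpj ((onSheet_iff_side hz).2 h)
        filter_upwards [hcj.eventually_lt_const h1] with u hu _ _
        exact ⟨fun h => absurd h hpj, fun _ => hu⟩
  obtain ⟨r, hr, hb⟩ := Metric.nhds_basis_closedBall.eventually_iff.1 hev
  set K := Metric.closedBall u₀ r with hK
  have hKc : IsCompact K := isCompact_closedBall _ _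
  -- Then `M * ε₀ ≤ r / 16`: within distance `ε₀` of the edge a kernel curve drifts by at most `r /
  -- 16` on its way to the edge, so a change of form supported in the ball of radius `r / 2` has no
  -- effect beyond `5 / 8 * r`.
  set ε₀ : ℝ := r / (16 * (M + 1)) with hε₀
  have hε₀0 : 0 < ε₀ := by positivity
  have hε₀M : M * ε₀ ≤ r / 16 := by
    rw [hε₀, mul_div_assoc', div_le_div_iff₀ (by positivity) (by norm_num)]
    nlinarith
  have hε₀r : ε₀ ≤ r := by
    rw [hε₀, div_le_iff₀ (by positivity)]
    nlinarith
  -- `k` and `k'` exceed `κ`, so a point of `U` over the ball satisfies `κ * |σ| ≤ ε`. The bound on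
  -- `ε` thus gives `|σ| ≤ ε₀ / 4`, where the homotopy equation is available.
  refine ⟨r, hr, fun u hu => (hb hu).2.2.2.2, κ * ε₀ / 4, by positivity, fun ε hε hεε β τ hβ hτ => ?_⟩
  -- sheets through `p` coincide near `p` with one of two sheets
  have hcoj : ∀ j, OnSheet p j → ∀ u ∈ K, u ∈ coincide (B.kind c) j (sh (decide (j = a))) := by
    intro j hj u hu
    by_cases hja : j = a
    · simp [hsh, hja, coincide_self]
    · have : sh (decide (j = a)) = 1 := by simp [hsh, hja]
      rw [this]
      refine mem_coincide_iff.2 (Or.inr ⟨?_, by simp [side_one]⟩)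
      by_cases hj0 : side (B.kind c) j = 0
      · simp [hj0]
      · exact (((hb hu).2.2.1 j hja hj0).1 hj).le
  -- `χ` localizes the change of the form and `φ` the rescaling of the pull-back; `φ` is `1` on a
  -- larger ball, beyond which nothing moves near the edge.
  obtain ⟨χ, Kχ, hχ, hχ1, -, hKχ, hχ0, -⟩ := exists_cutoff
    (isCompact_closedBall u₀ (r / 4)) (U := Metric.ball u₀ (r / 2)) Metric.isOpen_ball
    (Metric.closedBall_subset_ball (by linarith))
  obtain ⟨φ, Kφ, hφ, hφ1, -, hKφ, hφ0, -⟩ := exists_cutoff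
    (isCompact_closedBall u₀ (3 / 4 * r)) (U := Metric.ball u₀ r) Metric.isOpen_ball
    (Metric.closedBall_subset_ball (by linarith))
  have hφK : ∀ u ∉ K, φ u = 0 := fun u hu => hφ0 u fun h => hu (Metric.ball_subset_closedBall (hKφ h))
  have hχK : ∀ u, r / 2 ≤ dist u u₀ → χ u = 0 := fun u hu => hχ0 u fun h =>
    (not_lt.2 hu) (Metric.mem_ball.1 (hKχ h))
  have hχη : ∀ u, r / 2 ≤ |η u - η u₀| → χ u = 0 := fun u hu => hχK u (by
    rw [hdist]; exact hu.trans (le_max_right _ _))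
  set A : Bool → PPlane → (ℝ × ℝ →L[ℝ] ℝ) := fun b => homot β τ c (sh b) χ with hA
  have hAs : ∀ b u, SmoothNear (A b) ((0, 0), u) := fun b u => smoothNear_homot hβ hτ hχ u
  have hA0 : ∀ b u, A b ((0, 0), u) = α.rep c (sh b) u := fun b u => by
    simp only [hA]; rw [homot_self, hβ.1]
  have hAA : ∀ i j z, 0 ≤ σ z.2 → A i z = A j z := fun i j z h => homot_eq β τ (hco i j _ h)
  obtain ⟨f, hf, hf0, hpde, hfχ, hff⟩ := exists_edge_solutions (A := A)
    (E := fun b z => diffQuot β τ c (sh b) (z.1.1, z.2)) hχ hσn hσe hηn hηe hKc hM0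
    (fun b u _ => hAs b u)
    (fun b u _ => (smoothNear_diffQuot hβ hτ u).comp'
      ((by fun_prop : ContDiff ℝ ∞ fun z : PPlane => (z.1.1, z.2)).smoothNear _) rfl)
    (fun b u _ => (hAs b u).eventually.mono fun z hz => fderiv_homot hz.differentiableAt)
    (fun b u hu => by rw [hA0]; exact ⟨((hb hu).1 b).1, ((hb hu).1 b).2.1⟩) hAA
    (fun i j z h => diffQuot_eq β τ (z := (z.1.1, z.2)) (hco i j _ h))
    (fun i j u _ => by
      filter_upwards [(hAs i u).eventually, (hAs j u).eventually] with z h1 h2 h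
      exact fderiv_homot_eq h1.differentiableAt h2.differentiableAt (hco i j _ h))
  obtain ⟨Y, hYs, ⟨C, hC, hYC⟩, hYK, hYσ, hYη, hYY, hYv, hYv', hgood⟩ := exists_edge_field hne hdist
    hε hε₀0 hε₀r hvs hvs'
    (fun b u hu => by
      obtain ⟨h1, h2, h3, h4⟩ := (hb hu).1 b
      rw [hA0]
      exact ⟨hAs b u, h1, h3, h4⟩)
    (fun b u hu h => mul_nonneg h (hκ.le.trans ((hb hu).2.1.2 b).le)) hAA hf hf0 hpde
    (fun b z h1 h2 => hfχ b z fun w hw => hχη w (by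
      have h3 : M * |σ z.2| ≤ r / 16 := (mul_le_mul_of_nonneg_left h1.le hM0).trans hε₀M
      have h4 : |η z.2 - η u₀| ≤ |η w - η z.2| + |η w - η u₀| := by
        rw [abs_sub_comm (η w) (η z.2)]; exact abs_sub_le _ _ _
      linarith)) hff
  -- the field on all sheets
  set X : Fin 3 → PPlane → ℝ × ℝ := fun j => open Classical in
    if OnSheet p j then Y (decide (j = a)) else 0 with hX
  have hXon : ∀ j, OnSheet p j → X j = Y (decide (j = a)) := fun j hj => by simp only [hX, if_pos hj]
  have hXoff : ∀ j, ¬ OnSheet p j → X j = 0 := fun j hj => by simp only [hX, if_neg hj]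
  have hXsh : ∀ b, X (sh b) = Y b := fun b => by
    rw [hXon _ (hp b)]
    cases b <;> simp [hsh, h1a]
  have hXK : ∀ j z, z.2 ∉ K → X j z = 0 := by
    intro j z h
    by_cases hj : OnSheet p j
    · rw [hXon j hj]; exact hYK _ z h
    · rw [hXoff j hj]; rfl
  have hflow : ∀ j, ∃ Θ, IsFieldFlow (X j) Θ := by
    intro j
    refine exists_isFieldFlow ?_ hC fun z hz => ?_
    · by_cases hj : OnSheet p j
      · rw [hXon j hj]; exact hYs _
      · rw [hXoff j hj]; exact contDiff_const
    · by_cases hj : OnSheet p j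
      · rw [hXon j hj]; exact hYC _ z hz
      · rw [hXoff j hj]; rfl
  choose Θ hΘ using hflow
  have hp1 : OnSheet p 1 := hp false
  have hX1 : X 1 = Y false := hXsh false
  have hXa : X a = Y true := hXsh true
  have hXside : ∀ j z, side (B.kind c) j ≠ 0 → side (B.kind c) j z.2 = 0 → X 1 z = 0 := by
    intro j z hj0 hj
    by_cases hzK : z.2 ∈ K
    · by_cases hja : j = a
      · subst hja
        rw [hX1]
        exact hYσ _ z hj
      · have := (hb hzK).2.2.1 j hja hj0
        by_cases hpj : OnSheet p j
        · exact absurd hj (this.1 hpj).ne'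
        · exact absurd hj (this.2 hpj).ne
    · exact hXK 1 z hzK
  have hfield : SheetField (B.kind c) K X Θ := by
    refine SheetField.of_side hΘ hXK (fun j z h => ?_) (fun j t z h => ?_)
    · by_cases hja : j = a
      · subst hja
        rw [hXa, hX1]
        exact hYY _ _ z h
      · by_cases hpj : OnSheet p j
        · rw [hXon j hpj, hX1]
          simp [hja]
        · by_cases hzK : z.2 ∈ K
          · have hj0 : side (B.kind c) j ≠ 0 := fun h0 => hpj ((onSheet_iff_side hz).2 (by simp [h0]))
            exact absurd h (not_le.2 (((hb hzK).2.2.1 j hja hj0).2 hpj))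
          · rw [hXK j z hzK, hXK 1 z hzK]
    · by_cases hj0 : side (B.kind c) j = 0
      · simp [hj0]
      · exact (hΘ 1).nonneg_of_fixed (side (B.kind c) j).continuous (fun z => hXside j z hj0) h t
  set χ' : Fin 3 → ℝ × ℝ → ℝ := fun j => open Classical in if OnSheet p j then χ else 0 with hχ'
  set φ' : Fin 3 → ℝ × ℝ → ℝ := fun j => open Classical in if OnSheet p j then φ else 0 with hφ'
  have hon : ∀ u ∈ K, ∀ i j, u ∈ coincide (B.kind c) i j → (OnSheet p i ↔ OnSheet p j) :=
    fun u hu i j huc => ⟨fun hi => by_contra fun hj => (hb hu).2.2.2.1 i j hi hj huc,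
      fun hj => by_contra fun hi => (hb hu).2.2.2.1 j i hj hi (coincide_comm _ _ _ ▸ huc)⟩
  have hcut : ∀ g : ℝ × ℝ → ℝ, (∀ u ∉ K, g u = 0) → ∀ i j, ∀ u ∈ coincide (B.kind c) i j,
      (open Classical in if OnSheet p i then g else 0) u = (open Classical in if OnSheet p j then g else 0) u := by
    intro g hg i j u hu
    by_cases huK : u ∈ K
    · rw [propext (hon u huK i j hu)]
    · have : ∀ i, (open Classical in if OnSheet p i then g else 0) u = 0 := fun i => by
        split_ifs
        · exact hg u huK
        · rfl
      rw [this, this]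
  have hχK' : ∀ u ∉ K, χ u = 0 := fun u hu => hχK u (by
    have := not_le.1 fun h => hu (Metric.mem_closedBall.2 h); linarith)
  obtain ⟨γ, h1, h2, h3, h4, h5⟩ := hβ.exists_moser hKc hfield (θ := φ')
    (fun j => by
      by_cases hj : OnSheet p j
      · simp only [hφ', if_pos hj]; exact hφ
      · simp only [hφ', if_neg hj]; exact contDiff_const)
    (fun j u hu => by
      by_cases hj : OnSheet p j
      · simp only [hφ', if_pos hj]; exact hφK u hu
      · simp only [hφ', if_neg hj]; rfl)
    (hcut φ hφK) (A := fun j => homot β τ c j (χ' j)) (m := e)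
    (fun j u _ => smoothNear_homot hβ hτ (by
      by_cases hj : OnSheet p j
      · simp only [hχ', if_pos hj]; exact hχ
      · simp only [hχ', if_neg hj]; exact contDiff_const) u)
    (fun j u _ => by rw [homot_self, hβ.1])
    (fun i j u hu s => by
      have h := hcut χ hχK' i j u hu
      rw [homot_zero hβ hτ, homot_zero hβ hτ, (β s).rep_eq_of_mem_coincide hu,
        (τ s).rep_eq_of_mem_coincide hu]
      simp only [hχ']
      rw [h])
    (fun j => by
      by_cases hj : OnSheet p j
      · right
        intro u hu
        rw [α.rep_eq_of_mem_coincide (hcoj j hj u hu)]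
        exact ((hb hu).1 _).1
      · left
        intro u
        simp only [hφ', if_neg hj]
        rfl)
  have hχsh : ∀ b, χ' (sh b) = χ := fun b => by simp only [hχ', if_pos (hp b)]
  have hφsh : ∀ b, φ' (sh b) = φ := fun b => by simp only [hφ', if_pos (hp b)]
  -- For small `s` the trajectories which start in the strip `|σ| ≤ ε₀ / 4` remain where the
  -- homotopy equation holds.
  have htr : ∀ᶠ s in 𝓝 (0 : ℝ), ∀ b, ∀ u ∈ K ∩ {u | |σ u| ≤ ε₀ / 4}, ∀ t ∈ uIcc 0 s,
      Θ (sh b) (t, ((s, 0), u)) ∈ interior {z | GoodFor (A b) (Y b) e z} := by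
    rw [eventually_all]
    intro b
    refine eventually_trajectory (hΘ (sh b))
      (hKc.inter_right (isClosed_le σ.continuous.abs continuous_const)) isOpen_interior fun u hu => ?_
    exact mem_interior_iff_mem_nhds.2 (hgood b u hu.1 hu.2)
  refine ⟨γ, h1, ?_⟩
  filter_upwards [h2, h4, h5, htr] with s h2 h4 h5 htr U hU
  have hliftj : ∀ j, OnSheet p j → ∀ u ∈ K, lift (B.kind c) j u = lift (B.kind c) (sh (decide (j = a))) u :=
    fun j hj u hu => lift_eq_lift_iff.2 ⟨rfl, hcoj j hj u hu⟩
  have hlift1 : ∀ b u, 0 ≤ σ u → lift (B.kind c) (sh b) u = lift (B.kind c) 1 u := fun b u hu =>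
    lift_eq_lift_iff.2 ⟨rfl, hco b false u hu⟩
  -- the form near the edge
  have hkey : ∀ b, ∀ u ∈ K, B.chart c (lift _ (sh b) u) ∈ U → (γ s).rep c (sh b) u =
      (β s).rep c (sh b) u + χ u • ((τ s).rep c (sh b) u - (β s).rep c (sh b) u) := by
    intro b u hu huU
    have hσu : |σ u| ≤ ε₀ / 4 := by
      have hκu := (hb hu).2.1
      rcases le_total 0 (σ u) with h | h
      · rw [hlift1 b u h] at huU
        have h6 := ((hU u hu).1 h).1 huU
        rw [abs_of_nonneg h]
        have h7 : σ u * κ ≤ σ u * k u := mul_le_mul_of_nonneg_left hκu.1.le h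
        have h8 : κ * σ u ≤ κ * (ε₀ / 4) := by linarith
        exact le_of_mul_le_mul_left h8 hκ
      · have h6 := ((hU u hu).2 b h).1 huU
        rw [abs_of_nonpos h]
        have h7 : σ u * k' b u ≤ σ u * κ := mul_le_mul_of_nonpos_left (hκu.2 b).le h
        have h8 : κ * (-σ u) ≤ κ * (ε₀ / 4) := by linarith
        exact le_of_mul_le_mul_left h8 hκ
    have h6 := h4 (sh b) u (by
        have e1 : Θ (sh b) (s, ((s, 0), u)) = ((s, s), (Θ (sh b) (s, ((s, 0), u))).2) :=
          Prod.ext (by rw [(hΘ (sh b)).fst, zero_add]) rfl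
        conv_lhs => rw [e1]
        exact homot_self s _) (fun t ht => by
        rw [hχsh, hXsh]
        have hg : Θ (sh b) (t, ((s, 0), u)) ∈ {z | GoodFor (A b) (Y b) e z} :=
          interior_subset (htr b u ⟨hu, hσu⟩ t ht)
        exact hg) (by
        rw [hφsh, hχsh]
        rcases le_or_gt (dist u u₀) (3 / 4 * r) with hd | hd
        · left
          exact (eventually_nhdsSet_iff_forall.1 hφ1 u (Metric.mem_closedBall.2 hd)).self_of_nhds
        · right
          have hηu : 3 / 4 * r < |η u - η u₀| := by
            rw [hdist] at hd
            rcases lt_max_iff.1 hd with h | h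
            · linarith
            · exact h
          have hev : ∀ᶠ w in 𝓝 u, 5 / 8 * r < |η w - η u₀| :=
            ((η.continuous.sub continuous_const).abs.continuousAt).eventually_const_lt
              (lt_trans (by linarith) hηu)
          filter_upwards [hev] with w hw
          refine ⟨?_, ?_⟩
          · rw [(hΘ (sh b)).eq_self fun t => by rw [hXsh]; exact hYη b _ hw.le]
          · rw [homot_zero hβ hτ, homot_self, hχη w (by linarith), zero_smul, add_zero])
    rw [h6, homot_zero hβ hτ, hχsh]
  refine ⟨h2 U fun j t z hzU => ?_, fun x hx hβτ => ?_, fun i hi u hu huU => ?_⟩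
  · -- invariance
    by_cases hj : OnSheet p j
    · by_cases hzK : z.2 ∈ K
      · have hmem := (hΘ j).mem_of_mem (hXK j) hzK t
        rw [hliftj j hj _ hzK] at hzU
        rw [hliftj j hj _ hmem]
        set b := decide (j = a) with hbdef
        have hXj : X j = Y b := hXon j hj
        have hXσ : ∀ z : PPlane, σ z.2 = 0 → X j z = 0 := fun z h => by rw [hXj]; exact hYσ b z h
        rcases le_total 0 (σ z.2) with h | h
        · have hpos : ∀ t, 0 ≤ σ (Θ j (t, z)).2 := fun t =>
            (hΘ j).nonneg_of_fixed σ.continuous hXσ h t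
          rw [hlift1 b _ h, (hU _ hzK).1 h] at hzU
          rw [hlift1 b _ (hpos t), (hU _ hmem).1 (hpos t)]
          -- On the one-sheeted side `U` is a sublevel set of `v`, which is constant along
          -- trajectories; on the other side the estimate `hYv'` keeps `{v' ≥ -ε}`.
          have hd : ∀ t, HasDerivAt (fun t => v (Θ j (t, z)).2) 0 t := fun t => by
            have := (hvs.differentiable (by simp) _).hasFDerivAt.comp_hasDerivAt t
              ((hΘ j).hasDerivAt_snd t z)
            refine this.congr_deriv ?_
            rw [hXj]
            exact hYv b _ (hpos t)
          have := is_const_of_deriv_eq_zero (fun t => (hd t).differentiableAt) (fun t => (hd t).deriv) t 0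
          simp only [(hΘ j).flow.zero] at this
          exact this.le.trans hzU
        · have hneg : σ (Θ j (t, z)).2 ≤ 0 := by
            have := (hΘ j).nonneg_of_fixed (r := fun u => -σ u) σ.continuous.neg
              (fun z h => hXσ z (neg_eq_zero.1 h)) (neg_nonneg.2 h) t
            linarith
          have hzU' := ((hU _ hzK).2 b h).1 hzU
          refine ((hU _ hmem).2 b hneg).2 ?_
          obtain ⟨C', hC'⟩ := hYv' b
          have := (hΘ j).nonneg (r := fun u => v' b u + ε) (((hvs' b).differentiable (by simp)).add_const ε)
            (C := C') (z := z) (fun z => by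
              rw [fderiv_add_const, hXj]
              exact hC' z) (by simp only [hv']; linarith) t
          simp only [hv'] at this
          linarith
      · have := (hΘ j).eq_self (u := z.2) (s := z.1.1) (r := z.1.2) (fun t => hXK j _ hzK) t
        change Θ j (t, z) = _ at this
        rwa [this]
    · have := (hΘ j).eq_self (u := z.2) (s := z.1.1) (r := z.1.2) (fun t => by rw [hXoff j hj]; rfl) t
      change Θ j (t, z) = _ at this
      rwa [this]
  · by_cases hbox : x ∈ B.box c K
    · obtain ⟨q, hq, rfl⟩ := hbox
      have hq : q.1.1 ∈ K := hq
      obtain ⟨i, hi⟩ := exists_onSheet q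
      have hqβ : (β s).rep c i q.1.1 = (τ s).rep c i q.1.1 := by
        have := hβτ c q rfl
        rwa [← hi.lift_eq] at this
      rw [← hi.lift_eq] at hx ⊢
      by_cases hj : OnSheet p i
      · rw [hliftj i hj _ hq] at hx ⊢
        have hc := hcoj i hj _ hq
        rw [(β s).rep_eq_of_mem_coincide hc, (τ s).rep_eq_of_mem_coincide hc] at hqβ
        -- The new form is `β + χ (τ - β)`, so wherever `β s` already agrees with `τ s` it still
        -- does: earlier agreements survive.
        refine eqAt_of_chart ((hkey _ _ hq hx).trans ?_)
        rw [hqβ, sub_self, smul_zero, add_zero]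
        rfl
      · refine eqAt_of_chart ((h5 i q.1.1 (by simp only [hφ', if_neg hj]; rfl) ?_).trans hqβ)
        refine Eventually.of_forall fun w => ?_
        rw [(hΘ i).eq_self fun t => by rw [hXoff i hj]; rfl]
    · exact fun d q hq => (h3 s x hbox d q hq).trans (hβτ d q hq)
  · have huK : u ∈ K := Metric.closedBall_subset_closedBall (by linarith) hu
    rw [hliftj i hi u huK] at huU ⊢
    refine eqAt_of_chart ((hkey _ _ huK huU).trans ?_)
    rw [(eventually_nhdsSet_iff_forall.1 hχ1 u hu).self_of_nhds, one_smul, add_sub_cancel]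
    rfl

end OneForm

end BranchedSurface

end BranchedSurf

namespace BranchedSurf

/-! ### Defining functions of the singular set -/

theorem SmoothNear.abs {E : Type*} [NormedAddCommGroup E] [NormedSpace ℝ E] {f : E → ℝ} {x : E}
    (hf : SmoothNear f x) (h0 : f x ≠ 0) : SmoothNear (fun y => |f y|) x := by
  filter_upwards [hf, hf.continuousAt.eventually_ne h0] with y h1 h2
  exact (contDiffAt_abs h2).comp y h1

/-- Along the edge through `p` the function `f` vanishes, and is on each side of it the product of
the distance and a smooth nonnegative function, which is positive at `p` if `s` holds. -/
def EdgeForm {k : Kind} (f : Model k → ℝ) (p : Model k) (s : Prop) : Prop :=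
  ∀ a, side k a ≠ 0 → side k a p.1.1 = 0 → ∀ i, OnSheet p i → ∃ κ κ' : ℝ × ℝ → ℝ,
    SmoothNear κ p.1.1 ∧ SmoothNear κ' p.1.1 ∧ 0 ≤ κ p.1.1 ∧ 0 ≤ κ' p.1.1 ∧
    (s → 0 < κ p.1.1 ∧ 0 < κ' p.1.1) ∧ ∀ᶠ u in 𝓝 p.1.1,
      (0 ≤ side k a u → f (lift k i u) = side k a u * κ u) ∧
      (side k a u ≤ 0 → f (lift k i u) = -(side k a u * κ' u))

section

variable {k : Kind} {f g : Model k → ℝ} {p : Model k} {s t : Prop}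

theorem EdgeForm.mono (h : EdgeForm f p s) (hst : t → s) : EdgeForm f p t := by
  intro a ha hpa i hi
  obtain ⟨κ, κ', h1, h2, h3, h4, h5, h6⟩ := h a ha hpa i hi
  exact ⟨κ, κ', h1, h2, h3, h4, fun ht => h5 (hst ht), h6⟩

theorem EdgeForm.of_eventually_zero (h : ∀ᶠ q in 𝓝 p, f q = 0) (hs : ¬ s) : EdgeForm f p s := by
  intro a ha hpa i hi
  have : Tendsto (fun u => lift k i u) (𝓝 p.1.1) (𝓝 p) := by
    have h := (continuous_lift k i).tendsto p.1.1
    rwa [hi.lift_eq] at h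
  refine ⟨fun _ => 0, fun _ => 0, SmoothNear.const 0, SmoothNear.const 0, le_rfl, le_rfl,
    fun h => absurd h hs, ?_⟩
  filter_upwards [this.eventually h] with u hu
  simp [hu]

theorem EdgeForm.add (hf : EdgeForm f p s) (hg : EdgeForm g p t) :
    EdgeForm (fun q => f q + g q) p (s ∨ t) := by
  intro a ha hpa i hi
  obtain ⟨κ, κ', h1, h2, h3, h4, h5, h6⟩ := hf a ha hpa i hi
  obtain ⟨κ₂, κ₂', g1, g2, g3, g4, g5, g6⟩ := hg a ha hpa i hi
  refine ⟨_, _, h1.add g1, h2.add g2, add_nonneg h3 g3, add_nonneg h4 g4, ?_, ?_⟩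
  · rintro (h | h)
    · exact ⟨add_pos_of_pos_of_nonneg (h5 h).1 g3, add_pos_of_pos_of_nonneg (h5 h).2 g4⟩
    · exact ⟨add_pos_of_nonneg_of_pos h3 (g5 h).1, add_pos_of_nonneg_of_pos h4 (g5 h).2⟩
  · filter_upwards [h6, g6] with u e1 e2
    refine ⟨fun h => ?_, fun h => ?_⟩
    · rw [e1.1 h, e2.1 h]; ring
    · rw [e1.2 h, e2.2 h]; ring

/-- Strict positivity of one summand suffices because the others are nonnegative. So a sum of
cut-off local defining functions still vanishes to exactly first order on each side of the edge. -/
theorem EdgeForm.sum {ι : Type*} (F : Finset ι) {f : ι → Model k → ℝ} {s : ι → Prop}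
    (h : ∀ i ∈ F, EdgeForm (f i) p (s i)) :
    EdgeForm (fun q => ∑ i ∈ F, f i q) p (∃ i ∈ F, s i) := by
  classical
  induction F using Finset.induction_on with
  | empty => exact .of_eventually_zero (by simp) (by simp)
  | insert a F ha ih =>
    have h1 := (h a (Finset.mem_insert_self a F)).add (ih fun i hi => h i (Finset.mem_insert_of_mem hi))
    simp only [Finset.sum_insert ha]
    exact h1.mono (by simp)

theorem EdgeForm.mul {b : Model k → ℝ} (hf : EdgeForm f p s) (hb0 : 0 ≤ b p)
    (hb : ∀ i, OnSheet p i → SmoothNear (fun u => b (lift k i u)) p.1.1) :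
    EdgeForm (fun q => b q * f q) p (s ∧ 0 < b p) := by
  intro a ha hpa i hi
  obtain ⟨κ, κ', h1, h2, h3, h4, h5, h6⟩ := hf a ha hpa i hi
  have e : b (lift k i p.1.1) = b p := by rw [hi.lift_eq]
  refine ⟨_, _, (hb i hi).mul h1, (hb i hi).mul h2, mul_nonneg (e ▸ hb0) h3, mul_nonneg (e ▸ hb0) h4,
    fun h => ⟨mul_pos (e ▸ h.2) (h5 h.1).1, mul_pos (e ▸ h.2) (h5 h.1).2⟩, ?_⟩
  filter_upwards [h6] with u e1
  refine ⟨fun h => ?_, fun h => ?_⟩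
  · rw [e1.1 h]; ring
  · rw [e1.2 h]; ring

/-- On the other sheets the side functions are nonnegative near a point which is no vertex. -/
theorem eventually_side_nonneg (hp : p.1.2 = 0) (hv : ¬ IsVertexAt k p.1) {a : Fin 3} (ha : side k a ≠ 0)
    (hpa : side k a p.1.1 = 0) : ∀ᶠ u in 𝓝 p.1.1, ∀ i, i ≠ a → OnSheet p i → 0 ≤ side k i u := by
  rw [eventually_all]
  intro i
  by_cases h : i ≠ a ∧ OnSheet p i ∧ side k i ≠ 0
  · obtain ⟨h1, h2, h3⟩ := h
    have h4 : 0 < side k i p.1.1 := lt_of_le_of_ne ((onSheet_iff_side hp).1 h2)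
      fun h => hv (isVertexAt_of_side hp h1 h3 ha h.symm hpa)
    filter_upwards [(side k i).continuous.continuousAt.eventually_const_lt h4] with u hu _ _ using hu.le
  · refine Eventually.of_forall fun u h1 h2 => ?_
    have : side k i = 0 := by
      by_contra h3
      exact h ⟨h1, h2, h3⟩
    simp [this]

/-- The other side functions do not vanish near a point which is no vertex. -/
theorem eventually_side_ne (hp : p.1.2 = 0) (hv : ¬ IsVertexAt k p.1) {a : Fin 3} (ha : side k a ≠ 0)
    (hpa : side k a p.1.1 = 0) : ∀ᶠ u in 𝓝 p.1.1, ∀ b, b ≠ a → side k b ≠ 0 → side k b u ≠ 0 := by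
  simp only [eventually_all]
  intro b hb hb0
  exact (side k b).continuous.continuousAt.eventually_ne fun h =>
    hv (isVertexAt_of_side hp hb hb0 ha h hpa)

end

namespace BranchedSurface

variable {P : Type*} [TopologicalSpace P] {B : BranchedSurface P}

/-- Coordinate changes preserve the sides of an edge. -/
theorem exists_side_factor {c d : Fin B.num} {p : Model (B.kind c)} {q : Model (B.kind d)}
    (h : B.chart d q = B.chart c p) (hp : ¬ IsVertexAt (B.kind c) p.1)
    (hq : ¬ IsVertexAt (B.kind d) q.1) {a' : Fin 3} (hp0 : p.1.2 = 0) (ha' : side (B.kind c) a' ≠ 0) (hpa' : side (B.kind c) a' p.1.1 = 0)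
    {a : Fin 3} (hq0 : q.1.2 = 0) (ha : side (B.kind d) a ≠ 0) (hqa : side (B.kind d) a q.1.1 = 0)
    {i j : Fin 3} {T : ℝ × ℝ → ℝ × ℝ} (hT : LocalRep (B.chart d) (B.chart c) id q i j T) :
    ∃ μ : ℝ × ℝ → ℝ, SmoothNear μ q.1.1 ∧ 0 < μ q.1.1 ∧
      ∀ᶠ u in 𝓝 q.1.1, side (B.kind c) a' (T u) = μ u * side (B.kind d) a u := by
  set σ := side (B.kind d) a with hσ
  set σ' := side (B.kind c) a' with hσ'
  set n := edgeNormal (B.kind d) a with hn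
  have hσn : σ n = 1 := side_edgeNormal ha
  have hTp : T q.1.1 = p.1.1 := ((hT.onSheet (B.chart_injective c) h).2).symm
  have hTs : SmoothNear T q.1.1 := hT.smoothNear (B.isDiffeo_refl)
  have hbs : SmoothNear (fun u => σ' (T u)) q.1.1 := (SmoothNear.const σ').clm_apply hTs
  have hTt : Tendsto T (𝓝 q.1.1) (𝓝 p.1.1) := hTp ▸ hT.continuousAt.tendsto
  -- Coordinate changes preserve singular points, and near a point which is no vertex the given edge
  -- is the only one; hence `T` maps the edge into the edge.
  have hzero : ∀ᶠ u in 𝓝 q.1.1, σ u = 0 → σ' (T u) = 0 := by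
    filter_upwards [eventually_side_nonneg hq0 hq ha hqa, hT.2.2.2,
      hTt.eventually (eventually_side_ne hp0 hp ha' hpa')] with u h1 h2 h3 h0
    have hi : 0 ≤ side (B.kind d) i u := by
      by_cases hia : i = a
      · rw [hia]; exact h0.ge
      · exact h1 i hia hT.1
    have h4 : Sing (lift (B.kind d) i u) :=
      sing_iff_side.2 ⟨height_eq_zero_iff.2 hi, a, ha, h0⟩
    obtain ⟨-, b, hb, hb0⟩ := sing_iff_side.1 ((sing_iff_of_chart_eq h2).1 h4)
    by_contra hcon
    by_cases hba : b = a'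
    · exact hcon (by rw [hσ', ← hba]; exact hb0)
    · exact h3 b hba hb hb0
  have hfσ : fderiv ℝ σ q.1.1 n ≠ 0 := by rw [ContinuousLinearMap.fderiv, hσn]; exact one_ne_zero
  obtain ⟨μ, hμ, hμe⟩ := exists_division hbs (σ.contDiff.smoothNear _) hqa hfσ hzero
  have hμ0 : μ q.1.1 ≠ 0 := by
    intro hμ0
    have h3 : fderiv ℝ (fun u => σ' (T u)) q.1.1 = 0 := by
      have e : (fun u => σ' (T u)) =ᶠ[𝓝 q.1.1] fun u => μ u * σ u := hμe
      rw [e.fderiv_eq, fderiv_fun_mul hμ.differentiableAt σ.differentiableAt, hμ0, hqa]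
      simp
    have h4 : fderiv ℝ (fun u => σ' (T u)) q.1.1 = σ'.comp (fderiv ℝ T q.1.1) :=
      (σ'.hasFDerivAt.comp q.1.1 hTs.differentiableAt.hasFDerivAt).fderiv
    refine ha' (ContinuousLinearMap.ext fun w => ?_)
    have hdet : IsUnit (fderiv ℝ T q.1.1 : ℝ × ℝ →ₗ[ℝ] ℝ × ℝ) :=
      LinearMap.isUnit_iff_isUnit_det _ |>.2 (isUnit_iff_ne_zero.2 hT.2.2.1.ne')
    obtain ⟨w', hw'⟩ := ((Module.End.isUnit_iff _).1 hdet).2 w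
    have h5 := congrArg (fun L => L w') (h4.symm.trans h3)
    change σ' (fderiv ℝ T q.1.1 w') = 0 at h5
    have hw'' : fderiv ℝ T q.1.1 w' = w := hw'
    rw [hw''] at h5
    exact h5
  refine ⟨μ, hμ, lt_of_le_of_ne (not_lt.1 fun hneg => ?_) hμ0.symm, hμe⟩
  -- another sheet through `q`, which leaves the given one along the edge
  have hi' : ∃ i', OnSheet q i' ∧ ∀ u ∈ coincide (B.kind d) i i', 0 ≤ σ u := by
    by_cases hia : i = a
    · refine ⟨1, (onSheet_iff_side hq0).2 (by simp [side_one]), fun u hu => ?_⟩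
      have h1a : a ≠ 1 := fun h => ha (by rw [hσ, h]; exact side_one _)
      rw [hia, mem_coincide_iff] at hu
      exact (hu.resolve_left h1a).1
    · refine ⟨a, (onSheet_iff_side hq0).2 hqa.ge, fun u hu => ?_⟩
      rw [mem_coincide_iff] at hu
      exact (hu.resolve_left hia).2
  obtain ⟨i', hi', hco⟩ := hi'
  obtain ⟨j', T', hT'⟩ := B.exists_transition h hi'
  have hTp' : T' q.1.1 = p.1.1 := ((hT'.onSheet (B.chart_injective c) h).2).symm
  have hj := (hT.onSheet (B.chart_injective c) h).1
  have hj' := (hT'.onSheet (B.chart_injective c) h).1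
  have m1 : ∀ᶠ w in 𝓝 p.1.1, ∃ u, T u = w ∧ B.chart d (lift _ i u) = B.chart c (lift _ j (T u)) ∧
      σ' (T u) = μ u * σ u ∧ μ u < 0 := by
    rw [← hTp, ← hT.map_nhds]
    refine mem_of_superset (image_mem_map (hT.2.2.2.and (hμe.and
      (hμ.continuousAt.eventually_lt_const hneg)))) ?_
    rintro _ ⟨u, hu, rfl⟩
    exact ⟨u, rfl, hu⟩
  have m2 : ∀ᶠ w in 𝓝 p.1.1, ∃ u, T' u = w ∧
      B.chart d (lift _ i' u) = B.chart c (lift _ j' (T' u)) := by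
    rw [← hTp', ← hT'.map_nhds]
    refine mem_of_superset (image_mem_map hT'.2.2.2) ?_
    rintro _ ⟨u, hu, rfl⟩
    exact ⟨u, rfl, hu⟩
  have hline : Tendsto (fun t : ℝ => p.1.1 + t • edgeNormal (B.kind c) a') (𝓝[>] 0) (𝓝 p.1.1) :=
    ((by fun_prop : Continuous fun t : ℝ => p.1.1 + t • edgeNormal (B.kind c) a').tendsto' 0 _
      (by simp)).mono_left nhdsWithin_le_nhds
  -- A point on the one-sheeted side of the target edge. If `μ` were negative, its preimage would
  -- lie beyond the source edge, on two sheets at once, although these two sheets are separated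
  -- there.
  obtain ⟨t, ⟨h1, h2, h3⟩, ht⟩ := ((hline.eventually (m1.and (m2.and
    (eventually_side_nonneg hp0 hp ha' hpa')))).and self_mem_nhdsWithin).exists
  have ht : 0 < t := ht
  set w := p.1.1 + t • edgeNormal (B.kind c) a' with hw
  have hσw : σ' w = t := by
    rw [hw, map_add, map_smul, hpa', hσ', side_edgeNormal ha']; simp
  obtain ⟨u, hu, r1, r2, r3⟩ := h1
  obtain ⟨u', hu', r4⟩ := h2
  rw [hu] at r1 r2
  rw [hu'] at r4
  have hside : ∀ b, OnSheet p b → 0 ≤ side (B.kind c) b w := by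
    intro b hb
    by_cases hba : b = a'
    · rw [hba]; exact ht.le.trans hσw.ge
    · exact h3 b hba hb
  have h5 : lift (B.kind c) j w = lift (B.kind c) j' w :=
    lift_eq_lift_iff.2 ⟨rfl, mem_coincide_iff.2 (Or.inr ⟨hside j hj, hside j' hj'⟩)⟩
  rw [h5] at r1
  obtain ⟨rfl, h6⟩ := lift_eq_lift_iff.1 (B.chart_injective d (r1.trans r4.symm))
  have := hco u h6
  rw [hσw] at r2
  nlinarith

/-- The side functions of the two charts differ by a positive smooth factor, which is absorbed in
the coefficients. -/
theorem EdgeForm.transfer {g : P → ℝ} {c d : Fin B.num} {p : Model (B.kind c)} {q : Model (B.kind d)}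
    (h : B.chart d q = B.chart c p) (hp : ¬ IsVertexAt (B.kind c) p.1)
    (hq : ¬ IsVertexAt (B.kind d) q.1) {s : Prop}
    (hs : Sing q) (H : EdgeForm (fun p => g (B.chart c p)) p s) :
    EdgeForm (fun q => g (B.chart d q)) q s := by
  intro a ha hqa i hi
  obtain ⟨hp0, a', ha', hpa'⟩ := sing_iff_side.1 ((sing_iff_of_chart_eq h).1 hs)
  have hq0 := (sing_iff_side.1 hs).1
  obtain ⟨j, T, hT⟩ := B.exists_transition h hi
  obtain ⟨μ, hμ, hμ0, hμe⟩ := exists_side_factor h hp hq hp0 ha' hpa' hq0 ha hqa hT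
  obtain ⟨hj, hTp⟩ := hT.onSheet (B.chart_injective c) h
  obtain ⟨κ, κ', h1, h2, h3, h4, h5, h6⟩ := H a' ha' hpa' j hj
  have hTs : SmoothNear T q.1.1 := hT.smoothNear B.isDiffeo_refl
  refine ⟨_, _, hμ.mul (h1.comp' hTs hTp.symm), hμ.mul (h2.comp' hTs hTp.symm), ?_, ?_, ?_, ?_⟩
  · exact mul_nonneg hμ0.le (hTp ▸ h3)
  · exact mul_nonneg hμ0.le (hTp ▸ h4)
  · exact fun hs => ⟨mul_pos hμ0 (hTp ▸ (h5 hs).1), mul_pos hμ0 (hTp ▸ (h5 hs).2)⟩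
  · have hTt : Tendsto T (𝓝 q.1.1) (𝓝 p.1.1) := by
      have := hT.continuousAt.tendsto
      rwa [← hTp] at this
    filter_upwards [hTt.eventually h6, hμe, hμ.continuousAt.eventually_const_lt hμ0, hT.2.2.2] with
      u e1 e2 e3 e4
    have e4 : B.chart d (lift _ i u) = B.chart c (lift _ j (T u)) := e4
    rw [e2] at e1
    rw [e4]
    refine ⟨fun h => ?_, fun h => ?_⟩
    · rw [e1.1 (mul_nonneg e3.le h)]; ring
    · rw [e1.2 (mul_nonpos_of_nonneg_of_nonpos e3.le h)]; ring

end BranchedSurface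

end BranchedSurf

/-! ### Defining functions of the singular set in a model -/

namespace BranchedSurf

/-- A function which on `N` defines the singular set. -/
structure LocalDef {k : Kind} (R : Model k → ℝ) (N : Set (Model k)) : Prop where
  cont : Continuous R
  nonneg : ∀ q, 0 ≤ R q
  zero_iff : ∀ q ∈ N, R q = 0 ↔ Sing q
  smooth : ∀ q ∈ N, ¬ Sing q → ∀ i, OnSheet q i → SmoothNear (fun u => R (lift k i u)) q.1.1
  edge : ∀ q ∈ N, Sing q → ¬ IsVertexAt k q.1 → EdgeForm R q True

variable {k : Kind} {p : Model k}

theorem tendsto_lift {i : Fin 3} (hi : OnSheet p i) : Tendsto (lift k i) (𝓝 p.1.1) (𝓝 p) := by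
  have h := (continuous_lift k i).tendsto p.1.1
  rwa [hi.lift_eq] at h

theorem eventually_proj {Q : ℝ × ℝ → Prop} (h : ∀ᶠ u in 𝓝 p.1.1, Q u) : ∀ᶠ q in 𝓝 p, Q q.1.1 :=
  (by fun_prop : Continuous fun q : Model k => q.1.1).continuousAt.eventually h

theorem isClosed_sing (k : Kind) : IsClosed {q : Model k | Sing q} := by
  have : {q : Model k | Sing q} =
      {q : Model k | q.1.2 = 0} ∩ ⋃ a ∈ {a : Fin 3 | side k a ≠ 0}, {q : Model k | side k a q.1.1 = 0} := by
    ext q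
    simp [sing_iff_side]
  rw [this]
  exact (isClosed_eq (by fun_prop) continuous_const).inter ((Set.toFinite _).isClosed_biUnion
    fun a _ => isClosed_eq (by fun_prop) continuous_const)

theorem LocalDef.one : LocalDef (fun _ : Model k => (1 : ℝ)) {q | ¬ Sing q} where
  cont := continuous_const
  nonneg _ := zero_le_one
  zero_iff q hq := by simpa using hq
  smooth q _ _ i _ := SmoothNear.const 1
  edge q hq hs := absurd hs hq

/-- Near a point of an edge which is no vertex, the singular set is this edge. -/
theorem eventually_edge (hp : p.1.2 = 0) (hv : ¬ IsVertexAt k p.1) {a : Fin 3} (ha : side k a ≠ 0)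
    (hpa : side k a p.1.1 = 0) : ∀ᶠ q in 𝓝 p, (Sing q ↔ side k a q.1.1 = 0) ∧
      ∀ b, side k b ≠ 0 → side k b q.1.1 = 0 → b = a := by
  filter_upwards [eventually_proj (eventually_side_nonneg hp hv ha hpa),
    eventually_proj (eventually_side_ne hp hv ha hpa), eventually_onSheet p] with q h1 h2 h3
  have h4 : ∀ b, side k b ≠ 0 → side k b q.1.1 = 0 → b = a := fun b hb hb0 =>
    by_contra fun hba => h2 b hba hb hb0
  refine ⟨⟨fun hs => ?_, fun h => ?_⟩, h4⟩
  · obtain ⟨-, b, hb, hb0⟩ := sing_iff_side.1 hs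
    rwa [h4 b hb hb0] at hb0
  · obtain ⟨i, hi⟩ := exists_onSheet q
    refine sing_iff_side.2 ⟨hi.trans (height_eq_zero_iff.2 ?_), a, ha, h⟩
    by_cases hia : i = a
    · rw [hia, h]
    · exact h1 i hia (h3 i hi)

theorem LocalDef.edgeDef {a : Fin 3} : LocalDef (fun q : Model k => |side k a q.1.1|)
    {q | (Sing q ↔ side k a q.1.1 = 0) ∧ ∀ b, side k b ≠ 0 → side k b q.1.1 = 0 → b = a} where
  cont := by fun_prop
  nonneg _ := abs_nonneg _
  zero_iff q hq := by rw [abs_eq_zero, hq.1]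
  smooth q hq hs i _ := ((side k a).contDiff.smoothNear _).abs fun h => hs (hq.1.2 h)
  edge q hq hs _ := by
    intro b hb hqb i hi
    rw [hq.2 b hb hqb]
    refine ⟨fun _ => 1, fun _ => 1, SmoothNear.const 1, SmoothNear.const 1, zero_le_one, zero_le_one,
      fun _ => ⟨one_pos, one_pos⟩, Eventually.of_forall fun u => ⟨fun h => ?_, fun h => ?_⟩⟩
    · change |side k a u| = _
      rw [abs_of_nonneg h, mul_one]
    · change |side k a u| = _
      rw [abs_of_nonpos h, mul_one]

/-- The defining function near a vertex. -/
noncomputable def vertexDef (k : Kind) (q : Model k) : ℝ :=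
  if q.1.2 = 0 then |q.1.1.1 * q.1.1.2| else if 0 < q.1.2 then |side k 2 q.1.1| else |side k 0 q.1.1|

theorem vertexDef_lift (i : Fin 3) (u : ℝ × ℝ) :
    vertexDef k (lift k i u) = if 0 ≤ side k i u then |u.1 * u.2| else |side k i u| := by
  have e : (lift k i u).1 = (u, height k i u) := rfl
  rw [vertexDef, e]
  by_cases h : 0 ≤ side k i u
  · rw [if_pos (height_eq_zero_iff.2 h), if_pos h]
  · rw [if_neg (fun h0 => h (height_eq_zero_iff.1 h0)), if_neg h]
    rcases height_eq_zero_or (not_le.1 h) with ⟨rfl, h1⟩ | ⟨rfl, h1⟩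
    · rw [if_neg (not_lt.2 h1.le)]
    · rw [if_pos h1]

theorem abs_mul_coord (hk : k = .Vpos ∨ k = .Vneg) {a : Fin 3} (ha : a ≠ 1) (u : ℝ × ℝ) :
    |u.1 * u.2| = |side k a u| * |edgeCoord a u| := by
  rw [← abs_mul]
  rcases hk with rfl | rfl <;> fin_cases a <;> simp [side, edgeCoord, mul_comm, abs_mul] at ha ⊢

theorem isVertexAt_of_coord (hk : k = .Vpos ∨ k = .Vneg) {a : Fin 3} (ha : a ≠ 1) {q : Model k}
    (hq : q.1.2 = 0) (h1 : side k a q.1.1 = 0) (h2 : edgeCoord a q.1.1 = 0) : IsVertexAt k q.1 := by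
  refine ⟨hk, Prod.ext ?_ hq⟩
  rcases hk with rfl | rfl <;> fin_cases a <;> simp_all [side, edgeCoord, Prod.ext_iff]

theorem sing_iff_mul (hk : k = .Vpos ∨ k = .Vneg) {q : Model k} :
    Sing q ↔ q.1.2 = 0 ∧ q.1.1.1 * q.1.1.2 = 0 := by
  rw [mul_eq_zero]
  rcases hk with rfl | rfl
  · exact sing_Vpos
  · exact sing_Vneg

/-- The choice of `vertexDef` is dictated by the deformation at a vertex: `|x y|` is a first
integral of the saddle field on the horizontal sheet, and on a part which has left this sheet only
its own side function has to be controlled. The two expressions vanish together along the edge, so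
they fit continuously, and each is smooth off the singular set. -/
theorem LocalDef.vertex (hk : k = .Vpos ∨ k = .Vneg) : LocalDef (vertexDef k) univ where
  cont := by
    refine continuous_of_lift fun i => ?_
    simp only [vertexDef_lift]
    by_cases hi : i = 1
    · subst hi
      simp only [side_one, zero_apply, le_refl, if_true]
      fun_prop
    · refine Continuous.if_le (by fun_prop) (by fun_prop) continuous_const (by fun_prop) fun u hu => ?_
      rw [abs_mul_coord hk hi, ← hu]
      simp
  nonneg q := by
    rw [vertexDef]
    split_ifs <;> exact abs_nonneg _
  zero_iff q _ := by
    obtain ⟨i, hi⟩ := exists_onSheet q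
    rw [sing_iff_mul hk]
    have h1 : q.1.2 = 0 ↔ 0 ≤ side k i q.1.1 := by
      rw [← height_eq_zero_iff, ← hi]
    rw [h1, ← hi.lift_eq, vertexDef_lift]
    change _ ↔ 0 ≤ side k i q.1.1 ∧ q.1.1.1 * q.1.1.2 = 0
    split_ifs with h
    · rw [abs_eq_zero]; simp [h]
    · rw [abs_eq_zero]
      exact ⟨fun h0 => absurd h0.ge h, fun h0 => absurd h0.1 h⟩
  smooth q _ hs i hi := by
    have hprod : ContDiff ℝ ∞ fun u : ℝ × ℝ => u.1 * u.2 := contDiff_fst.mul contDiff_snd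
    have hh : q.1.2 = 0 ↔ 0 ≤ side k i q.1.1 := by
      rw [← height_eq_zero_iff, ← hi]
    simp only [vertexDef_lift]
    have hc : ContinuousAt (side k i) q.1.1 := (side k i).continuous.continuousAt
    by_cases h : 0 ≤ side k i q.1.1
    · have hne : q.1.1.1 * q.1.1.2 ≠ 0 := fun h0 => hs ((sing_iff_mul hk).2 ⟨hh.2 h, h0⟩)
      refine ((hprod.smoothNear _).abs hne).congr ?_
      have hev : ∀ᶠ u in 𝓝 q.1.1, 0 ≤ side k i u := by
        by_cases hi1 : i = 1
        · subst hi1; simp [side_one]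
        · have h2 : 0 < side k i q.1.1 := lt_of_le_of_ne h fun h0 => hne (by
            rw [← abs_eq_zero, abs_mul_coord hk hi1, ← h0]; simp)
          exact (hc.eventually_const_lt h2).mono fun _ h => h.le
      filter_upwards [hev] with u hu
      rw [if_pos hu]
    · have h2 := not_le.1 h
      refine (((side k i).contDiff.smoothNear _).abs h2.ne).congr ?_
      filter_upwards [hc.eventually_lt_const h2] with u hu
      rw [if_neg (not_le.2 hu)]
  edge q _ hs hv := by
    intro a ha hqa i hi
    have hq0 := (sing_iff_side.1 hs).1
    have ha1 : a ≠ 1 := fun h => ha (h ▸ side_one k)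
    have hη : edgeCoord a q.1.1 ≠ 0 := fun h => hv (isVertexAt_of_coord hk ha1 hq0 hqa h)
    have hηs : SmoothNear (fun u => |edgeCoord a u|) q.1.1 := ((edgeCoord a).contDiff.smoothNear _).abs hη
    have hη0 : 0 < |edgeCoord a q.1.1| := abs_pos.2 hη
    by_cases hia : i = a
    · subst hia
      refine ⟨_, fun _ => 1, hηs, SmoothNear.const 1, hη0.le, zero_le_one, fun _ => ⟨hη0, one_pos⟩,
        Eventually.of_forall fun u => ⟨fun h => ?_, fun h => ?_⟩⟩
      · rw [vertexDef_lift, if_pos h, abs_mul_coord hk ha1, abs_of_nonneg h]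
      · rw [vertexDef_lift]
        split_ifs with h0
        · rw [abs_mul_coord hk ha1, le_antisymm h h0]; simp
        · rw [abs_of_nonpos h, mul_one]
    · refine ⟨_, _, hηs, hηs, hη0.le, hη0.le, fun _ => ⟨hη0, hη0⟩, ?_⟩
      filter_upwards [eventually_side_nonneg hq0 hv ha hqa] with u hu
      rw [vertexDef_lift, if_pos (hu i hia hi), abs_mul_coord hk ha1]
      exact ⟨fun h => by rw [abs_of_nonneg h], fun h => by rw [abs_of_nonpos h, neg_mul]⟩

end BranchedSurf

namespace BranchedSurf

namespace BranchedSurface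

variable {P : Type*} [TopologicalSpace P] {B : BranchedSurface P}

/-- A local defining function of the singular set, cut off outside of a neighbourhood of a point. -/
theorem exists_patch [T2Space P] {c : Fin B.num} {p : Model (B.kind c)} {R : Model (B.kind c) → ℝ}
    {N : Set (Model (B.kind c))} (hR : LocalDef R N) (hN : N ∈ 𝓝 p) {Z : Set P} (hZ : IsClosed Z)
    (hpZ : B.chart c p ∉ Z) : ∃ (g : P → ℝ) (V : Set P), Continuous g ∧ (∀ x, 0 ≤ g x) ∧
      (∀ x ∈ B.singularSet, g x = 0) ∧ (∀ x ∈ V, g x = 0 → x ∈ B.singularSet) ∧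
      V ∈ 𝓝 (B.chart c p) ∧ (∀ᶠ q in 𝓝 p, g (B.chart c q) = R q) ∧
      (∀ z ∈ Z, ∀ᶠ x in 𝓝 z, g x = 0) ∧
      (∀ d (q : Model (B.kind d)), ¬ Sing q → ∀ i, OnSheet q i →
        SmoothNear (fun u => g (B.chart d (lift _ i u))) q.1.1) ∧
      ∀ d (q : Model (B.kind d)), Sing q → ¬ IsVertexAt (B.kind d) q.1 →
        (∀ p' ∈ N, B.chart c p' = B.chart d q → ¬ IsVertexAt (B.kind c) p'.1) →
        EdgeForm (fun q => g (B.chart d q)) q (B.chart d q ∈ V) := by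
  -- The cut-off is taken in the ambient space of the model, so that its restriction to every sheet
  -- is smooth.
  obtain ⟨G, hG, hGe⟩ := isOpen_induced_iff.1
    (isOpen_interior.inter (hZ.isOpen_compl.preimage (B.continuous_chart c)) :
      IsOpen (interior N ∩ B.chart c ⁻¹' Zᶜ))
  have hpG : p.1 ∈ G := by
    have : p ∈ Subtype.val ⁻¹' G := hGe ▸ ⟨mem_interior_iff_mem_nhds.2 hN, hpZ⟩
    exact this
  have hGN : ∀ q : Model (B.kind c), q.1 ∈ G → q ∈ N ∧ B.chart c q ∉ Z := fun q hq => by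
    have h : q ∈ interior N ∩ B.chart c ⁻¹' Zᶜ := hGe ▸ hq
    exact ⟨interior_subset h.1, h.2⟩
  obtain ⟨χ, K', hχ, hχ1, hK', hK'G, hχ0, hχI⟩ := exists_cutoff isCompact_singleton hG
    (singleton_subset_iff.2 hpG)
  have hχp : ∀ᶠ q : Model (B.kind c) in 𝓝 p, χ q.1 = 1 := by
    rw [nhdsSet_singleton] at hχ1
    exact continuous_subtype_val.continuousAt.eventually hχ1
  have hχs : ∀ i, ContDiff ℝ ∞ fun u => χ (lift (B.kind c) i u).1 := fun i =>
    hχ.comp (contDiff_id.prodMk (contDiff_height _ i))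
  set F : Model (B.kind c) → ℝ := fun q => χ q.1 * R q with hF
  have hF0 : ∀ q : Model (B.kind c), q.1.1 ∉ Prod.fst '' K' → F q = (fun _ => 0 : P → ℝ) (B.chart c q) :=
    fun q hq => by rw [hF]; dsimp only; rw [hχ0 q.1 fun h => hq ⟨_, h, rfl⟩, zero_mul]
  have hK : IsCompact (Prod.fst '' K') := hK'.image continuous_fst
  set C : Set P := B.chart c '' {q | q.1 ∈ K'} with hC
  have hCc : IsClosed C := by
    refine (IsCompact.image ?_ (B.continuous_chart c)).isClosed
    refine (isCompact_over hK).of_isClosed_subset (hK'.isClosed.preimage continuous_subtype_val) ?_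
    exact fun q hq => ⟨q.1, hq, rfl⟩
  set g := B.extend c F fun _ => 0 with hg
  have hgF : ∀ q, g (B.chart c q) = F q := fun q => extend_chart q
  have hgC : ∀ x ∉ C, g x = 0 := fun x hx => by
    by_cases h : x ∈ range (B.chart c)
    · obtain ⟨q, rfl⟩ := h
      rw [hgF, hF]; dsimp only
      rw [hχ0 q.1 fun h => hx ⟨q, h, rfl⟩, zero_mul]
    · exact extend_of_notMem h
  have hgl : ∀ x ∉ C, ∀ᶠ y in 𝓝 x, g y = 0 := fun x hx => by
    filter_upwards [hCc.isOpen_compl.mem_nhds hx] with y hy using hgC y hy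
  have hCN : ∀ q : Model (B.kind c), q.1 ∈ K' → q ∈ N ∧ B.chart c q ∉ Z := fun q hq =>
    hGN q (hK'G hq)
  have hpos : ∀ q : Model (B.kind c), 0 < χ q.1 → q.1 ∈ K' := fun q hq => by
    by_contra h
    rw [hχ0 q.1 h] at hq
    exact hq.false
  refine ⟨g, B.chart c '' {q | 0 < χ q.1}, continuous_extend hK hF0 ?_ continuous_const, fun x => ?_,
    fun x hx => ?_, ?_, ?_, ?_, fun z hz => hgl z ?_, fun d q hs i hi => ?_, fun d q hs hv hN' => ?_⟩
  · exact (hχ.continuous.comp continuous_subtype_val).mul hR.cont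
  · by_cases hx : x ∈ C
    · obtain ⟨q, -, rfl⟩ := hx
      rw [hgF]
      exact mul_nonneg (hχI _).1 (hR.nonneg q)
    · rw [hgC x hx]
  · by_cases hx' : x ∈ C
    · obtain ⟨q, hq, rfl⟩ := hx'
      rw [hgF, hF]; dsimp only
      rw [(hR.zero_iff q (hCN q hq).1).2 (chart_mem_singularSet.1 hx), mul_zero]
    · exact hgC x hx'
  · rintro _ ⟨q, hq, rfl⟩ h
    rw [hgF] at h
    have hq' : 0 < χ q.1 := hq
    exact chart_mem_singularSet.2 ((hR.zero_iff q (hCN q (hpos q hq)).1).1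
      ((mul_eq_zero.1 h).resolve_left hq'.ne'))
  · refine (B.isOpenEmbedding c).isOpenMap.image_mem_nhds ?_
    filter_upwards [hχp] with q hq
    rw [hq]; exact one_pos
  · filter_upwards [hχp] with q hq
    rw [hgF, hF]; dsimp only
    rw [hq, one_mul]
  · rintro ⟨q, hq, rfl⟩
    exact (hCN q hq).2 hz
  · by_cases hx : B.chart d q ∈ C
    · obtain ⟨p', hp', h⟩ := hx
      have hs' : ¬ Sing p' := fun h' => hs ((sing_iff_of_chart_eq h).1 h')
      obtain ⟨j, T, hT⟩ := B.exists_transition h.symm hi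
      obtain ⟨hj, hTp⟩ := hT.onSheet (B.chart_injective c) h.symm
      have h1 : SmoothNear (fun u => F (lift _ j u)) p'.1.1 :=
        ((hχs j).smoothNear _).mul (hR.smooth p' (hCN p' hp').1 hs' j hj)
      refine (h1.comp' (hT.smoothNear B.isDiffeo_refl) hTp.symm).congr ?_
      filter_upwards [hT.2.2.2] with u hu
      have hu : B.chart d (lift _ i u) = B.chart c (lift _ j (T u)) := hu
      rw [hu, hgF]
    · refine (SmoothNear.const (0 : ℝ)).congr ?_
      filter_upwards [(tendsto_chart_lift B hi).eventually (hgl _ hx)] with u hu using hu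
  · by_cases hx : B.chart d q ∈ C
    · obtain ⟨p', hp', h⟩ := hx
      have hp'N := (hCN p' hp').1
      have hv' := hN' p' hp'N h
      have hs' : Sing p' := (sing_iff_of_chart_eq h).2 hs
      have h1 : EdgeForm F p' (True ∧ 0 < χ p'.1) :=
        (hR.edge p' hp'N hs' hv').mul (b := fun q => χ q.1) (hχI _).1 fun i _ => (hχs i).smoothNear _
      refine (EdgeForm.transfer h.symm hv' hv hs (p := p') (g := g) (by simpa only [hgF] using h1)).mono ?_
      rintro ⟨p'', hp'', h''⟩
      rw [← h] at h''
      rw [← B.chart_injective c h'']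
      exact ⟨trivial, hp''⟩
    · refine .of_eventually_zero ((B.continuous_chart d).continuousAt.eventually (hgl _ hx)) ?_
      rintro ⟨p', hp', h⟩
      exact hx ⟨p', hpos p' hp', h⟩

end BranchedSurface

end BranchedSurf

namespace BranchedSurf

/-! ### A global defining function, regular neighbourhoods -/

/-- The neighbourhood contains no vertex except possibly `p` itself: edge forms can be transferred
between charts only away from the vertices of both. -/
theorem exists_localDef {k : Kind} (p : Model k) : ∃ R N, LocalDef R N ∧ N ∈ 𝓝 p ∧
    (∀ q ∈ N, IsVertexAt k q.1 → q = p) ∧ (IsVertexAt k p.1 → R = vertexDef k) ∧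
    (¬ IsVertexAt k p.1 → p.1.2 = 0 → ∀ a, side k a ≠ 0 → side k a p.1.1 = 0 →
      R = fun q : Model k => |side k a q.1.1|) := by
  by_cases hv : IsVertexAt k p.1
  · exact ⟨_, _, LocalDef.vertex hv.1, univ_mem, fun q _ hq => Subtype.ext (hq.2.trans hv.2.symm),
      fun _ => rfl, fun h => absurd hv h⟩
  by_cases hs : Sing p
  · obtain ⟨hp, a, ha, hpa⟩ := sing_iff_side.1 hs
    refine ⟨_, _, LocalDef.edgeDef (a := a), eventually_edge hp hv ha hpa, fun q hq hqv => ?_,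
      fun h => absurd h hv, fun _ _ b hb hpb => ?_⟩
    · have h0 : ∀ b, side k b q.1.1 = 0 := fun b => by
        rw [hqv.2]; exact map_zero (side k b)
      have h1 := hq.2 0 (hqv.sides 0 (by decide)) (h0 0)
      have h2 := hq.2 2 (hqv.sides 2 (by decide)) (h0 2)
      exact absurd (h1.trans h2.symm) (by decide)
    · obtain rfl : b = a := by_contra fun h => hv (isVertexAt_of_side hp h hb ha hpb hpa)
      rfl
  · refine ⟨_, _, LocalDef.one, (isClosed_sing k).isOpen_compl.mem_nhds hs, fun q hq hqv => ?_,
      fun h => absurd h hv, fun _ h0 a ha hpa => absurd (sing_iff_side.2 ⟨h0, a, ha, hpa⟩) hs⟩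
    refine absurd (sing_iff_side.2 ⟨by rw [hqv.2], 0, hqv.sides 0 (by decide), ?_⟩) hq
    rw [hqv.2]; exact map_zero _

namespace BranchedSurface

variable {P : Type*} [TopologicalSpace P] {B : BranchedSurface P}

/-- The vertices and the points of tangency to the singular set. -/
def Special (α : B.OneForm) (c : Fin B.num) (p : Model (B.kind c)) : Prop :=
  Sing p ∧ (IsVertexAt (B.kind c) p.1 ∨
    ∃ a, side (B.kind c) a ≠ 0 ∧ side (B.kind c) a p.1.1 = 0 ∧ α.coe c p (edgeDir a) = 0)

theorem OneForm.SStable.edge {α : B.OneForm} (hα : α.SStable) {c : Fin B.num} {p : Model (B.kind c)}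
    (hp : p.1.2 = 0) {a : Fin 3} (ha : side (B.kind c) a ≠ 0) (hpa : side (B.kind c) a p.1.1 = 0)
    (h0 : α.coe c p (edgeDir a) = 0) : ¬ IsVertexAt (B.kind c) p.1 ∧
      0 < α.coe c p (edgeNormal (B.kind c) a) *
        fderiv ℝ (fun u => α.coe c (lift (B.kind c) 1 u) (edgeDir a)) p.1.1 (edgeDir a) :=
  (hα c p _ _ (isEdgeAt_iff.2 ⟨hp, a, ha, hpa, rfl, rfl⟩)).2 h0

theorem OneForm.continuous_coe (α : B.OneForm) (c : Fin B.num) : Continuous (α.coe c) :=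
  continuous_of_lift fun i => (α.smooth c i).continuous

/-- The special points are isolated. -/
theorem OneForm.SStable.eventually_not_special {α : B.OneForm} (hα : α.SStable) {c : Fin B.num}
    (p : Model (B.kind c)) : ∀ᶠ q in 𝓝 p, q ≠ p → ¬ Special α c q := by
  by_cases hs : Sing p
  swap
  · filter_upwards [(isClosed_sing (B.kind c)).isOpen_compl.mem_nhds hs] with q hq _ h using hq h.1
  obtain ⟨hp, a, ha, hpa⟩ := sing_iff_side.1 hs
  have hne : ∀ b, α.coe c p (edgeDir b) ≠ 0 → ∀ᶠ q in 𝓝 p, α.coe c q (edgeDir b) ≠ 0 := fun b hb =>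
    ContinuousAt.eventually_ne (((α.continuous_coe c).clm_apply continuous_const).continuousAt) hb
  by_cases hv : IsVertexAt (B.kind c) p.1
  · have h1 : ∀ᶠ q in 𝓝 p, ∀ b, side (B.kind c) b ≠ 0 → α.coe c q (edgeDir b) ≠ 0 := by
      simp only [eventually_all]
      intro b hb
      refine hne b fun h0 => (hα.edge hp hb ?_ h0).1 hv
      rw [hv.2]; exact map_zero _
    filter_upwards [h1] with q h1 hqp
    rintro ⟨-, h | ⟨b, hb, -, h⟩⟩
    · exact hqp (Subtype.ext (h.2.trans hv.2.symm))
    · exact h1 b hb h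
  · suffices h : ∀ᶠ q in 𝓝 p, Sing q → q ≠ p → side (B.kind c) a q.1.1 = 0 →
        α.coe c q (edgeDir a) ≠ 0 by
      filter_upwards [h, eventually_edge hp hv ha hpa] with q h h1 hqp
      rintro ⟨h2, h3 | ⟨b, hb, hqb, h3⟩⟩
      · have h0 : ∀ b, side (B.kind c) b q.1.1 = 0 := fun b => by
          rw [h3.2]; exact map_zero (side (B.kind c) b)
        have e1 := h1.2 0 (h3.sides 0 (by decide)) (h0 0)
        have e2 := h1.2 2 (h3.sides 2 (by decide)) (h0 2)
        exact absurd (e1.trans e2.symm) (by decide)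
      · rw [h1.2 b hb hqb] at h3
        exact h h2 hqp (h1.1.1 h2) h3
    by_cases h0 : α.coe c p (edgeDir a) = 0
    swap
    · filter_upwards [hne a h0] with q hq _ _ _ using hq
    -- At a simple tangency the restriction of `α` to the edge has nonzero derivative, hence an
    -- isolated zero.
    have hD := (hα.edge hp ha hpa h0).2
    set f : ℝ × ℝ → ℝ := fun u => α.coe c (lift (B.kind c) 1 u) (edgeDir a) with hf
    have hp1 : lift (B.kind c) 1 p.1.1 = p := ((onSheet_iff_side hp).2 (by simp [side_one])).lift_eq
    have hfd : DifferentiableAt ℝ f (p.1.1 + (0 : ℝ) • edgeDir a) :=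
      (((α.smooth c 1).clm_apply contDiff_const).differentiable (by simp)) _
    have hl : HasDerivAt (fun t : ℝ => p.1.1 + t • edgeDir a) (edgeDir a) 0 := by
      simpa using ((hasDerivAt_id (0 : ℝ)).smul_const (edgeDir a)).const_add p.1.1
    have hd := hfd.hasFDerivAt.comp_hasDerivAt 0 hl
    rw [zero_smul, add_zero] at hd
    have h1 := hd.eventually_ne (c := 0) (right_ne_zero_of_mul hD.ne')
    rw [eventually_nhdsWithin_iff] at h1
    have ht : Tendsto (fun q : Model (B.kind c) => edgeCoord a (q.1.1 - p.1.1)) (𝓝 p) (𝓝 0) :=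
      (by fun_prop : Continuous fun q : Model (B.kind c) => edgeCoord a (q.1.1 - p.1.1)).tendsto' _ _
        (by simp)
    filter_upwards [ht.eventually h1] with q hq hqs hqp hqa
    have hq0 := (sing_iff_side.1 hqs).1
    have e1 : p.1.1 + edgeCoord a (q.1.1 - p.1.1) • edgeDir a = q.1.1 := by
      have := eq_side_smul_add ha (q.1.1 - p.1.1)
      rw [map_sub, hqa, hpa, sub_zero, zero_smul, zero_add] at this
      rw [← this]; abel
    have e2 := hq ?_
    · rw [Function.comp_apply, e1, hf] at e2
      dsimp only at e2
      rwa [((onSheet_iff_side hq0).2 (by simp [side_one])).lift_eq] at e2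
    · intro h
      have h : edgeCoord a (q.1.1 - p.1.1) = 0 := h
      rw [h, zero_smul, add_zero] at e1
      exact hqp (Subtype.ext (Prod.ext e1.symm (hq0.trans hp.symm)))

/-- There are finitely many special points, for a suitable choice of charts. -/
theorem OneForm.SStable.exists_special [CompactSpace P] [T2Space P] {α : B.OneForm} (hα : α.SStable) :
    ∃ (Q : Finset P) (c : P → Fin B.num) (p : ∀ x, Model (B.kind (c x))),
      (∀ x, B.chart (c x) (p x) = x) ∧ (∀ x ∈ Q, Special α (c x) (p x)) ∧
      ∀ x ∉ Q, ¬ Special α (c x) (p x) := by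
  classical
  -- By compactness of `P`, balls of one radius in the finitely many charts cover; the corresponding
  -- compact parts contain finitely many special points, since these are isolated.
  obtain ⟨n, hn⟩ : ∃ n : ℕ, univ ⊆ ⋃ c, B.box c (Metric.ball 0 n) := by
    refine isCompact_univ.elim_directed_cover (fun n : ℕ => ⋃ c, B.box c (Metric.ball 0 n))
      (fun n => isOpen_iUnion fun c => isOpen_box Metric.isOpen_ball) (fun x _ => ?_)
      (Monotone.directed_le fun m n hmn => iUnion_mono fun c => image_mono fun p hp =>
        Metric.ball_subset_ball (Nat.cast_le.2 hmn) hp)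
    obtain ⟨c, p, rfl⟩ := B.cover x
    obtain ⟨n, hn⟩ := exists_nat_gt ‖p.1.1‖
    exact mem_iUnion.2 ⟨n, mem_iUnion.2 ⟨c, chart_mem_box.2 (by simpa using hn)⟩⟩
  have hfin : ∀ c, {p : Model (B.kind c) | p.1.1 ∈ Metric.closedBall 0 n ∧ Special α c p}.Finite := by
    intro c
    have hK := isCompact_over (k := B.kind c) (isCompact_closedBall (0 : ℝ × ℝ) n)
    have := hK.induction_on (p := fun s => (s ∩ {p | Special α c p}).Finite) (by simp)
      (fun s t hst ht => ht.subset (inter_subset_inter_left _ hst))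
      (fun s t hs ht => by rw [union_inter_distrib_right]; exact hs.union ht) fun p _ => by
        refine ⟨_, mem_nhdsWithin_of_mem_nhds (hα.eventually_not_special p), (finite_singleton p).subset ?_⟩
        exact fun q hq => by_contra fun h => hq.1 h hq.2
    exact this
  have hQ := Set.finite_iUnion fun c => (hfin c).image (B.chart c)
  -- Every point receives one chart, in which it is special exactly when it belongs to the finite
  -- set. Independence of the notion from the chart is then not needed.
  have hch : ∀ x, ∃ c, ∃ p : Model (B.kind c), B.chart c p = x ∧
      (x ∈ hQ.toFinset ↔ Special α c p) := by
    intro x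
    by_cases hx : x ∈ hQ.toFinset
    · obtain ⟨c, p, hp, rfl⟩ := mem_iUnion.1 (hQ.mem_toFinset.1 hx)
      exact ⟨c, p, rfl, iff_of_true hx hp.2⟩
    · obtain ⟨c, p, hp, rfl⟩ := mem_iUnion.1 (hn (mem_univ x))
      refine ⟨c, p, rfl, iff_of_false hx fun h => hx ?_⟩
      exact hQ.mem_toFinset.2 (mem_iUnion.2 ⟨c, p, ⟨Metric.ball_subset_closedBall hp, h⟩, rfl⟩)
  choose c p hp hs using hch
  exact ⟨hQ.toFinset, c, p, hp, fun x hx => (hs x).1 hx, fun x hx h => hx ((hs x).2 h)⟩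

/-- A defining function of the singular set, which is a product along the edges in the given charts,
and is standard near the points of `Q`. -/
structure DefiningFun (Q : Finset P) (c : P → Fin B.num) (p : ∀ x, Model (B.kind (c x)))
    (ρ : P → ℝ) : Prop where
  cont : Continuous ρ
  nonneg : ∀ x, 0 ≤ ρ x
  zero_iff : ∀ x, ρ x = 0 ↔ x ∈ B.singularSet
  smooth : ∀ d (q : Model (B.kind d)), ¬ Sing q → ∀ i, OnSheet q i →
    SmoothNear (fun u => ρ (B.chart d (lift _ i u))) q.1.1
  vertex : ∀ x ∈ Q, IsVertexAt (B.kind (c x)) (p x).1 →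
    ∀ᶠ q in 𝓝 (p x), ρ (B.chart (c x) q) = vertexDef _ q
  edge : ∀ x ∈ Q, ¬ IsVertexAt (B.kind (c x)) (p x).1 → (p x).1.2 = 0 →
    ∀ a, side (B.kind (c x)) a ≠ 0 → side (B.kind (c x)) a (p x).1.1 = 0 →
    ∀ᶠ q in 𝓝 (p x), ρ (B.chart (c x) q) = |side (B.kind (c x)) a q.1.1|
  edgeForm : ∀ x, Sing (p x) → ¬ IsVertexAt (B.kind (c x)) (p x).1 →
    EdgeForm (fun q => ρ (B.chart (c x) q)) (p x) True

theorem exists_definingFun [CompactSpace P] [T2Space P] (Q : Finset P)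
    {c : P → Fin B.num} {p : ∀ x, Model (B.kind (c x))} (hp : ∀ x, B.chart (c x) (p x) = x) :
    ∃ ρ, DefiningFun Q c p ρ := by
  classical
  have hpatch : ∀ x, ∃ R N, (LocalDef R N ∧ N ∈ 𝓝 (p x) ∧ _) ∧ _ := fun x => by
    obtain ⟨R, N, hR, hN, h⟩ := exists_localDef (p x)
    -- The patch at `x` is kept away from the other points of `Q`, so near a point of `Q` the sum
    -- reduces to the exact local model.
    have hZ : B.chart (c x) (p x) ∉ ((Q.erase x : Finset P) : Set P) := by simp [hp]
    exact ⟨R, N, ⟨hR, hN, h⟩, exists_patch hR hN (Q.erase x).finite_toSet.isClosed hZ⟩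
  choose R N hRN g V hg g0 gS gV hV gR gZ gs ge using hpatch
  obtain ⟨F, hF⟩ := isCompact_univ.elim_nhds_subcover V fun x _ => by simpa only [hp] using hV x
  have hFV : ∀ y, ∃ x ∈ F ∪ Q, y ∈ V x := fun y => by
    obtain ⟨x, hx, hy⟩ := mem_iUnion₂.1 (hF.2 (mem_univ y))
    exact ⟨x, Finset.mem_union_left _ hx, hy⟩
  have hexact : ∀ x ∈ Q, ∀ᶠ q in 𝓝 (p x), ∑ y ∈ F ∪ Q, g y (B.chart (c x) q) = R x q := by
    intro x hx
    have h1 : ∀ y ∈ F ∪ Q, y ≠ x → ∀ᶠ q in 𝓝 (p x), g y (B.chart (c x) q) = 0 := fun y _ hyx =>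
      (B.continuous_chart (c x)).continuousAt.eventually
        (gZ y _ (by rw [hp]; simpa using ⟨hx, hyx.symm⟩))
    have h2 : ∀ᶠ q in 𝓝 (p x), ∀ y ∈ F ∪ Q, y ≠ x → g y (B.chart (c x) q) = 0 :=
      (Filter.eventually_all_finset _).2 fun y hy => by
        by_cases hyx : y = x
        · exact Eventually.of_forall fun q h => absurd hyx h
        · filter_upwards [h1 y hy hyx] with q hq _ using hq
    filter_upwards [h2, gR x] with q h2 h3
    rw [Finset.sum_eq_single x h2 fun h => absurd (Finset.mem_union_right _ hx) h, h3]
  refine ⟨fun y => ∑ x ∈ F ∪ Q, g x y, continuous_finsetSum _ fun x _ => hg x,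
    fun y => Finset.sum_nonneg fun x _ => g0 x y, fun y => ⟨fun h => ?_, fun h => ?_⟩,
    fun d q hs i hi => ?_, fun x hx hv => ?_, fun x hx hv h0 a ha hpa => ?_, fun y hs hv => ?_⟩
  · obtain ⟨x, hx, hyx⟩ := hFV y
    exact gV x y hyx ((Finset.sum_eq_zero_iff_of_nonneg fun x _ => g0 x y).1 h x hx)
  · exact Finset.sum_eq_zero fun x _ => gS x y h
  · have h : ∀ᶠ u in 𝓝 q.1.1, ∀ x ∈ F ∪ Q,
        ContDiffAt ℝ ∞ (fun u => g x (B.chart d (lift _ i u))) u :=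
      (Filter.eventually_all_finset _).2 fun x _ => gs x d q hs i hi
    filter_upwards [h] with u hu
    exact ContDiffAt.sum hu
  · filter_upwards [hexact x hx] with q hq
    rw [hq, (hRN x).2.2.2.1 hv]
  · filter_upwards [hexact x hx] with q hq
    rw [hq, (hRN x).2.2.2.2 hv h0 a ha hpa]
  · refine (EdgeForm.sum (F ∪ Q) fun x _ => ge x (c y) (p y) hs hv fun p' hp' h hv' => ?_).mono ?_
    · have e := (hRN x).2.2.1 p' hp' hv'
      have hxy : x = y := by rw [← hp x, ← e, h, hp]
      subst hxy
      exact hv (e ▸ hv')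
    · exact fun _ => by simpa only [hp] using hFV y

end BranchedSurface

end BranchedSurf

/-! ### Sublevel sets of the defining function are regular neighbourhoods -/

namespace BranchedSurf

/-- On either side of the edge the function is `±σ κ` with `κ > 0`. On the edge its normal
derivative is `±κ`, and nonvanishing persists nearby. -/
theorem EdgeForm.eventually_fderiv_ne {k : Kind} {f : Model k → ℝ} {p : Model k}
    (H : EdgeForm f p True) (hp : p.1.2 = 0) (hv : ¬ IsVertexAt k p.1) {a : Fin 3} (ha : side k a ≠ 0)
    (hpa : side k a p.1.1 = 0) {i : Fin 3} (hi : OnSheet p i) :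
    ∀ᶠ u in 𝓝 p.1.1, ¬ Sing (lift k i u) → fderiv ℝ (fun u => f (lift k i u)) u ≠ 0 := by
  obtain ⟨κ, κ', h1, h2, -, -, h5, h6⟩ := H a ha hpa i hi
  set σ := side k a with hσ
  have key : ∀ κ : ℝ × ℝ → ℝ, SmoothNear κ p.1.1 → 0 < κ p.1.1 →
      ∀ᶠ u in 𝓝 p.1.1, fderiv ℝ (fun v => σ v * κ v) u ≠ 0 := by
    intro κ hκ h0
    have hc : ContinuousAt (fderiv ℝ fun v => σ v * κ v) p.1.1 :=
      ((σ.contDiff.smoothNear _).mul hκ).fderiv.continuousAt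
    refine hc.eventually_ne fun h => ?_
    have h := congrArg (fun L => L (edgeNormal k a)) h
    rw [fderiv_fun_mul σ.differentiableAt hκ.differentiableAt] at h
    have e : σ (edgeNormal k a) = 1 := side_edgeNormal ha
    simp [hpa, e, h0.ne'] at h
  filter_upwards [key κ h1 (h5 trivial).1, key κ' h2 (h5 trivial).2, eventually_eventually_nhds.2 h6,
    (tendsto_lift hi).eventually (eventually_edge hp hv ha hpa)] with u e1 e2 e3 e4 hs
  have h0 : σ u ≠ 0 := fun h => hs (e4.1.2 h)
  rcases lt_or_gt_of_ne h0 with h | h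
  · have : (fun u => f (lift k i u)) =ᶠ[𝓝 u] fun v => -(σ v * κ' v) := by
      filter_upwards [e3, σ.continuous.continuousAt.eventually_lt_const h] with v hv hv' using hv.2 hv'.le
    rw [this.fderiv_eq, fderiv_fun_neg]
    exact neg_ne_zero.2 e2
  · have : (fun u => f (lift k i u)) =ᶠ[𝓝 u] fun v => σ v * κ v := by
      filter_upwards [e3, σ.continuous.continuousAt.eventually_const_lt h] with v hv hv' using hv.1 hv'.le
    rw [this.fderiv_eq]
    exact e1

/-- The standard function near a vertex is homogeneous on the sheets, hence has no critical points. -/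
theorem fderiv_vertexDef_ne {k : Kind} (hk : k = .Vpos ∨ k = .Vneg) {i : Fin 3} {u : ℝ × ℝ}
    (hs : ¬ Sing (lift k i u)) : fderiv ℝ (fun u => vertexDef k (lift k i u)) u ≠ 0 := by
  have hd : DifferentiableAt ℝ (fun u => vertexDef k (lift k i u)) u :=
    ((LocalDef.vertex hk).smooth (lift k i u) trivial hs i rfl).differentiableAt
  have h0 : vertexDef k (lift k i u) ≠ 0 := fun h =>
    hs (((LocalDef.vertex hk).zero_iff (lift k i u) trivial).1 h)
  have hl : HasDerivAt (fun t : ℝ => t • u) u 1 := by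
    simpa using (hasDerivAt_id (1 : ℝ)).smul_const u
  have hd' : HasFDerivAt (fun u => vertexDef k (lift k i u)) _ ((1 : ℝ) • u) :=
    (one_smul ℝ u).symm ▸ hd.hasFDerivAt
  have hc := hd'.comp_hasDerivAt 1 hl
  intro h
  rw [one_smul, h] at hc
  have ht : ∀ᶠ t : ℝ in 𝓝 1, 0 < t := lt_mem_nhds one_pos
  -- Euler's relation: the function is nonzero and homogeneous, of degree `2` or `1`, so its radial
  -- derivative is nonzero.
  by_cases hi : 0 ≤ side k i u
  · have e : (fun t : ℝ => t ^ 2 * vertexDef k (lift k i u)) =ᶠ[𝓝 1]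
        (fun u => vertexDef k (lift k i u)) ∘ fun t : ℝ => t • u := by
      filter_upwards [ht] with t ht
      rw [Function.comp_apply, vertexDef_lift, vertexDef_lift, if_pos hi, map_smul, smul_eq_mul,
        if_pos (mul_nonneg ht.le hi), Prod.smul_fst, Prod.smul_snd, smul_eq_mul, smul_eq_mul,
        show t * u.1 * (t * u.2) = t ^ 2 * (u.1 * u.2) by ring, abs_mul (t ^ 2),
        abs_of_nonneg (sq_nonneg t)]
    have h1 := ((hasDerivAt_pow 2 (1 : ℝ)).mul_const (vertexDef k (lift k i u))).unique
      (hc.congr_of_eventuallyEq e)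
    simp [h0] at h1
  · have e : (fun t : ℝ => t * vertexDef k (lift k i u)) =ᶠ[𝓝 1]
        (fun u => vertexDef k (lift k i u)) ∘ fun t : ℝ => t • u := by
      filter_upwards [ht] with t ht
      rw [Function.comp_apply, vertexDef_lift, vertexDef_lift, if_neg hi, map_smul, smul_eq_mul,
        if_neg (not_le.2 (mul_neg_of_pos_of_neg ht (not_le.1 hi))), abs_mul, abs_of_pos ht]
    have h1 := ((hasDerivAt_id (1 : ℝ)).mul_const (vertexDef k (lift k i u))).unique
      (hc.congr_of_eventuallyEq e)
    simp [h0] at h1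

namespace BranchedSurface

variable {P : Type*} [TopologicalSpace P] {B : BranchedSurface P}

namespace DefiningFun

variable {Q : Finset P} {c : P → Fin B.num} {p : ∀ x, Model (B.kind (c x))} {ρ : P → ℝ}

/-- On the compact complement of an open neighbourhood of the singular set, `ρ` has a positive
minimum. -/
theorem eventually_subset [CompactSpace P] (H : DefiningFun Q c p ρ) {V : Set P} (hV : V ∈ 𝓝ˢ B.singularSet) :
    ∃ ε₀ > 0, ∀ x, ρ x ≤ ε₀ → x ∈ V := by
  obtain ⟨W, hW, hSW, hWV⟩ := mem_nhdsSet_iff_exists.1 hV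
  rcases eq_empty_or_nonempty Wᶜ with h | h
  · exact ⟨1, one_pos, fun x _ => hWV (by rw [compl_empty_iff.1 h]; trivial)⟩
  obtain ⟨y, hy, hmin⟩ := hW.isClosed_compl.isCompact.exists_isMinOn h H.cont.continuousOn
  have hpos : 0 < ρ y := lt_of_le_of_ne (H.nonneg y) fun h0 => hy (hSW ((H.zero_iff y).1 h0.symm))
  refine ⟨ρ y / 2, half_pos hpos, fun x hx => hWV (by_contra fun hxW => ?_)⟩
  have := isMinOn_iff.1 hmin x hxW
  linarith

theorem eventually_noncritical (H : DefiningFun Q c p ρ) (hp : ∀ x, B.chart (c x) (p x) = x)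
    (hv : ∀ x ∉ Q, Sing (p x) → ¬ IsVertexAt (B.kind (c x)) (p x).1) {x : P} (hx : x ∈ B.singularSet) :
    ∀ᶠ y in 𝓝 x, ∀ d (q : Model (B.kind d)), B.chart d q = y → ¬ Sing q → ∀ i, OnSheet q i →
      fderiv ℝ (fun u => ρ (B.chart d (lift _ i u))) q.1.1 ≠ 0 := by
  have hs : Sing (p x) := chart_mem_singularSet.1 (by rwa [hp])
  obtain ⟨h0, a, ha, hpa⟩ := sing_iff_side.1 hs
  have h1 : ∀ j, OnSheet (p x) j → ∀ᶠ u in 𝓝 (p x).1.1, ¬ Sing (lift (B.kind (c x)) j u) →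
      fderiv ℝ (fun u => ρ (B.chart (c x) (lift _ j u))) u ≠ 0 := by
    intro j hj
    by_cases hvx : IsVertexAt (B.kind (c x)) (p x).1
    · have hxQ : x ∈ Q := by_contra fun h => hv x h hs hvx
      filter_upwards [eventually_eventually_nhds.2 ((tendsto_lift hj).eventually (H.vertex x hxQ hvx))]
        with u hu hsu
      have : (fun u => ρ (B.chart (c x) (lift _ j u))) =ᶠ[𝓝 u] fun u => vertexDef _ (lift _ j u) := hu
      rw [this.fderiv_eq]
      exact fderiv_vertexDef_ne hvx.1 hsu
    · exact (H.edgeForm x hs hvx).eventually_fderiv_ne h0 hvx ha hpa hj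
  have h2 : ∀ᶠ q in 𝓝 (p x), ¬ Sing q → ∀ j, OnSheet q j →
      fderiv ℝ (fun u => ρ (B.chart (c x) (lift _ j u))) q.1.1 ≠ 0 := by
    have h1' : ∀ᶠ u in 𝓝 (p x).1.1, ∀ j, OnSheet (p x) j → ¬ Sing (lift (B.kind (c x)) j u) →
        fderiv ℝ (fun u => ρ (B.chart (c x) (lift _ j u))) u ≠ 0 := by
      rw [eventually_all]
      intro j
      by_cases hj : OnSheet (p x) j
      · filter_upwards [h1 j hj] with u hu _ using hu
      · exact Eventually.of_forall fun u h => absurd h hj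
    filter_upwards [eventually_proj h1', eventually_onSheet (p x)] with q h3 h4 hq j hj
    exact h3 j (h4 j hj) (by rwa [hj.lift_eq])
  have h3 : ∀ᶠ y in 𝓝 x, ∃ q, B.chart (c x) q = y ∧ (¬ Sing q → ∀ j, OnSheet q j →
      fderiv ℝ (fun u => ρ (B.chart (c x) (lift _ j u))) q.1.1 ≠ 0) := by
    have h := (B.isOpenEmbedding (c x)).map_nhds_eq (p x)
    rw [hp] at h
    rw [← h]
    exact mem_of_superset (image_mem_map h2) (by rintro _ ⟨q, hq, rfl⟩; exact ⟨q, rfl, hq⟩)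
  filter_upwards [h3] with y hy d q hq hsq i hi
  obtain ⟨q', hq', hy⟩ := hy
  have e : B.chart d q = B.chart (c x) q' := hq.trans hq'.symm
  have hsq' : ¬ Sing q' := fun h => hsq ((sing_iff_of_chart_eq e).2 h)
  obtain ⟨j, T, hT⟩ := B.exists_transition e hi
  obtain ⟨hj, hTq⟩ := hT.onSheet (B.chart_injective (c x)) e
  have hT' : (fun u => ρ (B.chart d (lift _ i u))) =ᶠ[𝓝 q.1.1]
      (fun u => ρ (B.chart (c x) (lift _ j u))) ∘ T := hT.2.2.2.mono fun u hu => congrArg ρ hu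
  have hd : DifferentiableAt ℝ (fun u => ρ (B.chart (c x) (lift _ j u))) (T q.1.1) :=
    hTq ▸ (H.smooth _ q' hsq' j hj).differentiableAt
  rw [hT'.fderiv_eq, fderiv_comp _ hd (hT.2.1.differentiableAt (by simp)), ← hTq]
  intro h
  refine hy hsq' j hj (ContinuousLinearMap.ext fun w => ?_)
  have hdet : IsUnit (fderiv ℝ T q.1.1 : ℝ × ℝ →ₗ[ℝ] ℝ × ℝ) :=
    LinearMap.isUnit_iff_isUnit_det _ |>.2 (isUnit_iff_ne_zero.2 hT.2.2.1.ne')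
  obtain ⟨w', hw'⟩ := ((Module.End.isUnit_iff _).1 hdet).2 w
  have hw'' : fderiv ℝ T q.1.1 w' = w := hw'
  have h5 := congrArg (fun L => L w') h
  rw [← hw'']
  exact h5

theorem exists_isRegularNhd [CompactSpace P] (H : DefiningFun Q c p ρ)
    (hp : ∀ x, B.chart (c x) (p x) = x)
    (hv : ∀ x ∉ Q, Sing (p x) → ¬ IsVertexAt (B.kind (c x)) (p x).1) :
    ∃ ε₀ > 0, ∀ ε > 0, ε ≤ ε₀ → B.IsRegularNhd {x | ρ x ≤ ε} := by
  obtain ⟨ε₀, h0, h1⟩ := H.eventually_subset (V := {y | ∀ d (q : Model (B.kind d)), B.chart d q = y →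
    ¬ Sing q → ∀ i, OnSheet q i → fderiv ℝ (fun u => ρ (B.chart d (lift _ i u))) q.1.1 ≠ 0})
    (mem_nhdsSet_iff_forall.2 fun x hx => H.eventually_noncritical hp hv hx)
  refine ⟨ε₀, h0, fun ε hε hε' => ⟨fun x => ε⁻¹ * ρ x, H.cont.const_mul _, fun x =>
    mul_nonneg (inv_nonneg.2 hε.le) (H.nonneg x), fun x => ?_, ?_, fun d q i hi h2 h3 => ?_⟩⟩
  · rw [mul_eq_zero, H.zero_iff]
    simp [hε.ne']
  · ext x
    change _ ↔ ε⁻¹ * ρ x ≤ 1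
    rw [inv_mul_le_iff₀ hε, mul_one]
    rfl
  · have h2 : ρ (B.chart d q) ≠ 0 := fun h => by
      dsimp only at h2
      rw [h, mul_zero] at h2
      exact h2.false
    have hs : ¬ Sing q := fun h => h2 ((H.zero_iff _).2 (chart_mem_singularSet.2 h))
    dsimp only at h3
    rw [inv_mul_le_iff₀ hε, mul_one] at h3
    have hsm := H.smooth d q hs i hi
    refine ⟨contDiffAt_const.mul hsm.contDiffAt, ?_⟩
    rw [fderiv_const_mul hsm.differentiableAt]
    exact smul_ne_zero (inv_ne_zero hε.ne') (h1 _ (h3.trans hε') d q rfl hs i hi)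

end DefiningFun

end BranchedSurface

end BranchedSurf

namespace BranchedSurf

/-! ### Stability -/

theorem eventually_lift {k : Kind} {p : Model k} {Q : Model k → Prop} (h : ∀ᶠ q in 𝓝 p, Q q) :
    ∀ᶠ u in 𝓝 p.1.1, ∀ i, OnSheet p i → Q (lift k i u) := by
  rw [eventually_all]
  intro i
  by_cases hi : OnSheet p i
  · filter_upwards [(tendsto_lift hi).eventually h] with u hu _ using hu
  · exact Eventually.of_forall fun u h => absurd h hi

namespace BranchedSurface

variable {P : Type*} [TopologicalSpace P] {B : BranchedSurface P}

theorem spot_mem_nhds {c : Fin B.num} (p : Model (B.kind c)) {r : ℝ} (hr : 0 < r) :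
    B.spot c p r ∈ 𝓝 (B.chart c p) := by
  refine mem_of_superset ((B.isOpenEmbedding c).isOpenMap.image_mem_nhds ((eventually_proj
    (Metric.closedBall_mem_nhds p.1.1 hr)).and (eventually_onSheet p))) ?_
  rintro _ ⟨q, ⟨h1, h2⟩, rfl⟩
  obtain ⟨i, hi⟩ := exists_onSheet q
  exact ⟨i, h2 i hi, q.1.1, h1, congrArg _ hi.lift_eq⟩

theorem spot_subset {c : Fin B.num} {p : Model (B.kind c)} {r : ℝ} {W : Set P}
    (h : Metric.closedBall p.1.1 r ⊆ {u | ∀ i, OnSheet p i → B.chart c (lift _ i u) ∈ W}) :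
    B.spot c p r ⊆ W := by
  rintro _ ⟨i, hi, u, hu, rfl⟩
  exact h hu i hi

variable {Q : Finset P} {c : P → Fin B.num} {p : ∀ x, Model (B.kind (c x))} {ρ : P → ℝ}
  {α : B.OneForm} {τ : ℝ → B.OneForm}

open OneForm

/-- Near a special point `α` can be deformed to `τ`, preserving the level sets of `ρ`. -/
theorem DefiningFun.exists_special_deformation [T2Space P] (H : DefiningFun Q c p ρ)
    (hp : ∀ x, B.chart (c x) (p x) = x) (hα : α.SStable) (hτ : IsCurve α τ) {x : P} (hx : x ∈ Q)
    (hs : Special α (c x) (p x)) {W : Set P} (hW : W ∈ 𝓝 x) :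
    ∃ S S' : Set P, S ⊆ W ∧ S' ⊆ S ∧ S' ∈ 𝓝 x ∧ ∀ ε > 0, ∀ β, IsCurve α β →
      (∀ᶠ s in 𝓝 0, ∀ y ∈ S, EqAt (β s) α y) → ∃ γ, IsCurve α γ ∧ ∀ᶠ s in 𝓝 0,
        Conn {x | ρ x ≤ ε} (β s) (γ s) ∧ (∀ y ∉ S, EqAt (γ s) (β s) y) ∧
        ∀ y ∈ S', EqAt (γ s) (τ s) y := by
  obtain ⟨hz, a, ha, hpa⟩ := sing_iff_side.1 hs.1
  have hWe : ∀ᶠ q in 𝓝 (p x), B.chart (c x) q ∈ W :=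
    (B.continuous_chart (c x)).continuousAt.eventually (by rwa [hp])
  suffices h : ∃ r > 0, B.spot (c x) (p x) r ⊆ W ∧ ∀ ε > 0, ∀ β, IsCurve α β →
      (∀ᶠ s in 𝓝 0, ∀ i, OnSheet (p x) i → ∀ u ∈ Metric.closedBall (p x).1.1 r,
        (β s).rep (c x) i u = α.rep (c x) i u) →
      ∃ γ, IsCurve α γ ∧ (∀ᶠ s in 𝓝 0, Conn {x | ρ x ≤ ε} (β s) (γ s)) ∧
        (∀ᶠ s in 𝓝 0, ∀ x' ∉ B.spot (c x) (p x) r, EqAt (γ s) (β s) x') ∧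
        ∀ᶠ s in 𝓝 0, ∀ i, OnSheet (p x) i → ∀ u ∈ Metric.closedBall (p x).1.1 (r / 4),
          (γ s).rep (c x) i u = (τ s).rep (c x) i u by
    obtain ⟨r, hr, hrW, h⟩ := h
    refine ⟨_, B.spot (c x) (p x) (r / 4), hrW, ?_, ?_, fun ε hε β hβ hβe => ?_⟩
    · rintro _ ⟨i, hi, u, hu, rfl⟩
      exact ⟨i, hi, u, Metric.closedBall_subset_closedBall (by linarith) hu, rfl⟩
    · have := spot_mem_nhds (p x) (B := B) (show 0 < r / 4 by linarith)
      rwa [hp] at this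
    · obtain ⟨γ, hγ, h1, h2, h3⟩ := h ε hε β hβ (hβe.mono fun s h i hi u hu =>
        h _ ⟨i, hi, u, hu, rfl⟩ _ _ rfl)
      refine ⟨γ, hγ, ?_⟩
      filter_upwards [h1, h2, h3] with s h1 h2 h3
      refine ⟨h1, h2, ?_⟩
      rintro _ ⟨i, hi, u, hu, rfl⟩
      exact eqAt_of_chart (h3 i hi u hu)
  by_cases hv : IsVertexAt (B.kind (c x)) (p x).1
  · have hOn : ∀ i, OnSheet (p x) i := fun i => (onSheet_iff_side hz).2 (by rw [hv.2]; exact (map_zero _).ge)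
    have h0 : ∀ a, a ≠ 1 → α.coe (c x) (p x) (edgeDir a) ≠ 0 := fun a ha h =>
      (hα.edge hz (hv.sides a ha) (by rw [hv.2]; exact map_zero _) h).1 hv
    have h0' : ∀ a, α.coe (c x) (p x) (edgeDir a) ≠ 0 := fun a => by
      by_cases ha : a = 1
      · have : edgeDir a = edgeDir 0 := by rw [ha]; rfl
        rw [this]
        exact h0 0 (by decide)
      · exact h0 a ha
    -- The radius is fixed before `ε`: near the vertex `ρ` is exactly `vertexDef`, and one
    -- neighbourhood serves the sublevel sets of all levels.
    obtain ⟨r, hr, hrO, h⟩ := exists_vertex_deformation hτ hv h0' (eventually_lift (hWe.and (H.vertex x hx hv)))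
    refine ⟨r, hr, spot_subset fun u hu i hi => (hrO hu i hi).1, fun ε hε β hβ hβe => ?_⟩
    obtain ⟨γ, hγ, h1, h2⟩ := h ε hε β hβ hβe
    refine ⟨γ, hγ, ?_, h2⟩
    filter_upwards [h1] with s h1
    refine h1 _ (fun u hu v hv huv hu' => ?_) fun a ha u hu hua => ?_
    · have e : ∀ u ∈ Metric.closedBall (p x).1.1 r, ρ (B.chart (c x) (lift _ 1 u)) = |u.1 * u.2| :=
        fun u hu => by rw [(hrO hu 1 (hOn 1)).2, vertexDef_lift, if_pos (by simp [side_one])]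
      rw [mem_ofPred_eq] at hu' ⊢
      rwa [e v hv, ← huv, ← e u hu]
    · rw [mem_ofPred_eq]
      rw [(hrO hu a (hOn a)).2, vertexDef_lift]
      have e : (if 0 ≤ side (B.kind (c x)) a u then |u.1 * u.2| else |side (B.kind (c x)) a u|) =
          -side (B.kind (c x)) a u := by
        split_ifs with h
        · rw [abs_mul_coord hv.1 ha, le_antisymm hua h]; simp
        · exact abs_of_nonpos hua
      rw [e, neg_le]
  · obtain ⟨b, hb, hpb, hb0⟩ := hs.2.resolve_left hv
    have hD := (hα.edge hz hb hpb hb0).2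
    obtain ⟨r, hr, hrO, h⟩ := exists_tangency_deformation hτ hz hb hpb
      (fun b' h1 h2 h3 => hv (isVertexAt_of_side hz h1 h2 hb h3 hpb)) hb0 hD
      (eventually_lift (hWe.and (H.edge x hx hv hz b hb hpb)))
    refine ⟨r, hr, spot_subset fun u hu i hi => (hrO hu i hi).1, fun ε hε β hβ hβe => ?_⟩
    obtain ⟨γ, hγ, h1, h2⟩ := h β hβ hβe
    refine ⟨γ, hγ, ?_, h2⟩
    filter_upwards [h1] with s h1
    refine h1 _ fun i hi u hu v hv huv hu' => ?_
    rw [mem_ofPred_eq] at hu' ⊢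
    rw [(hrO hv i hi).2]
    rw [(hrO hu i hi).2] at hu'
    change |side (B.kind (c x)) b v| ≤ ε
    rwa [← huv]

/-- Near a point of the singular set which is not special `α` can be deformed to `τ` inside of
`{ρ ≤ ε}`, which is preserved. -/
theorem DefiningFun.exists_edge_deformation [T2Space P] (H : DefiningFun Q c p ρ)
    (hp : ∀ x, B.chart (c x) (p x) = x) {x : P} (hx : x ∈ B.singularSet)
    (hs : ¬ Special α (c x) (p x)) : ∃ M ∈ 𝓝 x, ∃ ε₁ > 0, ∀ ε > 0, ε ≤ ε₁ → ∀ β τ, IsCurve α β →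
      IsCurve α τ → ∃ γ, IsCurve α γ ∧ ∀ᶠ s in 𝓝 0, Conn {x | ρ x ≤ ε} (β s) (γ s) ∧
        (∀ y, ρ y ≤ ε → EqAt (β s) (τ s) y ∨ y ∈ M → EqAt (γ s) (τ s) y) := by
  have hsx : Sing (p x) := chart_mem_singularSet.1 (by rwa [hp])
  obtain ⟨hz, a, ha, hpa⟩ := sing_iff_side.1 hsx
  have hv : ¬ IsVertexAt (B.kind (c x)) (p x).1 := fun h => hs ⟨hsx, Or.inl h⟩
  have he : α.coe (c x) (p x) (edgeDir a) ≠ 0 := fun h => hs ⟨hsx, Or.inr ⟨a, ha, hpa, h⟩⟩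
  -- The edge form provides its coefficients only near the point; they are replaced by globally
  -- smooth functions with the same germs.
  have key : ∀ i, OnSheet (p x) i → ∃ κ κ' : ℝ × ℝ → ℝ, ContDiff ℝ ∞ κ ∧ ContDiff ℝ ∞ κ' ∧
      0 < κ (p x).1.1 ∧ 0 < κ' (p x).1.1 ∧ ∀ᶠ u in 𝓝 (p x).1.1,
        (0 ≤ side (B.kind (c x)) a u → ρ (B.chart (c x) (lift _ i u)) = side (B.kind (c x)) a u * κ u) ∧
        (side (B.kind (c x)) a u ≤ 0 →
          ρ (B.chart (c x) (lift _ i u)) = -(side (B.kind (c x)) a u * κ' u)) := by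
    intro i hi
    obtain ⟨κ, κ', h1, h2, -, -, h5, h6⟩ := H.edgeForm x hsx hv a ha hpa i hi
    have ext : ∀ κ : ℝ × ℝ → ℝ, SmoothNear κ (p x).1.1 →
        ∃ g : ℝ × ℝ → ℝ, ContDiff ℝ ∞ g ∧ ∀ᶠ u in 𝓝 (p x).1.1, g u = κ u := fun κ h => by
      obtain ⟨g, -, hg, hge, -⟩ := exists_contDiff_eventuallyEq isCompact_singleton
        (fun y hy => by rw [mem_singleton_iff.1 hy]; exact h)
      exact ⟨g, hg, by rwa [nhdsSet_singleton] at hge⟩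
    obtain ⟨g, hg, hge⟩ := ext κ h1
    obtain ⟨g', hg', hge'⟩ := ext κ' h2
    refine ⟨g, g', hg, hg', hge.self_of_nhds.symm ▸ (h5 trivial).1,
      hge'.self_of_nhds.symm ▸ (h5 trivial).2, ?_⟩
    filter_upwards [h6, hge, hge'] with u h h' h''
    rwa [h', h'']
  -- On the one-sheeted side a single coefficient describes `ρ`; on the other side each of the two
  -- branches has its own.
  obtain ⟨k, k₁, hk, hk₁, hk0, hk₁0, hO₁⟩ := key 1 ((onSheet_iff_side hz).2 (by simp [side_one]))
  obtain ⟨_, k₂, -, hk₂, -, hk₂0, hO₂⟩ := key a ((onSheet_iff_side hz).2 hpa.ge)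
  obtain ⟨r, hr, hrO, ε₁, hε₁, h⟩ := OneForm.exists_edge_deformation hz ha hpa
    (fun b' h1 h2 h3 => hv (isVertexAt_of_side hz h1 h2 ha h3 hpa)) he hk
    (k' := fun b => cond b k₂ k₁) (by rintro (_ | _) <;> assumption) hk0
    (by rintro (_ | _) <;> assumption) (hO₁.and hO₂)
  refine ⟨B.spot (c x) (p x) (r / 4), ?_, ε₁, hε₁, fun ε hε hε' β τ hβ hτ => ?_⟩
  · have := spot_mem_nhds (p x) (B := B) (show 0 < r / 4 by linarith)
    rwa [hp] at this
  obtain ⟨γ, hγ, h⟩ := h ε hε hε' β τ hβ hτ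
  refine ⟨γ, hγ, ?_⟩
  filter_upwards [h] with s h
  obtain ⟨h1, h2, h3⟩ := h {x | ρ x ≤ ε} fun u hu => by
    obtain ⟨e1, e2⟩ := hrO hu
    refine ⟨fun h => ?_, fun b h => ?_⟩
    · rw [mem_ofPred_eq]
      rw [e1.1 h]
    · rw [mem_ofPred_eq]
      rcases b with _ | _
      · rw [cond_false, e1.2 h, neg_le]; rfl
      · rw [cond_true, e2.2 h, neg_le]; rfl
  refine ⟨h1, ?_⟩
  rintro y hy (h | ⟨i, hi, u, hu, rfl⟩)
  · exact h2 y hy h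
  · exact h3 i hi u hu hy

/-- Every smooth curve `τ` at an S-stable form can be conjugated near the singular set to `α`. -/
theorem OneForm.SStable.exists_conn [CompactSpace P] [T2Space P] (hα : α.SStable) (hτ : IsCurve α τ) :
    ∃ U γ, B.IsRegularNhd U ∧ U ∈ 𝓝ˢ B.singularSet ∧ IsCurve α γ ∧
      ∀ᶠ s in 𝓝 0, Conn U α (γ s) ∧ ∀ y ∈ U, EqAt (γ s) (τ s) y := by
  classical
  obtain ⟨Q, c, p, hp, hQ, hQ'⟩ := hα.exists_special
  obtain ⟨ρ, H⟩ := exists_definingFun Q hp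
  obtain ⟨ε₀, hε₀, hreg⟩ := H.exists_isRegularNhd hp fun x hx hs hv => hQ' x hx ⟨hs, Or.inl hv⟩
  -- Disjoint neighbourhoods of the special points make the deformations there independent of each
  -- other.
  obtain ⟨W, hW, hWd⟩ := Q.finite_toSet.t2_separation
  have hspec := fun x : Q => H.exists_special_deformation hp hα hτ x.2 (hQ x x.2)
    ((hW x).2.mem_nhds (hW x).1)
  choose S S' hSW hS'S hS' hdef using hspec
  have hM : ∀ x : P, ∃ M ∈ 𝓝 x, (∀ h : x ∈ Q, M = S' ⟨x, h⟩) ∧ (x ∈ B.singularSet → x ∉ Q →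
      ∃ ε₁ > 0, ∀ ε > 0, ε ≤ ε₁ → ∀ β τ, IsCurve α β →
      IsCurve α τ → ∃ γ, IsCurve α γ ∧ ∀ᶠ s in 𝓝 0, Conn {x | ρ x ≤ ε} (β s) (γ s) ∧
        (∀ y, ρ y ≤ ε → EqAt (β s) (τ s) y ∨ y ∈ M → EqAt (γ s) (τ s) y)) := by
    intro x
    by_cases hx : x ∈ Q
    · exact ⟨_, hS' ⟨x, hx⟩, fun _ => rfl, fun _ h => absurd hx h⟩
    by_cases hs : x ∈ B.singularSet
    · obtain ⟨M, hM, h⟩ := H.exists_edge_deformation hp hs (hQ' x hx)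
      exact ⟨M, hM, fun h => absurd h hx, fun _ _ => h⟩
    · exact ⟨univ, univ_mem, fun h => absurd h hx, fun h => absurd h hs⟩
  choose M hMx hMQ hMe using hM
  have hSc : IsCompact B.singularSet := by
    have : B.singularSet = ρ ⁻¹' {0} := by ext x; exact (H.zero_iff x).symm
    rw [this]
    exact (isClosed_singleton.preimage H.cont).isCompact
  obtain ⟨F, hFS, hFM⟩ := hSc.elim_nhds_subcover (fun x => interior (M x))
    fun x _ => interior_mem_nhds.2 (hMx x)
  obtain ⟨ε₂, hε₂, hcov⟩ := H.eventually_subset ((isOpen_biUnion fun x _ => isOpen_interior).mem_nhdsSet.2 hFM)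
  choose e he hMe using hMe
  have hsmall : ∀ᶠ ε : ℝ in 𝓝[>] 0, ∀ x ∈ F, ∀ (h : x ∈ B.singularSet) (h' : x ∉ Q), ε ≤ e x h h' := by
    refine (Filter.eventually_all_finset _).2 fun x _ => ?_
    by_cases h : x ∈ B.singularSet ∧ x ∉ Q
    · filter_upwards [Ioc_mem_nhdsGT (he x h.1 h.2)] with ε hε _ _ using hε.2
    · exact Eventually.of_forall fun ε h1 h2 => absurd ⟨h1, h2⟩ h
  have hIoc : ∀ {b : ℝ}, 0 < b → ∀ᶠ ε in 𝓝[>] 0, ε ∈ Ioc 0 b := Ioc_mem_nhdsGT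
  -- One `ε` below finitely many bounds: regularity of `{ρ ≤ ε}`, its inclusion in the finite cover,
  -- and the thresholds of the edge deformations. The deformations at special points accept every
  -- `ε`, so the choices are not circular.
  obtain ⟨ε, ⟨hε, hε₀'⟩, ⟨-, hε₂'⟩, hεe⟩ := ((hIoc hε₀).and ((hIoc hε₂).and hsmall)).exists
  set U := {x | ρ x ≤ ε} with hU
  have hUS : U ∈ 𝓝ˢ B.singularSet := by
    refine mem_nhdsSet_iff_forall.2 fun y hy => ?_
    filter_upwards [H.cont.continuousAt.eventually_lt_const (((H.zero_iff y).2 hy).trans_lt hε)] with z hz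
      using hz.le
  -- The deformation at a special point `x` has to start from `α` on `S x`. Disjointness ensures
  -- that the preceding ones have not changed anything there.
  have step₁ : ∀ G : Finset Q, ∃ γ, IsCurve α γ ∧ ∀ᶠ s in 𝓝 0, Conn U α (γ s) ∧
      (∀ y, (∀ x ∈ G, y ∉ S x) → EqAt (γ s) α y) ∧ ∀ x ∈ G, ∀ y ∈ S' x, EqAt (γ s) (τ s) y := by
    intro G
    induction G using Finset.induction_on with
    | empty => exact ⟨_, isCurve_const α, Eventually.of_forall fun s =>
        ⟨Conn.refl U α, fun _ _ _ _ _ => rfl, by simp⟩⟩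
    | insert x G hxG ih =>
      obtain ⟨β, hβ, hβs⟩ := ih
      have hd : ∀ x' ∈ G, ∀ y ∈ S x', y ∉ S x := fun x' hx' y hy hy' => by
        refine disjoint_left.1 (hWd x'.2 x.2 fun h => hxG ?_) (hSW x' hy) (hSW x hy')
        rwa [← Subtype.ext h]
      obtain ⟨γ, hγ, hγs⟩ := hdef x ε hε β hβ (hβs.mono fun s h y hy =>
        h.2.1 y fun x' hx' hy' => hd x' hx' y hy' hy)
      refine ⟨γ, hγ, ?_⟩
      filter_upwards [hβs, hγs] with s h1 h2
      refine ⟨h1.1.trans h2.1, fun y hy c p hc => ?_, fun x' hx' y hy => ?_⟩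
      · rw [h2.2.1 y (hy x (Finset.mem_insert_self x G)) c p hc,
          h1.2.1 y (fun x' hx' => hy x' (Finset.mem_insert_of_mem hx')) c p hc]
      · rcases Finset.mem_insert.1 hx' with rfl | hx'
        · exact h2.2.2 y hy
        · intro c p hc
          rw [h2.2.1 y (hd x' hx' y (hS'S x' hy)) c p hc, h1.2.2 x' hx' y hy c p hc]
  -- An edge deformation may start from any curve at `α` and keeps the agreement with `τ` inside
  -- `U`, so overlaps of the spots do no harm.
  have step₂ : ∀ G ⊆ F, ∃ γ, IsCurve α γ ∧ ∀ᶠ s in 𝓝 0, Conn U α (γ s) ∧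
      ∀ y ∈ U, (∃ x, (x ∈ Q ∨ x ∈ G) ∧ y ∈ M x) → EqAt (γ s) (τ s) y := by
    intro G
    induction G using Finset.induction_on with
    | empty =>
      intro _
      obtain ⟨γ, hγ, h⟩ := step₁ Finset.univ
      refine ⟨γ, hγ, h.mono fun s h => ⟨h.1, ?_⟩⟩
      rintro y - ⟨x, hx | hx, hy⟩
      · exact h.2.2 ⟨x, hx⟩ (Finset.mem_univ _) y (hMQ x hx ▸ hy)
      · simp at hx
    | insert x G hxG ih =>
      intro hG
      obtain ⟨β, hβ, hβs⟩ := ih ((Finset.subset_insert x G).trans hG)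
      have hxF := hG (Finset.mem_insert_self x G)
      by_cases hxQ : x ∈ Q
      · refine ⟨β, hβ, hβs.mono fun s h => ⟨h.1, fun y hy => ?_⟩⟩
        rintro ⟨x', hx', hy'⟩
        refine h.2 y hy ⟨x', ?_, hy'⟩
        rcases hx' with hx' | hx'
        · exact Or.inl hx'
        · rcases Finset.mem_insert.1 hx' with rfl | hx'
          · exact Or.inl hxQ
          · exact Or.inr hx'
      · obtain ⟨γ, hγ, hγs⟩ := hMe x (hFS x hxF) hxQ ε hε (hεe x hxF _ hxQ) β τ hβ hτ
        refine ⟨γ, hγ, ?_⟩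
        filter_upwards [hβs, hγs] with s h1 h2
        refine ⟨h1.1.trans h2.1, fun y hy => ?_⟩
        rintro ⟨x', hx', hy'⟩
        refine h2.2 y hy ?_
        rcases hx' with hx' | hx'
        · exact Or.inl (h1.2 y hy ⟨x', Or.inl hx', hy'⟩)
        · rcases Finset.mem_insert.1 hx' with rfl | hx'
          · exact Or.inr hy'
          · exact Or.inl (h1.2 y hy ⟨x', Or.inr hx', hy'⟩)
  obtain ⟨γ, hγ, h⟩ := step₂ F subset_rfl
  refine ⟨U, γ, hreg ε hε hε₀', hUS, hγ, h.mono fun s h => ⟨h.1, fun y hy => ?_⟩⟩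
  obtain ⟨x, hx, hyx⟩ := mem_iUnion₂.1 (hcov y (le_trans hy hε₂'))
  exact h.2 y hy ⟨x, Or.inr hx, interior_subset hyx⟩

end BranchedSurface

end BranchedSurf

theorem mainTheorem9 {P : Type*} [TopologicalSpace P] [CompactSpace P] [T2Space P]
    (B : BranchedSurf.BranchedSurface P) (F : B.Foliation) (hF : F.SStable) :
    (∀ O ∈ 𝓝 (F, F), ∀ᶠ F' in 𝓝 F,
      ∃ (U : Set P) (φ : P ≃ₜ P), B.IsRegularNhd U ∧
        BranchedSurf.BranchedSurface.IsDiffeo B B φ ∧ φ '' U = U ∧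
        ∃ G : B.Foliation, BranchedSurf.BranchedSurface.Foliation.IsPushforward φ F G ∧
          G.EqOn F' U ∧ (G, F') ∈ O) ∧
    F.GermStable := by
  obtain ⟨α, rfl, hα⟩ := hF
  refine ⟨fun O hO => BranchedSurf.BranchedSurface.OneForm.eventually_foliation (BranchedSurf.BranchedSurface.OneForm.eventually_of_isCurve fun τ hτ => ?_),
    BranchedSurf.BranchedSurface.OneForm.eventually_foliation (BranchedSurf.BranchedSurface.OneForm.eventually_of_isCurve fun τ hτ => ?_)⟩
  · obtain ⟨U, γ, hU, -, hγ, h⟩ := hα.exists_conn hτ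
    -- Closeness on all of `P`: both curves of forms tend to `α`, so the pair of foliations
    -- eventually lies in `O`.
    have ht : Tendsto (fun s => ((γ s).foliation, (τ s).foliation)) (𝓝 0)
        (𝓝 (α.foliation, α.foliation)) :=
      ((BranchedSurf.BranchedSurface.OneForm.continuous_foliation.tendsto α).comp hγ.tendsto).prodMk_nhds
        ((BranchedSurf.BranchedSurface.OneForm.continuous_foliation.tendsto α).comp hτ.tendsto)
    filter_upwards [h, ht hO] with s ⟨⟨φ, h1, h2, h3, g, hg, hg0, h4⟩, h5⟩ h6
    exact ⟨U, φ, hU, h1, h3, _, ⟨_, _, BranchedSurf.BranchedSurface.OneForm.foliation_fmul hg hg0 α, rfl, h4⟩,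
      ⟨_, _, rfl, rfl, fun c p hcp => h5 _ hcp c p rfl⟩, h6⟩
  · obtain ⟨U, γ, -, hU, hγ, h⟩ := hα.exists_conn hτ
    filter_upwards [h] with s ⟨⟨φ, h1, h2, h3, g, hg, hg0, h4⟩, h5⟩
    exact ⟨φ, h1, h1.image_singularSet h2, _, ⟨_, _, BranchedSurf.BranchedSurface.OneForm.foliation_fmul hg hg0 α, rfl, h4⟩, U, hU,
      _, _, rfl, rfl, fun c p hcp => h5 _ hcp c p rfl⟩
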